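/- **Setting.** Let $d\ge 2$, $n\ge 0$. At each of two endstates $u_\pm$ let real $n\times n$ matrices $\mathcal A, A^0, A^j, B^{jk}, C^j$ ($1\le j,k\le d$) be given (the coefficients of $\mathcal A u_{tt}-\sum B^{jk}u_{x_jx_k}-\sum C^ju_{tx_j}+A^0u_t+\sum A^ju_{x_j}=0$). Put $A(\xi)=\sum\xi_jA^j$, $B(\xi)=\sum\xi_j\xi_kB^{jk}$, $C(\xi)=\sum\xi_jC^j$ and, for $\eta=(\eta_2,\dots,\eta_d)$, $A_2(\eta)=\sum_{j\ge2}\eta_jA^j$, $C_2(\eta)=\sum_{j\ge2}\eta_jC^j$, $B_{12}(\eta)=\sum_{j\ge2}\eta_j(B^{1j}+B^{j1})$, $B_{22}(\eta)=\sum_{j,k\ge2}\eta_j\eta_kB^{jk}$. Write $\operatorname{Re}M=\frac12(M+M^*)$. Assume at both endstates: * $A^0$ is symmetric positive definite, $\det A^1\ne0$, $\det B^{11}\neq 0$, and $A^1(B^{11})^{-1}$ has no purely imaginary eigenvalue; * for $\xi\ne0$ all eigenvalues of $(A^0)^{-1}A(\xi)$ are real and semi-simple, and their number and multiplicities do not depend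 on $\xi$; let $a_1(\xi)<a_2(\xi)<\dots$ be the distinct roots $\tau$ of $\det(\tau A^0+A(\xi))=0$; * (D1) there are a smooth family $S(\omega)$, $|\omega|=1$, of positive definite hermitian matrices with $S\check A$ hermitian, $\check A(\omega)=(A^0)^{-1/2}A(\omega)(A^0)^{-1/2}$ (a symmetrizer), and $\bar c>0$ such that $$W_1=S^{1/2}(A^0)^{-1/2}\big(-B(\omega)+\mathcal A((A^0)^{-1}A(\omega))^2+C(\omega)(A^0)^{-1}A(\omega)\big)(A^0)^{-1/2}S^{-1/2}$$ satisfies $\operatorname{Re}W_1\le-\bar c$ as a quadratic form on every eigenspace of $W_0=-S^{1/2}\check A(\omega)S^{-1/2}$. Consider also the conditions: * (S5) if $\eta_0\ne0$, $s\ge2$, $\partial_{\xi_1}^ja_l(\xi_1^0,\eta_0)=0$ for $1\le j<s$ and $\partial^s_{\xi_1}a_l(\xi_1^0,\eta_0)\ne0$, then on the curve $\xi_1=\tilde\xi_1(\eta)$, $\tilde\xi_1(\eta_0)=\xi_1^0$, defined near $\eta_0$ by $\partial_{\xi_1}^{s-1}a_l(\tilde\xi_1(\eta),\eta)=0$, one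 has $\partial_{\xi_1}^ja_l=0$ for all $1\le j\le s-1$ and $\eta$ near $\eta_0$; * (S6) for some symmetrizer $S$ the compressions of $W_1$ to the eigenspaces of $W_0$ are symmetric (hermitian). For $\zeta=(\tau,\gamma,\eta)\in\mathbb R\times\mathbb R\times\mathbb R^{d-1}$, $\lambda=\gamma+i\tau$, let $$G(\zeta)=\begin{pmatrix}0&(B^{11})^{-1}\\ s&-S(B^{11})^{-1}\end{pmatrix},\quad S=iB_{12}(\eta)+\lambda C^1-A^1,\quad s=\lambda^2\mathcal A-i\lambda C_2(\eta)+B_{22}(\eta)+\lambda A^0+iA_2(\eta),$$ $\mathcal G(\zeta)=\operatorname{diag}(G_+(\zeta),-G_-(\zeta))$ and $H_{0\pm}(\zeta)=\mp(A^1_\pm)^{-1}(\lambda A^0_\pm+iA_{2\pm}(\eta))$. In polar coordinates $\zeta=\rho\hat\zeta$, $\hat\zeta\in S^d$, let $\overline{S^d_c}=\{\rho\ge0,\ \hat\gamma\ge-c\,\kappa(\sqrt\rho\,|(\hat\tau,\hat\eta)|)\}$, $\kappa(r)=r^2/(1+r^2)$. All neighbourhoods below are relatively open subsets of $\overline{S^d_c}$.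 At a base point $\hat\zeta_0=(\tau_0,\gamma_0,\eta_0)\in S^d$ with $\gamma_0\ge0$, a mode is a pair $(\pm,\xi_1)$, $\xi_1\in\mathbb R$, with $i\xi_1$ an eigenvalue of $H_{0\pm}(\hat\zeta_0)$. It is glancing if $\eta_0\ne0$ and, for some $l$, $\tau_0=a_l^\pm(\pm\xi_1,\eta_0)$ and $\partial_{\xi_1}a_l^\pm(\pm\xi_1,\eta_0)=0$, and hyperbolic otherwise. A block decomposition is a smooth invertible family $T$ on a neighbourhood $\Omega$ of $(0,\hat\zeta_0)$ with $$T^{-1}\mathcal G(\rho\hat\zeta)T=\operatorname{diag}(P_+,P_-,\rho Q_{e+},\rho Q_{e-},\rho Q_h,\rho Q_g),$$ with smooth blocks such that for some $\delta>0$ on $\Omega$, $\operatorname{Re}P_+,\operatorname{Re}Q_{e+}\ge\delta$, $\operatorname{Re}P_-,\operatorname{Re}Q_{e-}\le-\delta$, and $Q_h$, $Q_g$ are the direct sums of blocks $Q_r$ over the hyperbolic, respectively glancing, modes $r=(\pm,\xi_1)$, where $Q_r(0,\hat\zeta_0)$ has $i\xi_1$ as its only eigenvalue and the columns of $T$ belonging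 to $Q_r$ lie in the component of $G_\pm$. **Proposition.** There is $c_0>0$ such that for all $0<c<c_0$ and every base point $\hat\zeta_0\in S^d$, $\gamma_0\ge0$, block decompositions exist, and for each of them there are a neighbourhood $\Omega_0\subset\Omega$ of $(0,\hat\zeta_0)$ and constants $K,c_1>0$ such that: (i) There is a smooth basis transformation $T_h$ on $\Omega_0$ with $|T_h|,|T_h^{-1}|\le K$ and $$T_h^{-1}Q_hT_h=\operatorname{diag}(Q_{h+},Q_{h-}),\qquad\operatorname{Re}Q_{h+}\ge c_1(\rho+\hat\gamma),\quad\operatorname{Re}Q_{h-}\le-c_1(\rho+\hat\gamma).$$ (ii) Assume (S5) and (S6) at both endstates. For every glancing mode $r=(\pm,\xi_1)$ there are $l$, $s_r\ge2$ and a smooth function $\xi_{1r}(\eta)$ near $\eta_0$ with $\xi_{1r}(\eta_0)=\pm\xi_1$, $a^\pm_l(\pm\xi_1,\eta_0)=\tau_0$, such that $\xi_{1r}(\eta)$ is, for $\eta$ near $\eta_0$, a root of multiplicity $s_r$ of $a_r(\eta)-a^\pm_l(\cdot,\eta)$, $a_r(\eta):=a^\pm_l(\xi_{1r}(\eta),\eta)$.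 With $$\nu_r=(|\hat\tau-a_r(\hat\eta)|+\hat\gamma+\rho)^{1/s_r},\qquad\beta_r=\nu_r^{1-s_r},\qquad\alpha_r=\nu_r^{1-\lfloor(s_r+1)/2\rfloor},$$ there is a basis transformation $T_r$ on $\Omega_0\setminus\{\rho=\hat\gamma=0\}$ with $|T_r|\le K$, $|T_r^{-1}|\le K\beta_r$, $$T_r^{-1}Q_rT_r=\operatorname{diag}(Q_{r+},Q_{r-}),\qquad\operatorname{Re}Q_{r+}\ge c_1(\rho+\hat\gamma)\beta_r,\quad\operatorname{Re}Q_{r-}\le-c_1(\rho+\hat\gamma)\beta_r,$$ and $|w|\le K\alpha_r\,|T_r(0,w)|$ for all vectors $(0,w)$ in the coordinates of the block $Q_{r-}$, i.e. $|(T_r|_{Q_{r-}})^{-1}|\le K\alpha_r$. -/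

import Mathlib

open Matrix Filter Topology
open scoped ContDiff ComplexOrder Matrix.Norms.L2Operator

namespace HHShock

noncomputable section

/-! ### Coefficients of the second-order system at an endstate -/

/-- The coefficient matrices at one endstate of
`𝒜 u_tt - ∑ B^{jk} u_{x_j x_k} - ∑ C^j u_{t x_j} + A⁰ u_t + ∑ A^j u_{x_j} = 0`
in space dimension `d = k + 1`. Index `0 : Fin (k+1)` is the direction `x₁` normal to the front,
the indices `Fin.succ j` are the tangential directions `x₂, …, x_d`. -/
structure Endstate (n k : ℕ) where
  /-- the coefficient `𝒜` of `u_tt` -/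
  Acal : Matrix (Fin n) (Fin n) ℝ
  /-- the coefficient `A⁰` of `u_t` -/
  A0 : Matrix (Fin n) (Fin n) ℝ
  /-- the coefficients `A^j` of `u_{x_j}` -/
  A : Fin (k + 1) → Matrix (Fin n) (Fin n) ℝ
  /-- the coefficients `B^{jk}` of `u_{x_j x_k}` -/
  B : Fin (k + 1) → Fin (k + 1) → Matrix (Fin n) (Fin n) ℝ
  /-- the coefficients `C^j` of `u_{t x_j}` -/
  C : Fin (k + 1) → Matrix (Fin n) (Fin n) ℝ

/-- A real matrix regarded as a complex matrix. -/
def cx {n : ℕ} (M : Matrix (Fin n) (Fin n) ℝ) : Matrix (Fin n) (Fin n) ℂ :=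
  M.map (fun x : ℝ => (x : ℂ))

/-- The hermitian part `Re M = (M + M*) / 2`. -/
def rePart {ι : Type*} (M : Matrix ι ι ℂ) : Matrix ι ι ℂ := (1 / 2 : ℂ) • (M + Mᴴ)

/-- `Re M ≥ r I` as hermitian matrices. -/
def ReGe {ι : Type*} [DecidableEq ι] (M : Matrix ι ι ℂ) (r : ℝ) : Prop :=
  (rePart M - (r : ℂ) • (1 : Matrix ι ι ℂ)).PosSemidef

/-- `Re M ≤ r I` as hermitian matrices. -/
def ReLe {ι : Type*} [DecidableEq ι] (M : Matrix ι ι ℂ) (r : ℝ) : Prop :=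
  ((r : ℂ) • (1 : Matrix ι ι ℂ) - rePart M).PosSemidef

namespace Endstate

variable {n k : ℕ} (E : Endstate n k)

/-- `A(ξ) = ∑ ξ_j A^j`. -/
def symA (ξ : Fin (k + 1) → ℝ) : Matrix (Fin n) (Fin n) ℝ := ∑ j, ξ j • E.A j

/-- `B(ξ) = ∑ ξ_j ξ_k B^{jk}`. -/
def symB (ξ : Fin (k + 1) → ℝ) : Matrix (Fin n) (Fin n) ℝ := ∑ i, ∑ j, (ξ i * ξ j) • E.B i j

/-- `C(ξ) = ∑ ξ_j C^j`. -/
def symC (ξ : Fin (k + 1) → ℝ) : Matrix (Fin n) (Fin n) ℝ := ∑ j, ξ j • E.C j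

/-- The tangential part `A₂(η) = ∑_{j ≥ 2} η_j A^j`. -/
def symA2 (η : Fin k → ℝ) : Matrix (Fin n) (Fin n) ℝ := ∑ j, η j • E.A j.succ

/-- The mixed part `B₁₂(η) = ∑_{j ≥ 2} η_j (B^{1j} + B^{j1})`. -/
def symB12 (η : Fin k → ℝ) : Matrix (Fin n) (Fin n) ℝ :=
  ∑ j, η j • (E.B 0 j.succ + E.B j.succ 0)

/-- The tangential part `B₂₂(η) = ∑_{j, k ≥ 2} η_j η_k B^{jk}`. -/
def symB22 (η : Fin k → ℝ) : Matrix (Fin n) (Fin n) ℝ :=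
  ∑ i, ∑ j, (η i * η j) • E.B i.succ j.succ

/-- The tangential part `C₂(η) = ∑_{j ≥ 2} η_j C^j`. -/
def symC2 (η : Fin k → ℝ) : Matrix (Fin n) (Fin n) ℝ := ∑ j, η j • E.C j.succ

/-- `(A⁰)⁻¹ A(ξ)`. -/
def firstOrder (ξ : Fin (k + 1) → ℝ) : Matrix (Fin n) (Fin n) ℝ := E.A0⁻¹ * E.symA ξ

/-- `-B(ξ) + 𝒜 ((A⁰)⁻¹A(ξ))² + C(ξ) (A⁰)⁻¹A(ξ)`. In the small-frequency expansion
`λ = i λ₁ + λ₂ + …` of the roots of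
`det (λ² 𝒜 + B(ξ) - i λ C(ξ) + λ A⁰ + i A(ξ)) = 0` with `λ₁` an eigenvalue of `-(A⁰)⁻¹A(ξ)`, the
second-order coefficients `λ₂` are the eigenvalues of `(A⁰)⁻¹` times this matrix, compressed to the
eigenspace of `λ₁`. -/
def secondOrder (ξ : Fin (k + 1) → ℝ) : Matrix (Fin n) (Fin n) ℝ :=
  -E.symB ξ + E.Acal * (E.firstOrder ξ) ^ 2 + E.symC ξ * E.firstOrder ξ

/-! ### The characteristic roots and the glancing set -/

/-- The distinct real roots `τ` of `p(τ, ξ) = det (τ A⁰ + A(ξ))`, that is (for invertible `A⁰`) the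
distinct real eigenvalues of `-(A⁰)⁻¹A(ξ)`. -/
def charRoots (ξ : Fin (k + 1) → ℝ) : Finset ℝ := (-(E.firstOrder ξ)).charpoly.roots.toFinset

/-- The `l`-th smallest distinct root `a_l(ξ)` of `p(·, ξ)`, counted from `l = 0`
(with value `0` if there are not so many roots). -/
def a (l : ℕ) (ξ : Fin (k + 1) → ℝ) : ℝ := ((E.charRoots ξ).sort (· ≤ ·)).getD l 0

/-- The partial derivative `∂_{ξ₁}^s a_l (ξ₁, η)`. -/
def dA (l s : ℕ) (ξ₁ : ℝ) (η : Fin k → ℝ) : ℝ :=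
  iteratedDeriv s (fun y : ℝ => E.a l (vecCons y η)) ξ₁

/-- The family `(A⁰)⁻¹A(ξ)`, `ξ ≠ 0`, is hyperbolic with constant multiplicities: all eigenvalues
are real and semi-simple (the dimensions of the eigenspaces to the real eigenvalues add up to `n`),
and their number and multiplicities do not depend on `ξ`. -/
def ConstantMultiplicities : Prop :=
  ∃ (L : ℕ) (m : ℕ → ℕ), ∑ l ∈ Finset.range L, m l = n ∧
    ∀ ξ : Fin (k + 1) → ℝ, ξ ≠ 0 → (E.charRoots ξ).card = L ∧
      ∀ l < L, Module.finrank ℝ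
        (Module.End.eigenspace (Matrix.toLin' (-(E.firstOrder ξ))) (E.a l ξ)) = m l

/-- `ξ₁` is a root of multiplicity exactly `s` of `a_l(ξ₁, η) - a_l(·, η)`. -/
def RootOrder (l s : ℕ) (ξ₁ : ℝ) (η : Fin k → ℝ) : Prop :=
  (∀ j, 1 ≤ j → j < s → E.dA l j ξ₁ η = 0) ∧ E.dA l s ξ₁ η ≠ 0

/-- `(τ, η)` is in the glancing set, with double (or higher) root `ξ₁`. -/
def IsGlancing (τ ξ₁ : ℝ) (η : Fin k → ℝ) : Prop :=
  η ≠ 0 ∧ ∃ l < (E.charRoots (vecCons ξ₁ η)).card,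
    E.a l (vecCons ξ₁ η) = τ ∧ E.dA l 1 ξ₁ η = 0

/-- Multiple roots persist: whenever `ξ₁` is a root of multiplicity `s ≥ 2` of
`a_l(ξ₁, η) - a_l(·, η)`, and `ξ₁'` is the (locally unique) curve through `ξ₁` on which
`∂_{ξ₁}^{s-1} a_l` vanishes, then all of `∂_{ξ₁} a_l, …, ∂_{ξ₁}^{s-1} a_l` vanish on that curve
near `η`. -/
def GlancingPersists : Prop :=
  ∀ (l s : ℕ) (ξ₁ : ℝ) (η : Fin k → ℝ), η ≠ 0 → 2 ≤ s → E.RootOrder l s ξ₁ η →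
    ∀ ξ₁' : (Fin k → ℝ) → ℝ, ContinuousAt ξ₁' η → ξ₁' η = ξ₁ →
      (∀ᶠ η' in 𝓝 η, E.dA l (s - 1) (ξ₁' η') η' = 0) →
      ∀ᶠ η' in 𝓝 η, ∀ j, 1 ≤ j → j ≤ s - 1 → E.dA l j (ξ₁' η') η' = 0

/-- `g` is a smooth function near `η₀` with `g η₀ = ξ₁`, `a_l(ξ₁, η₀) = τ`, such that
`g η` is a root of multiplicity `s ≥ 2` of `a_l(g η, η) - a_l(·, η)` for all `η` near `η₀`:
the surface `τ = a_l(g η, η)` is the glancing surface through `(τ, η₀)` with root `ξ₁`. -/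
structure IsGlancingCurve (τ ξ₁ : ℝ) (η₀ : Fin k → ℝ) (l s : ℕ) (g : (Fin k → ℝ) → ℝ) :
    Prop where
  two_le : 2 ≤ s
  smooth : ContDiffAt ℝ ∞ g η₀
  base : g η₀ = ξ₁
  value : E.a l (vecCons ξ₁ η₀) = τ
  order : ∀ᶠ η in 𝓝 η₀, E.RootOrder l s (g η) η

/-! ### Symmetrizers and dissipativity -/

/-- `S` is a symbolic symmetrizer of `(A⁰)⁻¹A(θ)`, `|θ| = 1`: a smooth family of hermitian positive
definite matrices with `S(θ) (A⁰)⁻¹A(θ)` hermitian. (A smooth family on the sphere is the same as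
the restriction to it of a smooth family on `ξ ≠ 0`. Uniform positivity and boundedness of the
derivatives hold by compactness.) The symmetrizers of
`(A⁰)^{-1/2} A(θ) (A⁰)^{-1/2}` are exactly the matrices `(A⁰)^{-1/2} S(θ) (A⁰)^{-1/2}`. -/
structure IsSymmetrizer (S : (Fin (k + 1) → ℝ) → Matrix (Fin n) (Fin n) ℂ) : Prop where
  smooth : ∀ i j, ContDiffOn ℝ ∞ (fun ξ => S ξ i j) {ξ | ξ ≠ 0}
  posDef : ∀ θ : Fin (k + 1) → ℝ, ∑ i, θ i ^ 2 = 1 → (S θ).PosDef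
  symm : ∀ θ : Fin (k + 1) → ℝ, ∑ i, θ i ^ 2 = 1 → (S θ * cx (E.firstOrder θ)).IsHermitian

/-- The sesquilinear form `⟨v, S (A⁰)⁻¹ (-B + 𝒜 ((A⁰)⁻¹A)² + C (A⁰)⁻¹A) w⟩`. With
`S = (A⁰)^{1/2} S' (A⁰)^{1/2}` it is `⟨v', W₁ w'⟩` for `v' = S'^{1/2} (A⁰)^{1/2} v`,
`w' = S'^{1/2} (A⁰)^{1/2} w` and
`W₁ = S'^{1/2} (A⁰)^{-1/2} (-B + 𝒜 ((A⁰)⁻¹A)² + C (A⁰)⁻¹A) (A⁰)^{-1/2} S'^{-1/2}`; the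
eigenvectors `v'` of `W₀ = -S'^{1/2} (A⁰)^{-1/2} A (A⁰)^{-1/2} S'^{-1/2}` correspond to the
eigenvectors `v` of `(A⁰)⁻¹A`, and `|v'|² = ⟨v, S v⟩`. -/
def dissForm (S : (Fin (k + 1) → ℝ) → Matrix (Fin n) (Fin n) ℂ) (θ : Fin (k + 1) → ℝ)
    (v w : Fin n → ℂ) : ℂ :=
  star v ⬝ᵥ ((S θ * (cx E.A0)⁻¹ * cx (E.secondOrder θ)) *ᵥ w)

/-- `v` is in the eigenspace of `(A⁰)⁻¹A(θ)` to `μ`. -/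
def InEigenspace (θ : Fin (k + 1) → ℝ) (μ : ℝ) (v : Fin n → ℂ) : Prop :=
  cx (E.firstOrder θ) *ᵥ v = (μ : ℂ) • v

/-- Low-frequency dissipativity: for some symmetrizer the restrictions of `Re W₁` to the eigenspaces
of `W₀` are uniformly negative. -/
def Dissipative : Prop :=
  ∃ S, E.IsSymmetrizer S ∧ ∃ c : ℝ, 0 < c ∧
    ∀ θ : Fin (k + 1) → ℝ, ∑ i, θ i ^ 2 = 1 → ∀ (μ : ℝ) (v : Fin n → ℂ), E.InEigenspace θ μ v →
      (E.dissForm S θ v v).re ≤ -c * (star v ⬝ᵥ (S θ *ᵥ v)).re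

/-- For some symmetrizer the restrictions of `W₁` to the eigenspaces of `W₀` are symmetric. -/
def SymmetricCompressions : Prop :=
  ∃ S, E.IsSymmetrizer S ∧
    ∀ θ : Fin (k + 1) → ℝ, ∑ i, θ i ^ 2 = 1 → ∀ (μ : ℝ) (v w : Fin n → ℂ),
      E.InEigenspace θ μ v → E.InEigenspace θ μ w →
      E.dissForm S θ v w = star (E.dissForm S θ w v)

/-- The structural assumptions on an endstate. -/
structure Admissible : Prop where
  A0_posDef : E.A0.PosDef
  A1_det : (E.A 0).det ≠ 0
  constMult : E.ConstantMultiplicities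
  B11_det : (E.B 0 0).det ≠ 0
  fast : ∀ x : ℝ, ¬ Module.End.HasEigenvalue
    (Matrix.toLin' (cx (E.A 0) * (cx (E.B 0 0))⁻¹)) (Complex.I * x)
  dissipative : E.Dissipative

end Endstate

/-! ### Frequencies and the limiting coefficient matrix -/

/-- Frequencies `ζ = (τ, γ, η)`, `λ = γ + i τ`. -/
abbrev Freq (k : ℕ) := ℝ × ℝ × (Fin k → ℝ)

/-- Polar coordinates `(ρ, ζ̂)` of a frequency `ζ = ρ ζ̂`. -/
abbrev Pt (k : ℕ) := ℝ × Freq k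

/-- `ζ` is in the unit sphere `S^d`. -/
def OnSphere {k : ℕ} (ζ : Freq k) : Prop := ζ.1 ^ 2 + ζ.2.1 ^ 2 + ∑ j, ζ.2.2 j ^ 2 = 1

/-- `κ(r) = r² / (1 + r²)`. -/
def kappa (r : ℝ) : ℝ := r ^ 2 / (1 + r ^ 2)

/-- The closure of
`S_c^d = {(ρ, ζ̂) ∈ (0, ∞) × S^d : γ̂ ≥ -c κ(√ρ |(τ̂, η̂)|)}`. -/
def SBar (k : ℕ) (c : ℝ) : Set (Pt k) :=
  {p | 0 ≤ p.1 ∧ OnSphere p.2 ∧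
    -c * kappa (√p.1 * √(p.2.1 ^ 2 + ∑ j, p.2.2.2 j ^ 2)) ≤ p.2.2.1}

/-- The sign belonging to an endstate: `true` is the endstate `u₊`, `false` is `u₋`. -/
def sgn (s : Bool) : ℝ := if s then 1 else -1

section
variable {n k : ℕ}

/-- `λ = γ + i τ`. -/
def lam (ζ : Freq k) : ℂ := ζ.2.1 + Complex.I * ζ.1

/-- The coefficient matrix `G(ζ)` of the first-order form `V_x = G V`, `V = (û, B¹¹ û_x)`, of the
Laplace-Fourier transformed system at an endstate. -/
def Gmat (E : Endstate n k) (ζ : Freq k) : Matrix (Fin n ⊕ Fin n) (Fin n ⊕ Fin n) ℂ :=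
  let η := ζ.2.2
  let S := Complex.I • cx (E.symB12 η) + lam ζ • cx (E.C 0) - cx (E.A 0)
  let s := (lam ζ) ^ 2 • cx E.Acal - (Complex.I * lam ζ) • cx (E.symC2 η) + cx (E.symB22 η)
    + lam ζ • cx E.A0 + Complex.I • cx (E.symA2 η)
  Matrix.fromBlocks 0 (cx (E.B 0 0))⁻¹ s (-(S * (cx (E.B 0 0))⁻¹))

/-- The limiting coefficient matrix `diag (G₊(ζ), -G₋(ζ))`, `ζ = ρ ζ̂`, of the double boundary value
problem. -/
def Ginf (E : Bool → Endstate n k) (p : Pt k) :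
    Matrix ((Fin n ⊕ Fin n) × Bool) ((Fin n ⊕ Fin n) × Bool) ℂ :=
  Matrix.blockDiagonal (fun s => (sgn s : ℂ) • Gmat (E s) (p.1 • p.2))

/-- `H_{0±}(ζ̂) = ∓ (A¹)⁻¹ (λ̂ A⁰ + i A₂(η̂))`, the leading part of the slow modes
(written without the similarity transformation by `(A⁰)^{1/2}`). -/
def H0 (E : Bool → Endstate n k) (s : Bool) (ζ : Freq k) : Matrix (Fin n) (Fin n) ℂ :=
  -(sgn s : ℂ) • ((cx ((E s).A 0))⁻¹ * (lam ζ • cx (E s).A0 + Complex.I • cx ((E s).symA2 ζ.2.2)))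

open Classical in
/-- The purely imaginary modes at `ζ`: the pairs `(±, ξ₁)` such that `i ξ₁`, `ξ₁` real, is an
eigenvalue of `H_{0±}(ζ)`. -/
def modes (E : Bool → Endstate n k) (ζ : Freq k) : Finset (Bool × ℝ) :=
  Finset.univ.biUnion (fun s : Bool =>
    ((H0 E s ζ).charpoly.roots.toFinset.filter (fun z => z.re = 0)).image (fun z => (s, z.im)))

/-- The mode `(±, ξ₁)` at `ζ = (τ, γ, η)` is glancing: `±ξ₁` is a multiple root of
`τ - a_l^±(·, η)` for some `l`. -/
def GlancingMode (E : Bool → Endstate n k) (ζ : Freq k) (j : Bool × ℝ) : Prop :=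
  (E j.1).IsGlancing ζ.1 (sgn j.1 * j.2) ζ.2.2

open Classical in
/-- The glancing modes. -/
def glancingModes (E : Bool → Endstate n k) (ζ : Freq k) : Finset (Bool × ℝ) :=
  (modes E ζ).filter (GlancingMode E ζ)

open Classical in
/-- The hyperbolic modes: the purely imaginary modes that are not glancing. -/
def hyperbolicModes (E : Bool → Endstate n k) (ζ : Freq k) : Finset (Bool × ℝ) :=
  (modes E ζ).filter (fun j => ¬ GlancingMode E ζ j)

/-- Column indices of a block decomposition with block sizes `kp, km` (fast), `ep, em` (elliptic)
and `ν j` (the purely imaginary modes, hyperbolic ones first). -/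
abbrev Col (E : Bool → Endstate n k) (ζ₀ : Freq k) (kp km ep em : ℕ)
    (ν : Bool × ℝ → ℕ) : Type :=
  ((Fin kp ⊕ Fin km) ⊕ (Fin ep ⊕ Fin em)) ⊕
    ((Σ j : hyperbolicModes E ζ₀, Fin (ν j.1)) ⊕ (Σ j : glancingModes E ζ₀, Fin (ν j.1)))

set_option synthInstance.maxSize 2000 in
instance (E : Bool → Endstate n k) (ζ₀ : Freq k) (kp km ep em : ℕ) (ν : Bool × ℝ → ℕ) :
    DecidableEq (Col E ζ₀ kp km ep em ν) :=
  inferInstance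

/-- A smooth block diagonalization of the limiting coefficient matrix near the base point
`(0, ζ₀)`, with respect to fast and slow modes and, for the slow modes, with respect to the groups
of eigenvalues splitting from the eigenvalues of `H_{0±}(ζ₀)`:
`T⁻¹ 𝒢 T = diag (P₊, P₋, ρ Q_{e+}, ρ Q_{e-}, ρ Q_h, ρ Q_g)`, where `Q_h` and `Q_g` are the direct
sums of the blocks `Q_j` belonging to the hyperbolic and to the glancing modes `j = (±, ξ₁)`. Smooth
families on `Ω = U ∩ SBar` are restrictions of smooth families on the open set `U`. -/
structure BlockDecomposition (E : Bool → Endstate n k) (c : ℝ) (ζ₀ : Freq k) where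
  U : Set (Pt k)
  isOpen_U : IsOpen U
  base_mem : ((0 : ℝ), ζ₀) ∈ U
  (kp km ep em : ℕ)
  /-- sizes of the blocks of the purely imaginary modes -/
  ν : Bool × ℝ → ℕ
  T : Pt k → Matrix ((Fin n ⊕ Fin n) × Bool) (Col E ζ₀ kp km ep em ν) ℂ
  Tinv : Pt k → Matrix (Col E ζ₀ kp km ep em ν) ((Fin n ⊕ Fin n) × Bool) ℂ
  Pp : Pt k → Matrix (Fin kp) (Fin kp) ℂ
  Pm : Pt k → Matrix (Fin km) (Fin km) ℂ
  Qep : Pt k → Matrix (Fin ep) (Fin ep) ℂ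
  Qem : Pt k → Matrix (Fin em) (Fin em) ℂ
  Q : (j : Bool × ℝ) → Pt k → Matrix (Fin (ν j)) (Fin (ν j)) ℂ
  smooth_T : ∀ i j, ContDiffOn ℝ ∞ (fun p => T p i j) U
  smooth_Pp : ∀ i j, ContDiffOn ℝ ∞ (fun p => Pp p i j) U
  smooth_Pm : ∀ i j, ContDiffOn ℝ ∞ (fun p => Pm p i j) U
  smooth_Qep : ∀ i j, ContDiffOn ℝ ∞ (fun p => Qep p i j) U
  smooth_Qem : ∀ i j, ContDiffOn ℝ ∞ (fun p => Qem p i j) U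
  smooth_Q : ∀ m ∈ modes E ζ₀, ∀ i j, ContDiffOn ℝ ∞ (fun p => Q m p i j) U
  mul_inv : ∀ p ∈ U ∩ SBar k c, T p * Tinv p = 1
  inv_mul : ∀ p ∈ U ∩ SBar k c, Tinv p * T p = 1
  diag : ∀ p ∈ U ∩ SBar k c, Tinv p * Ginf E p * T p =
    fromBlocks
      (fromBlocks (fromBlocks (Pp p) 0 0 (Pm p)) 0 0
        ((p.1 : ℂ) • fromBlocks (Qep p) 0 0 (Qem p))) 0 0
      ((p.1 : ℂ) • fromBlocks
        (blockDiagonal' (fun j : hyperbolicModes E ζ₀ => Q j.1 p)) 0 0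
        (blockDiagonal' (fun j : glancingModes E ζ₀ => Q j.1 p)))
  /-- the fast and the elliptic modes are uniformly definite -/
  definite : ∃ δ : ℝ, 0 < δ ∧ ∀ p ∈ U ∩ SBar k c,
    ReGe (Pp p) δ ∧ ReLe (Pm p) (-δ) ∧ ReGe (Qep p) δ ∧ ReLe (Qem p) (-δ)
  /-- the eigenvalues of the block `Q_j`, `j = (±, ξ₁)`, split from `i ξ₁` -/
  base_spectrum : ∀ j ∈ modes E ζ₀, (Q j (0, ζ₀)).charpoly =
    (Polynomial.X - Polynomial.C (Complex.I * (j.2 : ℂ))) ^ (ν j)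
  /-- the block `Q_j`, `j = (±, ξ₁)`, arises from the endstate `u_±` -/
  support_h : ∀ p ∈ U ∩ SBar k c, ∀ (i : Fin n ⊕ Fin n) (s : Bool)
    (j : hyperbolicModes E ζ₀) (b : Fin (ν j.1)), s ≠ j.1.1 →
      T p (i, s) (Sum.inr (Sum.inl ⟨j, b⟩)) = 0
  support_g : ∀ p ∈ U ∩ SBar k c, ∀ (i : Fin n ⊕ Fin n) (s : Bool)
    (j : glancingModes E ζ₀) (b : Fin (ν j.1)), s ≠ j.1.1 →
      T p (i, s) (Sum.inr (Sum.inr ⟨j, b⟩)) = 0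

/-! ### The assertions on the hyperbolic and on the glancing blocks -/

/-- The hyperbolic part: on `V ∩ SBar` the matrix `Q_h` is split by a smooth, uniformly bounded and
boundedly invertible change of basis `T_h` into a block with `Re ≥ c₁ (ρ + γ̂)` and a block with
`Re ≤ -c₁ (ρ + γ̂)`. -/
def HyperbolicSplitting {E : Bool → Endstate n k} {c : ℝ} {ζ₀ : Freq k}
    (D : BlockDecomposition E c ζ₀) (V : Set (Pt k)) (K c₁ : ℝ) : Prop :=
  ∃ (hp hm : ℕ)
    (Th : Pt k → Matrix (Σ j : hyperbolicModes E ζ₀, Fin (D.ν j.1)) (Fin hp ⊕ Fin hm) ℂ)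
    (Thinv : Pt k → Matrix (Fin hp ⊕ Fin hm) (Σ j : hyperbolicModes E ζ₀, Fin (D.ν j.1)) ℂ)
    (Qp : Pt k → Matrix (Fin hp) (Fin hp) ℂ) (Qm : Pt k → Matrix (Fin hm) (Fin hm) ℂ),
    (∀ i j, ContDiffOn ℝ ∞ (fun p => Th p i j) V) ∧
    ∀ p ∈ V ∩ SBar k c,
      Th p * Thinv p = 1 ∧ Thinv p * Th p = 1 ∧ ‖Th p‖ ≤ K ∧ ‖Thinv p‖ ≤ K ∧
      Thinv p * blockDiagonal' (fun j : hyperbolicModes E ζ₀ => D.Q j.1 p) * Th p =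
        fromBlocks (Qp p) 0 0 (Qm p) ∧
      ReGe (Qp p) (c₁ * (p.1 + p.2.2.1)) ∧ ReLe (Qm p) (-(c₁ * (p.1 + p.2.2.1)))

/-- `ν_r = (|τ̂ - a_r(η̂)| + γ̂ + ρ)^{1/s}` with `a_r(η̂) = a_l(g η̂, η̂)`. -/
def nu (E : Endstate n k) (l s : ℕ) (g : (Fin k → ℝ) → ℝ) (p : Pt k) : ℝ :=
  (|p.2.1 - E.a l (vecCons (g p.2.2.2) p.2.2.2)| + p.2.2.1 + p.1) ^ (1 / (s : ℝ))

/-- `β_r = ν_r^{1 - s} = (|τ̂ - a_r(η̂)| + γ̂ + ρ)^{1/s - 1}`. -/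
def beta (E : Endstate n k) (l s : ℕ) (g : (Fin k → ℝ) → ℝ) (p : Pt k) : ℝ :=
  nu E l s g p ^ (1 - (s : ℝ))

/-- `α_r = ν_r^{1 - [(s + 1)/2]}`, with the integer part in the exponent. -/
def alpha (E : Endstate n k) (l s : ℕ) (g : (Fin k → ℝ) → ℝ) (p : Pt k) : ℝ :=
  nu E l s g p ^ (1 - (((s + 1) / 2 : ℕ) : ℝ))

/-- The glancing part: for each glancing mode `r = (±, ξ₁)`, with its glancing surface
`τ = a_r(η)` of multiplicity `s`, the block `Q_r` is split on `(V ∩ SBar) \ {ρ = γ̂ = 0}` by a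
change of basis `T_r` with `|T_r| ≤ K`, `|T_r⁻¹| ≤ K β_r`, and `|(T_r|_-)⁻¹| ≤ K α_r` for the
restriction of `T_r` to the coordinates of the stable block, into a block with
`Re ≥ c₁ (ρ + γ̂) β_r` and a block with `Re ≤ -c₁ (ρ + γ̂) β_r`. -/
def GlancingSplitting {E : Bool → Endstate n k} {c : ℝ} {ζ₀ : Freq k}
    (D : BlockDecomposition E c ζ₀) (V : Set (Pt k)) (K c₁ : ℝ) : Prop :=
  ∀ r ∈ glancingModes E ζ₀, ∃ (l s : ℕ) (g : (Fin k → ℝ) → ℝ),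
    (E r.1).IsGlancingCurve ζ₀.1 (sgn r.1 * r.2) ζ₀.2.2 l s g ∧
    ∃ (gp gm : ℕ) (Tg : Pt k → Matrix (Fin (D.ν r)) (Fin gp ⊕ Fin gm) ℂ)
      (Tginv : Pt k → Matrix (Fin gp ⊕ Fin gm) (Fin (D.ν r)) ℂ)
      (Qp : Pt k → Matrix (Fin gp) (Fin gp) ℂ) (Qm : Pt k → Matrix (Fin gm) (Fin gm) ℂ),
      ∀ p ∈ V ∩ SBar k c, ¬ (p.1 = 0 ∧ p.2.2.1 = 0) →
        Tg p * Tginv p = 1 ∧ Tginv p * Tg p = 1 ∧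
        ‖Tg p‖ ≤ K ∧ ‖Tginv p‖ ≤ K * beta (E r.1) l s g p ∧
        (∀ w : Fin gm → ℂ, ‖WithLp.toLp 2 w‖ ≤
          K * alpha (E r.1) l s g p * ‖WithLp.toLp 2 (Tg p *ᵥ Sum.elim 0 w)‖) ∧
        Tginv p * D.Q r p * Tg p = fromBlocks (Qp p) 0 0 (Qm p) ∧
        ReGe (Qp p) (c₁ * (p.1 + p.2.2.1) * beta (E r.1) l s g p) ∧
        ReLe (Qm p) (-(c₁ * (p.1 + p.2.2.1) * beta (E r.1) l s g p))

end

end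

end HHShock

namespace HHShock

open Complex (I I_mul_I I_mul_im I_mul_re I_ne_zero I_re continuous_ofReal norm_I norm_real ofRealCLM ofRealHom ofReal_mul ofReal_one ofReal_pow ofReal_re ofReal_sub ofReal_zero re_mul_ofReal re_ofReal_mul re_sum real_smul star_def)
open Finset (mem_filter mem_range mem_univ mul_sum single_le_sum smul_sum sum_comm sum_congr sum_eq_single sum_eq_zero sum_le_sum sum_mul univ)
open Fintype (card card_fin equivFin equivOfCardEq sum_of_injective sum_prod_type sum_sigma sum_sum_type)
open Polynomial (eval_C eval_X eval_prod mem_roots)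
open Function (Bijective Injective bijective_id ne_iff)
open Real (norm_eq_abs norm_of_nonneg rpow_natCast rpow_nonneg sq_sqrt)

/-! ### Smooth matrix families -/

section Implicit

variable {X F : Type*} [NormedAddCommGroup X] [NormedSpace ℝ X] [CompleteSpace X]
  [NormedAddCommGroup F] [NormedSpace ℝ F] [FiniteDimensional ℝ F]

/-- The implicit function theorem in the form used below: the partial derivative is only required
to be injective along lines. -/
theorem exists_implicit_function (Φ : X × F → F) (x₀ : X) (z₀ : F)
    (hΦ : ContDiffAt ℝ ω Φ (x₀, z₀)) (h0 : Φ (x₀, z₀) = 0)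
    (hinj : ∀ w : F, HasDerivAt (fun t : ℝ => Φ (x₀, z₀ + t • w)) 0 0 → w = 0) :
    ∃ ψ : X → F, ψ x₀ = z₀ ∧ ContDiffAt ℝ ω ψ x₀ ∧ ∀ᶠ x in 𝓝 x₀, Φ (x, ψ x) = 0 := by
  have : CompleteSpace F := FiniteDimensional.complete ℝ F
  have hd : HasFDerivAt Φ (fderiv ℝ Φ (x₀, z₀)) (x₀, z₀) :=
    (hΦ.differentiableAt (by simp)).hasFDerivAt
  have key : Injective (fderiv ℝ Φ (x₀, z₀) ∘L .inr ℝ X F) := by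
    rw [injective_iff_map_eq_zero]
    intro w hw
    apply hinj
    have hc : HasDerivAt (fun t : ℝ => ((x₀, z₀ + t • w) : X × F)) (0, w) 0 := by
      have h2 : HasDerivAt (fun t : ℝ => z₀ + t • w) w 0 := by
        simpa using ((hasDerivAt_id (0 : ℝ)).smul_const w).const_add z₀
      exact (hasDerivAt_const (0 : ℝ) x₀).prodMk h2
    have h3 : HasFDerivAt Φ (fderiv ℝ Φ (x₀, z₀)) ((x₀, z₀ + (0 : ℝ) • w) : X × F) := by
      simpa using hd
    have h4 := h3.comp_hasDerivAt (0 : ℝ) hc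
    have h5 : fderiv ℝ Φ (x₀, z₀) (0, w) = 0 := by simpa using hw
    rw [h5] at h4
    exact h4
  let e : F ≃ₗ[ℝ] F := LinearEquiv.ofInjectiveEndo
    ((fderiv ℝ Φ (x₀, z₀) ∘L .inr ℝ X F : F →L[ℝ] F) : F →ₗ[ℝ] F) key
  have hinv : (fderiv ℝ Φ (x₀, z₀) ∘L .inr ℝ X F).IsInvertible := by
    refine ⟨e.toContinuousLinearEquiv, ?_⟩
    ext w
    rfl
  refine ⟨hΦ.implicitFunction (by simp) hinv, ?_, ?_, ?_⟩
  · exact hΦ.implicitFunction_apply_self (by simp) hinv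
  · exact hΦ.contDiffAt_implicitFunction (by simp) hinv
  · have := hΦ.eventually_apply_implicitFunction (by simp) hinv
    rw [h0] at this
    exact this

end Implicit

section MatTop

variable {ι κ Y : Type*}

theorem tendsto_matrix {f : Y → Matrix ι κ ℂ} {l : Filter Y} {M : Matrix ι κ ℂ} :
    Tendsto f l (𝓝 M) ↔ ∀ i j, Tendsto (fun p => f p i j) l (𝓝 (M i j)) := by
  refine Iff.trans (tendsto_pi_nhds (f := f) (u := l) (g := M)) (forall_congr' fun i => ?_)
  exact tendsto_pi_nhds

theorem continuousAt_matrix [TopologicalSpace Y] {f : Y → Matrix ι κ ℂ} {y : Y} :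
    ContinuousAt f y ↔ ∀ i j, ContinuousAt (fun p => f p i j) y := tendsto_matrix

end MatTop

section MatSmooth

variable {X : Type*} [NormedAddCommGroup X] [NormedSpace ℝ X] {N : ℕ∞ω} {x : X}
variable {ι κ μ : Type*}

/-- A matrix family is smooth at a point if its entries are. -/
def MSmooth (N : ℕ∞ω) (f : X → Matrix ι κ ℂ) (x : X) : Prop :=
  ∀ i j, ContDiffAt ℝ N (fun p => f p i j) x

theorem MSmooth.const (M : Matrix ι κ ℂ) : MSmooth N (fun _ : X => M) x :=
  fun _ _ => contDiffAt_const

theorem MSmooth.add {f g : X → Matrix ι κ ℂ} (hf : MSmooth N f x) (hg : MSmooth N g x) :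
    MSmooth N (fun p => f p + g p) x := fun i j => (hf i j).add (hg i j)

theorem MSmooth.sub {f g : X → Matrix ι κ ℂ} (hf : MSmooth N f x) (hg : MSmooth N g x) :
    MSmooth N (fun p => f p - g p) x := fun i j => (hf i j).sub (hg i j)

theorem MSmooth.neg {f : X → Matrix ι κ ℂ} (hf : MSmooth N f x) :
    MSmooth N (fun p => -f p) x := fun i j => (hf i j).neg

theorem MSmooth.smul {a : X → ℂ} {f : X → Matrix ι κ ℂ} (ha : ContDiffAt ℝ N a x)
    (hf : MSmooth N f x) : MSmooth N (fun p => a p • f p) x := fun i j => ha.mul (hf i j)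

theorem MSmooth.mul [Fintype κ] {f : X → Matrix ι κ ℂ} {g : X → Matrix κ μ ℂ}
    (hf : MSmooth N f x) (hg : MSmooth N g x) : MSmooth N (fun p => f p * g p) x := by
  intro i j
  simp only [Matrix.mul_apply]
  exact ContDiffAt.sum fun k _ => (hf i k).mul (hg k j)

theorem MSmooth.pow [Fintype ι] [DecidableEq ι] {f : X → Matrix ι ι ℂ}
    (hf : MSmooth N f x) (m : ℕ) : MSmooth N (fun p => f p ^ m) x := by
  induction m with
  | zero => simpa using MSmooth.const 1
  | succ m ih => simpa only [pow_succ] using ih.mul hf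

theorem MSmooth.sum {α : Type*} (s : Finset α) {f : α → X → Matrix ι κ ℂ}
    (hf : ∀ a ∈ s, MSmooth N (f a) x) : MSmooth N (fun p => ∑ a ∈ s, f a p) x := by
  intro i j
  simp only [Matrix.sum_apply]
  exact ContDiffAt.sum fun a ha => hf a ha i j

theorem MSmooth.of_le {N' : ℕ∞ω} {f : X → Matrix ι κ ℂ} (hf : MSmooth N f x) (h : N' ≤ N) :
    MSmooth N' f x := fun i j => (hf i j).of_le h

theorem MSmooth.comp {Y : Type*} [NormedAddCommGroup Y] [NormedSpace ℝ Y] {g : Y → X} {y : Y}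
    {f : X → Matrix ι κ ℂ} (hf : MSmooth N f (g y)) (hg : ContDiffAt ℝ N g y) :
    MSmooth N (fun p => f (g p)) y := fun i j =>
  ContDiffAt.comp (g := fun p => f p i j) y (hf i j) hg

theorem MSmooth.det [Fintype ι] [DecidableEq ι] {f : X → Matrix ι ι ℂ} (hf : MSmooth N f x) :
    ContDiffAt ℝ N (fun p => (f p).det) x := by
  simp only [det_apply]
  refine ContDiffAt.sum fun σ _ => ContDiffAt.const_smul _ ?_
  exact contDiffAt_prod fun i _ => hf _ _

theorem MSmooth.inv [Fintype ι] [DecidableEq ι] {f : X → Matrix ι ι ℂ} (hf : MSmooth N f x)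
    (h : (f x).det ≠ 0) : MSmooth N (fun p => (f p)⁻¹) x := by
  intro i j
  simp only [inv_def, Ring.inverse_eq_inv', Matrix.smul_apply, smul_eq_mul, adjugate_apply]
  refine (hf.det.inv h).mul (MSmooth.det (f := fun p => (f p).updateRow j (Pi.single i 1)) ?_)
  intro a b
  by_cases hab : a = j
  · subst hab
    simpa using contDiffAt_const
  · simpa [updateRow_ne hab] using hf a b

theorem MSmooth.submatrix {α β : Type*} {f : X → Matrix ι κ ℂ} (hf : MSmooth N f x)
    (a : α → ι) (b : β → κ) : MSmooth N (fun p => (f p).submatrix a b) x :=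
  fun i j => hf (a i) (b j)

theorem MSmooth.fromBlocks {α β : Type*} {A : X → Matrix ι κ ℂ} {B : X → Matrix ι β ℂ}
    {C : X → Matrix α κ ℂ} {D : X → Matrix α β ℂ} (hA : MSmooth N A x) (hB : MSmooth N B x)
    (hC : MSmooth N C x) (hD : MSmooth N D x) :
    MSmooth N (fun p => fromBlocks (A p) (B p) (C p) (D p)) x := by
  rintro (i | i) (j | j)
  · exact hA i j
  · exact hB i j
  · exact hC i j
  · exact hD i j

theorem MSmooth.conjTranspose {f : X → Matrix ι κ ℂ} (hf : MSmooth N f x) :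
    MSmooth N (fun p => (f p)ᴴ) x := by
  intro i j
  simp only [conjTranspose_apply]
  exact (Complex.conjCLE.contDiff.contDiffAt).comp x (hf j i)

theorem MSmooth.continuousAt {f : X → Matrix ι κ ℂ}
    (hf : MSmooth N f x) : ContinuousAt f x :=
  continuousAt_matrix.2 fun i j => (hf i j).continuousAt

theorem MSmooth.comp_matrix {α β : Type*} {f : X → Matrix ι κ ℂ} [Fintype ι] [Fintype κ]
    {T : (ι → κ → ℂ) → Matrix α β ℂ} {y : ι → κ → ℂ} (hT : MSmooth N T y)
    (hf : MSmooth N f x) (hy : ∀ i j, f x i j = y i j) :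
    MSmooth N (fun p => T fun i j => f p i j) x := by
  have h : ContDiffAt ℝ N (fun p => (fun i j => f p i j : ι → κ → ℂ)) x :=
    contDiffAt_pi.2 fun i => contDiffAt_pi.2 fun j => hf i j
  have hy' : (fun i j => f x i j : ι → κ → ℂ) = y := by
    funext i j; exact hy i j
  exact MSmooth.comp (f := T) (hy'.symm ▸ hT) h

end MatSmooth


/-! ### Block diagonalization near a diagonal matrix -/

section BlockDiag

variable {ι Λ : Type*} [Fintype ι] [DecidableEq ι] [DecidableEq Λ]

/-- The part of a matrix between indices of different labels. -/
def offPart (lab : ι → Λ) (Z : ι → ι → ℂ) : Matrix ι ι ℂ :=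
  of fun i j => if lab i = lab j then 0 else Z i j

/-- The part of a matrix between indices of equal labels. -/
def dgPart (lab : ι → Λ) (Z : ι → ι → ℂ) : Matrix ι ι ℂ :=
  of fun i j => if lab i = lab j then Z i j else 0

section

variable {X : Type*} [NormedAddCommGroup X] [NormedSpace ℝ X] {f : X → ι → ι → ℂ} {x : X} (lab : ι → Λ)

omit [Fintype ι] [DecidableEq ι] in
theorem mSmooth_offPart (hf : ∀ i j, ContDiffAt ℝ ω (fun p => f p i j) x) :
    MSmooth ω (fun p => offPart lab (f p)) x := fun i j => by
  by_cases h : lab i = lab j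
  · simpa [offPart, h] using contDiffAt_const
  · simpa [offPart, h] using hf i j

omit [Fintype ι] [DecidableEq ι] in
theorem mSmooth_dgPart (hf : ∀ i j, ContDiffAt ℝ ω (fun p => f p i j) x) :
    MSmooth ω (fun p => dgPart lab (f p)) x := fun i j => by
  by_cases h : lab i = lab j
  · simpa [dgPart, h] using hf i j
  · simpa [dgPart, h] using contDiffAt_const

end

/-- Near a diagonal matrix whose entries separate the labels, matrices are block diagonalized by an
analytic family of transformations. -/
theorem exists_blockDiag_pi (lab : ι → Λ) (d : ι → ℂ) (hd : ∀ i j, lab i ≠ lab j → d i ≠ d j)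
    (M₀ : ι → ι → ℂ) (hM₀ : ∀ i j, M₀ i j = diagonal d i j) :
    ∃ T D : (ι → ι → ℂ) → Matrix ι ι ℂ,
      T M₀ = 1 ∧ D M₀ = diagonal d ∧ MSmooth ω T M₀ ∧ MSmooth ω D M₀ ∧
      (∀ M i j, lab i ≠ lab j → D M i j = 0) ∧
      (∀ᶠ M in 𝓝 M₀, of M * T M = T M * D M ∧ (T M).det ≠ 0) ∧
      (∀ δ : ℝ, 0 < δ → ∀ᶠ p in 𝓝 (M₀, M₀), ∀ i j, lab i = lab j →
          ‖D p.1 i j - D p.2 i j - (p.1 i j - p.2 i j)‖ ≤ δ * ‖p.1 - p.2‖) := by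
  let Φ : (ι → ι → ℂ) × (ι → ι → ℂ) → (ι → ι → ℂ) := fun p =>
    (of p.1 * (1 + offPart lab p.2) - (1 + offPart lab p.2) * dgPart lab p.2 : Matrix ι ι ℂ)
  have hfst : MSmooth ω (fun p : (ι → ι → ℂ) × (ι → ι → ℂ) => of p.1)
      (M₀, M₀) := fun i j =>
    (contDiffAt_pi.1 (contDiffAt_pi.1 contDiffAt_fst i) j)
  have hsnd : ∀ i j, ContDiffAt ℝ ω (fun p : (ι → ι → ℂ) × (ι → ι → ℂ) => p.2 i j)
      (M₀, M₀) := fun i j =>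
    (contDiffAt_pi.1 (contDiffAt_pi.1 contDiffAt_snd i) j)
  have hΦ : ContDiffAt ℝ ω Φ (M₀, M₀) := by
    rw [contDiffAt_pi]
    intro i
    rw [contDiffAt_pi]
    intro j
    have h1 := (MSmooth.const (N := ω) (x := ((M₀, M₀) : (ι → ι → ℂ) × (ι → ι → ℂ)))
      (1 : Matrix ι ι ℂ)).add (mSmooth_offPart lab hsnd)
    exact ((hfst.mul h1).sub (h1.mul (mSmooth_dgPart lab hsnd))) i j
  have hM0 : ∀ i j, lab i ≠ lab j → M₀ i j = 0 := fun i j h => by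
    rw [hM₀, diagonal_apply_ne _ fun e => h (congrArg lab e)]
  have hoff0 : offPart lab M₀ = 0 := by
    ext i j
    by_cases h : lab i = lab j <;> simp [offPart, h, hM0]
  have hdg0 : dgPart lab M₀ = diagonal d := by
    ext i j
    by_cases h : lab i = lab j <;> simp [dgPart, h, ← hM₀, hM0]
  have hM₀' : of M₀ = diagonal d := by
    ext i j
    exact hM₀ i j
  have h0 : Φ (M₀, M₀) = 0 := by
    simp only [Φ, hoff0, hdg0, hM₀', add_zero, mul_one, one_mul]
    exact sub_self (diagonal d)
  have hinj : ∀ w : ι → ι → ℂ, HasDerivAt (fun t : ℝ => Φ (M₀, M₀ + t • w)) 0 0 → w = 0 := by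
    intro w hw
    let A : ι → ι → ℂ := fun i j =>
      (d i - d j) * offPart lab w i j - dgPart lab w i j
    let B : ι → ι → ℂ := fun i j => -(offPart lab w * dgPart lab w) i j
    have hform : (fun t : ℝ => Φ (M₀, M₀ + t • w)) = fun t : ℝ => t • A + (t ^ 2) • B := by
      funext t
      have e1 : offPart lab (M₀ + t • w) = (t : ℂ) • offPart lab w := by
        ext i j
        by_cases h : lab i = lab j <;> simp [offPart, h, hM0]
      have e2 : dgPart lab (M₀ + t • w) = diagonal d + (t : ℂ) • dgPart lab w := by
        ext i j
        by_cases h : lab i = lab j <;> simp [dgPart, h, ← hM₀, hM0]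
      have e3 : Φ (M₀, M₀ + t • w) = (diagonal d * (1 + (t : ℂ) • offPart lab w) -
          (1 + (t : ℂ) • offPart lab w) * (diagonal d + (t : ℂ) • dgPart lab w) : Matrix ι ι ℂ) := by
        simp only [Φ, e1, e2, hM₀']
        rfl
      rw [e3]
      have e4 : (diagonal d * (1 + (t : ℂ) • offPart lab w) -
          (1 + (t : ℂ) • offPart lab w) * (diagonal d + (t : ℂ) • dgPart lab w) :
          Matrix ι ι ℂ) = (t : ℂ) • (diagonal d * offPart lab w - offPart lab w * diagonal d -
            dgPart lab w) + ((t : ℂ) ^ 2) • (-(offPart lab w * dgPart lab w)) := by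
        simp only [mul_add, add_mul, mul_one, one_mul, Matrix.mul_smul, smul_mul, smul_sub,
          smul_smul, smul_neg, pow_two]
        abel
      rw [e4]
      funext i j
      simp only [Pi.add_apply, Pi.smul_apply, A, B, real_smul, ofReal_pow]
      simp only [Matrix.add_apply, Matrix.smul_apply, Matrix.sub_apply, Matrix.neg_apply,
        diagonal_mul, mul_diagonal, smul_eq_mul]
      ring
    rw [hform] at hw
    have hA : HasDerivAt (fun t : ℝ => t • A + (t ^ 2) • B) A 0 := by
      have h1 := ((hasDerivAt_id (0 : ℝ)).smul_const A).fun_add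
        ((hasDerivAt_pow 2 (0 : ℝ)).smul_const B)
      simpa using h1
    have hA0 : A = 0 := hA.unique hw
    funext i j
    have hij := congrFun (congrFun hA0 i) j
    by_cases h : lab i = lab j
    · simpa [A, offPart, dgPart, h] using hij
    · have hne := sub_ne_zero.2 (hd i j h)
      simpa [A, offPart, dgPart, h, hne] using hij
  obtain ⟨ψ, hψ0, hψs, hψ⟩ := exists_implicit_function Φ M₀ M₀ hΦ h0 hinj
  have hψe : ∀ i j, ContDiffAt ℝ ω (fun M => ψ M i j) M₀ := fun i j =>
    contDiffAt_pi.1 (contDiffAt_pi.1 hψs i) j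
  have hToff := mSmooth_offPart lab hψe
  have hT : MSmooth ω (fun M => 1 + offPart lab (ψ M)) M₀ := (MSmooth.const 1).add hToff
  have hD := mSmooth_dgPart lab hψe
  have hmul : ∀ᶠ M in 𝓝 M₀, of M * (1 + offPart lab (ψ M)) =
      (1 + offPart lab (ψ M)) * dgPart lab (ψ M) := by
    filter_upwards [hψ] with M hM
    exact sub_eq_zero.1 hM
  refine ⟨fun M => 1 + offPart lab (ψ M), fun M => dgPart lab (ψ M), ?_, ?_, hT, hD, ?_, ?_, ?_⟩
  · change 1 + offPart lab (ψ M₀) = 1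
    rw [hψ0, hoff0, add_zero]
  · change dgPart lab (ψ M₀) = _
    rw [hψ0, hdg0]
  · intro M i j h
    simp [dgPart, h]
  · have hdet : ContinuousAt (fun M => (1 + offPart lab (ψ M)).det) M₀ := hT.det.continuousAt
    have h1 : (1 + offPart lab (ψ M₀)).det ≠ 0 := by rw [hψ0, hoff0]; simp
    filter_upwards [hmul, hdet.eventually_ne h1] with M hM hM2
    exact ⟨hM, hM2⟩
  · intro δ hδ
    rw [eventually_all]
    intro i
    rw [eventually_all]
    intro j
    by_cases h : lab i = lab j
    swap
    · exact Eventually.of_forall fun p hp => absurd hp h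
    have hprod : ∀ a ∈ univ, HasStrictFDerivAt (fun M : ι → ι → ℂ => M i a * offPart lab (ψ M) a j)
        (0 : (ι → ι → ℂ) →L[ℝ] ℂ) M₀ := fun a _ => by
      by_cases ha : lab a = lab j
      · simpa [offPart, ha] using hasStrictFDerivAt_const (0 : ℂ) M₀
      · have h1 : ContDiffAt ℝ ω (fun M : ι → ι → ℂ => M i a) M₀ :=
          contDiffAt_pi.1 (contDiffAt_pi.1 contDiffAt_id i) a
        have h2 := (h1.hasStrictFDerivAt (by simp)).mul ((hToff a j).hasStrictFDerivAt (by simp))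
        refine h2.congr_fderiv ?_
        ext w
        simp [hψ0, hoff0, hM0 i a fun e => ha (e ▸ h)]
    have h1 : ∀ᶠ M in 𝓝 M₀, dgPart lab (ψ M) i j - M i j = ∑ a, M i a * offPart lab (ψ M) a j := by
      filter_upwards [hmul] with M hM
      have h2 := congrFun (congrFun hM i) j
      rw [Matrix.mul_add, Matrix.add_mul, Matrix.mul_one, Matrix.one_mul, Matrix.add_apply, Matrix.add_apply,
        Matrix.mul_apply, Matrix.mul_apply, sum_eq_zero (s := univ) (f := fun a => offPart lab (ψ M) i a * _) (fun a _ => by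
          by_cases ha : lab i = lab a
          · simp [offPart, ha]
          · simp [dgPart, ← h, Ne.symm ha]), add_zero] at h2
      exact sub_eq_of_eq_add' h2.symm
    filter_upwards [(HasStrictFDerivAt.fun_sum hprod).isLittleO.def hδ, h1.prod_nhds h1] with p hp hp' _
    rw [← hp'.1, ← hp'.2] at hp
    simpa [sub_sub_sub_comm] using hp

theorem norm_entry_le {κ : Type*} [Fintype κ] [DecidableEq κ] (M : Matrix ι κ ℂ) (i : ι) (j : κ) :
    ‖M i j‖ ≤ ‖M‖ := by
  have h := l2_opNorm_mulVec M (WithLp.toLp 2 (Pi.single j 1))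
  simp only [PiLp.norm_single, PiLp.toLp_single, norm_one, mul_one] at h
  refine le_trans ?_ h
  have h2 := PiLp.norm_apply_le (WithLp.toLp 2 (M *ᵥ Pi.single j (1 : ℂ))) i
  simpa using h2

/-- Near a diagonal matrix whose entries separate the labels, matrices are block diagonalized by an
analytic family of transformations; to first order the blocks of the block diagonal form are those
of the matrix. -/
theorem exists_blockDiag (lab : ι → Λ) (d : ι → ℂ) (hd : ∀ i j, lab i ≠ lab j → d i ≠ d j) :
    ∃ T D : Matrix ι ι ℂ → Matrix ι ι ℂ,
      T (diagonal d) = 1 ∧ D (diagonal d) = diagonal d ∧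
      ContinuousAt T (diagonal d) ∧ ContinuousAt D (diagonal d) ∧
      (∀ᶠ M in 𝓝 (diagonal d), ∀ (X : Type) [NormedAddCommGroup X] [NormedSpace ℝ X]
        (f : X → Matrix ι ι ℂ) (x : X), f x = M → MSmooth ω f x →
        MSmooth ω (fun p => T (f p)) x ∧ MSmooth ω (fun p => D (f p)) x) ∧
      (∀ M i j, lab i ≠ lab j → D M i j = 0) ∧
      (∀ᶠ M in 𝓝 (diagonal d), M * T M = T M * D M ∧ (T M).det ≠ 0) ∧
      (∀ δ : ℝ, 0 < δ → ∀ᶠ p in 𝓝 ((diagonal d, diagonal d) : Matrix ι ι ℂ × Matrix ι ι ℂ),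
        ∀ i j, lab i = lab j →
          ‖D p.1 i j - D p.2 i j - (p.1 i j - p.2 i j)‖ ≤ δ * ‖p.1 - p.2‖) := by
  obtain ⟨T, D, hT0, hD0, hTs, hDs, hoff, hTD, hstr⟩ :=
    exists_blockDiag_pi lab d hd (fun i j => diagonal d i j) fun _ _ => rfl
  have hto : Tendsto (fun M : Matrix ι ι ℂ => (fun i j => M i j : ι → ι → ℂ)) (𝓝 (diagonal d))
      (𝓝 fun i j => diagonal d i j) := by
    rw [tendsto_pi_nhds]; intro i
    rw [tendsto_pi_nhds]; intro j
    exact (continuousAt_matrix.1 continuousAt_id) i j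
  refine ⟨fun M => T fun i j => M i j, fun M => D fun i j => M i j, hT0, hD0, ?_, ?_, ?_,
    fun M => hoff _, hto.eventually hTD, fun δ hδ => ?_⟩
  · exact (hTs.continuousAt.tendsto.comp hto)
  · exact (hDs.continuousAt.tendsto.comp hto)
  · have h1 : ∀ᶠ M in 𝓝 (fun i j => diagonal d i j : ι → ι → ℂ), MSmooth ω T M ∧ MSmooth ω D M := by
      refine Filter.Eventually.and ?_ ?_
      · exact eventually_all.2 fun i => eventually_all.2 fun j =>
          (hTs i j).eventually (by simp)
      · exact eventually_all.2 fun i => eventually_all.2 fun j =>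
          (hDs i j).eventually (by simp)
    filter_upwards [hto.eventually h1] with M hM X _ _ f x hfx hf
    subst hfx
    exact ⟨hM.1.comp_matrix hf fun _ _ => rfl, hM.2.comp_matrix hf fun _ _ => rfl⟩
  · have h2 := (hto.prodMap hto)
    rw [← nhds_prod_eq, ← nhds_prod_eq] at h2
    filter_upwards [h2.eventually (hstr δ hδ)] with p hp i j hij
    refine (hp i j hij).trans (mul_le_mul_of_nonneg_left ?_ hδ.le)
    refine (pi_norm_le_iff_of_nonneg (norm_nonneg _)).2 fun a =>
      (pi_norm_le_iff_of_nonneg (norm_nonneg _)).2 fun b => ?_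
    exact norm_entry_le (p.1 - p.2) a b

end BlockDiag


/-! ### Matrices are similar to almost diagonal matrices -/

section NearDiag

variable {ι κ : Type*} [Fintype ι] [DecidableEq ι] [Fintype κ] [DecidableEq κ]

/-- `M` is similar to matrices arbitrarily close to a fixed diagonal matrix with the same
characteristic polynomial. -/
def NearDiag (M : Matrix ι ι ℂ) : Prop :=
  ∃ d : ι → ℂ, M.charpoly = ∏ i, (Polynomial.X - Polynomial.C (d i)) ∧
    ∀ ε : ℝ, 0 < ε → ∃ C : Matrix ι ι ℂ, C.det ≠ 0 ∧
      ∀ i j, ‖(C⁻¹ * M * C) i j - diagonal d i j‖ ≤ ε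

theorem NearDiag.conj {M P : Matrix ι ι ℂ} (hP : P.det ≠ 0) (h : NearDiag (P⁻¹ * M * P)) :
    NearDiag M := by
  obtain ⟨d, hd, h⟩ := h
  refine ⟨d, ?_, fun ε hε => ?_⟩
  · rw [← hd]
    have hu : IsUnit P.det := isUnit_iff_ne_zero.2 hP
    have h1 := charpoly_units_conj' (P.nonsingInvUnit hu) M
    exact h1.symm
  · obtain ⟨C, hC, hCd⟩ := h ε hε
    refine ⟨P * C, by simp [hP, hC], fun i j => ?_⟩
    have := hCd i j
    rwa [show (P * C)⁻¹ * M * (P * C) = C⁻¹ * (P⁻¹ * M * P) * C by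
      rw [Matrix.mul_inv_rev]; simp only [Matrix.mul_assoc]]

theorem NearDiag.reindex {M : Matrix ι ι ℂ} (e : κ ≃ ι) (h : NearDiag (M.submatrix e e)) :
    NearDiag M := by
  obtain ⟨d, hd, h⟩ := h
  refine ⟨d ∘ e.symm, ?_, fun ε hε => ?_⟩
  · have h1 : (M.submatrix e e).charpoly = M.charpoly := by
      simpa using charpoly_reindex e.symm M
    rw [← h1, hd]
    exact Fintype.prod_equiv e _ _ (by simp)
  · obtain ⟨C, hC, hCd⟩ := h ε hε
    refine ⟨C.submatrix e.symm e.symm, by simpa using hC, fun i j => ?_⟩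
    have := hCd (e.symm i) (e.symm j)
    have e1 : ((C.submatrix e.symm e.symm)⁻¹ * M * C.submatrix e.symm e.symm) i j =
        (C⁻¹ * M.submatrix e e * C) (e.symm i) (e.symm j) := by
      have hM : M = (M.submatrix e e).submatrix e.symm e.symm := by simp
      conv_lhs => rw [hM]
      rw [inv_submatrix_equiv, submatrix_mul_equiv, submatrix_mul_equiv]
      rfl
    rw [e1]
    simpa [diagonal_apply] using this

theorem NearDiag.cons (μ : ℂ) (r : Matrix Unit ι ℂ) (N : Matrix ι ι ℂ) (h : NearDiag N) :
    NearDiag (fromBlocks (diagonal fun _ : Unit => μ) r 0 N) := by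
  obtain ⟨d, hd, h⟩ := h
  refine ⟨Sum.elim (fun _ => μ) d, ?_, fun ε hε => ?_⟩
  · rw [charpoly_fromBlocks_zero₂₁, hd, Fintype.prod_sum_type]
    simp [charpoly]
  · obtain ⟨C, hC, hCd⟩ := h ε hε
    obtain ⟨t, ht0, ht⟩ : ∃ t : ℝ, 0 < t ∧ ∀ j, ‖(r * C) () j‖ ≤ ε * t := by
      refine ⟨1 + (∑ j, ‖(r * C) () j‖) / ε, by positivity, fun j => ?_⟩
      have h1 : ‖(r * C) () j‖ ≤ ∑ j, ‖(r * C) () j‖ :=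
        single_le_sum (f := fun j => ‖(r * C) () j‖) (fun _ _ => norm_nonneg _)
          (mem_univ j)
      have : ε * (1 + (∑ j, ‖(r * C) () j‖) / ε) = ε + ∑ j, ‖(r * C) () j‖ := by
        field_simp
      rw [this]; linarith
    have htc : (t : ℂ) ≠ 0 := by exact_mod_cast ht0.ne'
    have hCC : C⁻¹ * C = 1 := nonsing_inv_mul _ (isUnit_iff_ne_zero.2 hC)
    have hinv : (fromBlocks (diagonal fun _ : Unit => (t : ℂ)) 0 0 C)⁻¹ =
        fromBlocks (diagonal fun _ : Unit => (t : ℂ)⁻¹) 0 0 C⁻¹ := by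
      apply inv_eq_left_inv
      rw [fromBlocks_multiply]
      simp [hCC, htc]
    refine ⟨fromBlocks (diagonal fun _ => (t : ℂ)) 0 0 C, ?_, ?_⟩
    · simp [hC, htc]
    · rw [hinv, fromBlocks_multiply, fromBlocks_multiply]
      rintro (i | i) (j | j)
      · simp only [fromBlocks_apply₁₁, Matrix.mul_zero, Matrix.zero_mul, add_zero,
          diagonal_mul_diagonal, diagonal_apply, if_true, Sum.elim_inl]
        have : (t : ℂ)⁻¹ * μ * t - μ = 0 := by field_simp; ring
        rw [this]; simpa using hε.le
      · have h1 : ((diagonal fun _ : Unit => (t : ℂ)⁻¹) * r * C) i j = (t : ℂ)⁻¹ * (r * C) () j := by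
          rw [Matrix.mul_assoc, diagonal_mul]
        simp only [fromBlocks_apply₁₂, Matrix.mul_zero, Matrix.zero_mul, add_zero, zero_add, h1]
        simp only [diagonal_apply, reduceCtorEq, if_false, sub_zero, norm_mul, norm_inv,
          norm_real, norm_eq_abs, abs_of_pos ht0]
        rw [inv_mul_le_iff₀ ht0, mul_comm]
        exact ht j
      · simpa using hε.le
      · have := hCd i j
        simpa [diagonal_apply] using this

theorem nearDiag_of_card (n : ℕ) : ∀ {ι : Type} [Fintype ι] [DecidableEq ι]
    (M : Matrix ι ι ℂ), card ι = n → NearDiag M := by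
  induction n with
  | zero =>
    intro ι _ _ M hn
    have : IsEmpty ι := Fintype.card_eq_zero_iff.1 hn
    exact ⟨fun _ => 0, by simp [charpoly], fun ε _ => ⟨1, by simp, fun i => isEmptyElim i⟩⟩
  | succ n ih =>
    intro ι _ _ M hn
    have : Nonempty ι := Fintype.card_pos_iff.1 (by omega)
    obtain ⟨μ, hμ⟩ := Module.End.exists_eigenvalue (toLin' M)
    obtain ⟨v, hv, hv0⟩ := hμ.exists_hasEigenvector
    rw [Module.End.mem_eigenspace_iff, toLin'_apply] at hv
    obtain ⟨i₀, hi₀⟩ := ne_iff.1 hv0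
    have hP : ((1 : Matrix ι ι ℂ).updateCol i₀ v).det ≠ 0 := by
      rw [← cramer_apply]
      simpa using hi₀
    set P := (1 : Matrix ι ι ℂ).updateCol i₀ v with hPdef
    apply NearDiag.conj hP
    have hPe : P *ᵥ Pi.single i₀ 1 = v := by
      ext i; simp [hPdef]
    have hPi : P⁻¹ *ᵥ v = Pi.single i₀ 1 := by
      rw [← hPe, mulVec_mulVec, nonsing_inv_mul _ (isUnit_iff_ne_zero.2 hP), one_mulVec]
    have hcol : ∀ i, (P⁻¹ * M * P) i i₀ = if i = i₀ then μ else 0 := by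
      intro i
      have : (P⁻¹ * M * P) *ᵥ Pi.single i₀ 1 = μ • Pi.single i₀ 1 := by
        rw [← mulVec_mulVec, hPe, ← mulVec_mulVec, hv, mulVec_smul, hPi]
      have := congrFun this i
      simpa [Pi.single_apply] using this
    have e0 : card (Unit ⊕ Fin n) = card ι := by simp [hn]; omega
    let e1 : Unit ⊕ Fin n ≃ ι := equivOfCardEq e0
    let e : Unit ⊕ Fin n ≃ ι := e1.trans (Equiv.swap (e1 (Sum.inl ())) i₀)
    have he : ∀ u, e (Sum.inl u) = i₀ := fun u => by simp [e]
    apply NearDiag.reindex e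
    have hne : ∀ j, e (Sum.inr j) ≠ i₀ := fun j h => by
      rw [← he ()] at h
      exact absurd (e.injective h) (by simp)
    have hblock : (P⁻¹ * M * P).submatrix e e = fromBlocks (diagonal fun _ : Unit => μ)
        ((P⁻¹ * M * P).submatrix (fun u => e (Sum.inl u)) (fun j => e (Sum.inr j))) 0
        ((P⁻¹ * M * P).submatrix (fun u => e (Sum.inr u)) (fun j => e (Sum.inr j))) := by
      ext (i | i) (j | j)
      · simp [he, hcol]
      · rfl
      · simp [he, hcol, hne]
      · rfl
    rw [hblock]
    exact NearDiag.cons _ _ _ (ih _ (by simp))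

theorem nearDiag {ι : Type} [Fintype ι] [DecidableEq ι] (M : Matrix ι ι ℂ) : NearDiag M :=
  nearDiag_of_card _ M rfl

end NearDiag


/-! ### Eigenspaces of the first order symbol -/

theorem exists_pos_le {ι : Type*} [Finite ι] (f : ι → ℝ) (hf : ∀ i, 0 < f i) : ∃ c > 0, ∀ i, c ≤ f i := by
  rcases isEmpty_or_nonempty ι with h | h
  · exact ⟨1, one_pos, fun i => h.elim i⟩
  · obtain ⟨i, hi⟩ := Finite.exists_min f
    exact ⟨f i, hf i, hi⟩

section Eig

variable {ι κ : Type*} [Fintype ι] [Fintype κ]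

/-- Eigenvectors to different eigenvalues with sum zero vanish. -/
theorem eigenvectors_sum_eq_zero {R : Type*} [Field R] (M : Matrix ι ι R) (a : κ → R)
    (ha : Injective a) (x : κ → ι → R) (hx : ∀ l, M *ᵥ x l = a l • x l)
    (h : ∑ l, x l = 0) (l : κ) : x l = 0 := by
  classical
  by_contra hl
  have hind := Module.End.eigenvectors_linearIndependent' (toLin' M)
    (fun j : {j : κ // x j ≠ 0} => a j) (fun i j hij => Subtype.ext (ha hij))
    (fun j => x j) (fun j => ⟨by
      rw [Module.End.mem_eigenspace_iff, toLin'_apply]; exact hx j, j.2⟩)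
  rw [Fintype.linearIndependent_iff] at hind
  have hs : ∑ j : {j : κ // x j ≠ 0}, (1 : R) • x j = 0 := by
    simp only [one_smul]
    rw [← Finset.sum_subtype (univ.filter fun j => x j ≠ 0) (by simp), Finset.sum_filter_ne_zero, h]
  exact one_ne_zero (hind (fun _ => 1) hs ⟨l, hl⟩)

/-- Eigenvalues of a small perturbation of a diagonal matrix. -/
theorem eigenvalue_close {B : Matrix ι ι ℂ} [DecidableEq ι] {d : ι → ℂ} {β : ℂ} {δ : ℝ}
    (hB : ∀ i j, ‖B i j - diagonal d i j‖ ≤ δ) {v : ι → ℂ} (hv : v ≠ 0) (hBv : B *ᵥ v = β • v) :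
    ∃ i, ‖β - d i‖ ≤ card ι * δ := by
  obtain ⟨i₀, hi₀⟩ := ne_iff.1 hv
  have : Nonempty ι := ⟨i₀⟩
  obtain ⟨i, hi⟩ := Finite.exists_max fun i => ‖v i‖
  refine ⟨i, le_of_mul_le_mul_right (a := ‖v i‖) ?_ ((norm_pos_iff.2 hi₀).trans_le (hi i₀))⟩
  have e : (β - d i) * v i = ∑ j, (B i j - diagonal d i j) * v j := by
    have := congrFun hBv i
    simp only [mulVec, dotProduct, Pi.smul_apply, smul_eq_mul] at this
    simp [sub_mul, this, diagonal_apply]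
  rw [← norm_mul, e]
  refine (norm_sum_le _ _).trans ((sum_le_sum fun j _ => ?_ : _ ≤ ∑ j : ι, δ * ‖v i‖).trans (by simp [mul_assoc]))
  rw [norm_mul]
  exact mul_le_mul (hB i j) (hi j) (norm_nonneg _) ((norm_nonneg _).trans (hB i j))

end Eig

section Cx

variable {n : ℕ}

theorem cx_mul (A B : Matrix (Fin n) (Fin n) ℝ) : cx (A * B) = cx A * cx B :=
  Matrix.map_mul (f := ofRealHom)

theorem cx_one : cx (1 : Matrix (Fin n) (Fin n) ℝ) = 1 := by
  ext i j
  by_cases h : i = j <;> simp [cx, Matrix.one_apply, h]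

theorem cx_add (A B : Matrix (Fin n) (Fin n) ℝ) : cx (A + B) = cx A + cx B := by
  ext i j; simp [cx]

theorem cx_neg (A : Matrix (Fin n) (Fin n) ℝ) : cx (-A) = -cx A := by
  ext i j; simp [cx]

theorem cx_smul (r : ℝ) (A : Matrix (Fin n) (Fin n) ℝ) : cx (r • A) = (r : ℂ) • cx A := by
  ext i j; simp [cx]

theorem cx_sum {α : Type*} (s : Finset α) (A : α → Matrix (Fin n) (Fin n) ℝ) :
    cx (∑ a ∈ s, A a) = ∑ a ∈ s, cx (A a) := by
  ext i j; simp [cx, Matrix.sum_apply]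

theorem cx_det (A : Matrix (Fin n) (Fin n) ℝ) : (cx A).det = (A.det : ℂ) :=
  (RingHom.map_det ofRealHom A).symm

theorem cx_inv {A : Matrix (Fin n) (Fin n) ℝ} (h : A.det ≠ 0) : cx A⁻¹ = (cx A)⁻¹ := by
  symm
  apply inv_eq_left_inv
  rw [← cx_mul, nonsing_inv_mul _ (isUnit_iff_ne_zero.2 h), cx_one]

end Cx

namespace Endstate

variable {n k : ℕ} (E : Endstate n k)

theorem a_eq_orderEmb {ξ : Fin (k + 1) → ℝ} {L : ℕ} (h : (E.charRoots ξ).card = L) (l : Fin L) :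
    E.a l ξ = (E.charRoots ξ).orderEmbOfFin h l := by
  subst h
  rw [Finset.orderEmbOfFin_apply, a]
  rw [List.getD_eq_getElem _ _ (by simp)]
  rfl

theorem a_strictMono {ξ : Fin (k + 1) → ℝ} {L : ℕ} (h : (E.charRoots ξ).card = L) :
    StrictMono fun l : Fin L => E.a l ξ := by
  intro i j hij
  simp only [E.a_eq_orderEmb h]
  exact (Finset.orderEmbOfFin _ h).strictMono hij

theorem mem_charRoots {ξ : Fin (k + 1) → ℝ} {τ : ℝ} :
    τ ∈ E.charRoots ξ ↔ ∃ x : Fin n → ℝ, x ≠ 0 ∧ E.firstOrder ξ *ᵥ x = (-τ) • x := by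
  rw [charRoots, Multiset.mem_toFinset, mem_roots (charpoly_monic _).ne_zero,
    ← charpoly_toLin', ← Module.End.hasEigenvalue_iff_isRoot_charpoly]
  constructor
  · intro h
    obtain ⟨x, hx, hx0⟩ := h.exists_hasEigenvector
    rw [Module.End.mem_eigenspace_iff, toLin'_apply, neg_mulVec] at hx
    exact ⟨x, hx0, by rw [neg_smul, ← hx, neg_neg]⟩
  · rintro ⟨x, hx0, hx⟩
    refine Module.End.hasEigenvalue_of_hasEigenvector (x := x) ⟨?_, hx0⟩
    rw [Module.End.mem_eigenspace_iff, toLin'_apply, neg_mulVec, hx, neg_smul, neg_neg]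

theorem exists_a_eq {ξ : Fin (k + 1) → ℝ} {τ : ℝ} (h : τ ∈ E.charRoots ξ) :
    ∃ l < (E.charRoots ξ).card, E.a l ξ = τ := by
  have : τ ∈ Set.range ((E.charRoots ξ).orderEmbOfFin rfl) := by
    rw [Finset.range_orderEmbOfFin]; exact h
  obtain ⟨l, hl⟩ := this
  exact ⟨l, l.2, by rw [E.a_eq_orderEmb rfl l]; exact hl⟩

theorem a_mem_charRoots {ξ : Fin (k + 1) → ℝ} {l : ℕ} (hl : l < (E.charRoots ξ).card) :
    E.a l ξ ∈ E.charRoots ξ := by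
  rw [E.a_eq_orderEmb rfl ⟨l, hl⟩]
  exact Finset.orderEmbOfFin_mem _ _ _

/-- The first order symbol is diagonalizable. -/
theorem exists_diagonalization {L : ℕ} {m : ℕ → ℕ} (hn : ∑ l ∈ Finset.range L, m l = n)
    {ξ : Fin (k + 1) → ℝ} (hL : (E.charRoots ξ).card = L)
    (hm : ∀ l < L, Module.finrank ℝ
        (Module.End.eigenspace (toLin' (-(E.firstOrder ξ))) (E.a l ξ)) = m l) :
    ∃ (C : Matrix (Fin n) (Σ l : Fin L, Fin (m l)) ℂ) (Ci : Matrix (Σ l : Fin L, Fin (m l)) (Fin n) ℂ),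
      C * Ci = 1 ∧ Ci * C = 1 ∧
      cx (E.firstOrder ξ) * C = C * (diagonal (fun p => -(E.a p.1 ξ : ℂ)) :
        Matrix (Σ l : Fin L, Fin (m l)) (Σ l : Fin L, Fin (m l)) ℂ) := by
  let b : ∀ l : Fin L, Module.Basis (Fin (m l)) ℝ
      (Module.End.eigenspace (toLin' (-(E.firstOrder ξ))) (E.a l ξ)) :=
    fun l => Module.finBasisOfFinrankEq ℝ _ (hm l l.2)
  let v : (Σ l : Fin L, Fin (m l)) → Fin n → ℝ := fun p => b p.1 p.2
  have hv : ∀ p, -(E.firstOrder ξ) *ᵥ v p = E.a p.1 ξ • v p := by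
    intro p
    have := (b p.1 p.2).2
    rw [Module.End.mem_eigenspace_iff, toLin'_apply] at this
    exact this
  have hind : LinearIndependent ℝ v := by
    rw [Fintype.linearIndependent_iff]
    intro g hg p
    rw [sum_sigma] at hg
    have h1 := eigenvectors_sum_eq_zero (-(E.firstOrder ξ)) (fun l : Fin L => E.a l ξ)
      (E.a_strictMono hL).injective (fun l => ∑ j, g ⟨l, j⟩ • v ⟨l, j⟩) (by
        intro l
        rw [mulVec_sum, smul_sum]
        refine sum_congr rfl fun j _ => ?_
        rw [mulVec_smul, hv, smul_comm]) hg p.1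
    have h2 := (Fintype.linearIndependent_iff.1 (b p.1).linearIndependent) (fun j => g ⟨p.1, j⟩) (by
      apply Subtype.ext
      simpa [v] using h1) p.2
    exact h2
  have hcard : card (Fin n) = card (Σ l : Fin L, Fin (m l)) := by
    simp [← hn, Finset.sum_range]
  let e : Fin n ≃ (Σ l : Fin L, Fin (m l)) := equivOfCardEq hcard
  let R : Matrix (Fin n) (Fin n) ℝ := of fun i j => v (e j) i
  have hR : IsUnit R := by
    rw [← linearIndependent_cols_iff_isUnit]
    exact hind.comp e e.injective
  have hRdet : IsUnit R.det := (isUnit_iff_isUnit_det R).1 hR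
  refine ⟨(cx R).submatrix id e.symm, (cx R⁻¹).submatrix e.symm id, ?_, ?_, ?_⟩
  · rw [submatrix_mul_equiv (cx R) (cx R⁻¹) id e.symm id, ← cx_mul, mul_nonsing_inv _ hRdet, cx_one, submatrix_id_id]
  · rw [← submatrix_mul (cx R⁻¹) (cx R) e.symm id e.symm bijective_id, ← cx_mul,
      nonsing_inv_mul _ hRdet, cx_one, submatrix_one_equiv]
  · ext i p
    refine Eq.trans ?_ (mul_diagonal _ _ _ _).symm
    rw [Matrix.mul_apply]
    have := congrFun (hv p) i
    simp only [Matrix.neg_apply, neg_mul, Finset.sum_neg_distrib, Pi.smul_apply, mulVec,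
      dotProduct, smul_eq_mul] at this
    have h2 : ∑ j, E.firstOrder ξ i j * v p j = -(E.a p.1 ξ * v p i) := by linarith
    simp only [submatrix_apply, id, cx, map_apply, R, of_apply, Equiv.apply_symm_apply]
    have h3 := congrArg (fun r : ℝ => (r : ℂ)) h2
    simp only [Complex.ofReal_sum, ofReal_mul, Complex.ofReal_neg] at h3
    rw [h3]; ring

end Endstate


namespace Endstate

variable {n k : ℕ} (E : Endstate n k)

theorem contDiff_coord (j : Fin (k + 1)) (ξ : Fin (k + 1) → ℝ) :
    ContDiffAt ℝ ω (fun ξ : Fin (k + 1) → ℝ => (ξ j : ℂ)) ξ :=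
  (ofRealCLM.contDiff.contDiffAt).comp ξ (contDiffAt_pi.1 contDiffAt_id j)

theorem mSmooth_symA (ξ : Fin (k + 1) → ℝ) : MSmooth ω (fun ξ => cx (E.symA ξ)) ξ := by
  simp only [symA, cx_sum, cx_smul]
  exact MSmooth.sum _ fun j _ => MSmooth.smul (contDiff_coord j ξ) (MSmooth.const _)

theorem mSmooth_firstOrder (ξ : Fin (k + 1) → ℝ) :
    MSmooth ω (fun ξ => cx (E.firstOrder ξ)) ξ := by
  simp only [firstOrder, cx_mul]
  exact (MSmooth.const _).mul (E.mSmooth_symA ξ)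

/-- Near `ξ₀ ≠ 0` the `l`-th root and a frame of its eigenspaces are analytic. -/
theorem exists_frame (hc : E.ConstantMultiplicities) {ξ₀ : Fin (k + 1) → ℝ} (hξ₀ : ξ₀ ≠ 0) {l₀ : ℕ}
    (hl₀ : l₀ < (E.charRoots ξ₀).card) :
    ∃ (m : ℕ) (e : (Fin (k + 1) → ℝ) → Matrix (Fin n) (Fin m) ℂ), 0 < m ∧ MSmooth ω e ξ₀ ∧
      ContDiffAt ℝ ω (E.a l₀) ξ₀ ∧ ∀ᶠ ξ in 𝓝 ξ₀, l₀ < (E.charRoots ξ).card ∧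
        cx (E.firstOrder ξ) * e ξ = (-(E.a l₀ ξ : ℂ)) • e ξ ∧
        (∀ w, e ξ *ᵥ w = 0 → w = 0) ∧
        (∀ x, cx (E.firstOrder ξ) *ᵥ x = (-(E.a l₀ ξ : ℂ)) • x → ∃ w, x = e ξ *ᵥ w) := by
  obtain ⟨L, m, hn, hLm⟩ := hc
  obtain ⟨hL₀, hm₀⟩ := hLm ξ₀ hξ₀
  obtain ⟨C, Ci, hCCi, hCiC, hC⟩ := E.exists_diagonalization hn hL₀ hm₀
  have hl₀L : l₀ < L := hL₀ ▸ hl₀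
  have hmpos (l : Fin L) : 0 < m l := by
    obtain ⟨x, hx0, hx⟩ := E.mem_charRoots.1 (E.a_mem_charRoots (hL₀ ▸ l.2 : (l : ℕ) < (E.charRoots ξ₀).card))
    rw [← hm₀ l l.2, Module.finrank_pos_iff]
    refine ⟨⟨⟨x, ?_⟩, 0, fun h => hx0 (congrArg Subtype.val h)⟩⟩
    rw [Module.End.mem_eigenspace_iff, toLin'_apply, neg_mulVec, hx, neg_smul, neg_neg]
  let ι := Σ l : Fin L, Fin (m l)
  let F := fun ξ => cx (E.firstOrder ξ)
  let A (ξ : Fin (k + 1) → ℝ) : Matrix ι ι ℂ := diagonal fun p => (E.a p.1 ξ : ℂ)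
  have hC {ξ} {C : Matrix (Fin n) ι ℂ} (h : F ξ * C = C * diagonal fun p => -(E.a p.1 ξ : ℂ)) :
      F ξ * C = -(C * A ξ) := by rw [h, ← Matrix.mul_neg, diagonal_neg]; rfl
  let M : (Fin (k + 1) → ℝ) → Matrix ι ι ℂ := fun ξ => -(Ci * F ξ * C)
  have hM₀ : M ξ₀ = A ξ₀ := by
    simp only [M]
    rw [Matrix.mul_assoc, hC ‹_›, Matrix.mul_neg, neg_neg, ← Matrix.mul_assoc, hCiC, Matrix.one_mul]
  have hMs : MSmooth ω M ξ₀ := (((MSmooth.const Ci).mul (E.mSmooth_firstOrder ξ₀)).mul (MSmooth.const C)).neg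
  obtain ⟨T, D, hT0, hD0, -, -, hTDs, hDoff, hTD, -⟩ := exists_blockDiag (fun p : ι => p.1)
    (fun p => (E.a p.1 ξ₀ : ℂ)) (fun i j h => by
      simpa using fun h' => h ((E.a_strictMono hL₀).injective h'))
  rw [← show M ξ₀ = diagonal _ from hM₀] at hTDs hTD hD0
  obtain ⟨hTs', hDs'⟩ := hTDs.self_of_nhds _ M ξ₀ rfl hMs
  obtain ⟨r, hr0, hr⟩ := exists_pos_le (fun p : {p : Fin L × Fin L // p.1 < p.2} =>
    (E.a p.1.2 ξ₀ - E.a p.1.1 ξ₀) / 2) fun p => half_pos (sub_pos.2 (E.a_strictMono hL₀ p.2))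
  have hclose : ∀ᶠ ξ in 𝓝 ξ₀, ∀ (l : Fin L) (i j : Fin (m l)),
      ‖D (M ξ) ⟨l, i⟩ ⟨l, j⟩ - diagonal (fun _ => (E.a l ξ₀ : ℂ)) i j‖ ≤ r / (n + 1) := by
    simp only [eventually_all]
    intro l i j
    filter_upwards [Metric.tendsto_nhds.1 (hDs' ⟨l, i⟩ ⟨l, j⟩).continuousAt (r / (n + 1)) (by positivity)] with ξ hξ
    have h2 : D (M ξ₀) ⟨l, i⟩ ⟨l, j⟩ = diagonal (fun _ => (E.a l ξ₀ : ℂ)) i j := by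
      rw [hD0, hM₀]
      exact congrFun₂ (submatrix_diagonal (fun p : ι => (E.a p.1 ξ₀ : ℂ)) (Sigma.mk l) sigma_mk_injective) i j
    rw [← h2, ← dist_eq_norm]
    exact hξ.le
  let W := fun ξ => C * T (M ξ)
  have main : ∀ᶠ ξ in 𝓝 ξ₀, (E.charRoots ξ).card = L ∧ D (M ξ) = A ξ ∧ F ξ * W ξ = -(W ξ * A ξ) ∧
      ∃ Wi : Matrix ι (Fin n) ℂ, Wi * W ξ = 1 ∧ W ξ * Wi = 1 ∧ Wi * F ξ = -(A ξ * Wi) := by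
    filter_upwards [hclose, eventually_ne_nhds hξ₀, hMs.continuousAt.eventually hTD] with ξ hcl hξ0 ⟨hTD1, hdet⟩
    obtain ⟨hL, hm⟩ := hLm ξ hξ0
    have hTu := isUnit_iff_ne_zero.2 hdet
    obtain ⟨Wi, hWiW, hWWi⟩ : ∃ Wi : Matrix ι (Fin n) ℂ, Wi * W ξ = 1 ∧ W ξ * Wi = 1 := by
      refine ⟨(T (M ξ))⁻¹ * Ci, ?_, ?_⟩ <;> rw [Matrix.mul_assoc]
      · rw [← Matrix.mul_assoc Ci, hCiC, Matrix.one_mul, nonsing_inv_mul _ hTu]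
      · rw [mul_nonsing_inv_cancel_left _ _ hTu, hCCi]
    have hF : F ξ * W ξ = -(W ξ * D (M ξ)) := by
      simp only [W]
      rw [Matrix.mul_assoc C, ← hTD1]
      simp only [M, Matrix.neg_mul, Matrix.mul_neg, neg_neg, ← Matrix.mul_assoc, hCCi, Matrix.one_mul]
    have hWF : Wi * F ξ = -(D (M ξ) * Wi) := by
      rw [← Matrix.mul_one (Wi * F ξ), ← hWWi, Matrix.mul_assoc, ← Matrix.mul_assoc (F ξ), hF, Matrix.neg_mul,
        Matrix.mul_neg, Matrix.mul_assoc, ← Matrix.mul_assoc, hWiW, Matrix.one_mul]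
    suffices hD : D (M ξ) = A ξ from ⟨hL, hD, hD ▸ hF, Wi, hWiW, hWWi, hD ▸ hWF⟩
    obtain ⟨C', Ci', h1, h2, h3⟩ := E.exists_diagonalization hn hL hm
    let P : Matrix ι ι ℂ := Wi * C'
    have hPPi : P * (Ci' * W ξ) = 1 := by
      rw [Matrix.mul_assoc, ← Matrix.mul_assoc C', h1, Matrix.one_mul, hWiW]
    have hDP : D (M ξ) * P = P * A ξ := by
      rw [← neg_inj, ← Matrix.mul_assoc, ← Matrix.neg_mul, ← hWF, Matrix.mul_assoc, hC h3, Matrix.mul_neg,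
        Matrix.mul_assoc]
    have hrel (p q : ι) (hP : P p q ≠ 0) : |E.a q.1 ξ - E.a p.1 ξ₀| < r := by
      obtain ⟨_, h7⟩ := eigenvalue_close (hcl p.1) (v := fun j => P ⟨p.1, j⟩ q) (β := E.a q.1 ξ)
        (fun h => hP (congrFun h p.2)) (by
          ext j
          have h5 := congrFun (congrFun hDP ⟨p.1, j⟩) q
          rw [Matrix.mul_apply, mul_diagonal, sum_sigma, sum_eq_single p.1 (fun b _ hb => sum_eq_zero fun q' _ => by
            rw [hDoff (M ξ) ⟨p.1, j⟩ ⟨b, q'⟩ hb.symm, zero_mul]) (by simp)] at h5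
          rw [Pi.smul_apply, smul_eq_mul, mul_comm, ← h5]
          rfl)
      rw [← ofReal_sub, norm_real, norm_eq_abs, card_fin] at h7
      refine h7.trans_lt ?_
      have h8 : (m p.1 : ℝ) ≤ n := by
        exact_mod_cast hn ▸ single_le_sum (f := m) (fun _ _ => Nat.zero_le _) (mem_range.2 p.1.2)
      rw [mul_div_assoc', div_lt_iff₀ (by positivity)]
      nlinarith
    have hrow (l : Fin L) : ∃ i : Fin L, |E.a i ξ - E.a l ξ₀| < r := by
      by_contra! hcon
      have h9 (p : ι) : P ⟨l, ⟨0, hmpos l⟩⟩ p = 0 := by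
        by_contra hp
        exact (hrel _ _ hp).not_ge (hcon p.1)
      have := congrFun (congrFun hPPi ⟨l, ⟨0, hmpos l⟩⟩) ⟨l, ⟨0, hmpos l⟩⟩
      rw [Matrix.mul_apply] at this
      simp [h9] at this
    have hsep {l l' : Fin L} (h : l < l') : r ≤ (E.a l' ξ₀ - E.a l ξ₀) / 2 := hr ⟨(l, l'), h⟩
    choose ψ hψ using hrow
    have hψm : StrictMono ψ := fun l l' hl => (E.a_strictMono hL).lt_iff_lt.1 (by
      linarith [hsep hl, abs_lt.1 (hψ l), abs_lt.1 (hψ l')])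
    have hψid (l : Fin L) : ψ l = l := DFunLike.congr_fun (Subsingleton.elim (hψm.orderIsoOfSurjective ψ
      (Finite.injective_iff_surjective.1 hψm.injective)) (OrderIso.refl _)) l
    have hcomm : P * A ξ = A ξ * P := by
      ext p q
      refine (mul_diagonal _ _ _ _).trans (Eq.trans ?_ (diagonal_mul _ _ _ _).symm)
      by_cases h : P p q = 0
      · rw [h, zero_mul, mul_zero]
      · have h1 := abs_lt.1 (hrel p q h)
        have h2 := abs_lt.1 (hψ q.1)
        rw [hψid] at h2
        rcases lt_trichotomy p.1 q.1 with h | h | h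
        · linarith [hsep h]
        · rw [h, mul_comm]
        · linarith [hsep h]
    rw [← Matrix.mul_one (D (M ξ)), ← hPPi, ← Matrix.mul_assoc, hDP, hcomm, Matrix.mul_assoc, hPPi, Matrix.mul_one]
  let φ : Fin (m l₀) → ι := fun j => ⟨⟨l₀, hl₀L⟩, j⟩
  have hφ : Injective φ := fun _ _ h => eq_of_heq (Sigma.mk.inj h).2
  refine ⟨m l₀, fun ξ => (W ξ).submatrix id φ, hmpos ⟨l₀, hl₀L⟩, ((MSmooth.const C).mul hTs').submatrix _ _, ?_, ?_⟩
  · refine (Complex.reCLM.contDiff.contDiffAt.comp ξ₀ (hDs' (φ ⟨0, hmpos ⟨l₀, hl₀L⟩⟩) (φ ⟨0, hmpos ⟨l₀, hl₀L⟩⟩))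
      ).congr_of_eventuallyEq ?_
    filter_upwards [main] with ξ hξ
    simp [hξ.2.1, A, φ]
  · filter_upwards [main] with ξ ⟨hL, _, hFW, Wi, hWiW, hWWi, hWF⟩
    refine ⟨hL ▸ hl₀L, ?_, fun w hw => ?_, fun x hx => ⟨fun j => (Wi *ᵥ x) (φ j), ?_⟩⟩
    · ext i j
      refine (congrFun (congrFun hFW i) (φ j)).trans ?_
      simp [A, φ, mul_diagonal, mul_comm]
    · rw [← one_mulVec w, ← submatrix_one φ hφ, ← hWiW, submatrix_mul _ _ φ id φ bijective_id, ← mulVec_mulVec, hw,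
        mulVec_zero]
    · have hy (p : ι) : ((E.a l₀ ξ : ℂ) - E.a p.1 ξ) * (Wi *ᵥ x) p = 0 := by
        have h := congrFun (congrArg (fun Z => Z *ᵥ x) hWF) p
        simp only [neg_mulVec, ← mulVec_mulVec, show F ξ *ᵥ x = _ from hx, mulVec_smul] at h
        simp only [Pi.neg_apply, Pi.smul_apply, A, mulVec_diagonal, smul_eq_mul] at h
        linear_combination -h
      conv_lhs => rw [← one_mulVec x, ← hWWi, ← mulVec_mulVec]
      ext i
      refine (sum_of_injective φ hφ _ _ (fun p hp => ?_) fun _ => rfl).symm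
      refine mul_eq_zero_of_right _ ((mul_eq_zero.1 (hy p)).resolve_left fun h => hp ?_)
      obtain ⟨q, j⟩ := p
      obtain rfl : q = ⟨l₀, hl₀L⟩ := (E.a_strictMono hL).injective (by exact_mod_cast (sub_eq_zero.1 h).symm)
      exact ⟨j, rfl⟩

end Endstate


/-! ### Jordan chains from Taylor coefficients of eigenvectors -/

section Partial

variable {Y F : Type*} [NormedAddCommGroup Y] [NormedSpace ℝ Y] [NormedAddCommGroup F]
  [NormedSpace ℝ F]

/-- The partial derivatives of an analytic function in a real variable are analytic. -/
theorem contDiffAt_iteratedDeriv_partial {f : ℝ × Y → F} {q₀ : ℝ × Y} (hf : ContDiffAt ℝ ω f q₀)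
    (j : ℕ) : ContDiffAt ℝ ω (fun q : ℝ × Y => iteratedDeriv j (fun y => f (y, q.2)) q.1) q₀ := by
  induction j with
  | zero => simpa using hf
  | succ j ih =>
    have h1 : ContDiffAt ℝ ω (fun q => fderiv ℝ
        (fun q : ℝ × Y => iteratedDeriv j (fun y => f (y, q.2)) q.1) q (1, 0)) q₀ :=
      (ih.fderiv_right (m := ω) (by simp)).clm_apply contDiffAt_const
    refine h1.congr_of_eventuallyEq ?_
    filter_upwards [ih.eventually (by simp)] with q hq
    rw [iteratedDeriv_succ]
    have hd := (hq.differentiableAt (by simp)).hasFDerivAt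
    have hline : HasDerivAt (fun y : ℝ => ((y, q.2) : ℝ × Y)) (1, 0) q.1 :=
      (hasDerivAt_id q.1).prodMk (hasDerivAt_const q.1 q.2)
    exact (HasFDerivAt.comp_hasDerivAt (l := fun q : ℝ × Y => iteratedDeriv j (fun y => f (y, q.2)) q.1)
      q.1 hd hline).deriv

variable {φ : ℝ → ℝ} {h : ℝ → ℂ} {y₀ : ℝ}

theorem iteratedDeriv_smul_sum {j : ℕ} (hφ : ContDiffAt ℝ ω φ y₀) (hh : ContDiffAt ℝ ω h y₀) :
    iteratedDeriv j (φ • h) y₀ = ∑ i ∈ Finset.range (j + 1),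
      j.choose i • iteratedDeriv i φ y₀ • iteratedDeriv (j - i) h y₀ := by
  have := iteratedDerivWithin_smul (n := j) (Set.mem_univ y₀) uniqueDiffOn_univ
    (hφ.of_le (by simp)).contDiffWithinAt (hh.of_le (by simp)).contDiffWithinAt
  simpa only [iteratedDerivWithin_univ] using this

theorem iteratedDeriv_smul_of_flat {s j : ℕ} (hφ : ContDiffAt ℝ ω φ y₀) (hh : ContDiffAt ℝ ω h y₀)
    (hflat : ∀ i < s, iteratedDeriv i φ y₀ = 0) (hj : j < s) : iteratedDeriv j (φ • h) y₀ = 0 := by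
  rw [iteratedDeriv_smul_sum hφ hh]
  refine sum_eq_zero fun i hi => ?_
  rw [hflat i (by rw [mem_range] at hi; omega), zero_smul, smul_zero]

theorem iteratedDeriv_smul_flat {s : ℕ} (hφ : ContDiffAt ℝ ω φ y₀) (hh : ContDiffAt ℝ ω h y₀)
    (hflat : ∀ i < s, iteratedDeriv i φ y₀ = 0) :
    iteratedDeriv s (φ • h) y₀ = iteratedDeriv s φ y₀ • h y₀ := by
  rw [iteratedDeriv_smul_sum hφ hh, Finset.sum_range_succ, sum_eq_zero]
  · simp
  · intro i hi
    rw [hflat i (mem_range.1 hi), zero_smul, smul_zero]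

theorem iteratedDeriv_sub_smul {j : ℕ} (hh : ContDiffAt ℝ ω h y₀) :
    iteratedDeriv (j + 1) ((fun y => y - y₀) • h) y₀ = ((j : ℂ) + 1) * iteratedDeriv j h y₀ := by
  rw [iteratedDeriv_smul_sum (by fun_prop) hh, sum_eq_single 1]
  · simp [iteratedDeriv_one]
  · intro i _ hi
    have : iteratedDeriv i (fun y : ℝ => y - y₀) y₀ = 0 := by
      rcases Nat.lt_or_ge i 1 with h0 | h0
      · have : i = 0 := by omega
        subst this; simp
      · obtain ⟨a, rfl⟩ : ∃ a, i = a + 2 := ⟨i - 2, by omega⟩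
        rw [iteratedDeriv_succ', iteratedDeriv_succ']
        have : deriv (fun y : ℝ => y - y₀) = fun _ => 1 := by
          funext y; simp
        rw [this]; simp
    rw [this, zero_smul, smul_zero]
  · simp

end Partial

section Chain

variable {n m : ℕ}

/-- The `j`-th Taylor coefficient of a matrix valued function of a real variable. -/
noncomputable def taylorCoeff (e : ℝ → Matrix (Fin n) (Fin m) ℂ) (y₀ : ℝ) (j : ℕ) :
    Matrix (Fin n) (Fin m) ℂ :=
  of fun i b => (j.factorial : ℂ)⁻¹ * iteratedDeriv j (fun y => e y i b) y₀

theorem taylorCoeff_zero (e : ℝ → Matrix (Fin n) (Fin m) ℂ) (y₀ : ℝ) :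
    taylorCoeff e y₀ 0 = e y₀ := by
  ext i b; simp [taylorCoeff]

variable {A₀ A₁ A₂ : Matrix (Fin n) (Fin n) ℂ} {e : ℝ → Matrix (Fin n) (Fin m) ℂ} {α : ℝ → ℝ}
  {y₀ : ℝ}

/-- Leibniz' rule for the eigenvalue equation `(α(y) A₀ + y A₁ + A₂) e(y) = 0`. -/
theorem taylorCoeff_eigen (he : MSmooth ω e y₀) (hα : ContDiffAt ℝ ω α y₀)
    (hrel : ∀ᶠ y in 𝓝 y₀, ((α y : ℂ) • A₀ + (y : ℂ) • A₁ + A₂) * e y = 0) {s : ℕ}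
    (hflat : ∀ i, 1 ≤ i → i < s → iteratedDeriv i α y₀ = 0) (j : ℕ) :
    (j + 1 < s → ((α y₀ : ℂ) • A₀ + (y₀ : ℂ) • A₁ + A₂) * taylorCoeff e y₀ (j + 1) = -(A₁ * taylorCoeff e y₀ j)) ∧
    (j + 1 = s → ((α y₀ : ℂ) • A₀ + (y₀ : ℂ) • A₁ + A₂) * taylorCoeff e y₀ (j + 1) = -(A₁ * taylorCoeff e y₀ j) -
        (((iteratedDeriv s α y₀ : ℝ) : ℂ) / s.factorial) • (A₀ * taylorCoeff e y₀ 0)) := by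
  set M := (α y₀ : ℂ) • A₀ + (y₀ : ℂ) • A₁ + A₂ with hM
  have hcd : ∀ (B : Matrix (Fin n) (Fin n) ℂ), MSmooth ω (fun y => B * e y) y₀ := fun B =>
    (MSmooth.const B).mul he
  have hit : ∀ (B : Matrix (Fin n) (Fin n) ℂ) (i b) (r : ℕ),
      iteratedDeriv r (fun y => (B * e y) i b) y₀ =
        (r.factorial : ℂ) * (B * taylorCoeff e y₀ r) i b := by
    intro B i b r
    simp only [Matrix.mul_apply, taylorCoeff, of_apply]
    rw [iteratedDeriv_fun_sum fun k _ => (contDiffAt_const.mul (he k b)).of_le (by simp), mul_sum]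
    refine sum_congr rfl fun k _ => ?_
    rw [iteratedDeriv_const_mul _ ((he k b).of_le (by simp))]
    field_simp
  have hφ : ContDiffAt ℝ ω (fun y => α y - α y₀) y₀ := hα.sub contDiffAt_const
  have hφj : ∀ i, 1 ≤ i → iteratedDeriv i (fun y => α y - α y₀) y₀ = iteratedDeriv i α y₀ := by
    intro i hi
    obtain ⟨a, rfl⟩ : ∃ a, i = a + 1 := ⟨i - 1, by omega⟩
    rw [iteratedDeriv_succ', iteratedDeriv_succ']
    congr 1
    funext y; simp
  have hφflat : ∀ i < s, iteratedDeriv i (fun y => α y - α y₀) y₀ = 0 := by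
    intro i hi
    rcases Nat.eq_zero_or_pos i with h0 | h0
    · subst h0; simp
    · rw [hφj i h0, hflat i h0 hi]
  have hsum : ∀ i b, (0 : ℂ) = ((j + 1).factorial : ℂ) * (M * taylorCoeff e y₀ (j + 1)) i b +
      ((j : ℂ) + 1) * ((j.factorial : ℂ) * (A₁ * taylorCoeff e y₀ j) i b) +
      iteratedDeriv (j + 1) ((fun y => α y - α y₀) • fun y => (A₀ * e y) i b) y₀ := by
    intro i b
    rw [← hit M, ← hit A₁, ← iteratedDeriv_sub_smul (hcd A₁ i b)]
    have c1 : ContDiffAt ℝ (j + 1 : ℕ) (fun y => (M * e y) i b) y₀ := (hcd M i b).of_le (by simp)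
    have c2 : ContDiffAt ℝ (j + 1 : ℕ) ((fun y => y - y₀) • fun y => (A₁ * e y) i b) y₀ :=
      ContDiffAt.smul (by fun_prop) ((hcd A₁ i b).of_le (by simp))
    have c3 : ContDiffAt ℝ (j + 1 : ℕ) ((fun y => α y - α y₀) • fun y => (A₀ * e y) i b) y₀ :=
      (hφ.of_le (by simp)).smul ((hcd A₀ i b).of_le (by simp))
    have c12 : ContDiffAt ℝ (j + 1 : ℕ) ((fun y => (M * e y) i b) +
        ((fun y => y - y₀) • fun y => (A₁ * e y) i b)) y₀ := c1.add c2
    rw [← iteratedDeriv_add c1 c2, ← iteratedDeriv_add c12 c3]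
    have hz : ((fun y => (M * e y) i b) + ((fun y => y - y₀) • fun y => (A₁ * e y) i b) +
        ((fun y => α y - α y₀) • fun y => (A₀ * e y) i b)) =ᶠ[𝓝 y₀] fun _ => (0 : ℂ) := by
      filter_upwards [hrel] with y hy
      have h2 : ((α y : ℂ) • A₀ + (y : ℂ) • A₁ + A₂) * e y = M * e y +
          ((y - y₀ : ℝ) : ℂ) • (A₁ * e y) + ((α y - α y₀ : ℝ) : ℂ) • (A₀ * e y) := by
        rw [hM]
        simp only [Matrix.add_mul, smul_mul, ofReal_sub, sub_smul]
        abel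
      rw [h2] at hy
      have h3 := congrFun (congrFun hy i) b
      simpa [real_smul] using h3
    rw [hz.iteratedDeriv_eq]
    simp
  have hf1 : ((j + 1).factorial : ℂ) = ((j : ℂ) + 1) * (j.factorial : ℂ) := by
    rw [Nat.factorial_succ]; push_cast; ring
  have hne : ((j + 1).factorial : ℂ) ≠ 0 := by exact_mod_cast (j + 1).factorial_ne_zero
  constructor
  · intro hj
    ext i b
    have h1 := hsum i b
    rw [iteratedDeriv_smul_of_flat hφ (hcd A₀ i b) hφflat hj, add_zero, ← mul_assoc, ← hf1, ← mul_add] at h1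
    have h2 := (mul_eq_zero.1 h1.symm).resolve_left hne
    rw [Matrix.neg_apply]
    linear_combination h2
  · intro hj
    ext i b
    have h1 := hsum i b
    rw [hj, iteratedDeriv_smul_flat hφ (hcd A₀ i b) hφflat, hφj s (by omega), ← hj, ← mul_assoc, ← hf1,
      ← mul_add] at h1
    rw [Matrix.sub_apply, Matrix.neg_apply, Matrix.smul_apply, taylorCoeff_zero, smul_eq_mul, ← hj]
    rw [real_smul] at h1
    field_simp
    linear_combination -h1

theorem taylorCoeff_eigen_zero
    (hrel : ∀ᶠ y in 𝓝 y₀, ((α y : ℂ) • A₀ + (y : ℂ) • A₁ + A₂) * e y = 0) :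
    ((α y₀ : ℂ) • A₀ + (y₀ : ℂ) • A₁ + A₂) * taylorCoeff e y₀ 0 = 0 := by
  rw [taylorCoeff_zero]; exact hrel.self_of_nhds

/-- Jordan chains are linearly independent. -/
theorem chain_injective {ι : Type*} [Fintype ι] (K : Matrix ι ι ℂ) (s : ℕ)
    (e : ℕ → Matrix ι (Fin m) ℂ) (h0 : K * e 0 = 0) (hs : ∀ j, j + 1 < s → K * e (j + 1) = e j)
    (hinj : ∀ w, e 0 *ᵥ w = 0 → w = 0) (w : Fin s → Fin m → ℂ)
    (hw : ∑ j : Fin s, e j *ᵥ w j = 0) : w = 0 := by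
  classical
  have hpow : ∀ i j : ℕ, j < s → K ^ i * e j = if i ≤ j then e (j - i) else 0 := by
    intro i
    induction i with
    | zero => intro j _; simp
    | succ i ih =>
      intro j hj
      rcases Nat.eq_zero_or_pos j with h | h
      · subst h; rw [pow_succ, Matrix.mul_assoc, h0]; simp
      · obtain ⟨a, rfl⟩ : ∃ a, j = a + 1 := ⟨j - 1, by omega⟩
        rw [pow_succ, Matrix.mul_assoc, hs a hj, ih a (by omega)]
        simp [Nat.add_sub_add_right]
  by_contra hne
  have hex : ∃ j : Fin s, w j ≠ 0 := ne_iff.1 hne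
  obtain ⟨J, hJ, hmax⟩ := (univ.filter fun j : Fin s => w j ≠ 0).exists_max_image id
    (by obtain ⟨j, hj⟩ := hex; exact ⟨j, by simpa using hj⟩)
  simp only [mem_filter, mem_univ, true_and, id] at hJ hmax
  have h1 := congrArg (fun v => (K ^ (J : ℕ)) *ᵥ v) hw
  simp only [mulVec_sum, mulVec_mulVec, mulVec_zero] at h1
  rw [sum_eq_single J] at h1
  · rw [hpow J J J.2] at h1
    simp only [le_refl, if_true, Nat.sub_self] at h1
    exact hJ (hinj _ h1)
  · intro j _ hj
    by_cases hwj : w j = 0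
    · rw [hwj, mulVec_zero]
    · have hlt : (j : ℕ) < J := lt_of_le_of_ne (hmax j hwj) fun h => hj (Fin.ext h)
      rw [hpow J j j.2, if_neg (by omega), zero_mulVec]
  · simp

end Chain


/-! ### Quadratic forms -/

section Forms

variable {ι κ : Type*} [Fintype ι] [DecidableEq ι] [Fintype κ]

/-- The value `⟨x, M x⟩` of a quadratic form. -/
def qform (M : Matrix ι ι ℂ) (x : ι → ℂ) : ℂ := star x ⬝ᵥ (M *ᵥ x)

omit [DecidableEq ι] in
theorem qform_conjTranspose (M : Matrix ι ι ℂ) (x : ι → ℂ) : qform Mᴴ x = star (qform M x) := by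
  rw [qform, qform, ← star_dotProduct_star, star_mulVec, star_star, ← dotProduct_mulVec]

omit [DecidableEq ι] in
theorem qform_add (M N : Matrix ι ι ℂ) (x : ι → ℂ) : qform (M + N) x = qform M x + qform N x := by
  rw [qform, add_mulVec, dotProduct_add]; rfl

omit [DecidableEq ι] in
theorem qform_smul (c : ℂ) (M : Matrix ι ι ℂ) (x : ι → ℂ) : qform (c • M) x = c * qform M x := by
  rw [qform, smul_mulVec, dotProduct_smul]; rfl

omit [DecidableEq ι] in
theorem qform_neg (M : Matrix ι ι ℂ) (x : ι → ℂ) : qform (-M) x = -qform M x := by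
  rw [qform, neg_mulVec, dotProduct_neg]; rfl

omit [DecidableEq ι] in
theorem qform_sub (M N : Matrix ι ι ℂ) (x : ι → ℂ) : qform (M - N) x = qform M x - qform N x := by
  rw [sub_eq_add_neg, qform_add, qform_neg, sub_eq_add_neg]

theorem qform_one (x : ι → ℂ) : qform (1 : Matrix ι ι ℂ) x = ((∑ i, ‖x i‖ ^ 2 : ℝ) : ℂ) := by
  rw [qform, one_mulVec, dotProduct]
  push_cast
  refine sum_congr rfl fun i _ => ?_
  rw [Pi.star_apply, star_def, ← Complex.normSq_eq_conj_mul_self, Complex.normSq_eq_norm_sq]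
  norm_cast

omit [DecidableEq ι] in
theorem qform_congr (M : Matrix ι ι ℂ) (R : Matrix ι κ ℂ) (x : κ → ℂ) :
    qform (Rᴴ * M * R) x = qform M (R *ᵥ x) := by
  rw [qform, qform, star_mulVec, ← dotProduct_mulVec, mulVec_mulVec, mulVec_mulVec, Matrix.mul_assoc]

omit [DecidableEq ι] in
theorem rePart_isHermitian (M : Matrix ι ι ℂ) : (rePart M).IsHermitian := by
  rw [IsHermitian, rePart, conjTranspose_smul, conjTranspose_add, conjTranspose_conjTranspose, add_comm]
  congr 1
  simp

omit [DecidableEq ι] in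
theorem qform_rePart (M : Matrix ι ι ℂ) (x : ι → ℂ) : qform (rePart M) x = ((qform M x).re : ℂ) := by
  rw [rePart, qform_smul, qform_add, qform_conjTranspose, star_def, Complex.add_conj]
  push_cast; ring

theorem reGe_iff {M : Matrix ι ι ℂ} {r : ℝ} :
    ReGe M r ↔ ∀ x : ι → ℂ, r * ∑ i, ‖x i‖ ^ 2 ≤ (qform M x).re := by
  rw [ReGe, posSemidef_iff_dotProduct_mulVec]
  have h1 : (rePart M - (r : ℂ) • (1 : Matrix ι ι ℂ)).IsHermitian := by
    refine (rePart_isHermitian M).sub ?_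
    rw [IsHermitian, conjTranspose_smul, conjTranspose_one]
    simp
  refine ⟨fun h x => ?_, fun h => ⟨h1, fun x => ?_⟩⟩
  · have h2 := h.2 x
    change 0 ≤ qform _ x at h2
    rw [qform_sub, qform_rePart, qform_smul, qform_one, ← ofReal_mul, ← ofReal_sub, Complex.zero_le_real] at h2
    linarith
  · change 0 ≤ qform _ x
    rw [qform_sub, qform_rePart, qform_smul, qform_one, ← ofReal_mul, ← ofReal_sub, Complex.zero_le_real]
    linarith [h x]

theorem reLe_iff_reGe_neg {M : Matrix ι ι ℂ} {r : ℝ} : ReLe M r ↔ ReGe (-M) (-r) := by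
  have h : (r : ℂ) • (1 : Matrix ι ι ℂ) - rePart M = rePart (-M) - ((-r : ℝ) : ℂ) • 1 := by
    rw [rePart, rePart, conjTranspose_neg, ← neg_add, smul_neg]
    push_cast
    rw [neg_smul]
    abel
  rw [ReLe, ReGe, h]

theorem ReGe.mono {M : Matrix ι ι ℂ} {r r' : ℝ} (h : ReGe M r) (hr : r' ≤ r) : ReGe M r' := by
  rw [reGe_iff] at h ⊢
  exact fun x => (mul_le_mul_of_nonneg_right hr (by positivity)).trans (h x)

theorem reGe_diagonal {d : ι → ℂ} {r : ℝ} (h : ∀ i, r ≤ (d i).re) : ReGe (diagonal d) r := by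
  rw [reGe_iff]
  intro x
  rw [qform, dotProduct, re_sum, mul_sum]
  refine sum_le_sum fun i _ => ?_
  rw [mulVec_diagonal, Pi.star_apply, star_def, mul_left_comm,
    ← Complex.normSq_eq_conj_mul_self, re_mul_ofReal, Complex.normSq_eq_norm_sq]
  exact mul_le_mul_of_nonneg_right (h i) (by positivity)

theorem PosDef.exists_sqrt {G : Matrix ι ι ℂ} (hG : G.PosDef) :
    ∃ K : Matrix ι ι ℂ, Kᴴ = K ∧ K * K = G ∧ K.det ≠ 0 := by
  open scoped MatrixOrder in
  have h0 : 0 ≤ G := hG.posSemidef.nonneg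
  have h1 : CFC.sqrt G * CFC.sqrt G = G := CFC.sqrt_mul_sqrt_self G h0
  refine ⟨CFC.sqrt G, (CFC.sqrt_nonneg G).posSemidef.isHermitian, h1, fun h => ?_⟩
  have h2 := (isUnit_iff_isUnit_det _).1 hG.isUnit
  rw [← h1, det_mul, h, zero_mul] at h2
  exact not_isUnit_zero h2

theorem exists_conj_reGe {G M : Matrix ι ι ℂ} (hG : G.PosDef) {b : ℝ}
    (h : ∀ x, b * (qform G x).re ≤ (qform (G * M) x).re) :
    ∃ R : Matrix ι ι ℂ, R.det ≠ 0 ∧ ReGe (R⁻¹ * M * R) b := by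
  obtain ⟨K, hK, hKK, hdet⟩ := PosDef.exists_sqrt hG
  have hu : IsUnit K.det := isUnit_iff_ne_zero.2 hdet
  refine ⟨K⁻¹, by rw [det_nonsing_inv, Ring.inverse_eq_inv']; exact inv_ne_zero hdet, ?_⟩
  rw [reGe_iff, nonsing_inv_nonsing_inv _ hu]
  have hKi : (K⁻¹)ᴴ = K⁻¹ := by rw [conjTranspose_nonsing_inv, hK]
  have e1 : K * M * K⁻¹ = (K⁻¹)ᴴ * (G * M) * K⁻¹ := by
    rw [hKi, ← hKK, Matrix.mul_assoc K K M, ← Matrix.mul_assoc K⁻¹ K, nonsing_inv_mul _ hu, Matrix.one_mul]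
  have e2 : (1 : Matrix ι ι ℂ) = (K⁻¹)ᴴ * G * K⁻¹ := by
    rw [hKi, ← hKK, nonsing_inv_mul_cancel_left _ _ hu, mul_nonsing_inv _ hu]
  intro x
  have h1 := h (K⁻¹ *ᵥ x)
  rw [← qform_congr, ← qform_congr, ← e1, ← e2, qform_one, ofReal_re] at h1
  exact h1

theorem exists_conj_diagonal {G M : Matrix ι ι ℂ} (hG : G.PosDef) (h : (G * M).IsHermitian) :
    ∃ (R : Matrix ι ι ℂ) (μ : ι → ℝ), R.det ≠ 0 ∧ R⁻¹ * M * R = diagonal fun i => (μ i : ℂ) := by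
  obtain ⟨K, hK, hKK, hdet⟩ := PosDef.exists_sqrt hG
  have hu : IsUnit K.det := isUnit_iff_ne_zero.2 hdet
  have hKi : (K⁻¹)ᴴ = K⁻¹ := by rw [conjTranspose_nonsing_inv, hK]
  have e1 : K * M * K⁻¹ = K⁻¹ * (G * M) * K⁻¹ := by
    have e2 : K⁻¹ * (G * M) = K * M := by
      rw [← hKK, Matrix.mul_assoc K K M, ← Matrix.mul_assoc K⁻¹ K (K * M), nonsing_inv_mul _ hu, Matrix.one_mul]
    rw [e2]
  have hH : (K * M * K⁻¹).IsHermitian := by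
    rw [e1, IsHermitian, conjTranspose_mul, conjTranspose_mul, hKi, h.eq, ← Matrix.mul_assoc]
  have h1 := hH.spectral_theorem
  rw [Unitary.conjStarAlgAut_apply] at h1
  set U : Matrix ι ι ℂ := (hH.eigenvectorUnitary : Matrix ι ι ℂ) with hU
  have hU1 : star U * U = 1 := Unitary.coe_star_mul_self _
  have hUinv : U⁻¹ = star U := inv_eq_left_inv hU1
  have hUd : U.det ≠ 0 := fun h0 => by
    have := congrArg det hU1
    rw [det_mul, h0, mul_zero, det_one] at this
    exact zero_ne_one this
  refine ⟨K⁻¹ * U, hH.eigenvalues, ?_, ?_⟩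
  · rw [det_mul, det_nonsing_inv, Ring.inverse_eq_inv']
    exact mul_ne_zero (inv_ne_zero hdet) hUd
  · rw [Matrix.mul_inv_rev, nonsing_inv_nonsing_inv _ hu, hUinv]
    calc star U * K * M * (K⁻¹ * U) = star U * (K * M * K⁻¹) * U := by
          simp only [Matrix.mul_assoc]
      _ = star U * (U * (diagonal (RCLike.ofReal ∘ hH.eigenvalues)) * star U) * U :=
          congrArg (fun Z => star U * Z * U) h1
      _ = star U * U * (diagonal (RCLike.ofReal ∘ hH.eigenvalues)) * (star U * U) := by
          simp only [Matrix.mul_assoc]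
      _ = _ := by rw [hU1, Matrix.one_mul, Matrix.mul_one]; rfl

end Forms

/-! ### Homogeneity and symmetrizers -/

namespace Endstate

variable {n k : ℕ} (E : Endstate n k)

theorem symA_smul (r : ℝ) (ξ : Fin (k + 1) → ℝ) : E.symA (r • ξ) = r • E.symA ξ := by
  simp only [symA, Pi.smul_apply, smul_eq_mul, mul_smul, smul_sum]

theorem symC_smul (r : ℝ) (ξ : Fin (k + 1) → ℝ) : E.symC (r • ξ) = r • E.symC ξ := by
  simp only [symC, Pi.smul_apply, smul_eq_mul, mul_smul, smul_sum]

theorem symB_smul (r : ℝ) (ξ : Fin (k + 1) → ℝ) : E.symB (r • ξ) = r ^ 2 • E.symB ξ := by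
  simp only [symB, Pi.smul_apply, smul_eq_mul, smul_sum, smul_smul]
  refine sum_congr rfl fun i _ => sum_congr rfl fun j _ => ?_
  congr 1; ring

theorem firstOrder_smul (r : ℝ) (ξ : Fin (k + 1) → ℝ) :
    E.firstOrder (r • ξ) = r • E.firstOrder ξ := by
  simp only [firstOrder, symA_smul, Matrix.mul_smul]

theorem secondOrder_smul (r : ℝ) (ξ : Fin (k + 1) → ℝ) :
    E.secondOrder (r • ξ) = r ^ 2 • E.secondOrder ξ := by
  simp only [secondOrder, firstOrder_smul, symB_smul, symC_smul, smul_pow, Matrix.mul_smul,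
    smul_mul, smul_smul, smul_add, smul_neg]
  rw [sq r]

end Endstate

/-- The euclidean length of a vector. -/
noncomputable def len {ι : Type*} [Fintype ι] (ξ : ι → ℝ) : ℝ := √(∑ i, ξ i ^ 2)

theorem len_sq {ι : Type*} [Fintype ι] (ξ : ι → ℝ) : len ξ ^ 2 = ∑ i, ξ i ^ 2 :=
  sq_sqrt (Finset.sum_nonneg fun i _ => sq_nonneg _)

theorem len_pos {ι : Type*} [Fintype ι] {ξ : ι → ℝ} (h : ξ ≠ 0) : 0 < len ξ := by
  refine Real.sqrt_pos.2 ?_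
  obtain ⟨i, hi⟩ := ne_iff.1 h
  exact Finset.sum_pos' (fun i _ => sq_nonneg _) ⟨i, mem_univ i, by
    have : ξ i ≠ 0 := hi
    positivity⟩

theorem sum_sq_unit {ι : Type*} [Fintype ι] {ξ : ι → ℝ} (h : ξ ≠ 0) :
    ∑ i, ((len ξ)⁻¹ • ξ) i ^ 2 = 1 := by
  simp only [Pi.smul_apply, smul_eq_mul, mul_pow, ← mul_sum]
  rw [← len_sq, inv_pow, inv_mul_cancel₀ (pow_pos (len_pos h) 2).ne']

namespace Endstate

variable {n k : ℕ} {E : Endstate n k} {S : (Fin (k + 1) → ℝ) → Matrix (Fin n) (Fin n) ℂ}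

theorem IsSymmetrizer.isHermitian_mul (hS : E.IsSymmetrizer S) {ξ : Fin (k + 1) → ℝ} (h : ξ ≠ 0) :
    (S ((len ξ)⁻¹ • ξ) * cx (E.firstOrder ξ)).IsHermitian := by
  have h1 := hS.symm _ (sum_sq_unit h)
  rw [firstOrder_smul, cx_smul, Matrix.mul_smul] at h1
  have h2 : S ((len ξ)⁻¹ • ξ) * cx (E.firstOrder ξ) = (len ξ : ℂ) •
      ((((len ξ)⁻¹ : ℝ) : ℂ) • (S ((len ξ)⁻¹ • ξ) * cx (E.firstOrder ξ))) := by
    rw [smul_smul, ← ofReal_mul, mul_inv_cancel₀ (len_pos h).ne', ofReal_one, one_smul]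
  rw [h2, IsHermitian, conjTranspose_smul, h1.eq]
  simp

/-- Right eigenvectors give left eigenvectors. -/
theorem IsSymmetrizer.left_eigen (hS : E.IsSymmetrizer S) {ξ : Fin (k + 1) → ℝ} (h : ξ ≠ 0) {m : ℕ}
    {e : Matrix (Fin n) (Fin m) ℂ} {a : ℝ}
    (he : cx (E.firstOrder ξ) * e = (-(a : ℂ)) • e) :
    eᴴ * S ((len ξ)⁻¹ • ξ) * cx (E.firstOrder ξ) = (-(a : ℂ)) • (eᴴ * S ((len ξ)⁻¹ • ξ)) := by
  have h1 := (hS.isHermitian_mul h).eq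
  rw [Matrix.mul_assoc, ← h1, ← conjTranspose_mul, Matrix.mul_assoc, he, Matrix.mul_smul,
    conjTranspose_smul, conjTranspose_mul, (hS.posDef _ (sum_sq_unit h)).isHermitian.eq]
  simp

variable (E) in
/-- The first order symbol acts diagonally on the compression of the second order symbol. -/
theorem exists_compression (hc : E.ConstantMultiplicities) {ξ : Fin (k + 1) → ℝ} (hξ : ξ ≠ 0) {m : ℕ}
    {e : Matrix (Fin n) (Fin m) ℂ} {a : ℝ}
    (hspan : ∀ x, cx (E.firstOrder ξ) *ᵥ x = (-(a : ℂ)) • x → ∃ w, x = e *ᵥ w)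
    (H : Matrix (Fin n) (Fin m) ℂ) : ∃ (M : Matrix (Fin m) (Fin m) ℂ) (Y : Matrix (Fin n) (Fin m) ℂ),
      H = -(e * M) + (cx (E.firstOrder ξ) + (a : ℂ) • 1) * Y := by
  obtain ⟨L, mult, hn, hLm⟩ := hc
  obtain ⟨hL, hm⟩ := hLm ξ hξ
  obtain ⟨C, Ci, hCCi, -, hC⟩ := E.exists_diagonalization hn hL hm
  set F := cx (E.firstOrder ξ) with hF
  let ι := Σ l : Fin L, Fin (mult l)
  let d : ι → ℂ := fun p => (a : ℂ) - (E.a p.1 ξ : ℂ)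
  have hd : (F + (a : ℂ) • 1) * C = C * (diagonal d : Matrix ι ι ℂ) := by
    rw [Matrix.add_mul, hC, smul_mul, Matrix.one_mul]
    ext i p
    have h1 : (C * (diagonal (fun p : ι => -(E.a p.1 ξ : ℂ)) : Matrix ι ι ℂ)) i p =
      C i p * -(E.a p.1 ξ : ℂ) := mul_diagonal _ _ _ _
    have h2 : (C * (diagonal d : Matrix ι ι ℂ)) i p = C i p * d p := mul_diagonal _ _ _ _
    rw [Matrix.add_apply, h1, h2, Matrix.smul_apply, smul_eq_mul]
    simp only [d]; ring
  let Z : Matrix ι (Fin m) ℂ := Ci * H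
  let Z0 : Matrix ι (Fin m) ℂ := of fun p b => if d p = 0 then Z p b else 0
  let Z1 : Matrix ι (Fin m) ℂ := of fun p b => (d p)⁻¹ * Z p b
  have hZ : Z = Z0 + (diagonal d : Matrix ι ι ℂ) * Z1 := by
    ext p b
    have h2 : ((diagonal d : Matrix ι ι ℂ) * Z1) p b = d p * Z1 p b := diagonal_mul _ _ _ _
    rw [Matrix.add_apply, h2]
    by_cases h : d p = 0
    · simp [Z0, Z1, h]
    · simp [Z0, Z1, h]
  have hZ0 : (diagonal d : Matrix ι ι ℂ) * Z0 = 0 := by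
    ext p b
    refine (diagonal_mul _ _ _ _).trans ?_
    by_cases h : d p = 0 <;> simp [Z0, h]
  have hcol : ∀ b, ∃ w, (C * Z0).col b = e *ᵥ w := by
    intro b
    apply hspan
    have h3 : (F + (a : ℂ) • 1) * (C * Z0) = 0 := by
      rw [← Matrix.mul_assoc, hd, Matrix.mul_assoc, hZ0, Matrix.mul_zero]
    have h4 : (F + (a : ℂ) • 1) *ᵥ (C * Z0).col b = 0 := by
      have := congrArg (fun A => A.col b) h3
      ext i
      exact congrFun this i
    rw [add_mulVec, smul_mulVec, one_mulVec] at h4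
    rw [neg_smul]
    exact eq_neg_of_add_eq_zero_left h4
  choose w hw using hcol
  refine ⟨-of fun i b => w b i, C * Z1, ?_⟩
  have h5 : e * (of fun i b => w b i) = C * Z0 := by
    ext i b
    exact (congrFun (hw b) i).symm
  rw [Matrix.mul_neg, neg_neg, h5, ← Matrix.mul_assoc, hd, Matrix.mul_assoc, ← Matrix.mul_add, ← hZ,
    ← Matrix.mul_assoc, hCCi, Matrix.one_mul]

theorem IsSymmetrizer.compression (hS : E.IsSymmetrizer S) {ξ : Fin (k + 1) → ℝ} (h : ξ ≠ 0) {m : ℕ}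
    {e : Matrix (Fin n) (Fin m) ℂ} {a : ℝ}
    (he : cx (E.firstOrder ξ) * e = (-(a : ℂ)) • e) {M : Matrix (Fin m) (Fin m) ℂ}
    {Y H : Matrix (Fin n) (Fin m) ℂ}
    (hH : H = -(e * M) + (cx (E.firstOrder ξ) + (a : ℂ) • 1) * Y) :
    eᴴ * S ((len ξ)⁻¹ • ξ) * H = -(eᴴ * S ((len ξ)⁻¹ • ξ) * e * M) := by
  rw [hH, Matrix.mul_add, ← Matrix.mul_assoc _ _ Y, Matrix.mul_add, hS.left_eigen h he,
    Matrix.mul_smul, Matrix.mul_one, neg_smul, neg_add_cancel, Matrix.zero_mul, add_zero,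
    Matrix.mul_neg, Matrix.mul_assoc _ e M]

theorem IsSymmetrizer.gram_posDef (hS : E.IsSymmetrizer S) {ξ : Fin (k + 1) → ℝ} (h : ξ ≠ 0) {m : ℕ}
    {e : Matrix (Fin n) (Fin m) ℂ} (hinj : ∀ w, e *ᵥ w = 0 → w = 0) :
    (eᴴ * S ((len ξ)⁻¹ • ξ) * e).PosDef := by
  refine (hS.posDef _ (sum_sq_unit h)).conjTranspose_mul_mul_same fun x y hxy => ?_
  exact sub_eq_zero.1 (hinj _ (by rw [mulVec_sub, sub_eq_zero]; exact hxy))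

theorem dissForm_frame {ξ : Fin (k + 1) → ℝ} {m : ℕ} {e : Matrix (Fin n) (Fin m) ℂ}
    {G M : Matrix (Fin m) (Fin m) ℂ} (hA0 : E.A0.det ≠ 0)
    (hM : eᴴ * S ((len ξ)⁻¹ • ξ) * (cx E.A0⁻¹ * cx (E.secondOrder ξ) * e) = -(G * M)) (v w : Fin m → ℂ) :
    E.dissForm S ((len ξ)⁻¹ • ξ) (e *ᵥ v) (e *ᵥ w) =
      (((len ξ)⁻¹ ^ 2 : ℝ) : ℂ) * (-(star v ⬝ᵥ ((G * M) *ᵥ w))) := by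
  rw [dissForm, secondOrder_smul, cx_smul, Matrix.mul_smul, smul_mulVec, dotProduct_smul,
    smul_eq_mul, star_mulVec, ← dotProduct_mulVec, mulVec_mulVec, mulVec_mulVec]
  have : eᴴ * (S ((len ξ)⁻¹ • ξ) * (cx E.A0)⁻¹ * cx (E.secondOrder ξ)) * e = -(G * M) := by
    rw [← hM, cx_inv hA0]
    simp only [Matrix.mul_assoc]
  rw [this, neg_mulVec, dotProduct_neg]

theorem inEigenspace_unit {ξ : Fin (k + 1) → ℝ} {m : ℕ} {e : Matrix (Fin n) (Fin m) ℂ} {a : ℝ}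
    (he : cx (E.firstOrder ξ) * e = (-(a : ℂ)) • e) (v : Fin m → ℂ) :
    E.InEigenspace ((len ξ)⁻¹ • ξ) ((len ξ)⁻¹ * -a) (e *ᵥ v) := by
  rw [InEigenspace, firstOrder_smul, cx_smul, smul_mulVec, mulVec_mulVec, he, smul_mulVec, smul_smul]
  push_cast
  rfl

variable (E) in
/-- Frames of the eigenspaces that are adapted to the dissipation form. -/
theorem exists_frame_dissipative (hE : E.Admissible) : ∃ b : ℝ, 0 < b ∧
    ∀ (ξ₀ : Fin (k + 1) → ℝ) (_ : ξ₀ ≠ 0) (l₀ : ℕ) (_ : l₀ < (E.charRoots ξ₀).card),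
    ∃ (m : ℕ) (e : (Fin (k + 1) → ℝ) → Matrix (Fin n) (Fin m) ℂ) (M : Matrix (Fin m) (Fin m) ℂ)
      (Y : Matrix (Fin n) (Fin m) ℂ), 0 < m ∧ MSmooth ω e ξ₀ ∧
      ContDiffAt ℝ ω (E.a l₀) ξ₀ ∧ (∀ᶠ ξ in 𝓝 ξ₀, l₀ < (E.charRoots ξ).card ∧
        cx (E.firstOrder ξ) * e ξ = (-(E.a l₀ ξ : ℂ)) • e ξ ∧
        (∀ w, e ξ *ᵥ w = 0 → w = 0) ∧
        (∀ x, cx (E.firstOrder ξ) *ᵥ x = (-(E.a l₀ ξ : ℂ)) • x → ∃ w, x = e ξ *ᵥ w)) ∧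
      cx E.A0⁻¹ * cx (E.secondOrder ξ₀) * e ξ₀ =
        -(e ξ₀ * M) + (cx (E.firstOrder ξ₀) + (E.a l₀ ξ₀ : ℂ) • 1) * Y ∧
      ReGe M (b * ∑ i, ξ₀ i ^ 2) ∧
      (E.SymmetricCompressions → ∃ μ : Fin m → ℝ, M = diagonal (fun j => (μ j : ℂ)) ∧
        ∀ j, b * ∑ i, ξ₀ i ^ 2 ≤ μ j) := by
  have hA0 : E.A0.det ≠ 0 := hE.A0_posDef.det_pos.ne'
  obtain ⟨S, hS, b, hb, hdiss⟩ := hE.dissipative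
  refine ⟨b, hb, fun ξ₀ hξ₀ l₀ hl₀ => ?_⟩
  obtain ⟨m, e, hm, hes, has, hev⟩ := E.exists_frame hE.constMult hξ₀ hl₀
  obtain ⟨-, he, hinj, hspan⟩ := hev.self_of_nhds
  obtain ⟨M, Y, hMY⟩ := E.exists_compression hE.constMult hξ₀ hspan
    (cx E.A0⁻¹ * cx (E.secondOrder ξ₀) * e ξ₀)
  set G := (e ξ₀)ᴴ * S ((len ξ₀)⁻¹ • ξ₀) * e ξ₀ with hGdef
  have hG : G.PosDef := hS.gram_posDef hξ₀ hinj
  have hGM := hS.compression hξ₀ he hMY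
  have hform : ∀ x, b * (∑ i, ξ₀ i ^ 2) * (qform G x).re ≤ (qform (G * M) x).re := by
    intro x
    have h1 := hdiss _ (sum_sq_unit hξ₀) _ _ (inEigenspace_unit he x)
    rw [dissForm_frame hA0 hGM] at h1
    have h2 : star (e ξ₀ *ᵥ x) ⬝ᵥ (S ((len ξ₀)⁻¹ • ξ₀) *ᵥ (e ξ₀ *ᵥ x)) = qform G x := by
      rw [hGdef, qform_congr]; rfl
    rw [h2] at h1
    change ((((len ξ₀)⁻¹ ^ 2 : ℝ) : ℂ) * (-(qform (G * M) x))).re ≤ _ at h1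
    rw [re_ofReal_mul, Complex.neg_re, inv_pow] at h1
    have h3 := pow_pos (len_pos hξ₀) 2
    rw [← len_sq]
    have h4 : len ξ₀ ^ 2 * ((len ξ₀ ^ 2)⁻¹ * (qform (G * M) x).re) = (qform (G * M) x).re := by
      rw [← mul_assoc, mul_inv_cancel₀ h3.ne', one_mul]
    nlinarith
  have key : ∀ (R : Matrix (Fin m) (Fin m) ℂ), R.det ≠ 0 →
      MSmooth ω (fun ξ => e ξ * R) ξ₀ ∧ (∀ᶠ ξ in 𝓝 ξ₀, l₀ < (E.charRoots ξ).card ∧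
        cx (E.firstOrder ξ) * (e ξ * R) = (-(E.a l₀ ξ : ℂ)) • (e ξ * R) ∧
        (∀ w, (e ξ * R) *ᵥ w = 0 → w = 0) ∧
        (∀ x, cx (E.firstOrder ξ) *ᵥ x = (-(E.a l₀ ξ : ℂ)) • x → ∃ w, x = (e ξ * R) *ᵥ w)) ∧
      cx E.A0⁻¹ * cx (E.secondOrder ξ₀) * (e ξ₀ * R) =
        -((e ξ₀ * R) * (R⁻¹ * M * R)) +
          (cx (E.firstOrder ξ₀) + (E.a l₀ ξ₀ : ℂ) • 1) * (Y * R) := by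
    intro R hR
    have hu : IsUnit R.det := isUnit_iff_ne_zero.2 hR
    refine ⟨hes.mul (MSmooth.const R), ?_, ?_⟩
    · filter_upwards [hev] with ξ hξ
      obtain ⟨h1, h2, h3, h4⟩ := hξ
      refine ⟨h1, by rw [← Matrix.mul_assoc, h2, smul_mul], fun w hw => ?_, fun x hx => ?_⟩
      · rw [← mulVec_mulVec] at hw
        have h5 := congrArg (fun z => R⁻¹ *ᵥ z) (h3 _ hw)
        simpa [mulVec_mulVec, nonsing_inv_mul _ hu] using h5
      · obtain ⟨w, hw⟩ := h4 x hx
        refine ⟨R⁻¹ *ᵥ w, ?_⟩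
        rw [mulVec_mulVec, Matrix.mul_assoc, mul_nonsing_inv _ hu, Matrix.mul_one, hw]
    · have h5 : e ξ₀ * R * (R⁻¹ * M * R) = e ξ₀ * M * R := by
        simp only [Matrix.mul_assoc]
        rw [← Matrix.mul_assoc R R⁻¹ (M * R), mul_nonsing_inv _ hu, Matrix.one_mul]
      rw [← Matrix.mul_assoc, hMY, Matrix.add_mul, Matrix.neg_mul, h5, Matrix.mul_assoc _ Y R]
  by_cases hsym : E.SymmetricCompressions
  · obtain ⟨S₂, hS₂, hsymm⟩ := hsym
    have hG₂ := hS₂.gram_posDef hξ₀ hinj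
    set G₂ := (e ξ₀)ᴴ * S₂ ((len ξ₀)⁻¹ • ξ₀) * e ξ₀ with hG₂def
    have hGM₂ := hS₂.compression hξ₀ he hMY
    have hherm : (G₂ * M).IsHermitian := by
      have h1 : ∀ v w : Fin m → ℂ, star v ⬝ᵥ ((G₂ * M) *ᵥ w) = star (star w ⬝ᵥ ((G₂ * M) *ᵥ v)) := by
        intro v w
        have h2 := hsymm _ (sum_sq_unit hξ₀) _ _ _ (inEigenspace_unit he v) (inEigenspace_unit he w)
        rw [dissForm_frame hA0 hGM₂, dissForm_frame hA0 hGM₂, star_mul', star_neg] at h2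
        have h3 : ((((len ξ₀)⁻¹ ^ 2 : ℝ)) : ℂ) ≠ 0 := by
          exact_mod_cast (pow_pos (inv_pos.2 (len_pos hξ₀)) 2).ne'
        have h4 : star ((((len ξ₀)⁻¹ ^ 2 : ℝ)) : ℂ) = ((((len ξ₀)⁻¹ ^ 2 : ℝ)) : ℂ) :=
          Complex.conj_ofReal _
        rw [h4] at h2
        exact neg_injective (mul_left_cancel₀ h3 h2)
      ext i j
      have h5 := h1 (Pi.single j 1) (Pi.single i 1)
      have h6 : ∀ i j, star (Pi.single i (1 : ℂ) : Fin m → ℂ) ⬝ᵥ ((G₂ * M) *ᵥ Pi.single j 1) =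
          (G₂ * M) i j := by
        intro i j
        rw [← Pi.single_star, star_one, single_one_dotProduct, mulVec_single_one]
        rfl
      rw [h6, h6] at h5
      rw [conjTranspose_apply, h5, star_star]
    obtain ⟨R, μ, hR, hRM⟩ := exists_conj_diagonal hG₂ hherm
    obtain ⟨k1, k2, k3⟩ := key R hR
    have hu : IsUnit R.det := isUnit_iff_ne_zero.2 hR
    have hμ : ∀ j, b * ∑ i, ξ₀ i ^ 2 ≤ μ j := by
      intro j
      have h1 : M *ᵥ (R *ᵥ Pi.single j 1) = (μ j : ℂ) • (R *ᵥ Pi.single j 1) := by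
        have h2 : M * R = R * diagonal fun i => (μ i : ℂ) := by
          rw [← hRM, ← Matrix.mul_assoc, ← Matrix.mul_assoc, mul_nonsing_inv _ hu, Matrix.one_mul]
        rw [mulVec_mulVec, h2, ← mulVec_mulVec, diagonal_mulVec_single, ← mulVec_smul]
        congr 1
        ext i
        by_cases h : i = j
        · subst h; simp
        · simp [h]
      set x := R *ᵥ Pi.single j (1 : ℂ) with hx
      have hx0 : x ≠ 0 := by
        intro h0
        have h3 := congrArg (fun z => R⁻¹ *ᵥ z) (hx.symm.trans h0)
        simp only [mulVec_mulVec, nonsing_inv_mul _ hu, one_mulVec, mulVec_zero] at h3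
        have := congrFun h3 j
        simp at this
      have h4 := hform x
      have h5 : qform (G * M) x = (μ j : ℂ) * qform G x := by
        rw [qform, ← mulVec_mulVec, h1, mulVec_smul, dotProduct_smul]; rfl
      rw [h5, re_ofReal_mul] at h4
      have h6 : 0 < (qform G x).re := (Complex.pos_iff.1 (hG.dotProduct_mulVec_pos hx0)).1
      exact le_of_mul_le_mul_right h4 h6
    refine ⟨m, fun ξ => e ξ * R, _, _, hm, k1, has, k2, k3, ?_, fun _ => ⟨μ, hRM, hμ⟩⟩
    rw [hRM]
    exact reGe_diagonal fun j => by simpa using hμ j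
  · obtain ⟨R, hR, hRM⟩ := exists_conj_reGe hG hform
    obtain ⟨k1, k2, k3⟩ := key R hR
    exact ⟨m, fun ξ => e ξ * R, _, _, hm, k1, has, k2, k3, hRM, fun h => absurd h hsym⟩

end Endstate


/-! ### Chains along glancing curves -/

namespace Endstate

variable {n k : ℕ} (E : Endstate n k)

/-- The symbol `τ A⁰ + x A¹ + A₂(η)`. -/
noncomputable def charMat (τ x : ℝ) (η : Fin k → ℝ) : Matrix (Fin n) (Fin n) ℂ :=
  (τ : ℂ) • cx E.A0 + (x : ℂ) • cx (E.A 0) + cx (E.symA2 η)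

theorem symA_vecCons (x : ℝ) (η : Fin k → ℝ) :
    cx (E.symA (vecCons x η)) = (x : ℂ) • cx (E.A 0) + cx (E.symA2 η) := by
  rw [symA, Fin.sum_univ_succ, cx_add, cx_smul]
  simp [symA2]

theorem charMat_eq (hA0 : E.A0.det ≠ 0) (τ x : ℝ) (η : Fin k → ℝ) :
    E.charMat τ x η = cx E.A0 * (cx (E.firstOrder (vecCons x η)) + (τ : ℂ) • 1) := by
  have h : cx E.A0 * cx E.A0⁻¹ = 1 := by
    rw [← cx_mul, mul_nonsing_inv _ (isUnit_iff_ne_zero.2 hA0), cx_one]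
  rw [charMat, add_assoc, ← E.symA_vecCons, firstOrder, cx_mul, Matrix.mul_add, ← Matrix.mul_assoc, h,
    Matrix.one_mul, Matrix.mul_smul, Matrix.mul_one, add_comm]

theorem charMat_mul_eq_zero_iff (hA0 : E.A0.det ≠ 0) {τ x : ℝ} {η : Fin k → ℝ} {m : ℕ}
    {e : Matrix (Fin n) (Fin m) ℂ} : E.charMat τ x η * e = 0 ↔
      cx (E.firstOrder (vecCons x η)) * e = (-(τ : ℂ)) • e := by
  have h : cx E.A0⁻¹ * cx E.A0 = 1 := by
    rw [← cx_mul, nonsing_inv_mul _ (isUnit_iff_ne_zero.2 hA0), cx_one]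
  rw [E.charMat_eq hA0, Matrix.mul_assoc]
  constructor
  · intro h0
    have h1 := congrArg (fun Z => cx E.A0⁻¹ * Z) h0
    simp only [← Matrix.mul_assoc, h, Matrix.one_mul, Matrix.mul_zero, Matrix.add_mul, smul_mul] at h1
    rw [neg_smul]
    exact eq_neg_of_add_eq_zero_left h1
  · intro h0
    rw [Matrix.add_mul, h0, smul_mul, Matrix.one_mul, neg_smul, neg_add_cancel, Matrix.mul_zero]

theorem charMat_mulVec_eq_zero_iff (hA0 : E.A0.det ≠ 0) {τ x : ℝ} {η : Fin k → ℝ}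
    {v : Fin n → ℂ} : E.charMat τ x η *ᵥ v = 0 ↔
      cx (E.firstOrder (vecCons x η)) *ᵥ v = (-(τ : ℂ)) • v := by
  have h := E.charMat_mul_eq_zero_iff hA0 (τ := τ) (x := x) (η := η) (m := 1)
    (e := of fun i _ => v i)
  constructor
  · intro h0
    have h1 := h.1 (by ext i b; exact congrFun h0 i)
    ext i; exact congrFun (congrFun h1 i) 0
  · intro h0
    have h1 := h.2 (by ext i b; exact congrFun h0 i)
    ext i; exact congrFun (congrFun h1 i) 0

theorem contDiff_vecCons : ContDiff ℝ ω (fun q : ℝ × (Fin k → ℝ) => vecCons q.1 q.2) := by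
  rw [contDiff_pi]
  intro i
  refine Fin.cases ?_ (fun j => ?_) i
  · simpa using contDiff_fst
  · exact (contDiff_apply ℝ ℝ j).comp contDiff_snd

variable {E} {x₀ : ℝ} {η₀ : Fin k → ℝ} {l : ℕ}

theorem contDiffAt_dA (ha : ContDiffAt ℝ ω (E.a l) (vecCons x₀ η₀)) (j : ℕ) :
    ContDiffAt ℝ ω (fun q : ℝ × (Fin k → ℝ) => E.dA l j q.1 q.2) (x₀, η₀) := by
  have h : ContDiffAt ℝ ω (fun q : ℝ × (Fin k → ℝ) => E.a l (vecCons q.1 q.2)) (x₀, η₀) :=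
    ContDiffAt.comp (x₀, η₀) (g := E.a l) (f := fun q : ℝ × (Fin k → ℝ) => vecCons q.1 q.2) ha
      contDiff_vecCons.contDiffAt
  exact contDiffAt_iteratedDeriv_partial h j

/-- The curve of roots of multiplicity `s` through a root of multiplicity `s ≥ 2`. -/
theorem exists_glancing_curve (hp : E.GlancingPersists) (hη : η₀ ≠ 0)
    (ha : ContDiffAt ℝ ω (E.a l) (vecCons x₀ η₀)) {s : ℕ} (hs : 2 ≤ s) (ho : E.RootOrder l s x₀ η₀) :
    ∃ g : (Fin k → ℝ) → ℝ, ContDiffAt ℝ ω g η₀ ∧ g η₀ = x₀ ∧ ∀ᶠ η in 𝓝 η₀, E.RootOrder l s (g η) η := by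
  obtain ⟨t, rfl⟩ : ∃ t, s = t + 1 := ⟨s - 1, by omega⟩
  have hsw : ContDiffAt ℝ ω (fun p : (Fin k → ℝ) × ℝ => (p.2, p.1)) (η₀, x₀) :=
    (contDiff_snd.prodMk contDiff_fst).contDiffAt
  have hΦ : ContDiffAt ℝ ω (fun p : (Fin k → ℝ) × ℝ => E.dA l t p.2 p.1) (η₀, x₀) :=
    ContDiffAt.comp (η₀, x₀) (g := fun q : ℝ × (Fin k → ℝ) => E.dA l t q.1 q.2)
      (f := fun p : (Fin k → ℝ) × ℝ => (p.2, p.1)) (contDiffAt_dA ha t) hsw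
  obtain ⟨g, hg0, hg, hgz⟩ := exists_implicit_function (fun p : (Fin k → ℝ) × ℝ => E.dA l t p.2 p.1)
    η₀ x₀ hΦ (ho.1 t (by omega) (by omega)) (by
      intro w hw
      have h1 : HasDerivAt (fun y => E.dA l t y η₀) (E.dA l (t + 1) x₀ η₀) x₀ := by
        have hd : DifferentiableAt ℝ (fun y => E.dA l t y η₀) x₀ := by
          have h2 : ContDiffAt ℝ ω (fun y : ℝ => (y, η₀)) x₀ := contDiffAt_id.prodMk contDiffAt_const
          exact (ContDiffAt.comp x₀ (g := fun q : ℝ × (Fin k → ℝ) => E.dA l t q.1 q.2) (f := fun y : ℝ => (y, η₀))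
            (contDiffAt_dA ha t) h2).differentiableAt (by simp)
        have h3 := hd.hasDerivAt
        have h4 : deriv (fun y => E.dA l t y η₀) x₀ = E.dA l (t + 1) x₀ η₀ := by
          simp only [dA, iteratedDeriv_succ]
        rwa [h4] at h3
      have h5 : HasDerivAt (fun t' : ℝ => x₀ + t' • w) w 0 := by
        simpa using ((hasDerivAt_id (0 : ℝ)).smul_const w).const_add x₀
      have h8 : HasDerivAt (fun y => E.dA l t y η₀) (E.dA l (t + 1) x₀ η₀) (x₀ + (0 : ℝ) • w) := by
        rw [zero_smul, add_zero]; exact h1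
      have h6 := HasDerivAt.comp (0 : ℝ) (h₂ := fun y => E.dA l t y η₀) (h := fun t' : ℝ => x₀ + t' • w)
        h8 h5
      have h7 := h6.unique hw
      exact (mul_eq_zero.1 h7).resolve_left ho.2)
  refine ⟨g, hg, hg0, ?_⟩
  have h1 := hp l (t + 1) x₀ η₀ hη hs ho g hg.continuousAt hg0 hgz
  have h2 : ContinuousAt (fun η => E.dA l (t + 1) (g η) η) η₀ := by
    have h3 : ContinuousAt (fun η => (g η, η)) η₀ := hg.continuousAt.prodMk continuousAt_id
    have h4 := (contDiffAt_dA ha (t + 1)).continuousAt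
    rw [← hg0] at h4
    exact ContinuousAt.comp (g := fun q : ℝ × (Fin k → ℝ) => E.dA l (t + 1) q.1 q.2)
      (f := fun η => (g η, η)) h4 h3
  have h5 : ∀ᶠ η in 𝓝 η₀, E.dA l (t + 1) (g η) η ≠ 0 :=
    h2.eventually_ne (by rw [hg0]; exact ho.2)
  filter_upwards [h1, h5] with η h6 h7
  exact ⟨fun j hj1 hj2 => h6 j hj1 (by omega), h7⟩

theorem eventually_rootOrder_one (ha : ContDiffAt ℝ ω (E.a l) (vecCons x₀ η₀))
    (ho : E.RootOrder l 1 x₀ η₀) : ∀ᶠ η in 𝓝 η₀, E.RootOrder l 1 x₀ η := by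
  have h2 : ContinuousAt (fun η => E.dA l 1 x₀ η) η₀ := by
    have h3 : ContinuousAt (fun η => (x₀, η)) η₀ := continuousAt_const.prodMk continuousAt_id
    exact ContinuousAt.comp (g := fun q : ℝ × (Fin k → ℝ) => E.dA l 1 q.1 q.2) (f := fun η => (x₀, η))
      (contDiffAt_dA ha 1).continuousAt h3
  filter_upwards [h2.eventually_ne ho.2] with η h
  exact ⟨fun j h1 h2 => by omega, h⟩

variable {m : ℕ} {e : (Fin (k + 1) → ℝ) → Matrix (Fin n) (Fin m) ℂ}

theorem eventually_slice {P : (Fin (k + 1) → ℝ) → Prop} {x : ℝ} {η : Fin k → ℝ}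
    (h : ∀ᶠ ξ in 𝓝 (vecCons x η), P ξ) : ∀ᶠ y in 𝓝 x, P (vecCons y η) := by
  have hc : ContinuousAt (fun y : ℝ => vecCons y η) x :=
    ((contDiff_vecCons (k := k)).continuous.comp (Continuous.prodMk_left η)).continuousAt
  exact hc.eventually h

theorem chain_of_flat (hA0 : E.A0.det ≠ 0) {x : ℝ} {η : Fin k → ℝ}
    (he : MSmooth ω e (vecCons x η)) (ha : ContDiffAt ℝ ω (E.a l) (vecCons x η))
    (hev : ∀ᶠ ξ in 𝓝 (vecCons x η),
      cx (E.firstOrder ξ) * e ξ = (-(E.a l ξ : ℂ)) • e ξ) {s : ℕ}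
    (hflat : ∀ j, 1 ≤ j → j < s → E.dA l j x η = 0) :
    E.charMat (E.a l (vecCons x η)) x η * taylorCoeff (fun y => e (vecCons y η)) x 0 = 0 ∧
    (∀ j, j + 1 < s → E.charMat (E.a l (vecCons x η)) x η *
      taylorCoeff (fun y => e (vecCons y η)) x (j + 1) =
        -(cx (E.A 0) * taylorCoeff (fun y => e (vecCons y η)) x j)) ∧
    (∀ j, j + 1 = s → E.charMat (E.a l (vecCons x η)) x η *
      taylorCoeff (fun y => e (vecCons y η)) x (j + 1) =
        -(cx (E.A 0) * taylorCoeff (fun y => e (vecCons y η)) x j) -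
        ((E.dA l s x η : ℂ) / s.factorial) •
          (cx E.A0 * taylorCoeff (fun y => e (vecCons y η)) x 0)) := by
  have hc : ContDiffAt ℝ ω (fun y : ℝ => vecCons y η) x :=
    ContDiffAt.comp x (g := fun q : ℝ × (Fin k → ℝ) => vecCons q.1 q.2) (f := fun y : ℝ => (y, η)) contDiff_vecCons.contDiffAt
      (contDiffAt_id.prodMk contDiffAt_const)
  have he' : MSmooth ω (fun y => e (vecCons y η)) x := MSmooth.comp (g := fun y : ℝ => vecCons y η) he hc
  have ha' : ContDiffAt ℝ ω (fun y => E.a l (vecCons y η)) x := ContDiffAt.comp x (g := E.a l) (f := fun y : ℝ => vecCons y η) ha hc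
  have hrel : ∀ᶠ y in 𝓝 x, ((E.a l (vecCons y η) : ℂ) • cx E.A0 + (y : ℂ) • cx (E.A 0) +
      cx (E.symA2 η)) * e (vecCons y η) = 0 := by
    filter_upwards [eventually_slice hev] with y hy
    exact (E.charMat_mul_eq_zero_iff hA0).2 hy
  have hT := fun j => taylorCoeff_eigen (e := fun y => e (vecCons y η))
    (α := fun y => E.a l (vecCons y η)) (A₂ := cx (E.symA2 η)) he' ha' hrel (s := s) hflat j
  refine ⟨?_, fun j hj => ?_, fun j hj => ?_⟩
  · exact taylorCoeff_eigen_zero (e := fun y => e (vecCons y η))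
      (α := fun y => E.a l (vecCons y η)) (A₂ := cx (E.symA2 η)) hrel
  · exact (hT j).1 hj
  · exact (hT j).2 hj

theorem chain_inj (hA1 : (E.A 0).det ≠ 0) {τ x : ℝ} {η : Fin k → ℝ} {s : ℕ}
    {f : ℕ → Matrix (Fin n) (Fin m) ℂ} (h0 : E.charMat τ x η * f 0 = 0)
    (hs : ∀ j, j + 1 < s → E.charMat τ x η * f (j + 1) = -(cx (E.A 0) * f j))
    (hinj : ∀ w, f 0 *ᵥ w = 0 → w = 0) (w : Fin s → Fin m → ℂ)
    (hw : ∑ j : Fin s, f j *ᵥ w j = 0) : w = 0 := by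
  have h1 : (cx (E.A 0))⁻¹ * cx (E.A 0) = 1 :=
    nonsing_inv_mul _ (isUnit_iff_ne_zero.2 (by rw [cx_det]; exact_mod_cast hA1))
  refine chain_injective (-((cx (E.A 0))⁻¹ * E.charMat τ x η)) s f ?_ (fun j hj => ?_) hinj w hw
  · rw [Matrix.neg_mul, Matrix.mul_assoc, h0, Matrix.mul_zero, neg_zero]
  · rw [Matrix.neg_mul, Matrix.mul_assoc, hs j hj, Matrix.mul_neg, neg_neg, ← Matrix.mul_assoc, h1, Matrix.one_mul]

/-- Roots have finite multiplicity. -/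
theorem exists_rootOrder (hE : E.Admissible) (hm : 0 < m)
    (he : MSmooth ω e (vecCons x₀ η₀)) (ha : ContDiffAt ℝ ω (E.a l) (vecCons x₀ η₀))
    (hev : ∀ᶠ ξ in 𝓝 (vecCons x₀ η₀),
      cx (E.firstOrder ξ) * e ξ = (-(E.a l ξ : ℂ)) • e ξ)
    (hinj : ∀ w, e (vecCons x₀ η₀) *ᵥ w = 0 → w = 0) : ∃ s, 1 ≤ s ∧ E.RootOrder l s x₀ η₀ := by
  classical
  have hex : ∃ s, 1 ≤ s ∧ E.dA l s x₀ η₀ ≠ 0 := by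
    by_contra hcon
    push Not at hcon
    obtain ⟨h0, h1, -⟩ := chain_of_flat hE.A0_posDef.det_pos.ne' he ha hev (s := n + 1)
      fun j hj _ => hcon j hj
    have hi := chain_inj hE.A1_det h0 h1 (by rw [taylorCoeff_zero]; exact hinj)
    let φ : (Fin (n + 1) → Fin m → ℂ) →ₗ[ℂ] (Fin n → ℂ) :=
      ∑ j : Fin (n + 1), (mulVecLin (taylorCoeff (fun y => e (vecCons y η₀)) x₀ j)) ∘ₗ
        LinearMap.proj j
    have hφ : Injective φ := by
      rw [injective_iff_map_eq_zero]
      intro w hw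
      refine hi w ?_
      simpa [φ, LinearMap.sum_apply] using hw
    have := LinearMap.finrank_le_finrank_of_injective hφ
    simp only [Module.finrank_pi, Module.finrank_pi_fintype, card_fin, Finset.sum_const,
      Finset.card_univ, smul_eq_mul] at this
    nlinarith
  refine ⟨Nat.find hex, (Nat.find_spec hex).1, fun j hj1 hj2 => ?_, (Nat.find_spec hex).2⟩
  by_contra h
  exact Nat.find_min hex hj2 ⟨hj1, h⟩

end Endstate

/-- A chain of generalized eigenvectors along the curve `x = g(η)` of roots of multiplicity `s` of
`a_l(g(η), η) - a_l(·, η)`, with left eigenvectors `Lf`, and the compression `M` of the second order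
symbol. -/
structure Chain {n k : ℕ} (E : Endstate n k) (τ₀ x₀ : ℝ) (η₀ : Fin k → ℝ) (l s m : ℕ)
    (g : (Fin k → ℝ) → ℝ) (e : ℕ → (Fin k → ℝ) → Matrix (Fin n) (Fin m) ℂ)
    (Lf : (Fin k → ℝ) → Matrix (Fin m) (Fin n) ℂ) (M : Matrix (Fin m) (Fin m) ℂ) (α : ℝ) : Prop where
  m_pos : 0 < m
  s_pos : 1 ≤ s
  smooth_g : ContDiffAt ℝ ω g η₀
  base : g η₀ = x₀
  smooth_a : ContDiffAt ℝ ω (E.a l) (vecCons x₀ η₀)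
  value : E.a l (vecCons x₀ η₀) = τ₀
  order : ∀ᶠ η in 𝓝 η₀, E.RootOrder l s (g η) η
  coeff : α = E.dA l s x₀ η₀ / s.factorial
  smooth_e : ∀ j, MSmooth ω (e j) η₀
  chain : ∀ᶠ η in 𝓝 η₀, E.charMat (E.a l (vecCons (g η) η)) (g η) η * e 0 η = 0 ∧
    ∀ j, j + 1 < s → E.charMat (E.a l (vecCons (g η) η)) (g η) η * e (j + 1) η =
      -(cx (E.A 0) * e j η)
  inj : ∀ w, e 0 η₀ *ᵥ w = 0 → w = 0
  ker : ∀ x, E.charMat τ₀ x₀ η₀ *ᵥ x = 0 → ∃ w, x = e 0 η₀ *ᵥ w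
  evec : ∀ᶠ q : ℝ × (Fin k → ℝ) in 𝓝 (x₀, η₀), ∃ W : Matrix (Fin n) (Fin m) ℂ,
    (∀ w, W *ᵥ w = 0 → w = 0) ∧ E.charMat (E.a l (vecCons q.1 q.2)) q.1 q.2 * W = 0
  cont_L : ContinuousAt Lf η₀
  left : ∀ᶠ η in 𝓝 η₀, Lf η * E.charMat (E.a l (vecCons (g η) η)) (g η) η = 0
  left_chain : ∀ j, j + 1 < s → Lf η₀ * cx (E.A 0) * e j η₀ = 0
  left_top : Lf η₀ * cx (E.A 0) * e (s - 1) η₀ = -((α : ℂ) • (Lf η₀ * cx E.A0 * e 0 η₀))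
  gram : (Lf η₀ * cx E.A0 * e 0 η₀).det ≠ 0
  second : Lf η₀ * cx (E.secondOrder (vecCons x₀ η₀)) * e 0 η₀ = -(Lf η₀ * cx E.A0 * e 0 η₀ * M)

theorem Chain.coeff_ne {n k : ℕ} {E : Endstate n k} {τ₀ x₀ : ℝ} {η₀ : Fin k → ℝ} {l s m : ℕ}
    {g : (Fin k → ℝ) → ℝ} {e : ℕ → (Fin k → ℝ) → Matrix (Fin n) (Fin m) ℂ}
    {Lf : (Fin k → ℝ) → Matrix (Fin m) (Fin n) ℂ} {M : Matrix (Fin m) (Fin m) ℂ} {α : ℝ}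
    (h : Chain E τ₀ x₀ η₀ l s m g e Lf M α) : α ≠ 0 := by
  rw [h.coeff]
  have h1 := h.order.self_of_nhds.2
  rw [h.base] at h1
  exact div_ne_zero h1 (by positivity)

namespace Endstate

variable {n k : ℕ} {E : Endstate n k} {x₀ : ℝ} {η₀ : Fin k → ℝ} {l m : ℕ}
  {e : (Fin (k + 1) → ℝ) → Matrix (Fin n) (Fin m) ℂ}

theorem exists_chain (hE : E.Admissible) (hξ : vecCons x₀ η₀ ≠ 0) (hm : 0 < m)
    (he : MSmooth ω e (vecCons x₀ η₀)) (ha : ContDiffAt ℝ ω (E.a l) (vecCons x₀ η₀))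
    (hev : ∀ᶠ ξ in 𝓝 (vecCons x₀ η₀),
      cx (E.firstOrder ξ) * e ξ = (-(E.a l ξ : ℂ)) • e ξ ∧ (∀ w, e ξ *ᵥ w = 0 → w = 0) ∧
      (∀ x, cx (E.firstOrder ξ) *ᵥ x = (-(E.a l ξ : ℂ)) • x → ∃ w, x = e ξ *ᵥ w))
    {M : Matrix (Fin m) (Fin m) ℂ} {Y : Matrix (Fin n) (Fin m) ℂ}
    (hM : cx E.A0⁻¹ * cx (E.secondOrder (vecCons x₀ η₀)) * e (vecCons x₀ η₀) =
        -(e (vecCons x₀ η₀) * M) + (cx (E.firstOrder (vecCons x₀ η₀)) + (E.a l (vecCons x₀ η₀) : ℂ) • 1) * Y)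
    {s : ℕ} (hs : 1 ≤ s) {g : (Fin k → ℝ) → ℝ} (hg : ContDiffAt ℝ ω g η₀) (hg0 : g η₀ = x₀)
    (ho : ∀ᶠ η in 𝓝 η₀, E.RootOrder l s (g η) η) :
    ∃ e' Lf α, Chain E (E.a l (vecCons x₀ η₀)) x₀ η₀ l s m g e' Lf M α := by
  have hA0 : E.A0.det ≠ 0 := hE.A0_posDef.det_pos.ne'
  obtain ⟨S, hS, -⟩ := hE.dissipative
  subst hg0
  have hcurve : ContDiffAt ℝ ω (fun η => vecCons (g η) η) η₀ :=
    ContDiffAt.comp η₀ (g := fun q : ℝ × (Fin k → ℝ) => vecCons q.1 q.2) (f := fun η => (g η, η))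
      contDiff_vecCons.contDiffAt (hg.prodMk contDiffAt_id)
  have hes : ∀ᶠ ξ in 𝓝 (vecCons (g η₀) η₀), MSmooth ω e ξ := by
    simp only [MSmooth, eventually_all]
    exact fun i j => (he i j).eventually (by simp)
  have has : ∀ᶠ ξ in 𝓝 (vecCons (g η₀) η₀), ContDiffAt ℝ ω (E.a l) ξ := ha.eventually (by simp)
  let e' : ℕ → (Fin k → ℝ) → Matrix (Fin n) (Fin m) ℂ := fun j η =>
    taylorCoeff (fun y => e (vecCons y η)) (g η) j
  let θ : (Fin k → ℝ) → (Fin (k + 1) → ℝ) := fun η => (len (vecCons (g η) η))⁻¹ • vecCons (g η) η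
  let Lf : (Fin k → ℝ) → Matrix (Fin m) (Fin n) ℂ := fun η =>
    (e (vecCons (g η) η))ᴴ * S (θ η) * cx E.A0⁻¹
  have hAi : cx E.A0⁻¹ * cx E.A0 = 1 := by
    rw [← cx_mul, nonsing_inv_mul _ (isUnit_iff_ne_zero.2 hA0), cx_one]
  have hLA0 : ∀ η, Lf η * cx E.A0 = (e (vecCons (g η) η))ᴴ * S (θ η) := fun η => by
    rw [Matrix.mul_assoc, hAi, Matrix.mul_one]
  have hch : ∀ᶠ η in 𝓝 η₀,
      E.charMat (E.a l (vecCons (g η) η)) (g η) η * e' 0 η = 0 ∧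
      (∀ j, j + 1 < s → E.charMat (E.a l (vecCons (g η) η)) (g η) η * e' (j + 1) η =
        -(cx (E.A 0) * e' j η)) ∧
      (∀ j, j + 1 = s → E.charMat (E.a l (vecCons (g η) η)) (g η) η * e' (j + 1) η =
        -(cx (E.A 0) * e' j η) - ((E.dA l s (g η) η : ℂ) / s.factorial) •
          (cx E.A0 * e' 0 η)) := by
    filter_upwards [hcurve.continuousAt.eventually hes, hcurve.continuousAt.eventually has,
      hcurve.continuousAt.eventually hev.eventually_nhds, ho] with η h1 h2 h3 h4
    exact chain_of_flat hA0 h1 h2 (h3.mono fun ξ h => h.1) h4.1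
  have hne : ∀ᶠ η in 𝓝 η₀, vecCons (g η) η ≠ 0 := hcurve.continuousAt.eventually_ne hξ
  have hleft : ∀ᶠ η in 𝓝 η₀, Lf η * E.charMat (E.a l (vecCons (g η) η)) (g η) η = 0 := by
    filter_upwards [hcurve.continuousAt.eventually hev, hne] with η h1 h2
    rw [E.charMat_eq hA0, ← Matrix.mul_assoc, hLA0, Matrix.mul_add, hS.left_eigen h2 h1.1,
      Matrix.mul_smul, Matrix.mul_one, neg_smul, neg_add_cancel]
  have hθc : ContinuousAt θ η₀ := by
    have h1 : ContinuousAt (fun η => len (vecCons (g η) η)) η₀ := by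
      refine Real.continuous_sqrt.continuousAt.comp ?_
      have : ContinuousAt (fun ξ : Fin (k + 1) → ℝ => ∑ i, ξ i ^ 2) (vecCons (g η₀) η₀) :=
        (continuous_finsetSum _ fun i _ => (continuous_apply i).pow 2).continuousAt
      exact ContinuousAt.comp (g := fun ξ : Fin (k + 1) → ℝ => ∑ i, ξ i ^ 2)
        (f := fun η => vecCons (g η) η) this
        hcurve.continuousAt
    exact (h1.inv₀ (len_pos hξ).ne').smul hcurve.continuousAt
  have hθ0 : θ η₀ ≠ 0 := smul_ne_zero (inv_ne_zero (len_pos hξ).ne') hξ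
  have hSc : ContinuousAt (fun η => S (θ η)) η₀ := by
    refine continuousAt_matrix.2 fun i j => ?_
    have h1 : ContinuousAt (fun ξ => S ξ i j) (θ η₀) :=
      ((hS.smooth i j).continuousOn).continuousAt (isOpen_ne.mem_nhds hθ0)
    exact ContinuousAt.comp (g := fun ξ => S ξ i j) (f := θ) h1 hθc
  have hec : ContinuousAt (fun η => e (vecCons (g η) η)) η₀ := (MSmooth.comp (g := fun η => vecCons (g η) η) he hcurve).continuousAt
  have hmul : ∀ {p q r : ℕ} {f₁ : (Fin k → ℝ) → Matrix (Fin p) (Fin q) ℂ}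
      {f₂ : (Fin k → ℝ) → Matrix (Fin q) (Fin r) ℂ}, ContinuousAt f₁ η₀ → ContinuousAt f₂ η₀ →
      ContinuousAt (fun η => f₁ η * f₂ η) η₀ := by
    intro p q r f₁ f₂ h1 h2
    rw [continuousAt_matrix] at *
    intro i j
    simp only [Matrix.mul_apply]
    exact tendsto_finsetSum _ fun c _ => (h1 i c).mul (h2 c j)
  have hcs : ContinuousAt (fun η => (e (vecCons (g η) η))ᴴ) η₀ := by
    rw [continuousAt_matrix] at hec ⊢
    exact fun i j => (hec j i).star
  obtain ⟨c0, c1, c2⟩ := hch.self_of_nhds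
  obtain ⟨hE1, hE2, hE3⟩ := hev.self_of_nhds
  have hl0 := hleft.self_of_nhds
  have he0 : e' 0 η₀ = e (vecCons (g η₀) η₀) := taylorCoeff_zero _ _
  refine ⟨e', Lf, E.dA l s (g η₀) η₀ / s.factorial, hm, hs, hg, rfl, ha, rfl, ho, rfl, ?_,
    hch.mono fun η h => ⟨h.1, h.2.1⟩, ?_, ?_, ?_, hmul (hmul hcs hSc) continuousAt_const, hleft, ?_, ?_, ?_, ?_⟩
  · intro j i b
    have h1 : ContDiffAt ℝ ω (fun q : ℝ × (Fin k → ℝ) => e (vecCons q.1 q.2) i b) (g η₀, η₀) :=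
      ContDiffAt.comp (g η₀, η₀) (g := fun ξ => e ξ i b) (f := fun q : ℝ × (Fin k → ℝ) => vecCons q.1 q.2)
        (he i b) contDiff_vecCons.contDiffAt
    have h2 := contDiffAt_iteratedDeriv_partial h1 j
    have h3 : ContDiffAt ℝ ω (fun η => (g η, η)) η₀ := hg.prodMk contDiffAt_id
    have h4 := ContDiffAt.comp η₀ (g := fun q : ℝ × (Fin k → ℝ) =>
      iteratedDeriv j (fun y => e (vecCons y q.2) i b) q.1) (f := fun η => (g η, η)) h2 h3
    exact contDiffAt_const.mul h4
  · rw [he0]; exact hE2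
  · intro x hx
    rw [he0]
    exact hE3 x ((E.charMat_mulVec_eq_zero_iff hA0).1 hx)
  · have hc : ContinuousAt (fun q : ℝ × (Fin k → ℝ) => vecCons q.1 q.2) (g η₀, η₀) :=
      contDiff_vecCons.continuous.continuousAt
    filter_upwards [hc.eventually hev] with q hq
    exact ⟨e (vecCons q.1 q.2), hq.2.1, (E.charMat_mul_eq_zero_iff hA0).2 hq.1⟩
  · intro j hj
    have h1 := c1 j hj
    have h2 := congrArg (fun Z => Lf η₀ * Z) h1
    simp only [← Matrix.mul_assoc, hl0, Matrix.zero_mul, Matrix.mul_neg] at h2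
    rw [eq_comm, neg_eq_zero] at h2
    exact h2
  · have h1 := c2 (s - 1) (by omega)
    have h2 := congrArg (fun Z => Lf η₀ * Z) h1
    simp only [← Matrix.mul_assoc, hl0, Matrix.zero_mul, Matrix.mul_neg, Matrix.mul_sub, Matrix.mul_smul] at h2
    push_cast
    rw [eq_comm, sub_eq_zero] at h2
    rw [← h2, neg_neg]
  · have h1 := hS.gram_posDef hξ hE2
    have h2 := (isUnit_iff_isUnit_det _).1 h1.isUnit
    have h3 : Lf η₀ * cx E.A0 * e' 0 η₀ = (e (vecCons (g η₀) η₀))ᴴ * S (θ η₀) * e (vecCons (g η₀) η₀) := by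
      rw [hLA0, he0]
    rw [h3]
    exact h2.ne_zero
  · have h1 := hS.compression hξ hE1 hM
    rw [hLA0, he0]
    rw [← h1]
    simp only [Lf, θ, Matrix.mul_assoc]

end Endstate


/-! ### The slow blocks -/

section Symbols

variable {n k : ℕ} (E : Endstate n k)

theorem sgn_mul_self (b : Bool) : sgn b * sgn b = 1 := by cases b <;> simp [sgn]

theorem sgn_mul_self_cx (b : Bool) : (sgn b : ℂ) * (sgn b : ℂ) = 1 := by
  exact_mod_cast sgn_mul_self b

theorem contDiff_lam : ContDiff ℝ ω (fun p : Pt k => lam p.2) := by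
  have h1 : ContDiff ℝ ω (fun p : Pt k => (p.2.2.1 : ℂ)) :=
    ofRealCLM.contDiff.comp (contDiff_fst.comp (contDiff_snd.comp contDiff_snd))
  have h2 : ContDiff ℝ ω (fun p : Pt k => (p.2.1 : ℂ)) :=
    ofRealCLM.contDiff.comp (contDiff_fst.comp contDiff_snd)
  exact h1.add (contDiff_const.mul h2)

theorem contDiff_eta (j : Fin k) : ContDiff ℝ ω (fun p : Pt k => (p.2.2.2 j : ℂ)) :=
  ofRealCLM.contDiff.comp ((contDiff_apply ℝ ℝ j).comp (contDiff_snd.comp (contDiff_snd.comp contDiff_snd)))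

theorem contDiff_rho : ContDiff ℝ ω (fun p : Pt k => (p.1 : ℂ)) :=
  ofRealCLM.contDiff.comp contDiff_fst

variable {N : ℕ∞ω} (p : Pt k)

theorem mSmooth_A2 : MSmooth N (fun p : Pt k => cx (E.symA2 p.2.2.2)) p := by
  simp only [Endstate.symA2, cx_sum, cx_smul]
  exact MSmooth.sum _ fun j _ =>
    MSmooth.smul ((contDiff_eta j).contDiffAt.of_le le_top) (MSmooth.const _)

theorem mSmooth_B12 : MSmooth N (fun p : Pt k => cx (E.symB12 p.2.2.2)) p := by
  simp only [Endstate.symB12, cx_sum, cx_smul]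
  exact MSmooth.sum _ fun j _ =>
    MSmooth.smul ((contDiff_eta j).contDiffAt.of_le le_top) (MSmooth.const _)

theorem mSmooth_C2 : MSmooth N (fun p : Pt k => cx (E.symC2 p.2.2.2)) p := by
  simp only [Endstate.symC2, cx_sum, cx_smul]
  exact MSmooth.sum _ fun j _ =>
    MSmooth.smul ((contDiff_eta j).contDiffAt.of_le le_top) (MSmooth.const _)

theorem mSmooth_B22 : MSmooth N (fun p : Pt k => cx (E.symB22 p.2.2.2)) p := by
  simp only [Endstate.symB22, cx_sum, cx_smul, ofReal_mul]
  exact MSmooth.sum _ fun i _ => MSmooth.sum _ fun j _ =>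
    MSmooth.smul (((contDiff_eta i).mul (contDiff_eta j)).contDiffAt.of_le le_top) (MSmooth.const _)

/-- The part `λ A⁰ + i A₂(η)` of first order. -/
noncomputable def lead (ζ : Freq k) : Matrix (Fin n) (Fin n) ℂ :=
  lam ζ • cx E.A0 + I • cx (E.symA2 ζ.2.2)

/-- The part `λ² 𝒜 - i λ C₂(η) + B₂₂(η)` of second order. -/
noncomputable def quad (ζ : Freq k) : Matrix (Fin n) (Fin n) ℂ :=
  (lam ζ) ^ 2 • cx E.Acal - (I * lam ζ) • cx (E.symC2 ζ.2.2) + cx (E.symB22 ζ.2.2)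

/-- The part `i B₁₂(η) + λ C¹`. -/
noncomputable def cross (ζ : Freq k) : Matrix (Fin n) (Fin n) ℂ :=
  I • cx (E.symB12 ζ.2.2) + lam ζ • cx (E.C 0)

theorem mSmooth_lead : MSmooth N (fun p : Pt k => lead E p.2) p :=
  (MSmooth.smul (contDiff_lam.contDiffAt.of_le le_top) (MSmooth.const _)).add
    (MSmooth.smul contDiffAt_const (mSmooth_A2 E p))

theorem mSmooth_quad : MSmooth N (fun p : Pt k => quad E p.2) p :=
  ((MSmooth.smul ((contDiff_lam.pow 2).contDiffAt.of_le le_top) (MSmooth.const _)).sub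
    (MSmooth.smul ((contDiff_const.mul contDiff_lam).contDiffAt.of_le le_top) (mSmooth_C2 E p))).add
    (mSmooth_B22 E p)

theorem mSmooth_cross : MSmooth N (fun p : Pt k => cross E p.2) p :=
  (MSmooth.smul contDiffAt_const (mSmooth_B12 E p)).add
    (MSmooth.smul (contDiff_lam.contDiffAt.of_le le_top) (MSmooth.const _))

variable {ι : Type*} [Fintype ι]

/-- The second order remainder in the equation of the slow modes. -/
noncomputable def rest (ζ : Freq k) (u : Matrix (Fin n) ι ℂ) (q : Matrix ι ι ℂ) :
    Matrix (Fin n) ι ℂ :=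
  quad E ζ * u - cross E ζ * u * q - cx (E.B 0 0) * u * (q * q)

/-- The equation of the slow modes. -/
noncomputable def slowEq (p : Pt k) (u : Matrix (Fin n) ι ℂ) (q : Matrix ι ι ℂ) :
    Matrix (Fin n) ι ℂ :=
  lead E p.2 * u + cx (E.A 0) * u * q + (p.1 : ℂ) • rest E p.2 u q

variable {E p}

theorem mSmooth_rest {u : Pt k → Matrix (Fin n) ι ℂ} {q : Pt k → Matrix ι ι ℂ}
    (hu : MSmooth N u p) (hq : MSmooth N q p) : MSmooth N (fun p => rest E p.2 (u p) (q p)) p :=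
  (((mSmooth_quad E p).mul hu).sub (((mSmooth_cross E p).mul hu).mul hq)).sub
    (((MSmooth.const _).mul hu).mul (hq.mul hq))

theorem mSmooth_slowEq {u : Pt k → Matrix (Fin n) ι ℂ} {q : Pt k → Matrix ι ι ℂ}
    (hu : MSmooth N u p) (hq : MSmooth N q p) : MSmooth N (fun p => slowEq E p (u p) (q p)) p :=
  (((mSmooth_lead E p).mul hu).add (((MSmooth.const _).mul hu).mul hq)).add
    (MSmooth.smul (contDiff_rho.contDiffAt.of_le le_top) (mSmooth_rest hu hq))

variable (E) in
theorem lead_smul (r : ℝ) (ζ : Freq k) : lead E (r • ζ) = (r : ℂ) • lead E ζ := by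
  have h : lam (r • ζ) = (r : ℂ) * lam ζ := by simp [lam]; ring
  have h2 : cx (E.symA2 (r • ζ).2.2) = (r : ℂ) • cx (E.symA2 ζ.2.2) := by
    rw [← cx_smul]; simp [Endstate.symA2, smul_sum, mul_smul]
  rw [lead, lead, h, h2]
  module

variable (E) in
theorem quad_smul (r : ℝ) (ζ : Freq k) : quad E (r • ζ) = ((r : ℂ) ^ 2) • quad E ζ := by
  have h : lam (r • ζ) = (r : ℂ) * lam ζ := by simp [lam]; ring
  have h2 : cx (E.symC2 (r • ζ).2.2) = (r : ℂ) • cx (E.symC2 ζ.2.2) := by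
    rw [← cx_smul]; simp [Endstate.symC2, smul_sum, mul_smul]
  have h3 : cx (E.symB22 (r • ζ).2.2) = ((r : ℂ) ^ 2) • cx (E.symB22 ζ.2.2) := by
    rw [← ofReal_pow, ← cx_smul]
    simp only [Endstate.symB22, Prod.smul_snd, Pi.smul_apply, smul_eq_mul, smul_sum, smul_smul]
    congr 1
    refine sum_congr rfl fun i _ => sum_congr rfl fun j _ => ?_
    congr 1; ring
  rw [quad, quad, h, h2, h3, smul_add, smul_sub, smul_smul, smul_smul, smul_smul]
  congr 3
  · ring
  · ring

variable (E) in
theorem cross_smul (r : ℝ) (ζ : Freq k) : cross E (r • ζ) = (r : ℂ) • cross E ζ := by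
  have h : lam (r • ζ) = (r : ℂ) * lam ζ := by simp [lam]; ring
  have h2 : cx (E.symB12 (r • ζ).2.2) = (r : ℂ) • cx (E.symB12 ζ.2.2) := by
    rw [← cx_smul]; simp [Endstate.symB12, smul_sum, mul_smul]
  rw [cross, cross, h, h2]
  module

variable (E) in
theorem Gmat_smul (r : ℝ) (ζ : Freq k) : Gmat E (r • ζ) = fromBlocks 0 (cx (E.B 0 0))⁻¹
    ((r : ℂ) • lead E ζ + ((r : ℂ) ^ 2) • quad E ζ)
    (-(((r : ℂ) • cross E ζ - cx (E.A 0)) * (cx (E.B 0 0))⁻¹)) := by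
  rw [← lead_smul, ← quad_smul, ← cross_smul, Gmat, lead, quad, cross]
  congr 1
  abel

theorem slowEq_mul {κ : Type*} [Fintype κ] {u : Matrix (Fin n) ι ℂ} {q : Matrix ι ι ℂ}
    {J : Matrix ι κ ℂ} {q' : Matrix κ κ ℂ} (h : q * J = J * q') :
    slowEq E p u q * J = slowEq E p (u * J) q' := by
  have h3 : q * (J * q') = J * (q' * q') := by rw [← Matrix.mul_assoc, h, Matrix.mul_assoc]
  simp only [slowEq, rest, Matrix.add_mul, Matrix.sub_mul, smul_mul, Matrix.mul_assoc, h3, h]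

end Symbols

namespace BlockDecomposition

variable {n k : ℕ} {E : Bool → Endstate n k} {c : ℝ} {ζ₀ : Freq k} (D : BlockDecomposition E c ζ₀)

/-- The index type of the slow columns. -/
abbrev Slow : Type :=
  (Fin D.ep ⊕ Fin D.em) ⊕
    ((Σ j : hyperbolicModes E ζ₀, Fin (D.ν j.1)) ⊕ (Σ j : glancingModes E ζ₀, Fin (D.ν j.1)))

/-- The inclusion of the slow columns. -/
def slowCol : D.Slow → Col E ζ₀ D.kp D.km D.ep D.em D.ν
  | Sum.inl j => Sum.inl (Sum.inr j)
  | Sum.inr j => Sum.inr j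

/-- The slow block. -/
noncomputable def Qs (p : Pt k) : Matrix D.Slow D.Slow ℂ :=
  fromBlocks (fromBlocks (D.Qep p) 0 0 (D.Qem p)) 0 0
    (fromBlocks (blockDiagonal' (fun j : hyperbolicModes E ζ₀ => D.Q j.1 p)) 0 0
      (blockDiagonal' (fun j : glancingModes E ζ₀ => D.Q j.1 p)))

/-- The first components of the slow columns. -/
def slowU (b : Bool) (p : Pt k) : Matrix (Fin n) D.Slow ℂ :=
  of fun i j => D.T p (Sum.inl i, b) (D.slowCol j)

/-- The second components of the slow columns. -/
def slowV (b : Bool) (p : Pt k) : Matrix (Fin n) D.Slow ℂ :=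
  of fun i j => D.T p (Sum.inr i, b) (D.slowCol j)

variable {D} {p : Pt k}

theorem Ginf_mul (hp : p ∈ D.U ∩ SBar k c) : Ginf E p * D.T p = D.T p *
    fromBlocks
      (fromBlocks (fromBlocks (D.Pp p) 0 0 (D.Pm p)) 0 0 ((p.1 : ℂ) • fromBlocks (D.Qep p) 0 0 (D.Qem p))) 0 0
      ((p.1 : ℂ) • fromBlocks (blockDiagonal' (fun j : hyperbolicModes E ζ₀ => D.Q j.1 p)) 0 0
        (blockDiagonal' (fun j : glancingModes E ζ₀ => D.Q j.1 p))) := by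
  rw [← D.diag p hp, ← Matrix.mul_assoc, ← Matrix.mul_assoc, D.mul_inv p hp, Matrix.one_mul]

theorem Ginf_mul_slow (hp : p ∈ D.U ∩ SBar k c) :
    Ginf E p * (D.T p).submatrix id D.slowCol =
      (p.1 : ℂ) • ((D.T p).submatrix id D.slowCol * D.Qs p) := by
  ext i j
  have h := congrFun (congrFun (D.Ginf_mul hp) i) (D.slowCol j)
  refine Eq.trans ?_ (h.trans ?_)
  · simp [Matrix.mul_apply]
  · rw [Matrix.smul_apply, Matrix.mul_apply, Matrix.mul_apply, smul_eq_mul, mul_sum]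
    symm
    refine sum_of_injective D.slowCol ?_ _ _ ?_ ?_
    · rintro (a | a) (b | b) hab <;> simpa [slowCol] using hab
    · intro a ha
      have : ∃ f, a = Sum.inl (Sum.inl f) := by
        rcases a with (a | a) | a
        · exact ⟨a, rfl⟩
        · exact absurd ⟨Sum.inl a, rfl⟩ ha
        · exact absurd ⟨Sum.inr a, rfl⟩ ha
      obtain ⟨f, rfl⟩ := this
      rcases j with j | j <;> simp [slowCol]
    · intro a
      rw [mul_left_comm]
      congr 1
      rcases a with a | a <;> rcases j with j | j <;> simp [slowCol, Qs]

theorem Ginf_side (X : Matrix ((Fin n ⊕ Fin n) × Bool) D.Slow ℂ) (b : Bool) :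
    (Ginf E p * X).submatrix (fun i => (i, b)) id =
      ((sgn b : ℂ) • Gmat (E b) (p.1 • p.2)) * X.submatrix (fun i => (i, b)) id := by
  ext i j
  simp only [Matrix.mul_apply, submatrix_apply, id, Ginf, blockDiagonal_apply]
  rw [sum_prod_type]
  refine sum_congr rfl fun a _ => ?_
  rw [sum_eq_single b]
  · simp
  · intro b' _ hb
    rw [if_neg (Ne.symm hb), zero_mul]
  · simp

theorem smul_fromRows {ι κ μ : Type*} (z : ℂ) (A : Matrix ι μ ℂ) (B : Matrix κ μ ℂ) :
    z • fromRows A B = fromRows (z • A) (z • B) := by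
  ext (i | i) j <;> rfl

theorem slow_side (b : Bool) : ((D.T p).submatrix id D.slowCol).submatrix (fun i => (i, b)) id =
    fromRows (D.slowU b p) (D.slowV b p) := by
  ext (i | i) j <;> rfl

theorem slow_components (hp : p ∈ D.U ∩ SBar k c) (b : Bool) (hB : ((E b).B 0 0).det ≠ 0) :
    D.slowV b p = ((p.1 : ℂ) * sgn b) • (cx ((E b).B 0 0) * D.slowU b p * D.Qs p) ∧
    (p.1 : ℂ) • slowEq (E b) p (D.slowU b p) ((sgn b : ℂ) • D.Qs p) = 0 := by
  have hBu : IsUnit (cx ((E b).B 0 0)).det := isUnit_iff_ne_zero.2 (by rw [cx_det]; exact_mod_cast hB)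
  have hσ := sgn_mul_self_cx b
  have h1 := Ginf_side (p := p) ((D.T p).submatrix id D.slowCol) b
  have h0 : (((p.1 : ℂ) • ((D.T p).submatrix id D.slowCol * D.Qs p)).submatrix (fun i => (i, b)) id) =
      (p.1 : ℂ) • (((D.T p).submatrix id D.slowCol).submatrix (fun i => (i, b)) id * D.Qs p) := rfl
  rw [Ginf_mul_slow hp, Gmat_smul, h0, slow_side] at h1
  unfold slowEq rest
  generalize (sgn b : ℂ) = σ at *
  generalize (p.1 : ℂ) = ρ at *
  generalize cx ((E b).B 0 0) = B at *
  generalize D.slowU b p = U at *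
  generalize D.slowV b p = V at *
  generalize D.Qs p = Q at *
  generalize lead (E b) p.2 = A at *
  generalize quad (E b) p.2 = q₂ at *
  generalize cross (E b) p.2 = q₁ at *
  generalize cx ((E b).A 0) = A₁ at *
  rw [smul_mul, fromBlocks_mul_fromRows, fromRows_mul, smul_fromRows, smul_fromRows] at h1
  obtain ⟨htop, hbot⟩ := fromRows_inj h1
  rw [Matrix.zero_mul, zero_add] at htop
  have hV : V = (ρ * σ) • (B * U * Q) := by
    have h4 := congrArg (fun Z => σ • (B * Z)) htop
    simp only [Matrix.mul_smul, smul_smul, hσ, one_smul] at h4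
    rw [← Matrix.mul_assoc, mul_nonsing_inv_cancel_left _ _ hBu] at h4
    rw [← h4, mul_comm]
  refine ⟨hV, ?_⟩
  have h5 : B⁻¹ * V = (ρ * σ) • (U * Q) := by
    rw [hV, Matrix.mul_smul, ← Matrix.mul_assoc, ← Matrix.mul_assoc, nonsing_inv_mul _ hBu, Matrix.one_mul]
  rw [Matrix.neg_mul, Matrix.mul_assoc, h5] at hbot
  have h6 := congrArg (fun Z => σ • Z) hbot
  simp only [smul_smul, hσ, one_smul] at h6
  rw [hV, smul_mul, smul_smul] at h6
  have h7 : σ * ρ * (ρ * σ) = ρ ^ 2 := by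
    calc σ * ρ * (ρ * σ) = (σ * σ) * ρ ^ 2 := by ring
      _ = ρ ^ 2 := by rw [hσ, one_mul]
  rw [h7] at h6
  simp only [Matrix.mul_smul, smul_mul, smul_smul, hσ, one_smul, Matrix.add_mul,
    Matrix.sub_mul, Matrix.mul_assoc] at h6 ⊢
  linear_combination (norm := module) -h6

theorem mSmooth_of_mem (hp : p ∈ D.U) {ι κ : Type*} {f : Pt k → Matrix ι κ ℂ}
    (hf : ∀ i j, ContDiffOn ℝ ∞ (fun p => f p i j) D.U) : MSmooth ∞ f p :=
  fun i j => (hf i j).contDiffAt (D.isOpen_U.mem_nhds hp)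

theorem hyperbolicModes_subset (E : Bool → Endstate n k) (ζ₀ : Freq k) :
    hyperbolicModes E ζ₀ ⊆ modes E ζ₀ := by
  intro x hx
  simp only [hyperbolicModes, mem_filter] at hx
  exact hx.1

theorem glancingModes_subset (E : Bool → Endstate n k) (ζ₀ : Freq k) :
    glancingModes E ζ₀ ⊆ modes E ζ₀ := by
  intro x hx
  simp only [glancingModes, mem_filter] at hx
  exact hx.1

theorem mSmooth_blockDiagonal' {o : Type*} [DecidableEq o] {m : o → Type*} {N : ℕ∞ω}
    {f : ∀ j : o, Pt k → Matrix (m j) (m j) ℂ} (hf : ∀ j, MSmooth N (f j) p) :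
    MSmooth N (fun p => blockDiagonal' fun j => f j p) p := by
  rintro ⟨i, a⟩ ⟨j, b⟩
  by_cases h : i = j
  · subst h
    simpa [blockDiagonal'_apply_eq] using hf i a b
  · simpa [blockDiagonal'_apply_ne _ _ _ h] using contDiffAt_const

theorem mSmooth_Qs (hp : p ∈ D.U) : MSmooth ∞ D.Qs p := by
  refine MSmooth.fromBlocks (MSmooth.fromBlocks (mSmooth_of_mem hp D.smooth_Qep) (MSmooth.const 0)
    (MSmooth.const 0) (mSmooth_of_mem hp D.smooth_Qem)) (MSmooth.const 0) (MSmooth.const 0)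
    (MSmooth.fromBlocks (mSmooth_blockDiagonal' fun j => ?_) (MSmooth.const 0)
    (MSmooth.const 0) (mSmooth_blockDiagonal' fun j => ?_))
  · exact mSmooth_of_mem hp (D.smooth_Q _ (hyperbolicModes_subset E ζ₀ j.2))
  · exact mSmooth_of_mem hp (D.smooth_Q _ (glancingModes_subset E ζ₀ j.2))

theorem mSmooth_slowU (hp : p ∈ D.U) (b : Bool) : MSmooth ∞ (D.slowU b) p :=
  fun i j => mSmooth_of_mem hp D.smooth_T _ _

theorem slowEq_eq_zero (hc : 0 ≤ c) (hp : p ∈ D.U ∩ SBar k c) (b : Bool) (hB : ((E b).B 0 0).det ≠ 0) :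
    slowEq (E b) p (D.slowU b p) ((sgn b : ℂ) • D.Qs p) = 0 := by
  rcases hp.2.1.eq_or_lt with h0 | h0
  · have hγ : 0 ≤ p.2.2.1 := by
      have := hp.2.2.2
      rw [← h0] at this
      simpa [kappa] using this
    have hmem : ∀ᶠ ρ in 𝓝[>] (0 : ℝ), (ρ, p.2) ∈ D.U := by
      have hc : ContinuousAt (fun ρ : ℝ => (ρ, p.2)) 0 := by fun_prop
      have : ((0 : ℝ), p.2) ∈ D.U := by rw [h0]; exact hp.1
      exact (hc.eventually (D.isOpen_U.mem_nhds this)).filter_mono nhdsWithin_le_nhds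
    have hz : ∀ᶠ ρ in 𝓝[>] (0 : ℝ),
        slowEq (E b) (ρ, p.2) (D.slowU b (ρ, p.2)) ((sgn b : ℂ) • D.Qs (ρ, p.2)) = 0 := by
      filter_upwards [hmem, self_mem_nhdsWithin] with ρ hρ hρ0
      have hρ0 : 0 < ρ := hρ0
      have hS : ((ρ, p.2) : Pt k) ∈ SBar k c := by
        refine ⟨hρ0.le, hp.2.2.1, le_trans ?_ hγ⟩
        have : 0 ≤ kappa (√ρ * √(p.2.1 ^ 2 + ∑ j, p.2.2.2 j ^ 2)) := by unfold kappa; positivity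
        simp only
        nlinarith
      have h := (slow_components (D := D) ⟨hρ, hS⟩ b hB).2
      exact (smul_eq_zero.1 h).resolve_left (by exact_mod_cast hρ0.ne')
    have hT : Tendsto (fun ρ : ℝ => slowEq (E b) (ρ, p.2) (D.slowU b (ρ, p.2))
        ((sgn b : ℂ) • D.Qs (ρ, p.2))) (𝓝[>] (0 : ℝ))
        (𝓝 (slowEq (E b) (0, p.2) (D.slowU b (0, p.2)) ((sgn b : ℂ) • D.Qs (0, p.2)))) := by
      have hm : ((0 : ℝ), p.2) ∈ D.U := by rw [h0]; exact hp.1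
      have h1 := (mSmooth_slowEq (E := E b) (mSmooth_slowU hm b)
        (MSmooth.smul (contDiffAt_const (c := (sgn b : ℂ))) (mSmooth_Qs hm))).continuousAt
      have hcc : ContinuousAt (fun ρ : ℝ => ((ρ, p.2) : Pt k)) 0 := by fun_prop
      exact (ContinuousAt.comp (g := fun p : Pt k => slowEq (E b) p (D.slowU b p)
        ((sgn b : ℂ) • D.Qs p)) (f := fun ρ : ℝ => ((ρ, p.2) : Pt k)) h1 hcc).tendsto.mono_left
          nhdsWithin_le_nhds
    have h2 := tendsto_nhds_unique (hT.congr' hz) tendsto_const_nhds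
    rw [h0] at h2
    exact h2
  · exact (smul_eq_zero.1 (slow_components hp b hB).2).resolve_left (by exact_mod_cast h0.ne')

end BlockDecomposition


theorem ReGe.eq_zero {ι : Type*} [Fintype ι] [DecidableEq ι] {M : Matrix ι ι ℂ} {δ : ℝ}
    (h : ReGe M δ) {z : ℂ} (hz : z.re < δ) {v : ι → ℂ} (hv : M *ᵥ v = z • v) : v = 0 := by
  have h1 := reGe_iff.1 h v
  have h2 : qform M v = z * ((∑ i, ‖v i‖ ^ 2 : ℝ) : ℂ) := by
    rw [← qform_one, qform, hv, dotProduct_smul, qform, one_mulVec]; rfl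
  rw [h2, re_mul_ofReal] at h1
  have h3 : ∑ i, ‖v i‖ ^ 2 = 0 := by
    have : 0 ≤ ∑ i, ‖v i‖ ^ 2 := by positivity
    nlinarith
  ext i
  have := (Finset.sum_eq_zero_iff_of_nonneg fun i _ => sq_nonneg ‖v i‖).1 h3 i (mem_univ i)
  simpa using this

theorem ReLe.eq_zero {ι : Type*} [Fintype ι] [DecidableEq ι] {M : Matrix ι ι ℂ} {δ : ℝ}
    (h : ReLe M (-δ)) {z : ℂ} (hz : -δ < z.re) {v : ι → ℂ} (hv : M *ᵥ v = z • v) : v = 0 := by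
  rw [reLe_iff_reGe_neg, neg_neg] at h
  exact h.eq_zero (z := -z) (by simpa using neg_lt.1 hz) (by rw [neg_mulVec, hv, neg_smul])

/-- The frequencies at which the equation of the slow modes is available. -/
def Reg (k : ℕ) (c : ℝ) : Set (Pt k) := {p | p ∈ SBar k c ∨ (p.1 = 0 ∧ p.2.2.1 = 0)}

/-- A block of slow modes near `(0, ζ₀)` with the only eigenvalue `i x` at the base point. -/
structure SlowBlock {n k : ℕ} (E : Endstate n k) (c : ℝ) (ζ₀ : Freq k) (x : ℝ) {ι : Type*} [Fintype ι]
    [DecidableEq ι] (u : Pt k → Matrix (Fin n) ι ℂ) (q : Pt k → Matrix ι ι ℂ) : Prop where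
  smooth_u : MSmooth 1 u (0, ζ₀)
  smooth_q : MSmooth 1 q (0, ζ₀)
  eqn : ∀ᶠ p in 𝓝 (0, ζ₀), p ∈ Reg k c → slowEq E p (u p) (q p) = 0
  nilp : ∃ N : ℕ, (q (0, ζ₀) - (I * x) • 1) ^ N = 0
  inj : ∀ w, u (0, ζ₀) *ᵥ w = 0 → w = 0
  complete : ∀ᶠ t : (ℝ × (Fin k → ℝ)) × ℂ in 𝓝 ((ζ₀.1, ζ₀.2.2), I * x),
    ∀ (y : Fin n → ℂ) (w' : ι → ℂ),
      lead E (t.1.1, 0, t.1.2) *ᵥ y + t.2 • (cx (E.A 0) *ᵥ y) =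
        cx (E.A 0) *ᵥ (u (0, t.1.1, 0, t.1.2) *ᵥ w') →
      ∃ w, y = u (0, t.1.1, 0, t.1.2) *ᵥ w

namespace BlockDecomposition

variable {n k : ℕ} {E : Bool → Endstate n k} {c : ℝ} {ζ₀ : Freq k} {D : BlockDecomposition E c ζ₀}
  {p : Pt k}

theorem Qs_mulVec_ep (v : D.Slow → ℂ) (i : Fin D.ep) : (D.Qs p *ᵥ v) (Sum.inl (Sum.inl i)) =
    (D.Qep p *ᵥ fun a => v (Sum.inl (Sum.inl a))) i := by
  simp [Qs, mulVec, dotProduct, sum_sum_type]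

theorem Qs_mulVec_em (v : D.Slow → ℂ) (i : Fin D.em) : (D.Qs p *ᵥ v) (Sum.inl (Sum.inr i)) =
    (D.Qem p *ᵥ fun a => v (Sum.inl (Sum.inr a))) i := by
  simp [Qs, mulVec, dotProduct, sum_sum_type]

theorem blockDiagonal'_mulVec {o : Type*} [Fintype o] [DecidableEq o] {m : o → Type*}
    [∀ j, Fintype (m j)] (M : ∀ j, Matrix (m j) (m j) ℂ) (v : (Σ j, m j) → ℂ) (j : o) (b : m j) :
    (blockDiagonal' M *ᵥ v) ⟨j, b⟩ = (M j *ᵥ fun a => v ⟨j, a⟩) b := by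
  simp only [mulVec, dotProduct]
  rw [sum_sigma, sum_eq_single j]
  · simp [blockDiagonal'_apply_eq]
  · intro j' _ hj
    exact sum_eq_zero fun a _ => by rw [blockDiagonal'_apply_ne _ _ _ (Ne.symm hj), zero_mul]
  · simp

theorem Qs_mulVec_h (v : D.Slow → ℂ) (j : hyperbolicModes E ζ₀) (b : Fin (D.ν j.1)) :
    (D.Qs p *ᵥ v) (Sum.inr (Sum.inl ⟨j, b⟩)) =
      (D.Q j.1 p *ᵥ fun a => v (Sum.inr (Sum.inl ⟨j, a⟩))) b := by
  rw [← blockDiagonal'_mulVec (fun j : hyperbolicModes E ζ₀ => D.Q j.1 p) (fun i => v (Sum.inr (Sum.inl i))) j b]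
  simp [Qs, mulVec, dotProduct, sum_sum_type]

theorem Qs_mulVec_g (v : D.Slow → ℂ) (j : glancingModes E ζ₀) (b : Fin (D.ν j.1)) :
    (D.Qs p *ᵥ v) (Sum.inr (Sum.inr ⟨j, b⟩)) =
      (D.Q j.1 p *ᵥ fun a => v (Sum.inr (Sum.inr ⟨j, a⟩))) b := by
  rw [← blockDiagonal'_mulVec (fun j : glancingModes E ζ₀ => D.Q j.1 p) (fun i => v (Sum.inr (Sum.inr i))) j b]
  simp [Qs, mulVec, dotProduct, sum_sum_type]

/-- The kernel of the coefficient matrix at `ρ = 0` is spanned by the slow columns. -/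
theorem exists_slow_of_ker (hp : p ∈ D.U ∩ SBar k c) (h0 : p.1 = 0) (b : Bool) (y : Fin n → ℂ) :
    ∃ v, D.slowU b p *ᵥ v = y ∧ ∀ b', b' ≠ b → D.slowU b' p *ᵥ v = 0 := by
  let z : (Fin n ⊕ Fin n) × Bool → ℂ := fun i => if i.2 = b then Sum.elim y 0 i.1 else 0
  have hz : Ginf E p *ᵥ z = 0 := by
    ext ⟨i, b'⟩
    have h1 : (Ginf E p *ᵥ z) (i, b') =
        (((sgn b' : ℂ) • Gmat (E b') (p.1 • p.2)) *ᵥ fun a => z (a, b')) i := by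
      simp only [Ginf, mulVec, dotProduct, blockDiagonal_apply, sum_prod_type]
      refine sum_congr rfl fun a _ => ?_
      rw [sum_eq_single b']
      · simp
      · intro b'' _ hb
        rw [if_neg (Ne.symm hb), zero_mul]
      · simp
    rw [h1, Gmat_smul, h0]
    by_cases hb : b' = b
    · have : (fun a => z (a, b')) = Sum.elim y 0 := by ext a; simp [z, hb]
      rw [this, smul_mulVec, fromBlocks_mulVec]
      rcases i with i | i <;> simp [Function.comp_def, ← Pi.zero_def]
    · have : (fun a => z (a, b')) = 0 := by ext a; simp [z, hb]
      rw [this, mulVec_zero]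
      simp
  set C := D.Tinv p *ᵥ z with hC
  have hTC : D.T p *ᵥ C = z := by rw [hC, mulVec_mulVec, D.mul_inv p hp, one_mulVec]
  have hR : (D.Tinv p * Ginf E p * D.T p) *ᵥ C = 0 := by
    rw [← mulVec_mulVec, hTC, ← mulVec_mulVec, hz, mulVec_zero]
  rw [D.diag p hp] at hR
  obtain ⟨δ, hδ, hdef⟩ := D.definite
  obtain ⟨h1, h2, -, -⟩ := hdef p hp
  have hp0 : (fun a => C (Sum.inl (Sum.inl (Sum.inl a)))) = 0 := by
    refine h1.eq_zero (z := 0) (by simpa using hδ) ?_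
    ext a
    have := congrFun hR (Sum.inl (Sum.inl (Sum.inl a)))
    simpa [mulVec, dotProduct, sum_sum_type] using this
  have hm0 : (fun a => C (Sum.inl (Sum.inl (Sum.inr a)))) = 0 := by
    refine h2.eq_zero (z := 0) (by simpa using hδ) ?_
    ext a
    have := congrFun hR (Sum.inl (Sum.inl (Sum.inr a)))
    simpa [mulVec, dotProduct, sum_sum_type] using this
  have hcol : ∀ i, ∑ j, D.T p i (D.slowCol j) * C (D.slowCol j) = z i := by
    intro i
    rw [← hTC, mulVec, dotProduct]
    refine sum_of_injective D.slowCol ?_ _ _ ?_ fun _ => rfl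
    · rintro (a | a) (b | b) hab <;> simpa [slowCol] using hab
    · intro a ha
      rcases a with ((a | a) | a) | a
      · rw [show C (Sum.inl (Sum.inl (Sum.inl a))) = 0 from congrFun hp0 a, mul_zero]
      · rw [show C (Sum.inl (Sum.inl (Sum.inr a))) = 0 from congrFun hm0 a, mul_zero]
      · exact absurd ⟨Sum.inl a, rfl⟩ ha
      · exact absurd ⟨Sum.inr a, rfl⟩ ha
  refine ⟨fun j => C (D.slowCol j), ?_, fun b' hb' => ?_⟩
  · ext i
    refine (hcol (Sum.inl i, b)).trans ?_
    simp [z]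
  · ext i
    refine (hcol (Sum.inl i, b')).trans ?_
    simp [z, hb']

/-- The slow columns are independent. -/
theorem slow_injective (hE : ∀ s, (E s).Admissible) (hp : p ∈ D.U ∩ SBar k c) (h0 : p.1 = 0)
    {v : D.Slow → ℂ} (hv : ∀ b, D.slowU b p *ᵥ v = 0) : v = 0 := by
  have hV : ∀ b, D.slowV b p = 0 := fun b => by
    rw [(slow_components hp b (hE b).B11_det).1, h0]; simp
  let w : Col E ζ₀ D.kp D.km D.ep D.em D.ν → ℂ := Sum.elim (Sum.elim 0 (v ∘ Sum.inl)) (v ∘ Sum.inr)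
  have hwcol : ∀ j, w (D.slowCol j) = v j := by rintro (j | j) <;> rfl
  have hw : D.T p *ᵥ w = 0 := by
    ext ⟨i, b⟩
    have h1 : (D.T p *ᵥ w) (i, b) = ∑ j, D.T p (i, b) (D.slowCol j) * v j := by
      symm
      rw [mulVec, dotProduct]
      refine sum_of_injective D.slowCol ?_ _ _ ?_ fun j => by rw [hwcol]
      · rintro (a | a) (b | b) hab <;> simpa [slowCol] using hab
      · intro a ha
        rcases a with (a | a) | a
        · simp [w]
        · exact absurd ⟨Sum.inl a, rfl⟩ ha
        · exact absurd ⟨Sum.inr a, rfl⟩ ha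
    rw [h1]
    rcases i with i | i
    · exact congrFun (hv b) i
    · refine sum_eq_zero fun j _ => ?_
      have := congrFun (congrFun (hV b) i) j
      rw [show D.T p (Sum.inr i, b) (D.slowCol j) = 0 from this, zero_mul]
  have h2 := congrArg (fun x => D.Tinv p *ᵥ x) hw
  simp only [mulVec_mulVec, D.inv_mul p hp, one_mulVec, mulVec_zero] at h2
  ext j
  rw [← hwcol, h2]; rfl

/-- The columns of a mode among the slow columns. -/
structure ModeCols (D : BlockDecomposition E c ζ₀) (r : Bool × ℝ) (J : Fin (D.ν r) → D.Slow) :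
    Prop where
  inj : Injective J
  block : ∀ p b b', D.Qs p (J b) (J b') = D.Q r p b b'
  off : ∀ p i b, i ∉ Set.range J → D.Qs p i (J b) = 0
  not_ell : ∀ i, Sum.inl i ∉ Set.range J
  mem_h : ∀ (j : hyperbolicModes E ζ₀) (b : Fin (D.ν j.1)), j.1 = r →
    (Sum.inr (Sum.inl ⟨j, b⟩) : D.Slow) ∈ Set.range J
  not_h : ∀ (j : hyperbolicModes E ζ₀) (b : Fin (D.ν j.1)), j.1 ≠ r →
    (Sum.inr (Sum.inl ⟨j, b⟩) : D.Slow) ∉ Set.range J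
  mem_g : ∀ (j : glancingModes E ζ₀) (b : Fin (D.ν j.1)), j.1 = r →
    (Sum.inr (Sum.inr ⟨j, b⟩) : D.Slow) ∈ Set.range J
  not_g : ∀ (j : glancingModes E ζ₀) (b : Fin (D.ν j.1)), j.1 ≠ r →
    (Sum.inr (Sum.inr ⟨j, b⟩) : D.Slow) ∉ Set.range J
  support : ∀ p ∈ D.U ∩ SBar k c, ∀ b, b ≠ r.1 → ∀ i a, D.slowU b p i (J a) = 0

theorem disjoint_modes {r : Bool × ℝ} (h1 : r ∈ hyperbolicModes E ζ₀) (h2 : r ∈ glancingModes E ζ₀) :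
    False := by
  simp only [hyperbolicModes, glancingModes, mem_filter] at h1 h2
  exact h1.2 h2.2

theorem exists_modeCols {r : Bool × ℝ} (hr : r ∈ modes E ζ₀) : ∃ J, ModeCols D r J := by
  by_cases h : GlancingMode E ζ₀ r
  · have hg : r ∈ glancingModes E ζ₀ := by
      simp only [glancingModes, mem_filter]; exact ⟨hr, h⟩
    refine ⟨fun b => Sum.inr (Sum.inr ⟨⟨r, hg⟩, b⟩), ?_, ?_, ?_, ?_, ?_, ?_, ?_, ?_, ?_⟩
    · intro a b hab; simpa using hab
    · intro p b b'; simp [Qs, blockDiagonal'_apply_eq]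
    · intro p i b hi
      rcases i with i | i | ⟨j, a⟩
      · simp [Qs]
      · simp [Qs]
      · have hj : j ≠ ⟨r, hg⟩ := by
          rintro rfl; exact hi ⟨a, rfl⟩
        simpa [Qs] using blockDiagonal'_apply_ne _ _ _ hj
    · rintro i ⟨b, hb⟩; simp at hb
    · intro j b hj
      exact (disjoint_modes (hj ▸ j.2) hg).elim
    · rintro j b hj ⟨a, ha⟩; simp at ha
    · rintro ⟨j, hj'⟩ b hj
      subst hj
      exact ⟨b, rfl⟩
    · rintro j b hj ⟨a, ha⟩
      simp only [Sum.inr.injEq, Sigma.mk.injEq] at ha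
      exact hj (congrArg Subtype.val ha.1).symm
    · intro p hp b hb i a
      exact D.support_g p hp (Sum.inl i) b ⟨r, hg⟩ a hb
  · have hg : r ∈ hyperbolicModes E ζ₀ := by
      simp only [hyperbolicModes, mem_filter]; exact ⟨hr, h⟩
    refine ⟨fun b => Sum.inr (Sum.inl ⟨⟨r, hg⟩, b⟩), ?_, ?_, ?_, ?_, ?_, ?_, ?_, ?_, ?_⟩
    · intro a b hab; simpa using hab
    · intro p b b'; simp [Qs, blockDiagonal'_apply_eq]
    · intro p i b hi
      rcases i with i | ⟨j, a⟩ | i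
      · simp [Qs]
      · have hj : j ≠ ⟨r, hg⟩ := by
          rintro rfl; exact hi ⟨a, rfl⟩
        simpa [Qs] using blockDiagonal'_apply_ne _ _ _ hj
      · simp [Qs]
    · rintro i ⟨b, hb⟩; simp at hb
    · rintro ⟨j, hj'⟩ b hj
      subst hj
      exact ⟨b, rfl⟩
    · rintro j b hj ⟨a, ha⟩
      simp only [Sum.inr.injEq, Sum.inl.injEq, Sigma.mk.injEq] at ha
      exact hj (congrArg Subtype.val ha.1).symm
    · intro j b hj
      exact (disjoint_modes hg (hj ▸ j.2)).elim
    · rintro j b hj ⟨a, ha⟩; simp at ha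
    · intro p hp b hb i a
      exact D.support_h p hp (Sum.inl i) b ⟨r, hg⟩ a hb

/-- The columns of the mode in the component of its endstate. -/
def modeU (D : BlockDecomposition E c ζ₀) {r : Bool × ℝ} (J : Fin (D.ν r) → D.Slow) (p : Pt k) :
    Matrix (Fin n) (Fin (D.ν r)) ℂ := (D.slowU r.1 p).submatrix id J

theorem ModeCols.eqn {r : Bool × ℝ} {J : Fin (D.ν r) → D.Slow} (hJ : ModeCols D r J)
    (hE : ∀ s, (E s).Admissible) (hc : 0 ≤ c) (hp : p ∈ D.U ∩ SBar k c) :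
    slowEq (E r.1) p (D.modeU J p) ((sgn r.1 : ℂ) • D.Q r p) = 0 := by
  classical
  have h0 := slowEq_eq_zero (D := D) hc hp r.1 (hE r.1).B11_det
  let I : Matrix D.Slow (Fin (D.ν r)) ℂ := (1 : Matrix D.Slow D.Slow ℂ).submatrix id J
  have hUI : ∀ {m : Type} (X : Matrix m D.Slow ℂ), X * I = X.submatrix id J := by
    intro m X
    ext i b
    rw [Matrix.mul_apply, sum_eq_single (J b)]
    · have h1 : I (J b) b = 1 := by
        change (1 : Matrix D.Slow D.Slow ℂ) (J b) (J b) = 1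
        exact one_apply_eq _
      rw [h1, mul_one]; rfl
    · intro j _ hj
      simp [I, Matrix.one_apply, hj]
    · simp
  have hQ : ((sgn r.1 : ℂ) • D.Qs p) * I = I * ((sgn r.1 : ℂ) • D.Q r p) := by
    rw [smul_mul, Matrix.mul_smul, hUI]
    congr 1
    ext i b
    rw [Matrix.mul_apply]
    by_cases hi : i ∈ Set.range J
    · obtain ⟨a, rfl⟩ := hi
      simp [I, Matrix.one_apply, hJ.inj.eq_iff, hJ.block]
    · refine (hJ.off p i b hi).trans ?_
      symm
      refine sum_eq_zero fun a _ => ?_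
      have : i ≠ J a := fun h => hi ⟨a, h.symm⟩
      simp [I, Matrix.one_apply, this]
  have h1 := slowEq_mul (E := E r.1) (p := p) (u := D.slowU r.1 p) hQ
  rw [h0, Matrix.zero_mul, hUI] at h1
  exact h1.symm

theorem ModeCols.complete {r : Bool × ℝ} {J : Fin (D.ν r) → D.Slow} (hJ : ModeCols D r J)
    (hE : ∀ s, (E s).Admissible) (hc : 0 ≤ c) (hp : p ∈ D.U ∩ SBar k c) (h0 : p.1 = 0) {δ : ℝ}
    (hdef : ReGe (D.Qep p) δ ∧ ReLe (D.Qem p) (-δ)) {z : ℂ} (hz : |z.re| < δ)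
    (hdet : ∀ j ∈ modes E ζ₀, j.2 ≠ r.2 → (z • 1 - (sgn r.1 : ℂ) • D.Q j p).det ≠ 0)
    {y : Fin n → ℂ} {w' : Fin (D.ν r) → ℂ}
    (hy : lead (E r.1) p.2 *ᵥ y + z • (cx ((E r.1).A 0) *ᵥ y) =
      cx ((E r.1).A 0) *ᵥ (D.modeU J p *ᵥ w')) : ∃ w, y = D.modeU J p *ᵥ w := by
  classical
  obtain ⟨v, hv, hv'⟩ := exists_slow_of_ker hp h0 r.1 y
  have hA : ∀ b, ∀ {x : Fin n → ℂ}, cx ((E b).A 0) *ᵥ x = 0 → x = 0 := by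
    intro b x hx
    have hdetA : (cx ((E b).A 0)).det ≠ 0 := by rw [cx_det]; exact_mod_cast (hE b).A1_det
    exact mulVec_injective_of_det_ne_zero hdetA (by rw [hx, mulVec_zero])
  have hslow : ∀ b, lead (E b) p.2 *ᵥ (D.slowU b p *ᵥ v) + cx ((E b).A 0) *ᵥ (D.slowU b p *ᵥ
      ((sgn b : ℂ) • (D.Qs p *ᵥ v))) = 0 := by
    intro b
    have h1 := slowEq_eq_zero (D := D) hc hp b (hE b).B11_det
    rw [slowEq, h0, ofReal_zero, zero_smul, add_zero] at h1
    have h2 := congrArg (fun M => M *ᵥ v) h1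
    simp only [add_mulVec, zero_mulVec, ← mulVec_mulVec, smul_mulVec] at h2
    exact h2
  let I : (Fin (D.ν r) → ℂ) → D.Slow → ℂ := fun w i => ∑ b, if i = J b then w b else 0
  have hI : ∀ (X : Matrix (Fin n) D.Slow ℂ) (w : Fin (D.ν r) → ℂ),
      X *ᵥ I w = X.submatrix id J *ᵥ w := by
    intro X w
    ext i
    simp only [mulVec, dotProduct, I, mul_sum]
    rw [sum_comm]
    refine sum_congr rfl fun b _ => ?_
    rw [sum_eq_single (J b)]
    · simp
    · intro j _ hj; rw [if_neg hj, mul_zero]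
    · simp
  set d : D.Slow → ℂ := z • v - (sgn r.1 : ℂ) • (D.Qs p *ᵥ v) - I w' with hd
  have hd0 : d = 0 := by
    refine slow_injective hE hp h0 fun b => ?_
    by_cases hb : b = r.1
    · subst hb
      apply hA r.1
      have h3 := hslow r.1
      rw [hv] at h3
      rw [hd, mulVec_sub, mulVec_sub, mulVec_sub, mulVec_sub, hI, mulVec_smul, hv, mulVec_smul]
      change _ - _ - cx ((E r.1).A 0) *ᵥ (D.modeU J p *ᵥ w') = 0
      rw [← hy, eq_neg_of_add_eq_zero_left h3]
      abel
    · have h3 := hslow b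
      rw [hv' b hb, mulVec_zero, zero_add] at h3
      have h4 := hA b h3
      have h5 : D.slowU b p *ᵥ (D.Qs p *ᵥ v) = 0 := by
        simpa only [mulVec_smul, smul_smul, sgn_mul_self_cx, one_smul, smul_zero] using congrArg (fun x => (sgn b : ℂ) • x) h4
      rw [hd, mulVec_sub, mulVec_sub, mulVec_smul, mulVec_smul, hv' b hb, h5, hI]
      have h7 : (D.slowU b p).submatrix id J = 0 := by
        ext i a; exact hJ.support p hp b hb i a
      rw [h7]; simp
  have hcomp : ∀ i, i ∉ Set.range J → (D.Qs p *ᵥ v) i = ((sgn r.1 : ℂ) * z) * v i := by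
    intro i hi
    have h8 := congrFun hd0 i
    have h9 : I w' i = 0 := sum_eq_zero fun b _ => if_neg fun h => hi ⟨b, h.symm⟩
    simp only [hd, Pi.sub_apply, Pi.smul_apply, smul_eq_mul, h9, sub_zero, Pi.zero_apply] at h8
    have h10 := congrArg (fun x => (sgn r.1 : ℂ) * x) h8
    simp only [mul_sub, mul_zero, ← mul_assoc, sgn_mul_self_cx, one_mul] at h10
    exact (sub_eq_zero.1 h10).symm
  have hσ : |((sgn r.1 : ℂ) * z).re| < δ := by
    rw [re_ofReal_mul, abs_mul]
    have : |sgn r.1| = 1 := by cases r.1 <;> simp [sgn]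
    rw [this, one_mul]; exact hz
  have hep : (fun a => v (Sum.inl (Sum.inl a))) = 0 := by
    refine hdef.1.eq_zero (z := (sgn r.1 : ℂ) * z) (abs_lt.1 hσ).2 ?_
    ext a
    rw [← Qs_mulVec_ep, hcomp _ (hJ.not_ell _)]; rfl
  have hem : (fun a => v (Sum.inl (Sum.inr a))) = 0 := by
    refine hdef.2.eq_zero (z := (sgn r.1 : ℂ) * z) (abs_lt.1 hσ).1 ?_
    ext a
    rw [← Qs_mulVec_em, hcomp _ (hJ.not_ell _)]; rfl
  have hker : ∀ j ∈ modes E ζ₀, j.2 ≠ r.2 → ∀ x : Fin (D.ν j) → ℂ,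
      D.Q j p *ᵥ x = ((sgn r.1 : ℂ) * z) • x → x = 0 := by
    intro j hj hjr x hx
    refine mulVec_injective_of_det_ne_zero (hdet j hj hjr) ?_
    rw [mulVec_zero, sub_mulVec, smul_mulVec, smul_mulVec, hx, smul_smul,
      ← mul_assoc, sgn_mul_self_cx, one_mul, one_mulVec, sub_self]
  refine ⟨fun b => v (J b), ?_⟩
  rw [← hv]
  ext i
  symm
  simp only [mulVec, dotProduct]
  refine sum_of_injective J hJ.inj _ _ (fun a ha => ?_) fun b => rfl
  rcases a with (a | a) | ⟨j, a⟩ | ⟨j, a⟩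
  · rw [show v (Sum.inl (Sum.inl a)) = 0 from congrFun hep a, mul_zero]
  · rw [show v (Sum.inl (Sum.inr a)) = 0 from congrFun hem a, mul_zero]
  · have hjr : j.1 ≠ r := fun h => ha (hJ.mem_h j a h)
    by_cases h2 : j.1.2 = r.2
    · have h1 : r.1 ≠ j.1.1 := fun h => hjr (Prod.ext h.symm h2)
      rw [show D.slowU r.1 p i (Sum.inr (Sum.inl ⟨j, a⟩)) = 0 from
        D.support_h p hp (Sum.inl i) r.1 j a h1, zero_mul]
    · have := hker j.1 (hyperbolicModes_subset E ζ₀ j.2) h2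
        (fun a => v (Sum.inr (Sum.inl ⟨j, a⟩))) (by
          ext a
          rw [← Qs_mulVec_h, hcomp _ (hJ.not_h j a hjr)]; rfl)
      rw [show v (Sum.inr (Sum.inl ⟨j, a⟩)) = 0 from congrFun this a, mul_zero]
  · have hjr : j.1 ≠ r := fun h => ha (hJ.mem_g j a h)
    by_cases h2 : j.1.2 = r.2
    · have h1 : r.1 ≠ j.1.1 := fun h => hjr (Prod.ext h.symm h2)
      rw [show D.slowU r.1 p i (Sum.inr (Sum.inr ⟨j, a⟩)) = 0 from
        D.support_g p hp (Sum.inl i) r.1 j a h1, zero_mul]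
    · have := hker j.1 (glancingModes_subset E ζ₀ j.2) h2
        (fun a => v (Sum.inr (Sum.inr ⟨j, a⟩))) (by
          ext a
          rw [← Qs_mulVec_g, hcomp _ (hJ.not_g j a hjr)]; rfl)
      rw [show v (Sum.inr (Sum.inr ⟨j, a⟩)) = 0 from congrFun this a, mul_zero]

end BlockDecomposition


/-! ### Homogenization -/

section Homog

variable {k : ℕ}

/-- The euclidean length of a frequency. -/
noncomputable def nrm (ζ : Freq k) : ℝ := √(ζ.1 ^ 2 + ζ.2.1 ^ 2 + ∑ j, ζ.2.2 j ^ 2)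

/-- The homogeneous extension of the polar coordinates. -/
noncomputable def hom (p : Pt k) : Pt k := (p.1 * nrm p.2, (nrm p.2)⁻¹ • p.2)

theorem nrm_eq_one {ζ : Freq k} (h : OnSphere ζ) : nrm ζ = 1 := by
  rw [nrm, h, Real.sqrt_one]

theorem hom_eq_self {p : Pt k} (h : OnSphere p.2) : hom p = p := by
  rw [hom, nrm_eq_one h]; simp

theorem contDiffAt_nrm {p : Pt k} (h : OnSphere p.2) : ContDiffAt ℝ ω (fun p : Pt k => nrm p.2) p := by
  have h1 : ContDiff ℝ ω (fun p : Pt k => p.2.1 ^ 2 + p.2.2.1 ^ 2 + ∑ j, p.2.2.2 j ^ 2) := by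
    refine (ContDiff.add (ContDiff.pow (contDiff_fst.comp contDiff_snd) 2)
      (ContDiff.pow (contDiff_fst.comp (contDiff_snd.comp contDiff_snd)) 2)).add ?_
    exact ContDiff.sum fun j _ => ContDiff.pow ((contDiff_apply ℝ ℝ j).comp
      (contDiff_snd.comp (contDiff_snd.comp contDiff_snd))) 2
  refine ContDiffAt.comp (g := Real.sqrt) p (Real.contDiffAt_sqrt ?_) h1.contDiffAt
  rw [h]; exact one_ne_zero

theorem contDiffAt_hom {p : Pt k} (h : OnSphere p.2) : ContDiffAt ℝ ω (hom (k := k)) p := by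
  have h1 := contDiffAt_nrm h
  refine (contDiffAt_fst.mul h1).prodMk ((h1.inv ?_).smul contDiffAt_snd)
  rw [nrm_eq_one h]; exact one_ne_zero

theorem onSphere_hom {p : Pt k} (h : 0 < nrm p.2) : OnSphere (hom p).2 := by
  have h1 : nrm p.2 ^ 2 = p.2.1 ^ 2 + p.2.2.1 ^ 2 + ∑ j, p.2.2.2 j ^ 2 := sq_sqrt (by positivity)
  simp only [OnSphere, hom, Prod.smul_fst, Prod.smul_snd, smul_eq_mul, Pi.smul_apply, mul_pow, ← mul_sum, ← mul_add]
  rw [← h1, ← mul_pow, inv_mul_cancel₀ h.ne', one_pow]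

end Homog

namespace BlockDecomposition

variable {n k : ℕ} {E : Bool → Endstate n k} {c : ℝ} {ζ₀ : Freq k} {D : BlockDecomposition E c ζ₀}

theorem exists_slowBlock (D : BlockDecomposition E c ζ₀) (hE : ∀ s, (E s).Admissible) (hc : 0 < c)
    (hS : OnSphere ζ₀) (hγ : ζ₀.2.1 = 0) {r : Bool × ℝ} (hr : r ∈ modes E ζ₀) :
    ∃ (u : Pt k → Matrix (Fin n) (Fin (D.ν r)) ℂ) (q : Pt k → Matrix (Fin (D.ν r)) (Fin (D.ν r)) ℂ),
      SlowBlock (E r.1) c ζ₀ (sgn r.1 * r.2) u q ∧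
      ∀ p ∈ SBar k c, q p = (sgn r.1 : ℂ) • D.Q r p := by
  obtain ⟨J, hJ⟩ := exists_modeCols (D := D) hr
  have hhom0 : hom (0, ζ₀) = (0, ζ₀) := hom_eq_self hS
  have hSb : (0, ζ₀) ∈ SBar k c := ⟨le_rfl, hS, by simp [kappa, hγ]⟩
  have hmodeU : MSmooth 1 (D.modeU J) (0, ζ₀) :=
    ((mSmooth_slowU D.base_mem r.1).submatrix id J).of_le (by simp)
  have hQ : ∀ j ∈ modes E ζ₀, MSmooth 1 (D.Q j) (0, ζ₀) := fun j hj =>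
    (mSmooth_of_mem D.base_mem (D.smooth_Q j hj)).of_le (by simp)
  have hcomp : ∀ {ι κ : Type} {f : Pt k → Matrix ι κ ℂ}, MSmooth 1 f (0, ζ₀) →
      MSmooth 1 (fun p => f (hom p)) (0, ζ₀) := by
    intro ι κ f hf
    rw [← hhom0] at hf
    exact MSmooth.comp (g := hom) hf ((contDiffAt_hom hS).of_le le_top)
  have hnrm : ContDiffAt ℝ 1 (fun p : Pt k => (nrm p.2 : ℂ)) (0, ζ₀) :=
    (ofRealCLM.contDiff.contDiffAt).comp (0, ζ₀) ((contDiffAt_nrm hS).of_le le_top)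
  have hpos : ∀ᶠ p : Pt k in 𝓝 (0, ζ₀), 0 < nrm p.2 := by
    have h1 : 0 < nrm (0, ζ₀).2 := by rw [nrm_eq_one hS]; exact one_pos
    exact (contDiffAt_nrm hS).continuousAt.eventually_const_lt h1
  have hhomc : Tendsto hom (𝓝 (0, ζ₀)) (𝓝 (0, ζ₀)) := by
    simpa only [hhom0] using (contDiffAt_hom (p := (0, ζ₀)) hS).continuousAt.tendsto
  have hreg : ∀ p : Pt k, 0 < nrm p.2 → p.1 = 0 → p.2.2.1 = 0 → hom p ∈ SBar k c := by
    intro p h1 h2 h3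
    refine ⟨by simp [hom, h2], onSphere_hom h1, ?_⟩
    simp [hom, h2, h3, kappa]
  have hleadhom : ∀ p : Pt k, 0 < nrm p.2 → lead (E r.1) p.2 =
      (nrm p.2 : ℂ) • lead (E r.1) (hom p).2 := by
    intro p hp
    rw [← lead_smul, hom, smul_smul, mul_inv_cancel₀ hp.ne', one_smul]
  refine ⟨fun p => D.modeU J (hom p), fun p => (nrm p.2 : ℂ) • ((sgn r.1 : ℂ) • D.Q r (hom p)),
    ⟨hcomp hmodeU, MSmooth.smul hnrm (MSmooth.smul contDiffAt_const (hcomp (hQ r hr))), ?_, ?_, ?_, ?_⟩,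
    fun p hp => ?_⟩
  · filter_upwards [hpos, hhomc.eventually (D.isOpen_U.mem_nhds D.base_mem)] with p hp hU hR
    rcases hR with hR | ⟨h1, h2⟩
    · have h3 := hom_eq_self hR.2.1
      rw [h3] at hU ⊢
      rw [nrm_eq_one hR.2.1, ofReal_one, one_smul]
      exact hJ.eqn hE hc.le ⟨hU, hR⟩
    · have h3 := hJ.eqn hE hc.le ⟨hU, hreg p hp h1 h2⟩
      have h4 : (hom p).1 = 0 := by simp [hom, h1]
      rw [slowEq, h4, ofReal_zero, zero_smul, add_zero] at h3
      rw [slowEq, h1, ofReal_zero, zero_smul, add_zero, hleadhom p hp, smul_mul,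
        Matrix.mul_smul, ← smul_add, h3, smul_zero]
  · refine ⟨D.ν r, ?_⟩
    have h1 := aeval_self_charpoly (D.Q r (0, ζ₀))
    rw [D.base_spectrum r hr, map_pow, map_sub, Polynomial.aeval_X, Polynomial.aeval_C] at h1
    have h2 : ((nrm (0, ζ₀).2 : ℝ) : ℂ) • ((sgn r.1 : ℂ) • D.Q r (hom (0, ζ₀))) -
        (I * ((sgn r.1 * r.2 : ℝ) : ℂ)) • 1 =
        (sgn r.1 : ℂ) • (D.Q r (0, ζ₀) - algebraMap ℂ _ (I * (r.2 : ℂ))) := by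
      rw [nrm_eq_one hS, hhom0, ofReal_one, one_smul, smul_sub, Algebra.algebraMap_eq_smul_one, smul_smul]
      congr 2
      push_cast; ring
    rw [h2, smul_pow, h1, smul_zero]
  · intro w hw
    rw [hhom0] at hw
    let v : D.Slow → ℂ := fun i => ∑ b, if i = J b then w b else 0
    have hv : v = 0 := by
      refine slow_injective hE ⟨D.base_mem, hSb⟩ rfl fun b => ?_
      have h1 : D.slowU b (0, ζ₀) *ᵥ v = (D.slowU b (0, ζ₀)).submatrix id J *ᵥ w := by
        ext i
        simp only [mulVec, dotProduct, v, mul_sum]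
        rw [sum_comm]
        refine sum_congr rfl fun b _ => ?_
        rw [sum_eq_single (J b)]
        · simp
        · intro j _ hj; rw [if_neg hj, mul_zero]
        · simp
      rw [h1]
      by_cases hb : b = r.1
      · rw [hb]; exact hw
      · have h7 : (D.slowU b (0, ζ₀)).submatrix id J = 0 := by
          ext i a; exact hJ.support _ ⟨D.base_mem, hSb⟩ b hb i a
        rw [h7, zero_mulVec]
    ext b
    have h2 := congrFun hv (J b)
    have h3 : v (J b) = w b := by
      simp only [v]
      rw [sum_eq_single b]
      · simp
      · intro b' _ hb'
        exact if_neg fun h => hb' (hJ.inj h).symm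
      · simp
    rw [← h3, h2]; rfl
  · obtain ⟨δ, hδ, hdef⟩ := D.definite
    have hcond : ∀ᶠ a : Pt k × ℂ in 𝓝 ((0, ζ₀), I * ((sgn r.1 * r.2 : ℝ) : ℂ)),
        a.1 ∈ D.U ∧ |a.2.re| < δ ∧ ∀ j ∈ modes E ζ₀, j.2 ≠ r.2 →
          (a.2 • 1 - (sgn r.1 : ℂ) • D.Q j a.1).det ≠ 0 := by
      refine ((continuous_fst.continuousAt.eventually (D.isOpen_U.mem_nhds D.base_mem)).and
        (Filter.Eventually.and ?_ ?_))
      · have hcc : ContinuousAt (fun a : Pt k × ℂ => |a.2.re|)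
            ((0, ζ₀), I * ((sgn r.1 * r.2 : ℝ) : ℂ)) := by fun_prop
        refine hcc.eventually_lt_const ?_
        simpa using hδ
      · rw [eventually_all_finset]
        intro j hj
        by_cases hjr : j.2 = r.2
        · exact Eventually.of_forall fun a h => absurd hjr h
        · have h1 : MSmooth 1 (fun a : Pt k × ℂ => a.2 • (1 : Matrix (Fin (D.ν j)) (Fin (D.ν j)) ℂ) -
              (sgn r.1 : ℂ) • D.Q j a.1) ((0, ζ₀), I * ((sgn r.1 * r.2 : ℝ) : ℂ)) :=
            (MSmooth.smul contDiffAt_snd (MSmooth.const _)).sub (MSmooth.smul contDiffAt_const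
              (MSmooth.comp (g := Prod.fst) (hQ j hj) contDiffAt_fst))
          refine (h1.det.continuousAt.eventually_ne ?_).mono fun a h _ => h
          have h2 : (I * ((sgn r.1 * r.2 : ℝ) : ℂ)) • (1 : Matrix (Fin (D.ν j)) (Fin (D.ν j)) ℂ) -
              (sgn r.1 : ℂ) • D.Q j (0, ζ₀) =
              (sgn r.1 : ℂ) • (scalar _ (I * (r.2 : ℂ)) - D.Q j (0, ζ₀)) := by
            rw [smul_sub, scalar_apply, ← smul_one_eq_diagonal, smul_smul]
            congr 2
            push_cast; ring
          simp only
          rw [h2, det_smul, ← eval_charpoly, D.base_spectrum j hj, Polynomial.eval_pow,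
            Polynomial.eval_sub, eval_X, eval_C, ← mul_sub]
          refine mul_ne_zero (pow_ne_zero _ ?_) (pow_ne_zero _ (mul_ne_zero I_ne_zero ?_))
          · intro h
            have := sgn_mul_self_cx r.1
            rw [h, mul_zero] at this
            exact zero_ne_one this
          · rw [sub_ne_zero]
            intro h; exact hjr (by exact_mod_cast h.symm)
    have hbase : ((0 : ℝ), ζ₀.1, (0 : ℝ), ζ₀.2.2) = (0, ζ₀) := by
      rw [← hγ]
    have hpc : ContinuousAt (fun t : (ℝ × (Fin k → ℝ)) × ℂ => (((0 : ℝ), t.1.1, (0 : ℝ), t.1.2) : Pt k))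
        ((ζ₀.1, ζ₀.2.2), I * ((sgn r.1 * r.2 : ℝ) : ℂ)) := by fun_prop
    have hpt : Tendsto (fun t : (ℝ × (Fin k → ℝ)) × ℂ => (((0 : ℝ), t.1.1, (0 : ℝ), t.1.2) : Pt k))
        (𝓝 ((ζ₀.1, ζ₀.2.2), I * ((sgn r.1 * r.2 : ℝ) : ℂ))) (𝓝 (0, ζ₀)) := by
      have := hpc.tendsto
      simp only [hbase] at this
      exact this
    have hn1 : Tendsto (fun p : Pt k => (nrm p.2 : ℂ)) (𝓝 (0, ζ₀)) (𝓝 1) := by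
      have := hnrm.continuousAt.tendsto
      simpa [nrm_eq_one hS] using this
    have hzt : Tendsto (fun t : (ℝ × (Fin k → ℝ)) × ℂ =>
        (((nrm ((((0 : ℝ), t.1.1, (0 : ℝ), t.1.2) : Pt k)).2 : ℝ) : ℂ))⁻¹ * t.2)
        (𝓝 ((ζ₀.1, ζ₀.2.2), I * ((sgn r.1 * r.2 : ℝ) : ℂ)))
        (𝓝 (I * ((sgn r.1 * r.2 : ℝ) : ℂ))) := by
      have h1 := ((hn1.comp hpt).inv₀ one_ne_zero).mul
        (continuous_snd.tendsto ((ζ₀.1, ζ₀.2.2), I * ((sgn r.1 * r.2 : ℝ) : ℂ)))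
      simpa using h1
    filter_upwards [((hhomc.comp hpt).prodMk_nhds hzt).eventually hcond, hpt.eventually hpos] with
      t ht hN y w' hy
    obtain ⟨hU, hz, hdet⟩ := ht
    set p : Pt k := ((0 : ℝ), t.1.1, (0 : ℝ), t.1.2) with hp
    have hN0 : (nrm p.2 : ℂ) ≠ 0 := by exact_mod_cast hN.ne'
    have hpS : hom p ∈ D.U ∩ SBar k c := ⟨hU, hreg p hN rfl rfl⟩
    refine hJ.complete hE hc.le hpS (by simp [hom, hp]) ⟨(hdef _ hpS).2.2.1, (hdef _ hpS).2.2.2⟩ hz hdet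
      (w' := (nrm p.2 : ℂ)⁻¹ • w') ?_
    change lead (E r.1) p.2 *ᵥ y + _ = _ at hy
    rw [hleadhom p hN, smul_mulVec] at hy
    have h5 := congrArg (fun x => (nrm p.2 : ℂ)⁻¹ • x) hy
    simp only [smul_add, smul_smul, inv_mul_cancel₀ hN0, one_smul] at h5
    rw [mulVec_smul, mulVec_smul]
    exact h5
  · simp only
    rw [hom_eq_self hp.2.1, nrm_eq_one hp.2.1, ofReal_one, one_smul]

end BlockDecomposition


/-! ### The normal form of a block of slow modes -/

section Aux

variable {n : ℕ} {ι κ : Type*} [Fintype ι] [DecidableEq ι] [Fintype κ]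

theorem gram_det_ne_zero {u : Matrix κ ι ℂ} (hu : ∀ w, u *ᵥ w = 0 → w = 0) : (uᴴ * u).det ≠ 0 := by
  have h : Injective u.mulVec := by
    intro v w hvw
    rw [← sub_eq_zero]
    exact hu _ (by rw [mulVec_sub, sub_eq_zero]; exact hvw)
  exact ((isUnit_iff_isUnit_det _).1 (PosDef.conjTranspose_mul_self u h).isUnit).ne_zero

/-- The left inverse `(u* u)⁻¹ u*`. -/
noncomputable def pinv (u : Matrix κ ι ℂ) : Matrix ι κ ℂ := (uᴴ * u)⁻¹ * uᴴ

theorem pinv_mul {u : Matrix κ ι ℂ} (hu : (uᴴ * u).det ≠ 0) : pinv u * u = 1 := by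
  rw [pinv, Matrix.mul_assoc, nonsing_inv_mul _ (isUnit_iff_ne_zero.2 hu)]

theorem MSmooth.pinv {X : Type*} [NormedAddCommGroup X] [NormedSpace ℝ X] {N : ℕ∞ω} {x : X}
    {u : X → Matrix κ ι ℂ} (h : MSmooth N u x) (hu : ((u x)ᴴ * u x).det ≠ 0) :
    MSmooth N (fun p => pinv (u p)) x := ((h.conjTranspose.mul h).inv hu).mul h.conjTranspose

theorem eventually_gram {X : Type*} [NormedAddCommGroup X] [NormedSpace ℝ X] {N : ℕ∞ω} {x : X}
    {u : X → Matrix κ ι ℂ} (h : MSmooth N u x) (hu : ((u x)ᴴ * u x).det ≠ 0) :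
    ∀ᶠ y in 𝓝 x, ((u y)ᴴ * u y).det ≠ 0 :=
  (h.conjTranspose.mul h).det.continuousAt.eventually_ne hu

theorem exists_equiv_of_bijective [DecidableEq κ] {V : Matrix κ ι ℂ} (h1 : ∀ w, V *ᵥ w = 0 → w = 0)
    (h2 : ∀ y, ∃ w, y = V *ᵥ w) : Nonempty (ι ≃ κ) := by
  have hb : Bijective V.mulVecLin := by
    refine ⟨?_, fun y => ?_⟩
    · rw [injective_iff_map_eq_zero]
      exact h1
    · obtain ⟨w, hw⟩ := h2 y
      exact ⟨w, hw.symm⟩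
  have := (LinearEquiv.ofBijective _ hb).finrank_eq
  rw [Module.finrank_fintype_fun_eq_card, Module.finrank_fintype_fun_eq_card] at this
  exact ⟨equivOfCardEq this⟩

theorem exists_right_factor {u : Matrix κ ι ℂ} {μ : Type*} {Y : Matrix κ μ ℂ}
    (h : ∀ b, ∃ w, (fun i => Y i b) = u *ᵥ w) : ∃ W : Matrix ι μ ℂ, Y = u * W := by
  choose w hw using h
  refine ⟨of fun i b => w b i, ?_⟩
  ext i b
  have := congrFun (hw b) i
  rw [this]; rfl

end Aux

section Cols

variable {n m s : ℕ}

/-- The matrix with the columns of `e 0, …, e (s - 1)`. -/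
def colsOf (s : ℕ) (e : ℕ → Matrix (Fin n) (Fin m) ℂ) : Matrix (Fin n) (Fin s × Fin m) ℂ :=
  of fun i j => e j.1 i j.2

/-- Complex matrices consisting of `s × s` blocks of size `m`. -/
abbrev BMat (s m : ℕ) := Matrix (Fin s × Fin m) (Fin s × Fin m) ℂ

/-- The nilpotent shift between the blocks. -/
def shiftMat (s m : ℕ) : BMat s m :=
  of fun i j => if (j.1 : ℕ) = i.1 + 1 ∧ i.2 = j.2 then 1 else 0

theorem colsOf_mulVec (e : ℕ → Matrix (Fin n) (Fin m) ℂ) (z : Fin s × Fin m → ℂ) :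
    colsOf s e *ᵥ z = ∑ j : Fin s, e j *ᵥ fun b => z (j, b) := by
  ext i
  simp only [colsOf, mulVec, dotProduct, sum_prod_type, of_apply, Finset.sum_apply]

theorem mul_colsOf {p : ℕ} (A : Matrix (Fin p) (Fin n) ℂ) (e : ℕ → Matrix (Fin n) (Fin m) ℂ) :
    A * colsOf s e = colsOf s fun j => A * e j := rfl

theorem colsOf_mul_shift (e : ℕ → Matrix (Fin n) (Fin m) ℂ) :
    colsOf s e * shiftMat s m = colsOf s fun j => if j = 0 then 0 else e (j - 1) := by
  ext i ⟨j, b⟩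
  simp only [Matrix.mul_apply, colsOf, shiftMat, of_apply, mul_ite, mul_one, mul_zero]
  by_cases hj : (j : ℕ) = 0
  · rw [if_pos hj]
    refine sum_eq_zero fun x _ => if_neg fun h => ?_
    omega
  · rw [if_neg hj, sum_eq_single ((⟨j - 1, by omega⟩ : Fin s), b)]
    · exact if_pos ⟨by simp; omega, rfl⟩
    · rintro ⟨x, y⟩ - hne
      refine if_neg fun h => hne ?_
      ext
      · simp only at h ⊢; omega
      · rw [h.2]
    · simp

theorem shift_mul_transpose_mulVec {z : Fin s × Fin m → ℂ}
    (hz : ∀ (j : Fin s) b, (j : ℕ) + 1 = s → z (j, b) = 0) :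
    shiftMat s m *ᵥ ((shiftMat s m)ᵀ *ᵥ z) = z := by
  have hT : ∀ (j : Fin s) b, ((shiftMat s m)ᵀ *ᵥ z) (j, b) =
      if h : (j : ℕ) = 0 then 0 else z (⟨j - 1, by omega⟩, b) := by
    intro j b
    simp only [mulVec, dotProduct, shiftMat, transpose_apply, of_apply, ite_mul, one_mul, zero_mul]
    split_ifs with hj
    · exact sum_eq_zero fun x _ => if_neg fun h => by omega
    · rw [sum_eq_single ((⟨j - 1, by omega⟩ : Fin s), b)]
      · exact if_pos ⟨by simp; omega, rfl⟩
      · rintro ⟨x, y⟩ - hne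
        refine if_neg fun h => hne ?_
        ext
        · simp only at h ⊢; omega
        · rw [h.2]
      · simp
  ext ⟨j, b⟩
  rw [mulVec, dotProduct]
  by_cases hj : (j : ℕ) + 1 = s
  · rw [hz j b hj]
    refine sum_eq_zero fun x _ => ?_
    rw [shiftMat, of_apply, if_neg fun h => ?_, zero_mul]
    have := x.1.2
    simp only at h
    omega
  · rw [sum_eq_single ((⟨j + 1, by omega⟩ : Fin s), b)]
    · rw [hT, shiftMat, of_apply, if_pos ⟨rfl, rfl⟩, one_mul, dif_neg (by simp)]
      congr 2
    · rintro ⟨x, y⟩ - hne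
      rw [shiftMat, of_apply, if_neg fun h => hne ?_, zero_mul]
      ext
      · simp only at h ⊢; omega
      · rw [← h.2]
    · simp

end Cols

/-- The frequency `(0, τ, 0, η)`. -/
def neutral {k : ℕ} (τ : ℝ) (η : Fin k → ℝ) : Pt k := (0, τ, 0, η)

theorem neutral_mem {k : ℕ} {c τ : ℝ} {η : Fin k → ℝ} : neutral τ η ∈ Reg k c := Or.inr ⟨rfl, rfl⟩

theorem contDiff_neutral {k : ℕ} : ContDiff ℝ ω (fun q : ℝ × (Fin k → ℝ) => neutral q.1 q.2) :=
  contDiff_const.prodMk (contDiff_fst.prodMk (contDiff_const.prodMk contDiff_snd))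

section

variable {n k : ℕ} {E : Endstate n k}

theorem slowEq_neutral {ι : Type*} [Fintype ι] (τ : ℝ) (η : Fin k → ℝ) (u : Matrix (Fin n) ι ℂ)
    (q : Matrix ι ι ℂ) : slowEq E (neutral τ η) u q =
      lead E (neutral τ η).2 * u + cx (E.A 0) * u * q := by
  simp [slowEq, neutral]

theorem lead_neutral (τ x : ℝ) (η : Fin k → ℝ) : lead E (neutral τ η).2 =
    I • E.charMat τ x η - (I * x) • cx (E.A 0) := by
  simp only [lead, neutral, lam, Endstate.charMat]
  push_cast
  module

end

/-- The normal form of a block of slow modes along a chain of generalized eigenvectors: in the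
coordinates given by `V`, the block is `i g(η) + N` with `N` equal to `i` times the nilpotent shift on
the surface `τ = a_l(g(η), η)`, `ρ = γ = 0`. -/
structure NormalForm {n k : ℕ} (E : Endstate n k) (c : ℝ) (ζ₀ : Freq k) (x₀ : ℝ) (l s m : ℕ)
    (g : (Fin k → ℝ) → ℝ) (e : ℕ → (Fin k → ℝ) → Matrix (Fin n) (Fin m) ℂ)
    {ι : Type*} [Fintype ι] [DecidableEq ι] (q : Pt k → Matrix ι ι ℂ)
    (U : Pt k → Matrix (Fin n) (Fin s × Fin m) ℂ)
    (N : Pt k → BMat s m)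
    (V : (Fin k → ℝ) → Matrix ι (Fin s × Fin m) ℂ)
    (Vi : (Fin k → ℝ) → Matrix (Fin s × Fin m) ι ℂ) : Prop where
  smooth_U : MSmooth 1 U (0, ζ₀)
  smooth_N : MSmooth 1 N (0, ζ₀)
  smooth_V : MSmooth 1 V ζ₀.2.2
  smooth_Vi : MSmooth 1 Vi ζ₀.2.2
  inv : ∀ᶠ η in 𝓝 ζ₀.2.2, V η * Vi η = 1 ∧ Vi η * V η = 1
  conj : ∀ p, N p = Vi p.2.2.2 * (q p - (I * g p.2.2.2) • 1) * V p.2.2.2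
  U_surface : ∀ᶠ η in 𝓝 ζ₀.2.2,
    U (neutral (E.a l (vecCons (g η) η)) η) = colsOf s fun j => e j η
  N_surface : ∀ᶠ η in 𝓝 ζ₀.2.2,
    N (neutral (E.a l (vecCons (g η) η)) η) = I • shiftMat s m
  eqn : ∀ᶠ p in 𝓝 (0, ζ₀), p ∈ Reg k c →
    slowEq E p (U p) (N p + (I * g p.2.2.2) • 1) = 0
  exact : ∀ᶠ t : ℝ × (Fin k → ℝ) in 𝓝 (x₀, ζ₀.2.2), ∃ W : Matrix (Fin s × Fin m) (Fin m) ℂ,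
    (∀ w, W *ᵥ w = 0 → w = 0) ∧ N (neutral (E.a l (vecCons t.1 t.2)) t.2) * W =
      (I * ((t.1 - g t.2 : ℝ) : ℂ)) • W

section

variable {n k : ℕ} {E : Endstate n k} {c : ℝ} {ζ₀ : Freq k} {x₀ : ℝ} {l s m : ℕ}
  {g : (Fin k → ℝ) → ℝ} {e : ℕ → (Fin k → ℝ) → Matrix (Fin n) (Fin m) ℂ}
  {Lf : (Fin k → ℝ) → Matrix (Fin m) (Fin n) ℂ} {M : Matrix (Fin m) (Fin m) ℂ} {α : ℝ}
  {ι : Type*} [Fintype ι] [DecidableEq ι] {u : Pt k → Matrix (Fin n) ι ℂ} {q : Pt k → Matrix ι ι ℂ}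

theorem Chain.charMat_cols (hC : Chain E ζ₀.1 x₀ ζ₀.2.2 l s m g e Lf M α) : ∀ᶠ η in 𝓝 ζ₀.2.2,
    E.charMat (E.a l (vecCons (g η) η)) (g η) η * colsOf s (fun j => e j η) =
      -(cx (E.A 0) * (colsOf s (fun j => e j η) * shiftMat s m)) := by
  filter_upwards [hC.chain] with η h
  rw [colsOf_mul_shift, mul_colsOf, mul_colsOf]
  ext i ⟨j, b⟩
  rw [Matrix.neg_apply]
  simp only [colsOf, of_apply]
  rcases Nat.eq_zero_or_pos (j : ℕ) with h0 | h0
  · rw [h0, if_pos rfl, h.1]; simp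
  · have h1 := h.2 (j - 1) (by omega)
    rw [Nat.sub_add_cancel h0] at h1
    rw [if_neg h0.ne', h1]; rfl

theorem neutral_base (hγ : ζ₀.2.1 = 0) : neutral ζ₀.1 ζ₀.2.2 = (0, ζ₀) := by simp only [neutral]; rw [← hγ]

theorem SlowBlock.eventually_neutral (hS : SlowBlock E c ζ₀ x₀ u q) (hγ : ζ₀.2.1 = 0) :
    ∀ᶠ t : ℝ × ℝ × (Fin k → ℝ) in 𝓝 (x₀, ζ₀.1, ζ₀.2.2),
    (∀ y w, E.charMat t.2.1 t.1 t.2.2 *ᵥ y = -(cx (E.A 0) *ᵥ (u (neutral t.2.1 t.2.2) *ᵥ w)) →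
      ∃ w', y = u (neutral t.2.1 t.2.2) *ᵥ w') ∧
    I • (E.charMat t.2.1 t.1 t.2.2 * u (neutral t.2.1 t.2.2)) =
      -(cx (E.A 0) * (u (neutral t.2.1 t.2.2) * (q (neutral t.2.1 t.2.2) - (I * t.1) • 1))) ∧
    pinv (u (neutral t.2.1 t.2.2)) * u (neutral t.2.1 t.2.2) = 1 := by
  have hn : Tendsto (fun t : ℝ × ℝ × (Fin k → ℝ) => neutral t.2.1 t.2.2) (𝓝 (x₀, ζ₀.1, ζ₀.2.2)) (𝓝 (0, ζ₀)) := by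
    rw [← neutral_base hγ]
    exact (contDiff_neutral.continuous.comp continuous_snd).tendsto (x₀, ζ₀.1, ζ₀.2.2)
  have hc : Tendsto (fun t : ℝ × ℝ × (Fin k → ℝ) => (t.2, I * (t.1 : ℂ))) (𝓝 (x₀, ζ₀.1, ζ₀.2.2))
      (𝓝 ((ζ₀.1, ζ₀.2.2), I * x₀)) := Continuous.tendsto (by fun_prop) (x₀, ζ₀.1, ζ₀.2.2)
  filter_upwards [hc.eventually hS.complete, hn.eventually hS.eqn,
    hn.eventually (eventually_gram hS.smooth_u (gram_det_ne_zero hS.inj))] with ⟨x, τ, η⟩ h1 h2 h3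
  have h2 := h2 neutral_mem
  rw [slowEq_neutral, lead_neutral τ x η] at h2
  refine ⟨fun y w hy => h1 y (-(I • w)) ?_, ?_, pinv_mul h3⟩
  · change lead E (neutral τ η).2 *ᵥ y + _ = _
    rw [lead_neutral τ x η, sub_mulVec, smul_mulVec, smul_mulVec, sub_add_cancel, hy, mulVec_neg, mulVec_neg,
      mulVec_smul, mulVec_smul, smul_neg]
    rfl
  · simp only [Matrix.sub_mul, Matrix.mul_sub, smul_mul, Matrix.mul_smul, Matrix.mul_one, ← Matrix.mul_assoc] at h2 ⊢
    linear_combination (norm := module) h2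

theorem exists_normalForm (hE : E.Admissible) (hγ : ζ₀.2.1 = 0) (hS : SlowBlock E c ζ₀ x₀ u q)
    (hC : Chain E ζ₀.1 x₀ ζ₀.2.2 l s m g e Lf M α) :
    ∃ U N V Vi, NormalForm E c ζ₀ x₀ l s m g e q U N V Vi := by
  have hA1u : IsUnit (cx (E.A 0)).det := isUnit_iff_ne_zero.2 (by rw [cx_det]; exact_mod_cast hE.A1_det)
  have hcancel {p} (hp : pinv (u p) * u p = 1) {μ : Type} {X Y : Matrix ι μ ℂ}
      (h : cx (E.A 0) * (u p * X) = cx (E.A 0) * (u p * Y)) : X = Y := by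
    have := congrArg (fun Z => pinv (u p) * ((cx (E.A 0))⁻¹ * Z)) h
    simpa only [nonsing_inv_mul_cancel_left _ _ hA1u, ← Matrix.mul_assoc (pinv _), hp, Matrix.one_mul] using this
  have hn := hS.eventually_neutral hγ
  let ar : (Fin k → ℝ) → ℝ := fun η => E.a l (vecCons (g η) η)
  have har0 : ar ζ₀.2.2 = ζ₀.1 := by simp only [ar, hC.base, hC.value]
  have har : ContDiffAt ℝ ω ar ζ₀.2.2 :=
    ContDiffAt.comp ζ₀.2.2 (g := E.a l) (f := fun η => vecCons (g η) η) (by rw [hC.base]; exact hC.smooth_a)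
      (ContDiffAt.comp ζ₀.2.2 (g := fun q : ℝ × (Fin k → ℝ) => vecCons q.1 q.2) (f := fun η => (g η, η))
        Endstate.contDiff_vecCons.contDiffAt (hC.smooth_g.prodMk contDiffAt_id))
  let ps : (Fin k → ℝ) → Pt k := fun η => neutral (ar η) η
  have hps0 : ps ζ₀.2.2 = (0, ζ₀) := by rw [← neutral_base hγ, ← har0]
  have hps : ContDiffAt ℝ ω ps ζ₀.2.2 :=
    ContDiffAt.comp ζ₀.2.2 (g := fun q : ℝ × (Fin k → ℝ) => neutral q.1 q.2) (f := fun η => (ar η, η))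
      contDiff_neutral.contDiffAt (har.prodMk contDiffAt_id)
  have hus : MSmooth 1 (fun η => u (ps η)) ζ₀.2.2 :=
    MSmooth.comp (g := ps) (by rw [hps0]; exact hS.smooth_u) (hps.of_le le_top)
  let Ec : (Fin k → ℝ) → Matrix (Fin n) (Fin s × Fin m) ℂ := fun η => colsOf s fun j => e j η
  have hEc : MSmooth 1 Ec ζ₀.2.2 := fun i j => (hC.smooth_e j.1 i j.2).of_le le_top
  let V : (Fin k → ℝ) → Matrix ι (Fin s × Fin m) ℂ := fun η => pinv (u (ps η)) * Ec η
  have hV : MSmooth 1 V ζ₀.2.2 :=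
    (MSmooth.pinv hus (by rw [hps0]; exact gram_det_ne_zero hS.inj)).mul hEc
  have hnη : ∀ᶠ η in 𝓝 ζ₀.2.2, _ := Tendsto.eventually (f := fun η => (g η, ar η, η)) (by
    have := hC.smooth_g.continuousAt.tendsto.prodMk_nhds (har.continuousAt.tendsto.prodMk_nhds tendsto_id)
    rwa [hC.base, har0] at this) hn
  have huV : ∀ᶠ η in 𝓝 ζ₀.2.2, u (ps η) * V η = Ec η := by
    filter_upwards [hnη, hC.chain] with η ⟨h1, _, h3⟩ h2
    have hall (b) : ∀ j < s, ∃ w, (fun i => e j η i b) = u (ps η) *ᵥ w := by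
      intro j
      induction j with
      | zero => exact fun _ => h1 _ 0 ((funext fun i => congrFun (congrFun h2.1 i) b).trans (by
          simp [funext_iff]))
      | succ j ih =>
        intro hj
        obtain ⟨w, hw⟩ := ih (by omega)
        refine h1 _ w (Eq.trans (funext fun i => congrFun (congrFun (h2.2 j hj) i) b) ?_)
        exact congrArg (fun z => -(cx (E.A 0) *ᵥ z)) hw
    obtain ⟨W, hW⟩ := exists_right_factor (Y := Ec η) fun b => hall b.2 b.1 b.1.2
    simp only [V]
    rw [hW, ← Matrix.mul_assoc (pinv _), h3, Matrix.one_mul]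
  have huV0 : u (0, ζ₀) * V ζ₀.2.2 = Ec ζ₀.2.2 := hps0 ▸ huV.self_of_nhds
  have hch := hC.charMat_cols
  have hch0 := hch.self_of_nhds
  rw [hC.base, hC.value] at hch0
  have hVinj : ∀ w, V ζ₀.2.2 *ᵥ w = 0 → w = 0 := by
    intro w hw
    have h1 : Ec ζ₀.2.2 *ᵥ w = 0 := by rw [← huV0, ← mulVec_mulVec, hw, mulVec_zero]
    have h2 := Endstate.chain_inj hE.A1_det (f := fun j => e j ζ₀.2.2) hC.chain.self_of_nhds.1
      hC.chain.self_of_nhds.2 hC.inj (fun j b => w (j, b)) ((colsOf_mulVec _ _).symm.trans h1)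
    ext ⟨j, b⟩
    exact congrFun (congrFun h2 j) b
  have hnu := hn.self_of_nhds.2.1
  simp only [neutral_base hγ] at hnu
  have hVsurj : ∀ y, ∃ w, y = V ζ₀.2.2 *ᵥ w := by
    have hs := hC.s_pos
    have hstep : ∀ w, (∃ z, (q (0, ζ₀) - (I * x₀) • 1) *ᵥ w = V ζ₀.2.2 *ᵥ z) →
        ∃ z, w = V ζ₀.2.2 *ᵥ z := by
      rintro w ⟨z, hz⟩
      have h1 : I • (E.charMat ζ₀.1 x₀ ζ₀.2.2 *ᵥ (u (0, ζ₀) *ᵥ w)) =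
          -(cx (E.A 0) *ᵥ (Ec ζ₀.2.2 *ᵥ z)) := by
        have := congrArg (fun Z => Z *ᵥ w) hnu
        simp only [smul_mulVec, neg_mulVec, ← mulVec_mulVec, hz] at this
        rw [this, ← huV0, mulVec_mulVec z (u (0, ζ₀))]
      have hL0 := hC.left.self_of_nhds
      rw [hC.base, hC.value] at hL0
      have hLE : Lf ζ₀.2.2 *ᵥ (cx (E.A 0) *ᵥ (Ec ζ₀.2.2 *ᵥ z)) = -((α : ℂ) •
          ((Lf ζ₀.2.2 * cx E.A0 * e 0 ζ₀.2.2) *ᵥ fun b => z (⟨s - 1, by omega⟩, b))) := by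
        rw [colsOf_mulVec, mulVec_mulVec, mulVec_sum, sum_eq_single (⟨s - 1, by omega⟩ : Fin s) _ (by simp)]
        · rw [mulVec_mulVec, hC.left_top, neg_mulVec, smul_mulVec]
        · intro j _ hj
          rw [mulVec_mulVec, hC.left_chain j, zero_mulVec]
          have h3 : (j : ℕ) ≠ s - 1 := fun h => hj (Fin.ext h)
          omega
      have h2 := congrArg (fun Z => Lf ζ₀.2.2 *ᵥ Z) h1
      simp only [mulVec_smul, mulVec_neg, hLE, neg_neg] at h2
      rw [mulVec_mulVec, hL0, zero_mulVec, smul_zero] at h2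
      have h4 := eq_zero_of_mulVec_eq_zero hC.gram ((smul_eq_zero.1 h2.symm).resolve_left (by exact_mod_cast hC.coeff_ne))
      have h5 : shiftMat s m *ᵥ ((shiftMat s m)ᵀ *ᵥ z) = z := by
        refine shift_mul_transpose_mulVec fun j b hj => ?_
        rw [show j = ⟨s - 1, by omega⟩ from Fin.ext (by simp; omega)]
        exact congrFun h4 b
      have h7 := congrArg (fun Z => Z *ᵥ ((shiftMat s m)ᵀ *ᵥ z)) hch0
      simp only [neg_mulVec, ← mulVec_mulVec, h5] at h7
      obtain ⟨w', hw'⟩ := hC.ker (I • (u (0, ζ₀) *ᵥ w) - Ec ζ₀.2.2 *ᵥ ((shiftMat s m)ᵀ *ᵥ z)) (by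
        rw [mulVec_sub, mulVec_smul, h1, h7, sub_neg_eq_add, neg_add_cancel])
      have h8 : e 0 ζ₀.2.2 *ᵥ w' = Ec ζ₀.2.2 *ᵥ fun j => if (j.1 : ℕ) = 0 then w' j.2 else 0 := by
        rw [colsOf_mulVec, sum_eq_single (⟨0, hs⟩ : Fin s) _ (by simp)]
        · simp
        · intro j _ hj
          simp only [show (j : ℕ) ≠ 0 from fun h => hj (Fin.ext h), if_false]
          exact mulVec_zero _
      rw [h8, sub_eq_iff_eq_add, ← mulVec_add, ← huV0, ← mulVec_smul,
        ← mulVec_mulVec, ← sub_eq_zero, ← mulVec_sub] at hw'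
      refine ⟨I⁻¹ • ((fun j => if (j.1 : ℕ) = 0 then w' j.2 else 0) + (shiftMat s m)ᵀ *ᵥ z), ?_⟩
      rw [mulVec_smul, ← sub_eq_zero.1 (hS.inj _ hw'), smul_smul, inv_mul_cancel₀ I_ne_zero, one_smul]
    obtain ⟨K, hK⟩ := hS.nilp
    have : ∀ j w, (∃ z, (q (0, ζ₀) - (I * x₀) • 1) ^ j *ᵥ w = V ζ₀.2.2 *ᵥ z) →
        ∃ z, w = V ζ₀.2.2 *ᵥ z := by
      intro j
      induction j with
      | zero => intro w hw; simpa using hw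
      | succ j ih =>
        rintro w ⟨z, hz⟩
        exact hstep w (ih _ ⟨z, by rw [mulVec_mulVec, ← pow_succ, hz]⟩)
    exact fun y => this K y ⟨0, by rw [hK]; simp⟩
  obtain ⟨σ⟩ := exists_equiv_of_bijective hVinj hVsurj
  have hVg : ((V ζ₀.2.2)ᴴ * V ζ₀.2.2).det ≠ 0 := gram_det_ne_zero hVinj
  have hinv : ∀ᶠ η in 𝓝 ζ₀.2.2, V η * pinv (V η) = 1 ∧ pinv (V η) * V η = 1 := by
    filter_upwards [eventually_gram hV hVg] with η hη
    exact ⟨(mul_eq_one_comm_of_equiv σ).1 (pinv_mul hη), pinv_mul hη⟩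
  have hη0 : ContDiffAt ℝ (1 : ℕ∞ω) (fun p : Pt k => p.2.2.2) (0, ζ₀) :=
    (contDiff_snd.snd.snd).contDiffAt
  have hVp : MSmooth 1 (fun p : Pt k => V p.2.2.2) (0, ζ₀) :=
    MSmooth.comp (f := V) (g := fun p : Pt k => p.2.2.2) hV hη0
  have hVi := hV.pinv hVg
  have hVip : MSmooth 1 (fun p : Pt k => pinv (V p.2.2.2)) (0, ζ₀) :=
    MSmooth.comp (f := fun η => pinv (V η)) (g := fun p : Pt k => p.2.2.2) hVi hη0
  have hgp : ContDiffAt ℝ (1 : ℕ∞ω) (fun p : Pt k => I * (g p.2.2.2 : ℂ)) (0, ζ₀) :=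
    contDiffAt_const.mul (ofRealCLM.contDiff.contDiffAt.comp (0, ζ₀)
      (ContDiffAt.comp (0, ζ₀) (g := g) (f := fun p : Pt k => p.2.2.2) (hC.smooth_g.of_le le_top) hη0))
  refine ⟨fun p => u p * V p.2.2.2, fun p => pinv (V p.2.2.2) * (q p - (I * g p.2.2.2) • 1) * V p.2.2.2, V,
    fun η => pinv (V η), hS.smooth_u.mul hVp, (hVip.mul (hS.smooth_q.sub
      (MSmooth.smul hgp (MSmooth.const 1)))).mul hVp, hV, hVi, hinv, fun _ => rfl, huV, ?_, ?_, ?_⟩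
  · filter_upwards [huV, hinv, hch, hnη] with η h1 h2 h3 ⟨_, h4, h5⟩
    change pinv (V η) * (q (ps η) - (I * g η) • 1) * V η = _
    rw [Matrix.mul_assoc, hcancel (X := (q (ps η) - (I * g η) • 1) * V η) (Y := V η * (I • shiftMat s m)) h5, ← Matrix.mul_assoc, h2.2, Matrix.one_mul]
    have h8 := congrArg (fun Z => Z * V η) h4
    simp only [smul_mul, Matrix.mul_assoc, Matrix.neg_mul] at h8
    rw [show u (neutral (ar η) η) * V η = _ from h1, show E.charMat (ar η) (g η) η * Ec η = _ from h3] at h8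
    rw [← Matrix.mul_assoc _ (V η), h1, Matrix.mul_smul, Matrix.mul_smul]
    exact (neg_inj.1 (h8.symm.trans (smul_neg _ _)))
  · filter_upwards [hS.eqn, (hη0.continuousAt.tendsto).eventually hinv] with p h1 h2 hp
    rw [← slowEq_mul (u := u p) (q := q p), h1 hp, Matrix.zero_mul]
    rw [Matrix.mul_add, Matrix.mul_assoc (pinv (V p.2.2.2)), ← Matrix.mul_assoc (V p.2.2.2) (pinv (V p.2.2.2)), h2.1, Matrix.one_mul, Matrix.sub_mul,
      smul_mul, Matrix.mul_smul, Matrix.one_mul, Matrix.mul_one, sub_add_cancel]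
  · have ht1 : Tendsto (fun t : ℝ × (Fin k → ℝ) => E.a l (vecCons t.1 t.2)) (𝓝 (x₀, ζ₀.2.2)) (𝓝 ζ₀.1) :=
      hC.value ▸ hC.smooth_a.continuousAt.tendsto.comp
        (Endstate.contDiff_vecCons.continuous.tendsto (x₀, ζ₀.2.2))
    have hfst : Tendsto (fun t : ℝ × (Fin k → ℝ) => t.1) (𝓝 (x₀, ζ₀.2.2)) (𝓝 x₀) :=
      continuous_fst.tendsto (x₀, ζ₀.2.2)
    have hsnd : Tendsto (fun t : ℝ × (Fin k → ℝ) => t.2) (𝓝 (x₀, ζ₀.2.2)) (𝓝 ζ₀.2.2) :=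
      continuous_snd.tendsto (x₀, ζ₀.2.2)
    filter_upwards [hC.evec, (hfst.prodMk_nhds (ht1.prodMk_nhds hsnd)).eventually hn, hsnd.eventually hinv]
      with t ⟨W, hW, hKW⟩ ⟨h2, h6, h4⟩ h5
    set τ := E.a l (vecCons t.1 t.2) with hτ
    obtain ⟨W₀, rfl⟩ : ∃ W₀ : Matrix ι (Fin m) ℂ, W = u (neutral τ t.2) * W₀ :=
      exists_right_factor fun b => h2 _ 0 ((funext fun i => congrFun (congrFun hKW i) b).trans (by simp [funext_iff]))
    have h8 : (q (neutral τ t.2) - (I * t.1) • 1) * W₀ = 0 := hcancel h4 (by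
      have h8 := congrArg (fun Z => Z * W₀) h6
      simp only [smul_mul, Matrix.mul_assoc, Matrix.neg_mul, hKW, smul_zero] at h8
      exact (neg_eq_zero.1 h8.symm).trans (by simp))
    refine ⟨pinv (V t.2) * W₀, fun w hw => hW w ?_, ?_⟩
    · have h10 := congrArg (fun Z => V t.2 *ᵥ Z) hw
      simp only [mulVec_mulVec, ← Matrix.mul_assoc, h5.1, Matrix.one_mul, mulVec_zero] at h10
      rw [← mulVec_mulVec, h10, mulVec_zero]
    · change pinv (V t.2) * (q (neutral τ t.2) - (I * g t.2) • 1) * V t.2 * (pinv (V t.2) * W₀) = _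
      rw [Matrix.sub_mul, sub_eq_zero, smul_mul, Matrix.one_mul] at h8
      rw [Matrix.mul_assoc, ← Matrix.mul_assoc (V t.2), h5.1, Matrix.one_mul, Matrix.mul_assoc,
        Matrix.sub_mul, h8, smul_mul, Matrix.one_mul, ← sub_smul, Matrix.mul_smul]
      push_cast
      rw [mul_sub]

end


/-! ### First order variation of the normal form -/

open Asymptotics

section Landau

variable {Y : Type*} {F : Filter Y} {d : Y → ℝ} {ι κ μ : Type*}

/-- The entries are `O(d)`. -/
def MBigO (F : Filter Y) (f : Y → Matrix ι κ ℂ) (d : Y → ℝ) : Prop :=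
  ∀ i j, (fun y => f y i j) =O[F] d

/-- The entries are `o(d)`. -/
def MLittleO (F : Filter Y) (f : Y → Matrix ι κ ℂ) (d : Y → ℝ) : Prop :=
  ∀ i j, (fun y => f y i j) =o[F] d

variable {f g : Y → Matrix ι κ ℂ}

theorem MLittleO.add (hf : MLittleO F f d) (hg : MLittleO F g d) :
    MLittleO F (fun y => f y + g y) d := fun i j => (hf i j).add (hg i j)

theorem MLittleO.sub (hf : MLittleO F f d) (hg : MLittleO F g d) :
    MLittleO F (fun y => f y - g y) d := fun i j => (hf i j).sub (hg i j)

theorem MLittleO.neg (hf : MLittleO F f d) : MLittleO F (fun y => -f y) d := fun i j => (hf i j).neg_left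

theorem MLittleO.congr (hf : MLittleO F f d) (h : ∀ᶠ y in F, f y = g y) : MLittleO F g d :=
  fun i j => (hf i j).congr' (h.mono fun y hy => congrFun (congrFun hy i) j) EventuallyEq.rfl

theorem tendsto_matrix_mul [Fintype κ] {A : Y → Matrix ι κ ℂ} {B : Y → Matrix κ μ ℂ} {A₀ : Matrix ι κ ℂ}
    {B₀ : Matrix κ μ ℂ} (hA : Tendsto A F (𝓝 A₀)) (hB : Tendsto B F (𝓝 B₀)) :
    Tendsto (fun y => A y * B y) F (𝓝 (A₀ * B₀)) := by
  rw [tendsto_matrix] at *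
  intro i j
  simp only [Matrix.mul_apply]
  exact tendsto_finsetSum _ fun l _ => (hA i l).mul (hB l j)

theorem tendsto_matrix_smul {a : Y → ℂ} {A : Y → Matrix ι κ ℂ} {A₀ : Matrix ι κ ℂ} {a₀ : ℂ}
    (ha : Tendsto a F (𝓝 a₀)) (hA : Tendsto A F (𝓝 A₀)) : Tendsto (fun y => a y • A y) F (𝓝 (a₀ • A₀)) := by
  rw [tendsto_matrix] at *
  exact fun i j => ha.mul (hA i j)

theorem tendsto_matrix_sub {A B : Y → Matrix ι κ ℂ} {A₀ B₀ : Matrix ι κ ℂ}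
    (hA : Tendsto A F (𝓝 A₀)) (hB : Tendsto B F (𝓝 B₀)) : Tendsto (fun y => A y - B y) F (𝓝 (A₀ - B₀)) := by
  rw [tendsto_matrix] at *
  exact fun i j => (hA i j).sub (hB i j)

theorem tendsto_matrix_add {A B : Y → Matrix ι κ ℂ} {A₀ B₀ : Matrix ι κ ℂ}
    (hA : Tendsto A F (𝓝 A₀)) (hB : Tendsto B F (𝓝 B₀)) : Tendsto (fun y => A y + B y) F (𝓝 (A₀ + B₀)) := by
  rw [tendsto_matrix] at *
  exact fun i j => (hA i j).add (hB i j)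

theorem MBigO.smul_tendsto {a : Y → ℂ} (ha : Tendsto a F (𝓝 0)) (hf : MBigO F f d) :
    MLittleO F (fun y => a y • f y) d := fun i j => by
  simpa using ((isLittleO_one_iff ℝ).2 ha).mul_isBigO (hf i j)

theorem mLittleO_smul {a : Y → ℂ} (ha : a =O[F] d) (hf : Tendsto f F (𝓝 0)) :
    MLittleO F (fun y => a y • f y) d := fun i j => by
  simpa using ha.mul_isLittleO ((isLittleO_one_iff ℝ).2 (tendsto_matrix.1 hf i j))

variable [Fintype κ] {B : Y → Matrix κ μ ℂ}

theorem MLittleO.mul_left {A₀ : Matrix ι κ ℂ} (hf : Tendsto f F (𝓝 A₀)) (hB : MLittleO F B d) :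
    MLittleO F (fun y => f y * B y) d := by
  intro i j
  simp only [Matrix.mul_apply]
  refine IsLittleO.fun_sum fun l _ => ?_
  simpa using ((tendsto_matrix.1 hf i l).isBigO_one ℝ).mul_isLittleO (hB l j)

theorem MBigO.mul_left {A₀ : Matrix ι κ ℂ} (hf : Tendsto f F (𝓝 A₀)) (hB : MBigO F B d) :
    MBigO F (fun y => f y * B y) d := by
  intro i j
  simp only [Matrix.mul_apply]
  refine IsBigO.fun_sum fun l _ => ?_
  simpa using ((tendsto_matrix.1 hf i l).isBigO_one ℝ).mul (hB l j)

theorem MBigO.mul_right {B₀ : Matrix κ μ ℂ} (hf : MBigO F f d) (hB : Tendsto B F (𝓝 B₀)) :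
    MBigO F (fun y => f y * B y) d := by
  intro i j
  simp only [Matrix.mul_apply]
  refine IsBigO.fun_sum fun l _ => ?_
  simpa using (hf i l).mul ((tendsto_matrix.1 hB l j).isBigO_one ℝ)

theorem MBigO.tendsto_mul (hf : Tendsto f F (𝓝 0)) (hB : MBigO F B d) :
    MLittleO F (fun y => f y * B y) d := by
  intro i j
  simp only [Matrix.mul_apply]
  refine IsLittleO.fun_sum fun l _ => ?_
  simpa using ((isLittleO_one_iff ℝ).2 (tendsto_matrix.1 hf i l)).mul_isBigO (hB l j)

theorem MBigO.mul_tendsto (hf : MBigO F f d) (hB : Tendsto B F (𝓝 0)) :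
    MLittleO F (fun y => f y * B y) d := by
  intro i j
  simp only [Matrix.mul_apply]
  refine IsLittleO.fun_sum fun l _ => ?_
  simpa using (hf i l).mul_isLittleO ((isLittleO_one_iff ℝ).2 (tendsto_matrix.1 hB l j))

end Landau

theorem MSmooth.isBigO_sub {X : Type*} [NormedAddCommGroup X] [NormedSpace ℝ X] {ι κ : Type*} {x : X}
    {f : X → Matrix ι κ ℂ} (hf : MSmooth 1 f x) :
    MBigO (𝓝 (x, x)) (fun q : X × X => f q.1 - f q.2) (fun q => ‖q.1 - q.2‖) := fun i j => by
  obtain ⟨f', hf'⟩ : ∃ f', HasStrictFDerivAt (fun p => f p i j) f' x :=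
    ⟨_, (hf i j).hasStrictFDerivAt (by simp)⟩
  exact hf'.isBigO_sub.norm_right

section

variable {n k : ℕ} {E : Endstate n k} {c : ℝ} {ζ₀ : Freq k} {x₀ : ℝ} {l s m : ℕ}
  {g : (Fin k → ℝ) → ℝ} {e : ℕ → (Fin k → ℝ) → Matrix (Fin n) (Fin m) ℂ}
  {Lf : (Fin k → ℝ) → Matrix (Fin m) (Fin n) ℂ} {M : Matrix (Fin m) (Fin m) ℂ} {α : ℝ}
  {ι : Type*} [Fintype ι] [DecidableEq ι] {q : Pt k → Matrix ι ι ℂ}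
  {U : Pt k → Matrix (Fin n) (Fin s × Fin m) ℂ}
  {N : Pt k → BMat s m}
  {V : (Fin k → ℝ) → Matrix ι (Fin s × Fin m) ℂ} {Vi : (Fin k → ℝ) → Matrix (Fin s × Fin m) ι ℂ}

/-- Pairs of a frequency and a second value of `τ`. -/
def pairFilter (c : ℝ) (ζ₀ : Freq k) : Filter (Pt k × ℝ) :=
  𝓝 ((0, ζ₀), ζ₀.1) ⊓ 𝓟 {t | t.1 ∈ Reg k c}

/-- The distance of `p` to the frequency with `ρ = γ = 0` and the second value of `τ`. -/
def dist₀ (t : Pt k × ℝ) : ℝ := |t.1.2.2.1| + |t.1.2.1 - t.2| + |t.1.1|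

/-- The neutral frequency belonging to a pair. -/
def shadow (t : Pt k × ℝ) : Pt k := neutral t.2 t.1.2.2.2

theorem tendsto_fst_pair : Tendsto (fun t : Pt k × ℝ => t.1) (pairFilter c ζ₀) (𝓝 (0, ζ₀)) :=
  (continuous_fst.tendsto ((0, ζ₀), ζ₀.1)).mono_left inf_le_left

theorem tendsto_shadow (hγ : ζ₀.2.1 = 0) : Tendsto shadow (pairFilter c ζ₀) (𝓝 (0, ζ₀)) := by
  have h1 : Continuous (shadow (k := k)) := by
    unfold shadow neutral; fun_prop
  have h2 := h1.tendsto ((0, ζ₀), ζ₀.1)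
  have h3 : shadow ((0, ζ₀), ζ₀.1) = (0, ζ₀) := by
    simp only [shadow, neutral]; rw [← hγ]
  rw [h3] at h2
  exact h2.mono_left inf_le_left

theorem MSmooth.isBigO_pair (hγ : ζ₀.2.1 = 0) {κ μ : Type*} {f : Pt k → Matrix κ μ ℂ}
    (hf : MSmooth 1 f (0, ζ₀)) :
    MBigO (pairFilter c ζ₀) (fun t => f t.1 - f (shadow t)) dist₀ := fun i j => by
  have h1 := (hf.isBigO_sub i j).comp_tendsto ((tendsto_fst_pair (c := c)).prodMk_nhds (tendsto_shadow hγ))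
  refine h1.trans (IsBigO.of_bound 1 (Eventually.of_forall fun t => ?_))
  have h2 : t.1 - shadow t = (t.1.1, t.1.2.1 - t.2, t.1.2.2.1, 0) := by
    simp only [shadow, neutral]
    ext <;> simp
  have h3 : 0 ≤ dist₀ t := by unfold dist₀; positivity
  simp only [Function.comp, one_mul, norm_norm, norm_of_nonneg h3, h2]
  simp only [Prod.norm_def, norm_zero, norm_eq_abs, dist₀]
  have := abs_nonneg t.1.1
  have := abs_nonneg t.1.2.2.1
  have := abs_nonneg (t.1.2.1 - t.2)
  simp only [sup_le_iff]
  refine ⟨?_, ?_, ?_, ?_⟩ <;> linarith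

/-- The column of the first block. -/
def firstCols (s m : ℕ) : Matrix (Fin s × Fin m) (Fin m) ℂ :=
  of fun j b => if (j.1 : ℕ) = 0 ∧ j.2 = b then 1 else 0

theorem mul_firstCols (hs : 0 < s) {κ : Type*} (X : Matrix κ (Fin s × Fin m) ℂ) :
    X * firstCols s m = X.submatrix id fun b => (⟨0, hs⟩, b) := by
  ext i b
  rw [Matrix.mul_apply, sum_eq_single ((⟨0, hs⟩ : Fin s), b)]
  · simp [firstCols]
  · rintro ⟨j, a⟩ - hne
    rw [firstCols, of_apply, if_neg, mul_zero]
    rintro ⟨h1, h2⟩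
    exact hne (Prod.ext (Fin.ext h1) h2)
  · simp

theorem shift_mul_firstCols : shiftMat s m * firstCols s m = 0 := by
  rcases Nat.eq_zero_or_pos s with rfl | hs
  · ext ⟨i, _⟩; exact i.elim0
  · rw [mul_firstCols hs]
    ext i b
    simp [shiftMat]

theorem colsOf_mul_firstCols (hs : 0 < s) (f : ℕ → Matrix (Fin n) (Fin m) ℂ) :
    colsOf s f * firstCols s m = f 0 := by
  rw [mul_firstCols hs]; rfl

theorem NormalForm.base_eq (hγ : ζ₀.2.1 = 0) (hC : Chain E ζ₀.1 x₀ ζ₀.2.2 l s m g e Lf M α) :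
    neutral (E.a l (vecCons (g ζ₀.2.2) ζ₀.2.2)) ζ₀.2.2 = (0, ζ₀) := by
  rw [hC.base, hC.value, neutral, ← hγ]

/-- The compression of the remainder at the base point. -/
theorem Chain.rest_base (hE : E.Admissible) (hγ : ζ₀.2.1 = 0)
    (hC : Chain E ζ₀.1 x₀ ζ₀.2.2 l s m g e Lf M α) :
    Lf ζ₀.2.2 * rest E ζ₀ (colsOf s fun j => e j ζ₀.2.2)
      (I • shiftMat s m + (I * x₀) • 1) * firstCols s m =
      Lf ζ₀.2.2 * cx E.A0 * e 0 ζ₀.2.2 * M := by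
  have hs : 0 < s := hC.s_pos
  have h1 : (I • shiftMat s m + (I * x₀) • 1) * firstCols s m =
      (I * x₀) • firstCols s m := by
    rw [Matrix.add_mul, smul_mul, shift_mul_firstCols, smul_zero, zero_add, smul_mul, Matrix.one_mul]
  have h2 := hC.second
  have hA0 : E.A0.det ≠ 0 := hE.A0_posDef.det_pos.ne'
  have hfe : cx (E.firstOrder (vecCons x₀ ζ₀.2.2)) * e 0 ζ₀.2.2 = (-((ζ₀.1 : ℝ) : ℂ)) • e 0 ζ₀.2.2 := by
    have := hC.chain.self_of_nhds.1
    rw [hC.base, hC.value] at this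
    exact (E.charMat_mul_eq_zero_iff hA0).1 this
  have h3 : rest E ζ₀ (colsOf s fun j => e j ζ₀.2.2)
      (I • shiftMat s m + (I * x₀) • 1) * firstCols s m =
      -(cx (E.secondOrder (vecCons x₀ ζ₀.2.2)) * e 0 ζ₀.2.2) := by
    have hlam : lam ζ₀ = I * ζ₀.1 := by simp [lam, hγ]
    have hB : cx (E.symB (vecCons x₀ ζ₀.2.2)) = ((x₀ : ℂ) ^ 2) • cx (E.B 0 0) +
        (x₀ : ℂ) • cx (E.symB12 ζ₀.2.2) + cx (E.symB22 ζ₀.2.2) := by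
      rw [← ofReal_pow, ← cx_smul, ← cx_smul, ← cx_add, ← cx_add]
      congr 1
      simp only [Endstate.symB, Endstate.symB12, Endstate.symB22, Fin.sum_univ_succ, cons_val_zero,
        cons_val_succ, smul_add, smul_sum, Finset.sum_add_distrib, smul_smul, pow_two]
      have h5 : ∀ x : Fin k, ζ₀.2.2 x * x₀ = x₀ * ζ₀.2.2 x := fun x => mul_comm _ _
      simp only [h5]
      abel
    have hCC : cx (E.symC (vecCons x₀ ζ₀.2.2)) = (x₀ : ℂ) • cx (E.C 0) + cx (E.symC2 ζ₀.2.2) := by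
      rw [← cx_smul, ← cx_add]
      congr 1
      simp only [Endstate.symC, Endstate.symC2, Fin.sum_univ_succ, cons_val_zero, cons_val_succ]
    have h4 : cx (E.secondOrder (vecCons x₀ ζ₀.2.2)) * e 0 ζ₀.2.2 =
        -(cx (E.symB (vecCons x₀ ζ₀.2.2)) * e 0 ζ₀.2.2) +
        ((ζ₀.1 : ℂ) ^ 2) • (cx E.Acal * e 0 ζ₀.2.2) -
        ((ζ₀.1 : ℂ)) • (cx (E.symC (vecCons x₀ ζ₀.2.2)) * e 0 ζ₀.2.2) := by
      have h6 : cx (E.firstOrder (vecCons x₀ ζ₀.2.2) ^ 2) * e 0 ζ₀.2.2 = ((ζ₀.1 : ℂ) ^ 2) • e 0 ζ₀.2.2 := by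
        rw [pow_two, cx_mul, Matrix.mul_assoc, hfe, Matrix.mul_smul, hfe, smul_smul]
        congr 1; ring
      rw [Endstate.secondOrder, cx_add, cx_add, cx_mul, cx_mul, cx_neg, Matrix.add_mul, Matrix.add_mul,
        Matrix.neg_mul, Matrix.mul_assoc _ (cx (E.firstOrder _ ^ 2)), h6, Matrix.mul_assoc _ (cx (E.firstOrder _)),
        hfe, Matrix.mul_smul, Matrix.mul_smul]
      module
    rw [rest, Matrix.sub_mul, Matrix.sub_mul, Matrix.mul_assoc _ _ (firstCols s m),
      Matrix.mul_assoc _ _ (firstCols s m), Matrix.mul_assoc _ _ (firstCols s m),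
      Matrix.mul_assoc _ _ (firstCols s m),
      h1, Matrix.mul_smul, Matrix.mul_smul, h1, smul_smul, Matrix.mul_smul, Matrix.mul_assoc,
      colsOf_mul_firstCols hs, Matrix.mul_assoc, colsOf_mul_firstCols hs, h4, hB, hCC, quad, cross, hlam]
    simp only [Matrix.add_mul, Matrix.sub_mul, smul_mul]
    have hI : I ^ 2 = -1 := Complex.I_sq
    have e1 : (I * (ζ₀.1 : ℂ)) ^ 2 = -((ζ₀.1 : ℂ) ^ 2) := by rw [mul_pow, hI]; ring
    have e2 : I * (I * (ζ₀.1 : ℂ)) = -(ζ₀.1 : ℂ) := by rw [← mul_assoc, ← pow_two, hI]; ring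
    have e3 : I * (x₀ : ℂ) * (I * x₀) = -((x₀ : ℂ) ^ 2) := by
      linear_combination ((x₀ : ℂ) ^ 2) * hI
    rw [e1, e2, e3]
    simp only [smul_add, smul_smul]
    have e4 : I * (x₀ : ℂ) * I = -x₀ := by linear_combination (x₀ : ℂ) * hI
    have e5 : I * (x₀ : ℂ) * (I * ζ₀.1) = -(x₀ * ζ₀.1) := by
      linear_combination ((x₀ : ℂ) * ζ₀.1) * hI
    rw [e4, e5]
    module
  rw [Matrix.mul_assoc, h3, Matrix.mul_neg, ← Matrix.mul_assoc, h2, neg_neg]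

theorem Chain.left_cols (hC : Chain E ζ₀.1 x₀ ζ₀.2.2 l s m g e Lf M α) (hs : s - 1 < s) {κ : Type*}
    (X : Matrix (Fin s × Fin m) κ ℂ) :
    Lf ζ₀.2.2 * cx (E.A 0) * colsOf s (fun j => e j ζ₀.2.2) * X =
      -((α : ℂ) • (Lf ζ₀.2.2 * cx E.A0 * e 0 ζ₀.2.2 * X.submatrix (fun a => (⟨s - 1, hs⟩, a)) id)) := by
  ext i b
  have h1 : (Lf ζ₀.2.2 * cx (E.A 0) * colsOf s (fun j => e j ζ₀.2.2) * X) i b =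
      ∑ j : Fin s, ((Lf ζ₀.2.2 * cx (E.A 0) * e j ζ₀.2.2) * X.submatrix (fun a => (j, a)) id) i b := by
    rw [mul_colsOf, Matrix.mul_apply, sum_prod_type]
    rfl
  rw [h1, sum_eq_single (⟨s - 1, hs⟩ : Fin s)]
  · simp only
    rw [hC.left_top, Matrix.neg_mul, smul_mul]
  · intro j _ hj
    have h3 : (j : ℕ) ≠ s - 1 := fun h => hj (Fin.ext h)
    rw [hC.left_chain j (by have := j.2; omega), Matrix.zero_mul]
    rfl
  · simp

theorem NormalForm.variation (hE : E.Admissible) (hγ : ζ₀.2.1 = 0)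
    (hC : Chain E ζ₀.1 x₀ ζ₀.2.2 l s m g e Lf M α) (hN : NormalForm E c ζ₀ x₀ l s m g e q U N V Vi)
    (hs : s - 1 < s) :
    MLittleO (pairFilter c ζ₀) (fun t =>
      ((N t.1 - N (shadow t)) * firstCols s m).submatrix (fun a => (⟨s - 1, hs⟩, a)) id -
      (α : ℂ)⁻¹ • (((t.1.2.2.1 : ℂ) + I * ((t.1.2.1 - t.2 : ℝ) : ℂ)) • (1 : Matrix (Fin m) (Fin m) ℂ) +
        (t.1.1 : ℂ) • M)) dist₀ := by
  have hs0 : 0 < s := hC.s_pos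
  have hb := NormalForm.base_eq hγ hC
  have hU0 : U (0, ζ₀) = colsOf s fun j => e j ζ₀.2.2 := hb ▸ hN.U_surface.self_of_nhds
  have hN0 : N (0, ζ₀) = I • shiftMat s m := hb ▸ hN.N_surface.self_of_nhds
  set F := pairFilter c ζ₀ with hF
  set P := firstCols s m with hP
  set Ec := colsOf s fun j => e j ζ₀.2.2 with hEc
  set G := Lf ζ₀.2.2 * cx E.A0 * e 0 ζ₀.2.2 with hG
  have t1 : Tendsto (fun t : Pt k × ℝ => t.1) F (𝓝 (0, ζ₀)) := tendsto_fst_pair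
  have t2 : Tendsto shadow F (𝓝 (0, ζ₀)) := tendsto_shadow hγ
  have tη : Tendsto (fun t : Pt k × ℝ => t.1.2.2.2) F (𝓝 ζ₀.2.2) :=
    ((continuous_snd.comp (continuous_snd.comp continuous_snd)).tendsto (0, ζ₀)).comp t1
  have tU : Tendsto (fun t : Pt k × ℝ => U t.1) F (𝓝 Ec) := by
    rw [← hU0]; exact hN.smooth_U.continuousAt.tendsto.comp t1
  have tN1 : Tendsto (fun t : Pt k × ℝ => N t.1) F (𝓝 (I • shiftMat s m)) := by
    rw [← hN0]; exact hN.smooth_N.continuousAt.tendsto.comp t1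
  have tN : Tendsto (fun t : Pt k × ℝ => N (shadow t)) F (𝓝 (I • shiftMat s m)) := by
    rw [← hN0]; exact hN.smooth_N.continuousAt.tendsto.comp t2
  have tL : Tendsto (fun t : Pt k × ℝ => Lf t.1.2.2.2) F (𝓝 (Lf ζ₀.2.2)) := hC.cont_L.tendsto.comp tη
  have tg : Tendsto (fun t : Pt k × ℝ => g t.1.2.2.2) F (𝓝 x₀) := hC.base ▸ hC.smooth_g.continuousAt.tendsto.comp tη
  have tar : Tendsto (fun t : Pt k × ℝ => E.a l (vecCons (g t.1.2.2.2) t.1.2.2.2)) F (𝓝 ζ₀.1) := by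
    have h1 : Tendsto (fun t : Pt k × ℝ => vecCons (g t.1.2.2.2) t.1.2.2.2) F (𝓝 (vecCons x₀ ζ₀.2.2)) :=
      (Endstate.contDiff_vecCons.continuous.tendsto (x₀, ζ₀.2.2)).comp (tg.prodMk_nhds tη)
    have := hC.smooth_a.continuousAt.tendsto.comp h1
    rwa [hC.value] at this
  have tτ' : Tendsto (fun t : Pt k × ℝ => t.2) F (𝓝 ζ₀.1) :=
    (continuous_snd.tendsto ((0, ζ₀), ζ₀.1)).mono_left inf_le_left
  have dU : MBigO F (fun t => U t.1 - U (shadow t)) dist₀ := hN.smooth_U.isBigO_pair hγ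
  have dN : MBigO F (fun t => N t.1 - N (shadow t)) dist₀ := hN.smooth_N.isBigO_pair hγ
  have bγ : (fun t : Pt k × ℝ => (t.1.2.2.1 : ℂ) + I * ((t.1.2.1 - t.2 : ℝ) : ℂ)) =O[F] dist₀ := by
    refine IsBigO.of_bound 1 (Eventually.of_forall fun t => ?_)
    have h3 : 0 ≤ dist₀ t := by unfold dist₀; positivity
    rw [one_mul, norm_of_nonneg h3]
    refine (norm_add_le _ _).trans ?_
    rw [norm_mul, norm_I, one_mul, norm_real, norm_real, dist₀]
    simp only [norm_eq_abs]
    linarith [abs_nonneg t.1.1]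
  have bρ : (fun t : Pt k × ℝ => (t.1.1 : ℂ)) =O[F] dist₀ := by
    refine IsBigO.of_bound 1 (Eventually.of_forall fun t => ?_)
    have h3 : 0 ≤ dist₀ t := by unfold dist₀; positivity
    rw [one_mul, norm_of_nonneg h3, norm_real, dist₀, norm_eq_abs]
    linarith [abs_nonneg t.1.2.2.1, abs_nonneg (t.1.2.1 - t.2)]
  have key : ∀ᶠ t in F,
      ((t.1.2.2.1 : ℂ) + I * ((t.1.2.1 - t.2 : ℝ) : ℂ)) • (Lf t.1.2.2.2 * cx E.A0 * U t.1 * P) +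
      (I * ((t.2 - E.a l (vecCons (g t.1.2.2.2) t.1.2.2.2) : ℝ) : ℂ)) •
        (Lf t.1.2.2.2 * cx E.A0 * (U t.1 - U (shadow t)) * P) +
      Lf t.1.2.2.2 * cx (E.A 0) * U t.1 * ((N t.1 - N (shadow t)) * P) +
      Lf t.1.2.2.2 * cx (E.A 0) * (U t.1 - U (shadow t)) * (N (shadow t) * P) +
      (t.1.1 : ℂ) • (Lf t.1.2.2.2 * rest E t.1.2 (U t.1) (N t.1 + (I * g t.1.2.2.2) • 1) * P) = 0 := by
    have hreg : ∀ᶠ t in F, t.1 ∈ Reg k c := (eventually_principal.2 fun t ht => ht).filter_mono inf_le_right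
    filter_upwards [t1.eventually hN.eqn, t2.eventually hN.eqn, tη.eventually hC.left, hreg]
      with t h1 h2 h3 h4
    have h1 := h1 h4
    have h2 := h2 neutral_mem
    have hη : (shadow t).2.2.2 = t.1.2.2.2 := rfl
    rw [hη] at h2
    have h5 : lead E t.1.2 = I • E.charMat (E.a l (vecCons (g t.1.2.2.2) t.1.2.2.2))
        (g t.1.2.2.2) t.1.2.2.2 + ((t.1.2.2.1 : ℂ) + I * t.1.2.1 -
          I * (E.a l (vecCons (g t.1.2.2.2) t.1.2.2.2) : ℝ)) • cx E.A0 -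
        (I * (g t.1.2.2.2 : ℝ)) • cx (E.A 0) := by
      simp only [lead, lam, Endstate.charMat]; module
    have h6 : lead E (shadow t).2 = I • E.charMat (E.a l (vecCons (g t.1.2.2.2) t.1.2.2.2))
        (g t.1.2.2.2) t.1.2.2.2 + (I * t.2 - I * (E.a l (vecCons (g t.1.2.2.2) t.1.2.2.2) : ℝ)) • cx E.A0 -
        (I * (g t.1.2.2.2 : ℝ)) • cx (E.A 0) := by
      simp only [shadow]
      rw [lead_neutral t.2 (g t.1.2.2.2) t.1.2.2.2, Endstate.charMat, Endstate.charMat]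
      module
    have h7 : slowEq E (shadow t) (U (shadow t)) (N (shadow t) + (I * g t.1.2.2.2) • 1) =
        lead E (shadow t).2 * U (shadow t) + cx (E.A 0) * U (shadow t) *
          (N (shadow t) + (I * g t.1.2.2.2) • 1) := slowEq_neutral _ _ _ _
    rw [h7, h6] at h2
    rw [slowEq, h5] at h1
    generalize rest E t.1.2 (U t.1) (N t.1 + (I * g t.1.2.2.2) • 1) = R at h1 ⊢
    generalize U (shadow t) = U' at *
    generalize N (shadow t) = N' at *
    generalize U t.1 = U₁ at *
    generalize N t.1 = N₁ at *
    generalize hLL : Lf t.1.2.2.2 = L at *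
    have h8 := congrArg (fun Z => L * Z * P) h1
    have h9 := congrArg (fun Z => L * Z * P) h2
    simp only [Matrix.add_mul, Matrix.sub_mul, smul_mul, Matrix.mul_add, Matrix.mul_sub,
      Matrix.mul_smul, Matrix.mul_one, Matrix.zero_mul, Matrix.mul_zero, ← Matrix.mul_assoc, h3,
      smul_zero, zero_add] at h8 h9 ⊢
    push_cast
    linear_combination (norm := module) h8 - h9
  have hsP : I • shiftMat s m * P = 0 := by
    rw [smul_mul, shift_mul_firstCols, smul_zero]
  have tU' : Tendsto (fun t : Pt k × ℝ => Lf t.1.2.2.2 * cx E.A0 * U t.1 * P - G) F (𝓝 0) := by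
    have h1 := tendsto_matrix_sub (tendsto_matrix_mul (tendsto_matrix_mul (tendsto_matrix_mul tL
      (tendsto_const_nhds (x := cx E.A0))) tU) (tendsto_const_nhds (x := P))) (tendsto_const_nhds (x := G))
    have h2 : Lf ζ₀.2.2 * cx E.A0 * Ec * P - G = 0 := by
      rw [Matrix.mul_assoc, colsOf_mul_firstCols hs0, sub_self]
    rwa [h2] at h1
  have tR : Tendsto (fun t : Pt k × ℝ => Lf t.1.2.2.2 * rest E t.1.2 (U t.1)
      (N t.1 + (I * g t.1.2.2.2) • 1) * P - G * M) F (𝓝 0) := by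
    have tq : Tendsto (fun t : Pt k × ℝ => N t.1 + (I * (g t.1.2.2.2 : ℝ)) • (1 : BMat s m)) F
        (𝓝 (I • shiftMat s m + (I * (x₀ : ℝ)) • 1)) :=
      tendsto_matrix_add tN1 (tendsto_matrix_smul (((continuous_ofReal.tendsto _).comp tg).const_mul _)
        tendsto_const_nhds)
    have h1 : Tendsto (fun t : Pt k × ℝ => quad E t.1.2) F (𝓝 (quad E ζ₀)) :=
      (mSmooth_quad (N := 1) E (0, ζ₀)).continuousAt.tendsto.comp t1
    have h2 : Tendsto (fun t : Pt k × ℝ => cross E t.1.2) F (𝓝 (cross E ζ₀)) :=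
      (mSmooth_cross (N := 1) E (0, ζ₀)).continuousAt.tendsto.comp t1
    have h3 := tendsto_matrix_sub (tendsto_matrix_mul (tendsto_matrix_mul tL
      (tendsto_matrix_sub (tendsto_matrix_sub (tendsto_matrix_mul h1 tU)
        (tendsto_matrix_mul (tendsto_matrix_mul h2 tU) tq)) (tendsto_matrix_mul (tendsto_matrix_mul
          (tendsto_const_nhds (x := cx (E.B 0 0))) tU) (tendsto_matrix_mul tq tq))))
      (tendsto_const_nhds (x := P))) (tendsto_const_nhds (x := G * M))
    have h4 := hC.rest_base hE hγ
    rw [rest] at h4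
    rw [h4, sub_self] at h3
    exact h3
  have tA : Tendsto (fun t : Pt k × ℝ => I * ((t.2 - E.a l (vecCons (g t.1.2.2.2) t.1.2.2.2) : ℝ) : ℂ)) F (𝓝 0) := by
    have h1 := ((continuous_ofReal.tendsto _).comp (tτ'.sub tar)).const_mul I
    simpa using h1
  have tLA : Tendsto (fun t : Pt k × ℝ => Lf t.1.2.2.2 * cx (E.A 0)) F (𝓝 (Lf ζ₀.2.2 * cx (E.A 0))) :=
    tendsto_matrix_mul tL tendsto_const_nhds
  have tLU : Tendsto (fun t : Pt k × ℝ => Lf t.1.2.2.2 * cx (E.A 0) * U t.1 -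
      Lf ζ₀.2.2 * cx (E.A 0) * Ec) F (𝓝 0) := by
    simpa only [sub_self] using tendsto_matrix_sub (tendsto_matrix_mul tLA tU) (tendsto_const_nhds (x := Lf ζ₀.2.2 * cx (E.A 0) * Ec))
  have tNP : Tendsto (fun t : Pt k × ℝ => N (shadow t) * P) F (𝓝 0) := hsP ▸ tendsto_matrix_mul tN (tendsto_const_nhds (x := P))
  have o1 := mLittleO_smul bγ tU'
  have o2 := mLittleO_smul bρ tR
  have o3 := MBigO.smul_tendsto tA (MBigO.mul_right (MBigO.mul_left (tendsto_matrix_mul tL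
    (tendsto_const_nhds (x := cx E.A0))) dU) (tendsto_const_nhds (x := P)))
  have o4 := MBigO.tendsto_mul tLU (MBigO.mul_right dN (tendsto_const_nhds (x := P)))
  have o5 := MBigO.mul_tendsto (MBigO.mul_left tLA dU) tNP
  have o6 := (((o1.add o2).add o3).add o4).add o5
  have hGu : IsUnit G.det := isUnit_iff_ne_zero.2 hC.gram
  have hα : (α : ℂ) ≠ 0 := by exact_mod_cast hC.coeff_ne
  have o7 := MLittleO.mul_left (tendsto_const_nhds (x := (α : ℂ)⁻¹ • G⁻¹)) o6
  refine o7.congr ?_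
  filter_upwards [key] with t ht
  set Δ := N t.1 - N (shadow t) with hΔ
  have h1 := hC.left_cols hs (Δ * P)
  rw [← hEc, ← hG] at h1
  have h2 : ∀ X : Matrix (Fin m) (Fin m) ℂ, ((α : ℂ)⁻¹ • G⁻¹) * (G * X) = (α : ℂ)⁻¹ • X := by
    intro X
    rw [smul_mul, nonsing_inv_mul_cancel_left _ _ hGu]
  set δ := (Δ * P).submatrix (fun a => ((⟨s - 1, hs⟩ : Fin s), a)) id with hδ
  set z := (t.1.2.2.1 : ℂ) + I * ((t.1.2.1 - t.2 : ℝ) : ℂ) with hz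
  have h3 : δ - (α : ℂ)⁻¹ • (z • 1 + (t.1.1 : ℂ) • M) =
      ((α : ℂ)⁻¹ • G⁻¹) * (G * ((α : ℂ) • δ - (z • (1 : Matrix (Fin m) (Fin m) ℂ) + (t.1.1 : ℂ) • M))) := by
    rw [h2, smul_sub, smul_smul, inv_mul_cancel₀ hα, one_smul]
  rw [h3]
  congr 1
  have h5 : G * ((α : ℂ) • δ - (z • (1 : Matrix (Fin m) (Fin m) ℂ) + (t.1.1 : ℂ) • M)) =
      (α : ℂ) • (G * δ) - (z • G + (t.1.1 : ℂ) • (G * M)) := by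
    rw [Matrix.mul_sub, Matrix.mul_add, Matrix.mul_smul, Matrix.mul_smul, Matrix.mul_smul, Matrix.mul_one]
  rw [h5, Matrix.sub_mul (Lf t.1.2.2.2 * cx (E.A 0) * U t.1), h1]
  linear_combination (norm := module) ht

end


/-! ### Purely imaginary modes -/

section

variable {n k : ℕ} {E : Bool → Endstate n k} {ζ₀ : Freq k}

theorem Endstate.bound_eigenvalue (E : Endstate n k) : ∃ C : ℝ, 0 ≤ C ∧
    ∀ (ξ : Fin (k + 1) → ℝ) (τ : ℝ) (v : Fin n → ℂ), v ≠ 0 →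
      cx (E.firstOrder ξ) *ᵥ v = (τ : ℂ) • v → τ ^ 2 ≤ C * ∑ i, ξ i ^ 2 := by
  let K : Fin (k + 1) → ℝ := fun j => ∑ a, ∑ b, |(E.A0⁻¹ * E.A j) a b|
  refine ⟨∑ j, K j ^ 2, by positivity, fun ξ τ v hv h => ?_⟩
  have hexp : cx (E.firstOrder ξ) = ∑ j, (ξ j : ℂ) • cx (E.A0⁻¹ * E.A j) := by
    simp only [Endstate.firstOrder, Endstate.symA, Matrix.mul_sum, Matrix.mul_smul, cx_sum, cx_smul]
  have hb : ∀ j (a : Fin n), ‖(cx (E.A0⁻¹ * E.A j) *ᵥ v) a‖ ≤ K j * ‖v‖ := by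
    intro j a
    rw [mulVec, dotProduct]
    refine (norm_sum_le _ _).trans ?_
    have h1 : ∀ b ∈ univ, ‖cx (E.A0⁻¹ * E.A j) a b * v b‖ ≤ |(E.A0⁻¹ * E.A j) a b| * ‖v‖ := by
      intro b _
      rw [norm_mul]
      refine mul_le_mul (le_of_eq ?_) (norm_le_pi_norm v b) (norm_nonneg _) (abs_nonneg _)
      simp only [cx, map_apply, norm_real, norm_eq_abs]
    refine (sum_le_sum h1).trans ?_
    rw [← sum_mul]
    refine mul_le_mul_of_nonneg_right ?_ (norm_nonneg _)
    exact single_le_sum (f := fun a => ∑ b, |(E.A0⁻¹ * E.A j) a b|) (fun i _ => by positivity)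
      (mem_univ a)
  have h2 : ‖(τ : ℂ) • v‖ ≤ (∑ j, |ξ j| * K j) * ‖v‖ := by
    refine (pi_norm_le_iff_of_nonneg (by positivity)).2 fun a => ?_
    rw [← h, hexp, sum_mulVec, Finset.sum_apply, sum_mul]
    refine (norm_sum_le _ _).trans (sum_le_sum fun j _ => ?_)
    rw [smul_mulVec, Pi.smul_apply, norm_smul, norm_real, norm_eq_abs, mul_assoc]
    exact mul_le_mul_of_nonneg_left (hb j a) (abs_nonneg _)
  rw [norm_smul, norm_real, norm_eq_abs] at h2
  have h3 : |τ| ≤ ∑ j, |ξ j| * K j := le_of_mul_le_mul_right h2 (norm_pos_iff.2 hv)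
  calc τ ^ 2 = |τ| ^ 2 := (sq_abs _).symm
    _ ≤ (∑ j, |ξ j| * K j) ^ 2 := pow_le_pow_left₀ (abs_nonneg _) h3 2
    _ ≤ (∑ j, |ξ j| ^ 2) * ∑ j, K j ^ 2 := Finset.sum_mul_sq_le_sq_mul_sq _ _ _
    _ = _ := by simp only [sq_abs]; ring

/-- Purely imaginary modes occur only for `γ = 0`, and belong to real characteristic roots. -/
theorem exists_root_of_mode (hE : ∀ s, (E s).Admissible) (hS : OnSphere ζ₀) {r : Bool × ℝ}
    (hr : r ∈ modes E ζ₀) : ζ₀.2.1 = 0 ∧ vecCons (sgn r.1 * r.2) ζ₀.2.2 ≠ 0 ∧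
      ∃ v ≠ 0, (E r.1).charMat ζ₀.1 (sgn r.1 * r.2) ζ₀.2.2 *ᵥ v = 0 := by
  classical
  have hA0 : (E r.1).A0.det ≠ 0 := (hE r.1).A0_posDef.det_pos.ne'
  have hA1 : IsUnit (cx ((E r.1).A 0)).det := isUnit_iff_ne_zero.2 (by
    rw [cx_det]; exact_mod_cast (hE r.1).A1_det)
  simp only [modes, Finset.mem_biUnion, mem_univ, true_and, Finset.mem_image, mem_filter, Multiset.mem_toFinset] at hr
  obtain ⟨b, z, ⟨hz, hz0⟩, hr⟩ := hr
  obtain ⟨rfl, hr2⟩ : r.1 = b ∧ r.2 = z.im := by rw [← hr]; exact ⟨rfl, rfl⟩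
  rw [mem_roots (charpoly_monic _).ne_zero, ← charpoly_toLin', ← Module.End.hasEigenvalue_iff_isRoot_charpoly] at hz
  obtain ⟨v, hv, hv0⟩ := hz.exists_hasEigenvector
  rw [Module.End.mem_eigenspace_iff, toLin'_apply] at hv
  set σ := sgn r.1 with hσ
  have hσσ : (σ : ℂ) * σ = 1 := sgn_mul_self_cx r.1
  set x := σ * r.2 with hx
  have hzI : z = I * (σ * x : ℂ) := by
    rw [hx]; push_cast; rw [← mul_assoc (σ : ℂ), hσσ, one_mul]
    apply Complex.ext <;> simp [hz0, hr2]
  have h1 : (lam ζ₀ • cx (E r.1).A0 + I • cx ((E r.1).symA2 ζ₀.2.2)) *ᵥ v =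
      -((I * x) • (cx ((E r.1).A 0) *ᵥ v)) := by
    have h2 := congrArg (fun y => (-(σ : ℂ)) • (cx ((E r.1).A 0) *ᵥ y)) hv
    simp only [H0, smul_mulVec, mulVec_smul, smul_smul, mulVec_mulVec, mul_nonsing_inv_cancel_left _ _ hA1] at h2
    rw [neg_mul_neg, hσσ, one_smul] at h2
    rw [h2, hzI, ← neg_smul]
    congr 1
    linear_combination (-(I * x)) * hσσ
  have h2 : cx ((E r.1).firstOrder (vecCons x ζ₀.2.2)) *ᵥ v = (I * lam ζ₀) • v := by
    have h3 : I • (cx ((E r.1).symA (vecCons x ζ₀.2.2)) *ᵥ v) = -(lam ζ₀ • (cx (E r.1).A0 *ᵥ v)) := by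
      rw [Endstate.symA_vecCons, add_mulVec, smul_mulVec]
      rw [add_mulVec, smul_mulVec, smul_mulVec] at h1
      linear_combination (norm := module) h1
    have h4 := congrArg (fun y => (-I) • (cx (E r.1).A0⁻¹ *ᵥ y)) h3
    simp only [mulVec_smul, mulVec_neg, smul_smul, mulVec_mulVec, ← cx_mul,
      nonsing_inv_mul _ (isUnit_iff_ne_zero.2 hA0), cx_one, one_mulVec, neg_mul, I_mul_I, neg_neg, one_smul] at h4
    rw [Endstate.firstOrder, h4]
    module
  have hξ : vecCons x ζ₀.2.2 ≠ 0 := by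
    intro h0
    rw [h0] at h2
    have h3 : (E r.1).firstOrder 0 = 0 := by simp [Endstate.firstOrder, Endstate.symA]
    have h4 : cx (0 : Matrix (Fin n) (Fin n) ℝ) = 0 := by ext i j; simp [cx]
    rw [h3, h4, zero_mulVec, eq_comm, smul_eq_zero] at h2
    have h5 := (mul_eq_zero.1 (h2.resolve_right hv0)).resolve_left I_ne_zero
    have h6 : ζ₀.2.2 = 0 := by
      funext j
      have := congrFun h0 j.succ
      simpa using this
    have h7 := congrArg Complex.re h5
    have h8 := congrArg Complex.im h5
    simp [lam] at h7 h8
    rw [OnSphere, h6, h7, h8] at hS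
    simp at hS
  obtain ⟨L, m, hn, hcm⟩ := (hE r.1).constMult
  obtain ⟨hL, hm⟩ := hcm _ hξ
  obtain ⟨C, Ci, hCC, hCiC, hFC⟩ := (E r.1).exists_diagonalization hn hL hm
  have hre : (I * lam ζ₀).im = 0 := by
    have hw0 : Ci *ᵥ v ≠ 0 := by
      intro h
      have := congrArg (fun y => C *ᵥ y) h
      simp only [mulVec_mulVec, hCC, one_mulVec, mulVec_zero] at this
      exact hv0 this
    obtain ⟨p, hp⟩ := ne_iff.1 hw0
    have h3 : (diagonal (fun p : (Σ l : Fin L, Fin (m l)) => -(((E r.1).a p.1 (vecCons x ζ₀.2.2) : ℝ) : ℂ)) :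
        Matrix (Σ l : Fin L, Fin (m l)) (Σ l : Fin L, Fin (m l)) ℂ) *ᵥ (Ci *ᵥ v) =
          (I * lam ζ₀) • (Ci *ᵥ v) := by
      have h4 : cx ((E r.1).firstOrder (vecCons x ζ₀.2.2)) *ᵥ (C *ᵥ (Ci *ᵥ v)) = (I * lam ζ₀) • v := by
        rw [mulVec_mulVec v, hCC, one_mulVec, h2]
      rw [mulVec_mulVec, hFC] at h4
      have h5 := congrArg (fun y => Ci *ᵥ y) h4
      simp only [mulVec_smul] at h5
      rw [mulVec_mulVec, ← Matrix.mul_assoc Ci C, hCiC, Matrix.one_mul] at h5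
      exact h5
    have h4 := congrFun h3 p
    rw [mulVec_diagonal, Pi.smul_apply, smul_eq_mul] at h4
    have h5 := mul_right_cancel₀ hp h4
    rw [← h5]; simp
  have hγ : ζ₀.2.1 = 0 := by
    simpa [lam] using hre
  refine ⟨hγ, hξ, v, hv0, (Endstate.charMat_mulVec_eq_zero_iff (E r.1) hA0).2 ?_⟩
  rw [h2, lam, hγ]
  congr 1
  push_cast
  rw [zero_add, ← mul_assoc, I_mul_I]; ring

end

namespace Endstate

variable {n k : ℕ} {E : Endstate n k}

/-- Chains at the real characteristic frequencies. -/
theorem exists_mode_chain (hE : E.Admissible) : ∃ b : ℝ, 0 < b ∧ b ≤ 1 ∧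
    ∀ (ζ₀ : Freq k) (x₀ : ℝ), OnSphere ζ₀ → ζ₀.2.1 = 0 → vecCons x₀ ζ₀.2.2 ≠ 0 →
      (∃ v ≠ 0, E.charMat ζ₀.1 x₀ ζ₀.2.2 *ᵥ v = 0) →
      ∃ (l m : ℕ) (M : Matrix (Fin m) (Fin m) ℂ), ReGe M b ∧
        (E.SymmetricCompressions → ∃ μ : Fin m → ℝ, M = diagonal (fun j => (μ j : ℂ)) ∧ ∀ j, b ≤ μ j) ∧
        (¬ E.IsGlancing ζ₀.1 x₀ ζ₀.2.2 → ∃ e Lf α, Chain E ζ₀.1 x₀ ζ₀.2.2 l 1 m (fun _ => x₀) e Lf M α) ∧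
        (E.IsGlancing ζ₀.1 x₀ ζ₀.2.2 → E.GlancingPersists → ∃ s g e Lf α, 2 ≤ s ∧
          Chain E ζ₀.1 x₀ ζ₀.2.2 l s m g e Lf M α) := by
  have hA0 : E.A0.det ≠ 0 := hE.A0_posDef.det_pos.ne'
  obtain ⟨b, hb, hframe⟩ := E.exists_frame_dissipative hE
  obtain ⟨C, hC0, hC⟩ := E.bound_eigenvalue
  have hbC : 0 < b / (1 + C) := by positivity
  refine ⟨min 1 (b / (1 + C)), lt_min one_pos hbC, min_le_left _ _, fun ζ₀ x₀ hS hγ hξ hv => ?_⟩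
  obtain ⟨v, hv0, hv⟩ := hv
  have hfv := (E.charMat_mulVec_eq_zero_iff hA0).1 hv
  have hlow : min 1 (b / (1 + C)) ≤ b * ∑ i, (vecCons x₀ ζ₀.2.2) i ^ 2 := by
    refine (min_le_right _ _).trans ?_
    have h1 := hC (vecCons x₀ ζ₀.2.2) (-ζ₀.1) v hv0 (by push_cast; exact hfv)
    have h2 : ∑ i, (vecCons x₀ ζ₀.2.2) i ^ 2 = x₀ ^ 2 + ∑ j, ζ₀.2.2 j ^ 2 := by
      rw [Fin.sum_univ_succ]; simp
    have h3 := hS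
    rw [OnSphere, hγ] at h3
    rw [div_le_iff₀ (by positivity), mul_assoc]
    refine le_mul_of_one_le_right hb.le ?_
    nlinarith [sq_nonneg x₀]
  have hroot : ζ₀.1 ∈ E.charRoots (vecCons x₀ ζ₀.2.2) := by
    rw [charRoots, Multiset.mem_toFinset, mem_roots (charpoly_monic _).ne_zero, Polynomial.IsRoot.def, eval_charpoly]
    have h1 : (cx (scalar (Fin n) ζ₀.1 - -E.firstOrder (vecCons x₀ ζ₀.2.2))).det = 0 := by
      refine exists_mulVec_eq_zero_iff.1 ⟨v, hv0, ?_⟩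
      have h2 : cx (scalar (Fin n) ζ₀.1 - -E.firstOrder (vecCons x₀ ζ₀.2.2)) =
          (ζ₀.1 : ℂ) • 1 + cx (E.firstOrder (vecCons x₀ ζ₀.2.2)) := by
        have h3 : scalar (Fin n) ζ₀.1 = ζ₀.1 • (1 : Matrix (Fin n) (Fin n) ℝ) := by
          ext i j; simp [diagonal_apply, Matrix.one_apply]
        rw [sub_neg_eq_add, cx_add, h3, cx_smul, cx_one]
      rw [h2, add_mulVec, hfv, smul_mulVec, one_mulVec, neg_smul, add_neg_cancel]
    rw [cx_det] at h1
    exact_mod_cast h1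
  obtain ⟨l, hl, hal⟩ := E.exists_a_eq hroot
  obtain ⟨m, e, M, Y, hm, hes, has, hev, hMY, hMb, hMd⟩ := hframe _ hξ l hl
  have hev' : ∀ᶠ ξ in 𝓝 (vecCons x₀ ζ₀.2.2),
      cx (E.firstOrder ξ) * e ξ = (-(E.a l ξ : ℂ)) • e ξ ∧ (∀ w, e ξ *ᵥ w = 0 → w = 0) ∧
      (∀ x, cx (E.firstOrder ξ) *ᵥ x = (-(E.a l ξ : ℂ)) • x → ∃ w, x = e ξ *ᵥ w) :=
    hev.mono fun ξ h => h.2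
  have hinj := hev'.self_of_nhds.2.1
  obtain ⟨s, hs1, ho⟩ := exists_rootOrder hE hm hes has (hev'.mono fun ξ h => h.1) hinj
  refine ⟨l, m, M, hMb.mono hlow, fun hsym => ?_, fun hng => ?_, fun hg hp => ?_⟩
  · obtain ⟨μ, h1, h2⟩ := hMd hsym
    exact ⟨μ, h1, fun j => hlow.trans (h2 j)⟩
  · have hs : s = 1 := by
      by_contra hne
      have hs2 : 2 ≤ s := by omega
      have h1 : E.dA l 1 x₀ ζ₀.2.2 = 0 := ho.1 1 le_rfl hs2
      have hη : ζ₀.2.2 = 0 := by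
        by_contra hη
        exact hng ⟨hη, l, hl, hal, h1⟩
      obtain ⟨S, hSym, -⟩ := hE.dissipative
      obtain ⟨c0, -, c2⟩ := chain_of_flat hA0 hes has (hev'.mono fun ξ h => h.1) (s := 1)
        (fun j h1 h2 => by omega)
      have c2 := c2 0 rfl
      rw [taylorCoeff_zero, h1] at c2
      rw [taylorCoeff_zero] at c0
      simp only [ofReal_zero, zero_div, zero_smul, sub_zero] at c2
      have hτ : ζ₀.1 ≠ 0 := by
        intro h0
        rw [OnSphere, hγ, hη, h0] at hS
        simp at hS
      set f := e (vecCons x₀ ζ₀.2.2) with hf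
      let L := fᴴ * S ((len (vecCons x₀ ζ₀.2.2))⁻¹ • vecCons x₀ ζ₀.2.2) * cx E.A0⁻¹
      have hAi : cx E.A0⁻¹ * cx E.A0 = 1 := by
        rw [← cx_mul, nonsing_inv_mul _ (isUnit_iff_ne_zero.2 hA0), cx_one]
      have hLA0 : L * cx E.A0 = fᴴ * S ((len (vecCons x₀ ζ₀.2.2))⁻¹ • vecCons x₀ ζ₀.2.2) := by
        simp only [L]
        rw [Matrix.mul_assoc, hAi, Matrix.mul_one]
      have hL : L * E.charMat (E.a l (vecCons x₀ ζ₀.2.2)) x₀ ζ₀.2.2 = 0 := by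
        rw [E.charMat_eq hA0, ← Matrix.mul_assoc, hLA0, Matrix.mul_add,
          hSym.left_eigen hξ hev'.self_of_nhds.1, Matrix.mul_smul, Matrix.mul_one, neg_smul, neg_add_cancel]
      have h3 := congrArg (fun Z => L * Z) c2
      simp only [← Matrix.mul_assoc, hL, Matrix.zero_mul, Matrix.mul_neg] at h3
      have h4 := congrArg (fun Z => L * Z) c0
      have hA2 : cx (E.symA2 ζ₀.2.2) = 0 := by
        rw [hη]
        have : E.symA2 (0 : Fin k → ℝ) = 0 := by simp [symA2]
        rw [this]; ext i j; simp [cx]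
      simp only [charMat, hA2, add_zero, Matrix.add_mul, Matrix.mul_add, smul_mul, Matrix.mul_smul,
        Matrix.mul_zero, ← Matrix.mul_assoc] at h4
      rw [neg_eq_zero.1 h3.symm, smul_zero, add_zero, hal, hLA0] at h4
      have h5 := (smul_eq_zero.1 h4).resolve_left (by exact_mod_cast hτ)
      have h6 := hSym.gram_posDef hξ hinj
      rw [h5] at h6
      have h7 := ((isUnit_iff_isUnit_det _).1 h6.isUnit).ne_zero
      have : Nonempty (Fin m) := ⟨⟨0, hm⟩⟩
      exact h7 det_zero
    subst hs
    obtain ⟨e', Lf, α, h⟩ := exists_chain hE hξ hm hes has hev' hMY le_rfl (g := fun _ => x₀)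
      contDiffAt_const rfl (eventually_rootOrder_one has ho)
    rw [hal] at h
    exact ⟨e', Lf, α, h⟩
  · obtain ⟨hη, l', hl', hal', hd⟩ := hg
    have hll : l' = l := by
      have h1 := (E.a_strictMono rfl).injective (a₁ := (⟨l', hl'⟩ : Fin _)) (a₂ := ⟨l, hl⟩)
        (by simp only; rw [hal', hal])
      exact congrArg Fin.val h1
    subst hll
    have hs2 : 2 ≤ s := by
      by_contra hlt
      have : s = 1 := by omega
      subst this
      exact ho.2 hd
    obtain ⟨g, hg, hg0, hgo⟩ := exists_glancing_curve hp hη has hs2 ho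
    obtain ⟨e', Lf, α, h⟩ := exists_chain hE hξ hm hes has hev' hMY hs1 hg hg0 hgo
    rw [hal] at h
    exact ⟨s, g, e', Lf, α, hs2, h⟩

end Endstate


open Asymptotics

/-! ### Hyperbolic modes -/

section Forms

variable {ι κ : Type*} [Fintype ι] [DecidableEq ι] [Fintype κ] [DecidableEq κ]

theorem ReGe.add {M N : Matrix ι ι ℂ} {a b : ℝ} (hM : ReGe M a) (hN : ReGe N b) :
    ReGe (M + N) (a + b) := by
  rw [reGe_iff] at *
  intro x
  rw [qform_add, Complex.add_re, add_mul]
  exact add_le_add (hM x) (hN x)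

theorem ReGe.smul {M : Matrix ι ι ℂ} {a r : ℝ} (hM : ReGe M a) (hr : 0 ≤ r) :
    ReGe ((r : ℂ) • M) (r * a) := by
  rw [reGe_iff] at *
  intro x
  rw [qform_smul, re_ofReal_mul, mul_assoc]
  exact mul_le_mul_of_nonneg_left (hM x) hr

theorem reGe_scalar (z : ℂ) : ReGe (z • (1 : Matrix ι ι ℂ)) z.re := by
  rw [reGe_iff]
  intro x
  rw [qform_smul, qform_one, re_mul_ofReal]

theorem reGe_of_entries {M : Matrix ι ι ℂ} {δ : ℝ} (h : ∀ i j, ‖M i j‖ ≤ δ) :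
    ReGe M (-(card ι * δ)) := by
  rw [reGe_iff]
  intro x
  have h1 : ‖qform M x‖ ≤ δ * (∑ i, ‖x i‖) ^ 2 := by
    rw [qform, dotProduct, pow_two, sum_mul, mul_sum]
    refine (norm_sum_le _ _).trans (sum_le_sum fun i _ => ?_)
    rw [norm_mul, Pi.star_apply, norm_star, mulVec, dotProduct, mul_left_comm]
    refine mul_le_mul_of_nonneg_left ?_ (norm_nonneg _)
    rw [mul_sum]
    refine (norm_sum_le _ _).trans (sum_le_sum fun j _ => ?_)
    rw [norm_mul]
    exact mul_le_mul_of_nonneg_right (h i j) (norm_nonneg _)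
  rcases isEmpty_or_nonempty ι with hι | ⟨⟨i0⟩⟩
  · simp [qform]
  have hδ : 0 ≤ δ := (norm_nonneg _).trans (h i0 i0)
  have h2 : (∑ i, ‖x i‖) ^ 2 ≤ card ι * ∑ i, ‖x i‖ ^ 2 := sq_sum_le_card_mul_sum_sq
  have h3 := (Complex.abs_re_le_norm (qform M x)).trans h1
  have h4 := neg_le_of_abs_le h3
  nlinarith

theorem ReGe.submatrix {M : Matrix ι ι ℂ} {r : ℝ} (h : ReGe M r) {f : κ → ι}
    (hf : Injective f) : ReGe (M.submatrix f f) r := by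
  have h1 := PosSemidef.submatrix h f
  rw [ReGe]
  convert h1 using 1
  ext i j
  simp [rePart, Matrix.one_apply, hf.eq_iff]

/-- Reordering of an index set according to a sign. -/
theorem exists_sign_equiv (sg : ι → Bool) : ∃ (a b : ℕ) (e : Fin a ⊕ Fin b ≃ ι),
    (∀ i, sg (e (Sum.inl i)) = true) ∧ ∀ i, sg (e (Sum.inr i)) = false := by
  refine ⟨_, _, (Equiv.sumCongr (equivFin {i // sg i = true}).symm
    (equivFin {i // ¬ sg i = true}).symm).trans (Equiv.sumCompl fun i => sg i = true), fun i => ?_, fun i => ?_⟩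
  · simpa using ((equivFin {i // sg i = true}).symm i).2
  · simpa using ((equivFin {i // ¬ sg i = true}).symm i).2

theorem split_of_sign {sg : ι → Bool} {a b : ℕ} {e : Fin a ⊕ Fin b ≃ ι}
    (h1 : ∀ i, sg (e (Sum.inl i)) = true) (h2 : ∀ i, sg (e (Sum.inr i)) = false) {M : Matrix ι ι ℂ}
    (hM : ∀ i j, sg i ≠ sg j → M i j = 0) {r : ℝ} (h : ReGe (of fun i j => (sgn (sg i) : ℂ) * M i j) r) :
    M.submatrix e e = fromBlocks (M.submatrix (e ∘ Sum.inl) (e ∘ Sum.inl)) 0 0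
      (M.submatrix (e ∘ Sum.inr) (e ∘ Sum.inr)) ∧
    ReGe (M.submatrix (e ∘ Sum.inl) (e ∘ Sum.inl)) r ∧ ReLe (M.submatrix (e ∘ Sum.inr) (e ∘ Sum.inr)) (-r) := by
  refine ⟨?_, ?_, ?_⟩
  · ext (i | i) (j | j)
    · rfl
    · simpa using hM _ _ (by rw [h1, h2]; simp)
    · simpa using hM _ _ (by rw [h1, h2]; simp)
    · rfl
  · convert h.submatrix (f := e ∘ Sum.inl) (e.injective.comp Sum.inl_injective) using 1
    ext i j
    simp [h1, sgn]
  · rw [reLe_iff_reGe_neg, neg_neg]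
    convert h.submatrix (f := e ∘ Sum.inr) (e.injective.comp Sum.inr_injective) using 1
    ext i j
    simp [h2, sgn]

theorem eq_smul_one_of_injective (e : ι ≃ κ) {N : Matrix ι ι ℂ} {W : Matrix ι κ ℂ} {z : ℂ}
    (hW : ∀ w, W *ᵥ w = 0 → w = 0) (h : N * W = z • W) : N = z • 1 := by
  have h1 : IsUnit (W.submatrix id e) := by
    rw [← mulVec_injective_iff_isUnit]
    intro v w hvw
    have h2 : W.submatrix id e *ᵥ (v - w) = 0 := by rw [mulVec_sub, sub_eq_zero]; exact hvw
    rw [submatrix_mulVec_equiv] at h2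
    ext i
    simpa [sub_eq_zero] using congrFun (hW _ h2) (e i)
  have h2 : N * W.submatrix id e = (z • (1 : Matrix ι ι ℂ)) * W.submatrix id e := by
    rw [smul_mul, Matrix.one_mul]
    exact congrArg (fun Z => Z.submatrix id e) h
  exact h1.mul_right_cancel h2

end Forms

theorem SBar.bounds {k : ℕ} {c : ℝ} (hc : 0 ≤ c) {p : Pt k} (h : p ∈ SBar k c) :
    0 ≤ p.1 ∧ -(c * p.1) ≤ p.2.2.1 := by
  obtain ⟨h1, h2, h3⟩ := h
  refine ⟨h1, le_trans ?_ h3⟩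
  have h4 : 0 ≤ p.2.1 ^ 2 + ∑ j, p.2.2.2 j ^ 2 := by positivity
  have h5 : p.2.1 ^ 2 + ∑ j, p.2.2.2 j ^ 2 ≤ 1 := by
    rw [OnSphere] at h2
    nlinarith [sq_nonneg p.2.2.1]
  have h6 : kappa (√p.1 * √(p.2.1 ^ 2 + ∑ j, p.2.2.2 j ^ 2)) ≤ p.1 := by
    rw [kappa, mul_pow, sq_sqrt h1, sq_sqrt h4, div_le_iff₀ (by positivity)]
    nlinarith [mul_nonneg h1 h4, mul_nonneg h1 (mul_nonneg h1 h4)]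
  nlinarith

section

variable {n k : ℕ} {E : Endstate n k} {c b : ℝ} {ζ₀ : Freq k} {x₀ : ℝ} {l m : ℕ}
  {e : ℕ → (Fin k → ℝ) → Matrix (Fin n) (Fin m) ℂ}
  {Lf : (Fin k → ℝ) → Matrix (Fin m) (Fin n) ℂ} {M : Matrix (Fin m) (Fin m) ℂ} {α : ℝ}
  {ι : Type*} [Fintype ι] [DecidableEq ι] {u : Pt k → Matrix (Fin n) ι ℂ} {q : Pt k → Matrix ι ι ℂ}

theorem Chain.exists_simple_root (hC : Chain E ζ₀.1 x₀ ζ₀.2.2 l 1 m (fun _ => x₀) e Lf M α) :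
    ∃ ψ : ℝ × (Fin k → ℝ) → ℝ, Tendsto ψ (𝓝 (ζ₀.1, ζ₀.2.2)) (𝓝 x₀) ∧
      ∀ᶠ t in 𝓝 (ζ₀.1, ζ₀.2.2), E.a l (vecCons (ψ t) t.2) = t.1 := by
  have hm : ContDiffAt ℝ ω (fun p : (ℝ × (Fin k → ℝ)) × ℝ => (p.2, p.1.2)) ((ζ₀.1, ζ₀.2.2), x₀) :=
    (contDiff_snd.prodMk (contDiff_snd.comp contDiff_fst)).contDiffAt
  have hΦ : ContDiffAt ℝ ω (fun p : (ℝ × (Fin k → ℝ)) × ℝ => E.a l (vecCons p.2 p.1.2) - p.1.1)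
      ((ζ₀.1, ζ₀.2.2), x₀) := by
    refine ContDiffAt.sub ?_ (contDiff_fst.comp contDiff_fst).contDiffAt
    have h1 : ContDiffAt ℝ ω (fun q : ℝ × (Fin k → ℝ) => E.a l (vecCons q.1 q.2)) (x₀, ζ₀.2.2) :=
      ContDiffAt.comp (x₀, ζ₀.2.2) (g := E.a l) (f := fun q : ℝ × (Fin k → ℝ) => vecCons q.1 q.2) hC.smooth_a
        Endstate.contDiff_vecCons.contDiffAt
    exact ContDiffAt.comp ((ζ₀.1, ζ₀.2.2), x₀) (g := fun q : ℝ × (Fin k → ℝ) => E.a l (vecCons q.1 q.2))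
      (f := fun p : (ℝ × (Fin k → ℝ)) × ℝ => (p.2, p.1.2)) h1 hm
  have hd : HasDerivAt (fun y => E.a l (vecCons y ζ₀.2.2)) (E.dA l 1 x₀ ζ₀.2.2) x₀ := by
    have h2 : ContDiffAt ℝ ω (fun y : ℝ => vecCons y ζ₀.2.2) x₀ :=
      ContDiffAt.comp x₀ (g := fun q : ℝ × (Fin k → ℝ) => vecCons q.1 q.2) (f := fun y : ℝ => (y, ζ₀.2.2))
        Endstate.contDiff_vecCons.contDiffAt (contDiffAt_id.prodMk contDiffAt_const)
    have h3 := ((ContDiffAt.comp x₀ (g := E.a l) (f := fun y : ℝ => vecCons y ζ₀.2.2) hC.smooth_a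
      h2).differentiableAt (by simp)).hasDerivAt
    rw [Endstate.dA, iteratedDeriv_one]
    exact h3
  obtain ⟨ψ, h1, h2, h3⟩ := exists_implicit_function _ (ζ₀.1, ζ₀.2.2) x₀ hΦ (by simp [hC.value]) (by
    intro w hw
    have h5 : HasDerivAt (fun t : ℝ => x₀ + t • w) w 0 := by
      simpa using ((hasDerivAt_id (0 : ℝ)).smul_const w).const_add x₀
    have h8 : HasDerivAt (fun y => E.a l (vecCons y ζ₀.2.2)) (E.dA l 1 x₀ ζ₀.2.2) (x₀ + (0 : ℝ) • w) := by
      rw [zero_smul, add_zero]; exact hd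
    have h6 := (HasDerivAt.comp (0 : ℝ) (h₂ := fun y => E.a l (vecCons y ζ₀.2.2))
      (h := fun t : ℝ => x₀ + t • w) h8 h5).sub_const ζ₀.1
    exact (mul_eq_zero.1 (h6.unique hw)).resolve_left hC.order.self_of_nhds.2)
  exact ⟨ψ, h1 ▸ h2.continuousAt.tendsto, h3.mono fun t ht => sub_eq_zero.1 ht⟩

theorem norm_sgn (b : Bool) : ‖(sgn b : ℂ)‖ = 1 := by cases b <;> simp [sgn]

theorem hyperbolic_mode (hE : E.Admissible) (hγ : ζ₀.2.1 = 0) (hS : SlowBlock E c ζ₀ x₀ u q)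
    (hC : Chain E ζ₀.1 x₀ ζ₀.2.2 l 1 m (fun _ => x₀) e Lf M α) (hb : 0 < b) (hb1 : b ≤ 1)
    (hM : ReGe M b) (hc : 0 ≤ c) (hcb : c ≤ b / 4) :
    ∃ (T Ti : Matrix ι ι ℂ) (ε : Bool) (c₁ : ℝ), T * Ti = 1 ∧ Ti * T = 1 ∧ 0 < c₁ ∧
      ∀ᶠ p in 𝓝 (0, ζ₀), p ∈ SBar k c →
        ReGe ((sgn ε : ℂ) • (Ti * q p * T)) (c₁ * (p.1 + p.2.2.1)) := by
  obtain ⟨U, N, V, Vi, hN⟩ := exists_normalForm hE hγ hS hC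
  obtain ⟨ψ, hψ, hψa⟩ := hC.exists_simple_root
  have hinv0 := hN.inv.self_of_nhds
  have hvar := hN.variation hE hγ hC (by norm_num : 1 - 1 < 1)
  set V₀ := V ζ₀.2.2 with hV₀
  set Vi₀ := Vi ζ₀.2.2 with hVi₀
  let M' : BMat 1 m := M.submatrix Prod.snd Prod.snd
  have hM' : ReGe M' b := hM.submatrix fun a b h => Prod.ext (Subsingleton.elim _ _) h
  let G : Filter (Pt k) := 𝓝 (0, ζ₀) ⊓ 𝓟 (Reg k c)
  let d : Pt k → ℝ := fun p => |p.2.2.1| + |p.1|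
  have hGn : G ≤ 𝓝 (0, ζ₀) := inf_le_left
  have tη : Tendsto (fun p : Pt k => p.2.2.2) G (𝓝 ζ₀.2.2) :=
    ((continuous_snd.comp (continuous_snd.comp continuous_snd)).tendsto (0, ζ₀)).mono_left hGn
  have tτ : Tendsto (fun p : Pt k => p.2.1) G (𝓝 ζ₀.1) :=
    ((continuous_fst.comp continuous_snd).tendsto (0, ζ₀)).mono_left hGn
  let R : Pt k → BMat 1 m := fun p =>
    N p - N (neutral p.2.1 p.2.2.2) - (α : ℂ)⁻¹ • ((p.2.2.1 : ℂ) • 1 + (p.1 : ℂ) • M')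
  have hR : MLittleO G R d := by
    have ht : Tendsto (fun p : Pt k => (p, p.2.1)) G (pairFilter c ζ₀) :=
      tendsto_inf.2 ⟨(tendsto_id.mono_left hGn).prodMk_nhds tτ,
        tendsto_principal.2 ((eventually_principal.2 fun p hp => hp).filter_mono inf_le_right)⟩
    rintro ⟨i, a⟩ ⟨j, b⟩
    have h1 := (hvar a b).comp_tendsto ht
    rw [show (dist₀ ∘ fun p : Pt k => (p, p.2.1)) = d by funext p; simp [dist₀, d]] at h1
    refine h1.congr_left fun p => ?_
    obtain rfl : i = ⟨1 - 1, by norm_num⟩ := Subsingleton.elim _ _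
    obtain rfl : j = ⟨0, one_pos⟩ := Subsingleton.elim _ _
    have h3 : (1 : BMat 1 m) (⟨1 - 1, by norm_num⟩, a) (⟨0, one_pos⟩, b) =
        (1 : Matrix (Fin m) (Fin m) ℂ) a b := by
      simp [Matrix.one_apply, Prod.ext_iff]
    simp only [Function.comp, R, shadow, mul_firstCols one_pos, M', Matrix.sub_apply, submatrix_apply,
      Matrix.smul_apply, Matrix.add_apply, h3, id, sub_self, ofReal_zero, mul_zero, add_zero]
  have hex : ∀ᶠ p in G, N (neutral p.2.1 p.2.2.2) =
      (I * ((ψ (p.2.1, p.2.2.2) - x₀ : ℝ) : ℂ)) • 1 := by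
    have h1 : Tendsto (fun p : Pt k => (p.2.1, p.2.2.2)) G (𝓝 (ζ₀.1, ζ₀.2.2)) := tτ.prodMk_nhds tη
    filter_upwards [((hψ.comp h1).prodMk_nhds tη).eventually hN.exact, h1.eventually hψa] with p ⟨W, hW1, hW2⟩ hp2
    simp only [Function.comp] at hW2
    rw [hp2] at hW2
    exact eq_smul_one_of_injective (Equiv.uniqueProd (Fin m) (Fin 1)) hW1 hW2
  have hW : Tendsto (fun p : Pt k => Vi p.2.2.2 * V₀) G (𝓝 1) := by
    rw [← hinv0.2]
    exact tendsto_matrix_mul (hN.smooth_Vi.continuousAt.tendsto.comp tη) tendsto_const_nhds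
  have hWi : Tendsto (fun p : Pt k => Vi₀ * V p.2.2.2) G (𝓝 1) := by
    rw [← hinv0.2]
    exact tendsto_matrix_mul tendsto_const_nhds (hN.smooth_V.continuousAt.tendsto.comp tη)
  let R' : Pt k → BMat 1 m := fun p =>
    (p.1 : ℂ) • ((α : ℂ)⁻¹ • (Vi₀ * V p.2.2.2 * M' * (Vi p.2.2.2 * V₀) - M')) +
      Vi₀ * V p.2.2.2 * (R p * (Vi p.2.2.2 * V₀))
  have hR' : MLittleO G R' d := by
    refine MLittleO.add (mLittleO_smul ?_ ?_) (MLittleO.mul_left hWi ?_)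
    · refine IsBigO.of_bound 1 (Eventually.of_forall fun p => ?_)
      simp only [norm_real, norm_eq_abs, one_mul, d]
      rw [abs_of_nonneg (by positivity : (0:ℝ) ≤ |p.2.2.1| + |p.1|)]
      linarith [abs_nonneg p.2.2.1]
    · have h1 := tendsto_matrix_smul (tendsto_const_nhds (x := (α : ℂ)⁻¹) (f := G)) (tendsto_matrix_sub
        (tendsto_matrix_mul (tendsto_matrix_mul hWi (tendsto_const_nhds (x := M'))) hW)
        (tendsto_const_nhds (x := M')))
      rwa [Matrix.one_mul, Matrix.mul_one, sub_self, smul_zero] at h1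
    · intro i j
      simp only [Matrix.mul_apply]
      refine IsLittleO.fun_sum fun a _ => ?_
      have h1 : Tendsto (fun p : Pt k => (Vi p.2.2.2 * V₀) a j) G (𝓝 _) := tendsto_matrix.1 hW a j
      simpa [Matrix.mul_apply] using (hR i a).mul_isBigO (h1.isBigO_one ℝ)
  have hrep : ∀ᶠ p in G, Vi₀ * q p * V₀ = (I * ψ (p.2.1, p.2.2.2)) • 1 +
      (α : ℂ)⁻¹ • ((p.2.2.1 : ℂ) • 1 + (p.1 : ℂ) • M') + R' p := by
    filter_upwards [hex, tη.eventually hN.inv] with p hp hi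
    have h1 : q p = V p.2.2.2 * (N p + (I * x₀) • 1) * Vi p.2.2.2 := by
      rw [hN.conj p, Matrix.mul_add, Matrix.add_mul, ← Matrix.mul_assoc, ← Matrix.mul_assoc, hi.1,
        Matrix.one_mul, Matrix.mul_assoc, hi.1, Matrix.mul_one, Matrix.mul_smul, Matrix.mul_one,
        smul_mul, hi.1, sub_add_cancel]
    have h2 : N p = (I * ((ψ (p.2.1, p.2.2.2) - x₀ : ℝ) : ℂ)) • 1 +
        (α : ℂ)⁻¹ • ((p.2.2.1 : ℂ) • 1 + (p.1 : ℂ) • M') + R p := by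
      simp only [R]; rw [hp]; abel
    have h3 : Vi₀ * V p.2.2.2 * (Vi p.2.2.2 * V₀) = 1 := by
      rw [Matrix.mul_assoc, ← Matrix.mul_assoc (V _), hi.1, Matrix.one_mul, hinv0.2]
    have h4 : Vi₀ * q p * V₀ = Vi₀ * V p.2.2.2 * (N p + (I * x₀) • 1) * (Vi p.2.2.2 * V₀) := by
      rw [h1]; simp only [Matrix.mul_assoc]
    rw [h4, h2]
    simp only [R']
    generalize Vi₀ * V p.2.2.2 = A at *
    generalize Vi p.2.2.2 * V₀ = B at *
    simp only [Matrix.mul_add, Matrix.add_mul, Matrix.mul_smul, smul_mul, Matrix.mul_one, h3,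
      smul_sub, smul_add, Matrix.mul_assoc]
    push_cast
    module
  obtain ⟨σ⟩ : Nonempty (ι ≃ Fin 1 × Fin m) := by
    refine ⟨(exists_equiv_of_bijective (V := V₀) (fun w hw => ?_) fun y => ⟨Vi₀ *ᵥ y, ?_⟩).some.symm⟩
    · have := congrArg (fun y => Vi₀ *ᵥ y) hw
      simpa [mulVec_mulVec, hinv0.2] using this
    · rw [mulVec_mulVec, hinv0.1, one_mulVec]
  have hα := hC.coeff_ne
  let ε : Bool := decide (0 < α)
  have hεα : sgn ε * α⁻¹ = |α|⁻¹ := by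
    by_cases h : 0 < α
    · simp [ε, h, sgn, abs_of_pos h]
    · have h' : α < 0 := lt_of_le_of_ne (not_lt.1 h) hα
      simp [ε, h, sgn, abs_of_neg h']
  set C := (card (Fin 1 × Fin m) : ℝ) with hCdef
  let δ : ℝ := |α|⁻¹ * b / (16 * (C + 1))
  have hδ : 0 < δ := by positivity
  refine ⟨V₀.submatrix id σ, Vi₀.submatrix σ id, ε, |α|⁻¹ * (b / 4), ?_, ?_, by positivity, ?_⟩
  · rw [submatrix_mul_equiv, hinv0.1, submatrix_id_id]
  · rw [← submatrix_mul Vi₀ V₀ σ id σ bijective_id, hinv0.2, submatrix_one_equiv]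
  have hsmall : ∀ᶠ p in G, ∀ i j, ‖R' p i j‖ ≤ δ * ‖d p‖ := by
    simp only [eventually_all]
    exact fun i j => (hR' i j).def hδ
  filter_upwards [eventually_inf_principal.1 (hrep.and hsmall)] with p hp hps
  obtain ⟨h1, h2⟩ := hp (Or.inl hps)
  obtain ⟨hρ, hγρ⟩ := SBar.bounds hc hps
  have hd : ‖d p‖ ≤ 2 * (p.1 + p.2.2.1) := by
    simp only [d]
    rw [norm_of_nonneg (by positivity), abs_of_nonneg hρ]
    have : |p.2.2.1| ≤ p.1 + 2 * p.2.2.1 + 2 * (c * p.1) - p.1 + (c * p.1) := by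
      rw [abs_le]; constructor <;> nlinarith [mul_nonneg hc hρ]
    nlinarith [mul_nonneg hc hρ]
  have h5 : ReGe ((sgn ε : ℂ) • (Vi₀ * q p * V₀)) (0 + |α|⁻¹ * (p.2.2.1 + p.1 * b) + -(C * (δ * ‖d p‖))) := by
    have h4 : (sgn ε : ℂ) • (Vi₀ * q p * V₀) = ((sgn ε * ψ (p.2.1, p.2.2.2) : ℝ) * I) • 1 +
        ((|α|⁻¹ : ℝ) : ℂ) • ((p.2.2.1 : ℂ) • 1 + (p.1 : ℂ) • M') + (sgn ε : ℂ) • R' p := by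
      rw [h1, ← hεα]; push_cast; module
    rw [h4]
    refine ReGe.add (ReGe.add ?_ (ReGe.smul (ReGe.add ?_ (hM'.smul hρ)) (by positivity))) (reGe_of_entries ?_)
    · have := reGe_scalar (ι := Fin 1 × Fin m) ((sgn ε * ψ (p.2.1, p.2.2.2) : ℝ) * I)
      rwa [re_ofReal_mul, I_re, mul_zero] at this
    · exact reGe_scalar (ι := Fin 1 × Fin m) (p.2.2.1 : ℂ)
    · intro i j
      rw [Matrix.smul_apply, norm_smul, norm_sgn, one_mul]
      exact h2 i j
  have h6 : ReGe ((sgn ε : ℂ) • (Vi₀.submatrix σ id * q p * V₀.submatrix id σ)) _ :=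
    h5.submatrix (f := σ) σ.injective
  refine h6.mono ?_
  have h7 : C * (δ * ‖d p‖) ≤ |α|⁻¹ * (b / 8 * (p.1 + p.2.2.1)) := by
    have h8 : C * δ ≤ |α|⁻¹ * (b / 16) := by
      simp only [δ]
      rw [← mul_div_assoc, div_le_iff₀ (by positivity)]
      have : 0 < |α|⁻¹ * b := by positivity
      nlinarith
    calc C * (δ * ‖d p‖) = C * δ * ‖d p‖ := by ring
      _ ≤ |α|⁻¹ * (b / 16) * (2 * (p.1 + p.2.2.1)) :=
        mul_le_mul h8 hd (norm_nonneg _) (by positivity)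
      _ = _ := by ring
  have h9 : b / 4 * (p.1 + p.2.2.1) + b / 8 * (p.1 + p.2.2.1) ≤ p.2.2.1 + p.1 * b := by
    have : 0 ≤ (1 - 3 / 8 * b) * (p.2.2.1 + c * p.1) := mul_nonneg (by linarith) (by linarith)
    have : 0 ≤ (1 - 3 / 8 * b) * ((b / 4 - c) * p.1) := mul_nonneg (by linarith) (mul_nonneg (by linarith) hρ)
    have : 0 ≤ b * b * p.1 := by positivity
    have : 0 ≤ b * p.1 := by positivity
    nlinarith
  have h10 : 0 < |α|⁻¹ := by positivity
  nlinarith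

end


/-! ### Perturbation of block companion matrices -/

section

variable {Y : Type*} {G : Filter Y}

theorem reGe_of_tendsto_diagonal {ι : Type*} [Fintype ι] [DecidableEq ι] {z : ι → ℂ}
    {f : Y → Matrix ι ι ℂ} (hf : Tendsto f G (𝓝 (diagonal z))) (hz : ∀ i, 0 < (z i).re) :
    ∃ c > 0, ∀ᶠ p in G, ReGe (f p) c := by
  obtain ⟨c, hc, hcz⟩ := exists_pos_le (fun i => (z i).re) hz
  let δ := c / (2 * (card ι + 1))
  have hδ : 0 < δ := by positivity
  refine ⟨c / 2, by positivity, ?_⟩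
  have h1 : ∀ᶠ p in G, ∀ i j, ‖(f p - diagonal z) i j‖ ≤ δ := by
    simp only [eventually_all]
    intro i j
    filter_upwards [Metric.tendsto_nhds.1 (tendsto_matrix.1 hf i j) δ hδ] with p hp
    rw [dist_eq_norm] at hp
    exact hp.le
  filter_upwards [h1] with p hp
  have h2 := (reGe_diagonal hcz).add (reGe_of_entries hp)
  rw [add_sub_cancel] at h2
  refine h2.mono ?_
  have : (card ι : ℝ) * δ ≤ c / 2 := by
    simp only [δ]
    rw [← mul_div_assoc, div_le_div_iff₀ (by positivity) (by positivity)]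
    nlinarith
  linarith

theorem reGe_blockDiagonal' {o : Type*} [Fintype o] [DecidableEq o] {m : o → Type*}
    [∀ j, Fintype (m j)] [∀ j, DecidableEq (m j)] {M : ∀ j, Matrix (m j) (m j) ℂ} {r : ℝ}
    (h : ∀ j, ReGe (M j) r) : ReGe (blockDiagonal' M) r := by
  rw [reGe_iff]
  intro x
  have h1 : qform (blockDiagonal' M) x = ∑ j, qform (M j) fun a => x ⟨j, a⟩ := by
    rw [qform, dotProduct, sum_sigma]
    refine sum_congr rfl fun j _ => ?_
    rw [qform, dotProduct]
    refine sum_congr rfl fun a _ => ?_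
    rw [BlockDecomposition.blockDiagonal'_mulVec]
    rfl
  rw [h1, re_sum, sum_sigma, mul_sum]
  exact sum_le_sum fun j _ => reGe_iff.1 (h j) _

theorem reGe_of_blocks {s m : ℕ} {M : BMat s m} {r : ℝ}
    (hM : ∀ i j, i.1 ≠ j.1 → M i j = 0) (h : ∀ k, ReGe (M.submatrix (fun a => (k, a)) fun a => (k, a)) r) :
    ReGe M r := by
  have h1 := (reGe_blockDiagonal' h).submatrix (f := (Equiv.sigmaEquivProd (Fin s) (Fin m)).symm)
    (Equiv.injective _)
  convert h1 using 1
  ext ⟨k, a⟩ ⟨k', b⟩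
  by_cases hk : k = k'
  · subst hk
    simp [blockDiagonal'_apply]
  · rw [hM _ _ hk]
    simp [blockDiagonal'_apply, hk]

/-- The euclidean norm. -/
noncomputable def enorm₂ {ι : Type*} [Fintype ι] (v : ι → ℂ) : ℝ := ‖WithLp.toLp 2 v‖

theorem enorm₂_mulVec {ι κ : Type*} [Fintype ι] [Fintype κ] [DecidableEq κ] (A : Matrix ι κ ℂ) (v : κ → ℂ) :
    enorm₂ (A *ᵥ v) ≤ ‖A‖ * enorm₂ v := l2_opNorm_mulVec A (WithLp.toLp 2 v)

theorem enorm₂_add {ι : Type*} [Fintype ι] (v w : ι → ℂ) : enorm₂ (v + w) ≤ enorm₂ v + enorm₂ w :=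
  norm_add_le (WithLp.toLp 2 v) (WithLp.toLp 2 w)

theorem enorm₂_sq {ι : Type*} [Fintype ι] (v : ι → ℂ) : enorm₂ v ^ 2 = ∑ i, ‖v i‖ ^ 2 :=
  EuclideanSpace.norm_sq_eq _

theorem enorm₂_nonneg {ι : Type*} [Fintype ι] (v : ι → ℂ) : 0 ≤ enorm₂ v := norm_nonneg _

theorem enorm₂_le {ι κ : Type*} [Fintype ι] [Fintype κ] {v : ι → ℂ} {w : κ → ℂ}
    (h : ∑ i, ‖v i‖ ^ 2 ≤ ∑ i, ‖w i‖ ^ 2) : enorm₂ v ≤ enorm₂ w := by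
  rw [← enorm₂_sq, ← enorm₂_sq] at h
  exact (pow_le_pow_iff_left₀ (enorm₂_nonneg _) (enorm₂_nonneg _) two_ne_zero).1 h

/-- A lower bound persists under perturbation. -/
theorem lower_bound_of_tendsto {ι κ : Type*} [Fintype ι] [Fintype κ] [DecidableEq κ] [DecidableEq ι]
    {S : Y → Matrix ι κ ℂ} {S₀ : Matrix ι κ ℂ} (hS : Tendsto S G (𝓝 S₀)) (hinj : ∀ v, S₀ *ᵥ v = 0 → v = 0) :
    ∃ K > 0, ∀ᶠ p in G, ∀ v, enorm₂ v ≤ K * enorm₂ (S p *ᵥ v) := by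
  have h1 := pinv_mul (gram_det_ne_zero hinj)
  set L := pinv S₀
  have h2 : Tendsto (fun p => S₀ - S p) G (𝓝 0) := by
    simpa only [sub_self] using tendsto_matrix_sub (tendsto_const_nhds (x := S₀)) hS
  have h3 := Metric.tendsto_nhds.1 h2 (1 / (2 * (‖L‖ + 1))) (by positivity)
  refine ⟨2 * (‖L‖ + 1), by positivity, ?_⟩
  filter_upwards [h3] with p hp v
  rw [dist_zero_right, lt_div_iff₀ (by positivity)] at hp
  have h4 : v = L *ᵥ (S p *ᵥ v + (S₀ - S p) *ᵥ v) := by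
    rw [← add_mulVec, add_sub_cancel, mulVec_mulVec, h1, one_mulVec]
  have h5 : enorm₂ v ≤ ‖L‖ * (enorm₂ (S p *ᵥ v) + ‖S₀ - S p‖ * enorm₂ v) := by
    conv_lhs => rw [h4]
    refine (enorm₂_mulVec _ _).trans (mul_le_mul_of_nonneg_left ?_ (norm_nonneg _))
    exact (enorm₂_add _ _).trans (add_le_add le_rfl (enorm₂_mulVec _ _))
  have h6 := enorm₂_nonneg v
  have h7 := enorm₂_nonneg (S p *ᵥ v)
  have h8 := norm_nonneg L
  have h9 := norm_nonneg (S₀ - S p)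
  nlinarith [mul_nonneg h8 h7, mul_nonneg h8 (mul_nonneg h9 h6), mul_nonneg h9 h6]

end

section Companion

variable {s m : ℕ} {c : ℂ} {w : Fin m → ℂ} {y : Fin s → Fin m → ℂ}

/-- A diagonal block in the lower left corner. -/
def corner (s : ℕ) (w : Fin m → ℂ) : BMat s m :=
  of fun i j => if (i.1 : ℕ) + 1 = s ∧ (j.1 : ℕ) = 0 ∧ i.2 = j.2 then w i.2 else 0

/-- The eigenvectors of a block companion matrix. -/
noncomputable def eigR (c : ℂ) (y : Fin s → Fin m → ℂ) : BMat s m :=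
  of fun i j => if i.2 = j.2 then (y j.1 j.2 / c) ^ (i.1 : ℕ) else 0

/-- The inverse of the matrix of eigenvectors. -/
noncomputable def eigRi (c : ℂ) (y : Fin s → Fin m → ℂ) : BMat s m :=
  of fun i j => if i.2 = j.2 then (s : ℂ)⁻¹ * (c / y i.1 i.2) ^ (j.1 : ℕ) else 0

variable (hc : c ≠ 0) (hy : ∀ k a, y k a ≠ 0) (hys : ∀ k a, y k a ^ s = c ^ (s - 1) * w a)
  (hd : ∀ k k' a a', k ≠ k' → y k a ≠ y k' a')

include hc hy hys hd in
theorem eigRi_mul : eigRi c y * eigR c y = 1 := by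
  ext ⟨k, a⟩ ⟨k', b⟩
  have hs : s ≠ 0 := by have := k.2; omega
  rw [Matrix.mul_apply, sum_prod_type]
  have h1 : ∀ i : Fin s, ∑ e : Fin m, eigRi c y (k, a) (i, e) * eigR c y (i, e) (k', b) =
      if a = b then (s : ℂ)⁻¹ * (y k' b / y k a) ^ (i : ℕ) else 0 := by
    intro i
    rw [sum_eq_single a]
    · simp only [eigRi, eigR, of_apply, if_true]
      split_ifs with hab
      · rw [mul_assoc, ← mul_pow]
        congr 2
        have := hy k a
        field_simp
      · ring
    · intro e _ he
      simp [eigRi, Ne.symm he]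
    · simp
  simp only [h1]
  by_cases hab : a = b
  · subst hab
    simp only [if_true, ← mul_sum, Fin.sum_univ_eq_sum_range (fun i => (y k' a / y k a) ^ i)]
    by_cases hk : k = k'
    · subst hk
      have hs' : (s : ℂ) ≠ 0 := by exact_mod_cast hs
      simp [div_self (hy k a), hs']
    · have hz : y k' a / y k a ≠ 1 := by
        rw [Ne, div_eq_one_iff_eq (hy k a)]
        exact (hd k k' a a hk).symm
      have hz1 : (y k' a / y k a) ^ s = 1 := by
        rw [div_pow, hys, hys, div_self]
        rw [← hys k a]; exact pow_ne_zero _ (hy k a)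
      rw [geom_sum_eq hz, hz1]
      simp [hk]
  · simp [hab]

include hc hys in
theorem companion_mul_eigR : (c • shiftMat s m + corner s w) * eigR c y =
    eigR c y * (diagonal (fun i => y i.1 i.2) : BMat s m) := by
  ext ⟨i, a⟩ ⟨k, b⟩
  refine Eq.trans ?_ (mul_diagonal _ _ _ _).symm
  have hs : 0 < s := by have := k.2; omega
  rw [Matrix.add_mul, Matrix.add_apply, smul_mul, Matrix.smul_apply, smul_eq_mul]
  by_cases hi : (i : ℕ) + 1 = s
  · have h1 : (shiftMat s m * eigR c y) (i, a) (k, b) = 0 := by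
      rw [Matrix.mul_apply]
      refine sum_eq_zero fun x _ => ?_
      rw [shiftMat, of_apply, if_neg fun h => ?_, zero_mul]
      have := x.1.2
      have := h.1
      simp only at this
      omega
    have h2 : (corner s w * eigR c y) (i, a) (k, b) = w a * eigR c y (⟨0, hs⟩, a) (k, b) := by
      rw [Matrix.mul_apply, sum_eq_single ((⟨0, hs⟩ : Fin s), a)]
      · simp [corner, hi]
      · rintro ⟨x, e⟩ - hne
        rw [corner, of_apply, if_neg, zero_mul]
        rintro ⟨-, h3, h4⟩
        exact hne (Prod.ext (Fin.ext h3) h4.symm)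
      · simp
    rw [h1, h2]
    simp only [eigR, of_apply]
    split_ifs with hab
    · subst hab
      have h3 := hys k a
      have h4 : (i : ℕ) = s - 1 := by omega
      have h5 : y k a ^ (s - 1) * y k a = c ^ (s - 1) * w a := by
        rw [← pow_succ, Nat.sub_add_cancel hs, h3]
      have h6 : (y k a / c) ^ (s - 1) * y k a = w a := by
        rw [div_pow, div_mul_eq_mul_div, h5]
        field_simp
      rw [h4, h6]
      simp
    · simp
  · have h1 : (shiftMat s m * eigR c y) (i, a) (k, b) = eigR c y (⟨i + 1, by omega⟩, a) (k, b) := by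
      rw [Matrix.mul_apply, sum_eq_single ((⟨i + 1, by omega⟩ : Fin s), a)]
      · simp [shiftMat]
      · rintro ⟨x, e⟩ - hne
        rw [shiftMat, of_apply, if_neg, zero_mul]
        rintro ⟨h3, h4⟩
        exact hne (Prod.ext (Fin.ext h3) h4.symm)
      · simp
    have h2 : (corner s w * eigR c y) (i, a) (k, b) = 0 := by
      rw [Matrix.mul_apply]
      refine sum_eq_zero fun x _ => ?_
      rw [corner, of_apply, if_neg fun h => hi h.1, zero_mul]
    rw [h1, h2]
    simp only [eigR, of_apply]
    split_ifs with hab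
    · rw [pow_succ]; field_simp; simp
    · simp

theorem eigRi_corner_eigR (hs : 0 < s) (e : Fin m → ℂ) (k : Fin s) (a b : Fin m) :
    (eigRi c y * corner s e * eigR c y) (k, a) (k, b) =
      (diagonal (fun a => (s : ℂ)⁻¹ * (c / y k a) ^ (s - 1) * e a) : Matrix (Fin m) (Fin m) ℂ) a b := by
  have h1 : ∀ x : Fin s × Fin m, (eigRi c y * corner s e) (k, a) x =
      if (x.1 : ℕ) = 0 ∧ a = x.2 then (s : ℂ)⁻¹ * (c / y k a) ^ (s - 1) * e a else 0 := by
    rintro ⟨i, b'⟩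
    rw [Matrix.mul_apply, sum_eq_single ((⟨s - 1, by omega⟩ : Fin s), a)]
    · simp only [eigRi, corner, of_apply, if_true, Nat.sub_add_cancel hs, true_and]
      split_ifs <;> simp
    · rintro ⟨x, f⟩ - hne
      by_cases hf : a = f
      · rw [corner, of_apply, if_neg, mul_zero]
        rintro ⟨h3, -⟩
        exact hne (Prod.ext (Fin.ext (by simp only at h3 ⊢; omega)) hf.symm)
      · simp [eigRi, hf]
    · simp
  rw [Matrix.mul_apply, sum_eq_single ((⟨0, hs⟩ : Fin s), a)]
  · rw [h1]
    simp [eigR, diagonal_apply]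
  · rintro ⟨x, f⟩ - hne
    rw [h1, if_neg, zero_mul]
    rintro ⟨h3, h4⟩
    exact hne (Prod.ext (Fin.ext h3) h4.symm)
  · simp

include hc hd in
/-- The first components of the eigenvectors to few eigenvalues are independent. -/
theorem eigR_inj {sg : Fin s → Bool} {h : ℕ} (hcount : (univ.filter fun k => sg k = false).card ≤ h)
    {v : Fin s × Fin m → ℂ} (hv : ∀ i, sg i.1 = true → v i = 0)
    (h0 : ∀ i : Fin s × Fin m, (i.1 : ℕ) < h → (eigR c y *ᵥ v) i = 0) : v = 0 := by
  have hcs : (univ.filter fun k => sg k = false).card ≤ s := by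
    simpa using Finset.card_filter_le (univ : Finset (Fin s)) fun k => sg k = false
  set S := univ.filter fun k => sg k = false with hS
  let e := S.equivFin
  ext ⟨k, a⟩
  by_cases hk : sg k = true
  · exact hv (k, a) hk
  have hkS : k ∈ S := by simp [hS, hk]
  have h1 := eq_zero_of_forall_pow_sum_mul_pow_eq_zero (R := ℂ)
    (f := fun j : Fin S.card => y (e.symm j) a / c) (v := fun j => v (e.symm j, a)) (fun i j hij => by
      by_contra hne
      have h2 : ((e.symm i : Fin s)) ≠ (e.symm j : Fin s) := fun h =>
        hne (e.symm.injective (Subtype.ext h))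
      exact hd _ _ a a h2 ((div_left_inj' hc).1 hij)) (fun i => by
      have h2 := h0 (⟨i, lt_of_lt_of_le i.2 hcs⟩, a) (lt_of_lt_of_le i.2 hcount)
      rw [mulVec, dotProduct, sum_prod_type] at h2
      have h3 : ∀ x : Fin s, ∑ b, eigR c y (⟨i, lt_of_lt_of_le i.2 hcs⟩, a) (x, b) * v (x, b) =
          v (x, a) * (y x a / c) ^ (i : ℕ) := by
        intro x
        rw [sum_eq_single a]
        · simp [eigR, mul_comm]
        · intro b _ hb
          simp [eigR, Ne.symm hb]
        · simp
      simp only [h3] at h2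
      rw [← h2, ← Finset.sum_subset (Finset.subset_univ S), ← Finset.sum_coe_sort S]
      · exact Fintype.sum_equiv e.symm _ _ fun j => rfl
      · intro x _ hx
        rw [hv (x, a) (by simpa [hS] using hx), zero_mul])
  have h2 := congrFun h1 (e ⟨k, hkS⟩)
  simpa using h2

end Companion


section Splitting

/-- The diagonal block with index `k`. -/
abbrev BMat.block {s m : ℕ} (D : BMat s m) (k : Fin s) : Matrix (Fin m) (Fin m) ℂ := D.submatrix (Prod.mk k) (Prod.mk k)

variable {Y : Type*} {G : Filter Y} {s m : ℕ} {c : ℂ} {w : Fin m → ℂ} {y : Fin s → Fin m → ℂ}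

/-- A block commuting with many eigenvectors is scalar. -/
theorem block_eq_scalar {B T D : BMat s m} (hT : T.det ≠ 0)
    (hBT : B * T = T * D) (hD : ∀ i j, i.1 ≠ j.1 → D i j = 0) {W : Matrix (Fin s × Fin m) (Fin m) ℂ}
    (hW : ∀ v, W *ᵥ v = 0 → v = 0) {z : ℂ} (hBW : B * W = z • W) (k : Fin s)
    (hk : ∀ k' ≠ k, ∀ v, BMat.block D k' *ᵥ v = z • v → v = 0) :
    BMat.block D k = z • 1 := by
  have hu : IsUnit T.det := isUnit_iff_ne_zero.2 hT
  set W' := T⁻¹ * W with hW'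
  have hTW : T * W' = W := by rw [hW', mul_nonsing_inv_cancel_left _ _ hu]
  have hDW : D * W' = z • W' := by
    have h1 : T * (D * W') = T * (z • W') := by
      rw [← Matrix.mul_assoc, ← hBT, Matrix.mul_assoc, hTW, hBW, Matrix.mul_smul, hTW]
    simpa only [nonsing_inv_mul_cancel_left _ _ hu] using congrArg (fun Z : Matrix (Fin s × Fin m) (Fin m) ℂ => T⁻¹ * Z) h1
  have hrow : ∀ k', BMat.block D k' * W'.submatrix (Prod.mk k') id =
      z • W'.submatrix (Prod.mk k') id := by
    intro k'
    ext a b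
    have h1 := congrFun (congrFun hDW (k', a)) b
    rw [Matrix.mul_apply, sum_prod_type, sum_eq_single k'] at h1
    · exact h1
    · intro x _ hx
      exact sum_eq_zero fun e _ => by rw [hD _ _ (Ne.symm hx), zero_mul]
    · simp
  have hz : ∀ k' ≠ k, ∀ a b, W' (k', a) b = 0 := by
    intro k' hk' a b
    have h1 := hk k' hk' (fun a => W' (k', a) b) (by
      ext a
      exact congrFun (congrFun (hrow k') a) b)
    exact congrFun h1 a
  refine eq_smul_one_of_injective (Equiv.refl _) (W := W'.submatrix (Prod.mk k) id) (fun v hv => ?_) (hrow k)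
  refine hW v ?_
  have h1 : W' *ᵥ v = 0 := by
    ext ⟨k', a⟩
    by_cases h : k' = k
    · subst h
      exact congrFun hv a
    · simp [mulVec, dotProduct, hz k' h]
  rw [← hTW, ← mulVec_mulVec, h1, mulVec_zero]

theorem tendsto_submatrix {ι κ ι' κ' : Type*} {f : Y → Matrix ι κ ℂ} {f₀ : Matrix ι κ ℂ}
    (h : Tendsto f G (𝓝 f₀)) (a : ι' → ι) (b : κ' → κ) :
    Tendsto (fun p => (f p).submatrix a b) G (𝓝 (f₀.submatrix a b)) := by
  rw [tendsto_matrix] at *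
  exact fun i j => h _ _

/-- A change of basis of size `K` that splits `X` into blocks with real parts `≥ r` up to the signs `sg`, where the
vectors with components in the negative blocks are controlled by their first `h` components. -/
def SplitBy (sg : Fin s → Bool) (h : ℕ) (X : BMat s m) (K r : ℝ) : Prop :=
  ∃ T Ti : BMat s m, T * Ti = 1 ∧ Ti * T = 1 ∧ ‖T‖ ≤ K ∧ ‖Ti‖ ≤ K ∧ (∀ i j, i.1 ≠ j.1 → (Ti * X * T) i j = 0) ∧
    ReGe (of fun i j => (sgn (sg i.1) : ℂ) * (Ti * X * T) i j) r ∧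
    ∀ v : Fin s × Fin m → ℂ, (∀ i, sg i.1 = true → v i = 0) →
      enorm₂ v ≤ K * enorm₂ fun i => if (i.1 : ℕ) < h then (T *ᵥ v) i else 0

theorem SplitBy.mono {sg : Fin s → Bool} {h : ℕ} {X : BMat s m} {K K' r r' : ℝ} (H : SplitBy sg h X K r)
    (hK : K ≤ K') (hr : r' ≤ r) : SplitBy sg h X K' r' := by
  obtain ⟨T, Ti, h1, h2, h3, h4, h5, h6, h7⟩ := H
  exact ⟨T, Ti, h1, h2, h3.trans hK, h4.trans hK, h5, h6.mono hr, fun v hv =>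
    (h7 v hv).trans (mul_le_mul_of_nonneg_right hK (enorm₂_nonneg _))⟩

/-- Splitting of a perturbed block companion matrix. A block either has definite real part, or it is
compared with a perturbation with an exact imaginary eigenvalue. -/
theorem companion_splitting (hs : 0 < s) {κ : Y → ℝ} (hκ : ∀ᶠ p in G, 0 < κ p ∧ κ p ≤ 1)
    {X X₀ : Y → BMat s m} (hc : c ≠ 0) (hy : ∀ k a, y k a ≠ 0)
    (hys : ∀ k a, y k a ^ s = c ^ (s - 1) * w a) (hd : ∀ k k' a a', k ≠ k' → y k a ≠ y k' a')
    (hX : Tendsto X G (𝓝 (c • shiftMat s m + corner s w)))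
    {sg : Fin s → Bool} {h : ℕ} (hcount : (univ.filter fun k => sg k = false).card ≤ h)
    (hsg : ∀ k, (∀ a, 0 < sgn (sg k) * (y k a).re) ∨ ∃ (e : Fin m → ℂ) (z : ℂ), (∀ a, y k a = z) ∧
      Tendsto X₀ G (𝓝 (c • shiftMat s m + corner s w)) ∧
      Tendsto (fun p => (κ p : ℂ)⁻¹ • (X p - X₀ p)) G (𝓝 (corner s e)) ∧
      (∀ δ > 0, ∀ᶠ p in G, ∃ β : ℝ, ‖I * β - z‖ ≤ δ ∧ ∃ W : Matrix (Fin s × Fin m) (Fin m) ℂ,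
        (∀ v, W *ᵥ v = 0 → v = 0) ∧ X₀ p * W = (I * β) • W) ∧
      ∀ a, 0 < sgn (sg k) * ((s : ℂ)⁻¹ * (c / z) ^ (s - 1) * e a).re) :
    ∃ K c₁ : ℝ, 0 < K ∧ 0 < c₁ ∧ ∀ᶠ p in G, SplitBy sg h (X p) K (c₁ * κ p) := by
  have hRi := eigRi_mul hc hy hys hd
  have hR := mul_eq_one_comm.1 hRi
  have hcR := companion_mul_eigR (m := m) hc hys
  set R := eigR c y with hRdef
  set Ri := eigRi c y with hRidef
  set d : Fin s × Fin m → ℂ := fun i => y i.1 i.2 with hddef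
  obtain ⟨τ, D, hτ0, hD0, hτc, hDc, -, hDoff, hTD, hstr⟩ := exists_blockDiag (Prod.fst : Fin s × Fin m → Fin s) d
    fun i j hij => hd _ _ _ _ hij
  have hconj : ∀ {Z : Y → BMat s m},
      Tendsto Z G (𝓝 (c • shiftMat s m + corner s w)) →
      Tendsto (fun p => Ri * Z p * R) G (𝓝 (diagonal d)) := by
    intro Z hZ
    have h1 := tendsto_matrix_mul (tendsto_matrix_mul (tendsto_const_nhds (x := Ri)) hZ)
      (tendsto_const_nhds (x := R))
    rwa [Matrix.mul_assoc, hcR, ← Matrix.mul_assoc, hRi, Matrix.one_mul] at h1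
  let B : Y → BMat s m := fun p => Ri * X p * R
  have hB : Tendsto B G (𝓝 (diagonal d)) := hconj hX
  rw [ContinuousAt, hD0] at hDc
  rw [ContinuousAt, hτ0] at hτc
  have hDB : Tendsto (fun p => D (B p)) G _ := hDc.comp hB
  have hτB : Tendsto (fun p => τ (B p)) G _ := hτc.comp hB
  have hdiagblock : ∀ k : Fin s, BMat.block (diagonal d) k = diagonal fun a => y k a := by
    intro k
    ext a b
    simp [diagonal_apply, hddef]
  have hblock : ∀ k, ∃ c₁ > 0, ∀ᶠ p in G,
      ReGe ((sgn (sg k) : ℂ) • BMat.block (D (B p)) k) (c₁ * κ p) := by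
    intro k
    rcases hsg k with hA | ⟨e, z, hyz, hX₀, hdiff, hroot, hpos⟩
    · have h1 := tendsto_matrix_smul (tendsto_const_nhds (x := (sgn (sg k) : ℂ)))
        (tendsto_submatrix hDB (Prod.mk k) (Prod.mk k))
      rw [show submatrix _ _ _ = _ from hdiagblock k, ← diagonal_smul] at h1
      obtain ⟨c₁, hc₁, h2⟩ := reGe_of_tendsto_diagonal h1 fun a => by
        simpa [re_ofReal_mul] using hA a
      refine ⟨c₁, hc₁, ?_⟩
      filter_upwards [h2, hκ] with p hp hκp
      exact hp.mono (by nlinarith)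
    · have hB₀ := hconj hX₀
      let B₀ : Y → BMat s m := fun p => Ri * X₀ p * R
      have hq : Tendsto (fun p => (κ p : ℂ)⁻¹ • (B p - B₀ p)) G (𝓝 (Ri * corner s e * R)) := by
        have h1 := tendsto_matrix_mul (tendsto_matrix_mul (tendsto_const_nhds (x := Ri)) hdiff)
          (tendsto_const_nhds (x := R))
        refine h1.congr fun p => ?_
        simp only [B, B₀]
        rw [Matrix.mul_smul, smul_mul, Matrix.mul_sub, Matrix.sub_mul]
      have hscalar : ∀ᶠ p in G, ∃ β : ℝ,
          BMat.block (D (B₀ p)) k = (I * β) • 1 := by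
        obtain ⟨r, hr, hrk⟩ := exists_pos_le (fun t : {k' : Fin s // k' ≠ k} × Fin m => ‖y t.1 t.2 - z‖)
          fun t => norm_pos_iff.2 (sub_ne_zero.2 (by rw [← hyz t.2]; exact hd _ _ _ _ t.1.2))
        have hδ : 0 < r / (4 * (m + 1)) := by positivity
        have h4 : ∀ᶠ p in G, ∀ i j, ‖D (B₀ p) i j - diagonal d i j‖ ≤ r / (4 * (m + 1)) := by
          simp only [eventually_all]
          intro i j
          filter_upwards [Metric.tendsto_nhds.1 (tendsto_matrix.1 (hDc.comp hB₀) i j) _ hδ] with p hp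
          rw [dist_eq_norm] at hp
          exact hp.le
        filter_upwards [hroot (r / 4) (by positivity), hB₀.eventually hTD, h4] with p ⟨β, hβ, W, hW, hXW⟩ h5 h6
        refine ⟨β, block_eq_scalar (W := Ri * W) h5.2 h5.1 (hDoff _) (fun v hv => hW v ?_) ?_ k ?_⟩
        · have h7 := congrArg (fun Z => R *ᵥ Z) hv
          simpa only [mulVec_mulVec, ← Matrix.mul_assoc, hR, Matrix.one_mul, mulVec_zero] using h7
        · rw [Matrix.mul_assoc, ← Matrix.mul_assoc R, hR, Matrix.one_mul, Matrix.mul_assoc, hXW, Matrix.mul_smul]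
        · intro k' hk' v hv
          by_contra hv0
          obtain ⟨a, h8⟩ := eigenvalue_close (d := y k') (fun i j => by
            simpa [hddef, diagonal_apply] using h6 (k', i) (k', j)) hv0 hv
          have h9 := hrk (⟨k', hk'⟩, a)
          have h10 : ‖y k' a - z‖ ≤ ‖I * β - z‖ + ‖I * β - y k' a‖ := by
            rw [norm_sub_rev _ (y k' a), add_comm]
            exact norm_sub_le_norm_sub_add_norm_sub _ _ _
          have h11 : (m : ℝ) * (r / (4 * (m + 1))) ≤ r / 4 := by
            rw [← mul_div_assoc, div_le_div_iff₀ (by positivity) (by positivity)]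
            nlinarith
          rw [card_fin] at h8
          linarith
      have hder : Tendsto (fun p => (κ p : ℂ)⁻¹ • (BMat.block (D (B p)) k - BMat.block (D (B₀ p)) k)) G
          (𝓝 (diagonal fun a => (s : ℂ)⁻¹ * (c / z) ^ (s - 1) * e a)) := by
        rw [tendsto_matrix]
        intro a b
        have h1 := tendsto_matrix.1 hq (k, a) (k, b)
        have h0 : (Ri * corner s e * R) (k, a) (k, b) =
            (diagonal (fun a => (s : ℂ)⁻¹ * (c / z) ^ (s - 1) * e a) : Matrix (Fin m) (Fin m) ℂ) a b := by
          rw [eigRi_corner_eigR hs]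
          simp only [hyz]
        rw [h0] at h1
        have h3 : Tendsto (fun p => (κ p : ℂ)⁻¹ * (D (B p) (k, a) (k, b) - D (B₀ p) (k, a) (k, b)) -
            (κ p : ℂ)⁻¹ * (B p (k, a) (k, b) - B₀ p (k, a) (k, b))) G (𝓝 0) := by
          rw [Metric.tendsto_nhds]
          intro δ hδ
          set C := ‖Ri * corner s e * R‖ + 1 with hCdef
          have hC : 0 < C := by positivity
          filter_upwards [(hB.prodMk_nhds hB₀).eventually (hstr (δ / (2 * C)) (by positivity)), hκ,
            hq.norm.eventually_lt_const (lt_add_one _)] with p h4 h5 h6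
          rw [dist_zero_right, ← mul_sub, norm_mul, norm_inv, norm_real, norm_of_nonneg h5.1.le]
          rw [norm_smul, norm_inv, norm_real, norm_of_nonneg h5.1.le] at h6
          have h7 := h4 (k, a) (k, b) rfl
          have h8 : (κ p)⁻¹ * ‖D (B p) (k, a) (k, b) - D (B₀ p) (k, a) (k, b) -
              (B p (k, a) (k, b) - B₀ p (k, a) (k, b))‖ ≤ (κ p)⁻¹ * (δ / (2 * C) * ‖B p - B₀ p‖) :=
            mul_le_mul_of_nonneg_left h7 (inv_nonneg.2 h5.1.le)
          refine lt_of_le_of_lt h8 ?_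
          calc (κ p)⁻¹ * (δ / (2 * C) * ‖B p - B₀ p‖) = δ / (2 * C) * ((κ p)⁻¹ * ‖B p - B₀ p‖) := by ring
            _ ≤ δ / (2 * C) * C := mul_le_mul_of_nonneg_left h6.le (by positivity)
            _ = δ / 2 := by field_simp
            _ < δ := by linarith
        have h4 := h3.add h1
        rw [zero_add] at h4
        refine h4.congr fun p => ?_
        simp only [Matrix.smul_apply, Matrix.sub_apply, submatrix_apply, smul_eq_mul]
        ring
      have h1 := tendsto_matrix_smul (tendsto_const_nhds (x := (sgn (sg k) : ℂ))) hder
      rw [← diagonal_smul] at h1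
      obtain ⟨c₁, hc₁, h2⟩ := reGe_of_tendsto_diagonal h1 fun a => by
        simpa [re_ofReal_mul] using hpos a
      refine ⟨c₁, hc₁, ?_⟩
      filter_upwards [h2, hκ, hscalar] with p h3 h4 h5
      obtain ⟨β, hβ⟩ := h5
      have h6 := (reGe_scalar (ι := Fin m) (((sgn (sg k) * β : ℝ) : ℂ) * I)).add (h3.smul h4.1.le)
      rw [re_ofReal_mul, I_re, mul_zero, zero_add, mul_comm (κ p)] at h6
      convert h6 using 1
      rw [hβ, smul_smul, smul_smul, mul_right_comm, mul_inv_cancel₀ (by exact_mod_cast h4.1.ne'), one_mul,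
        smul_sub, smul_smul]
      push_cast
      module
  choose ck hck hckev using hblock
  obtain ⟨c₁, hc₁, hc₁k⟩ := exists_pos_le ck hck
  let S : BMat s m → Matrix ((Fin s × Fin m) ⊕ (Fin s × Fin m)) (Fin s × Fin m) ℂ :=
    fun T => of fun i j => Sum.elim (fun i : Fin s × Fin m => if (i.1 : ℕ) < h then T i j else 0)
      (fun i : Fin s × Fin m => if sg i.1 = true then (if i = j then 1 else 0) else 0) i
  have hS1 : ∀ T v i, (S T *ᵥ v) (Sum.inl i) = if (i.1 : ℕ) < h then (T *ᵥ v) i else 0 := by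
    intro T v i
    simp only [S, mulVec, dotProduct, of_apply, Sum.elim_inl]
    split_ifs <;> simp
  have hS2 : ∀ T v i, (S T *ᵥ v) (Sum.inr i) = if sg i.1 = true then v i else 0 := by
    intro T v i
    simp only [S, mulVec, dotProduct, of_apply, Sum.elim_inr]
    split_ifs <;> simp
  have hT : Tendsto (fun p => R * τ (B p)) G (𝓝 R) := by
    simpa only [Matrix.mul_one] using tendsto_matrix_mul (tendsto_const_nhds (x := R)) hτB
  have hST : Tendsto (fun p => S (R * τ (B p))) G (𝓝 (S R)) := by
    rw [tendsto_matrix]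
    rintro (i | i) j
    · simp only [S, of_apply, Sum.elim_inl]
      split_ifs
      · exact tendsto_matrix.1 hT i j
      · exact tendsto_const_nhds
    · exact tendsto_const_nhds
  obtain ⟨K₁, hK₁, hlow⟩ := lower_bound_of_tendsto hST (fun v hv => by
    refine eigR_inj hc hd hcount (fun i hi => ?_) fun i hi => ?_
    · have := congrFun hv (Sum.inr i)
      rwa [hS2, if_pos hi] at this
    · have := congrFun hv (Sum.inl i)
      rwa [hS1, if_pos hi] at this)
  have hTi : Tendsto (fun p => (τ (B p))⁻¹ * Ri) G (𝓝 Ri) := by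
    have h2 := NormedRing.inverse_continuousAt (1 : (BMat s m)ˣ)
    rw [show (Ring.inverse : BMat s m → _) = fun M => M⁻¹ from funext fun M => (nonsing_inv_eq_ringInverse M).symm,
      ContinuousAt, Units.val_one, inv_one] at h2
    simpa only [Matrix.one_mul, Function.comp_def] using tendsto_matrix_mul (h2.comp hτB) (tendsto_const_nhds (x := Ri))
  refine ⟨max K₁ (max (‖R‖ + 1) (‖Ri‖ + 1)), c₁, lt_of_lt_of_le hK₁ (le_max_left _ _), hc₁, ?_⟩
  filter_upwards [eventually_all.2 hckev, hlow, hB.eventually hTD, hκ,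
    hT.norm.eventually_lt_const (lt_add_one _), hTi.norm.eventually_lt_const (lt_add_one _)]
    with p h1 h2 h3 h4 h5 h6
  have hu : IsUnit (τ (B p)).det := isUnit_iff_ne_zero.2 h3.2
  have hD : (τ (B p))⁻¹ * Ri * X p * (R * τ (B p)) = D (B p) := by
    rw [← nonsing_inv_mul_cancel_left _ (D (B p)) hu, ← h3.1]
    simp only [B, Matrix.mul_assoc]
  refine ⟨R * τ (B p), (τ (B p))⁻¹ * Ri, ?_, ?_, ?_, ?_, ?_, ?_, fun v hv => ?_⟩
  · rw [Matrix.mul_assoc, ← Matrix.mul_assoc (τ (B p)), mul_nonsing_inv _ hu, Matrix.one_mul, hR]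
  · rw [Matrix.mul_assoc, ← Matrix.mul_assoc Ri, hRi, Matrix.one_mul, nonsing_inv_mul _ hu]
  · exact h5.le.trans ((le_max_left _ _).trans (le_max_right _ _))
  · exact h6.le.trans ((le_max_right _ _).trans (le_max_right _ _))
  · rw [hD]; exact hDoff _
  · rw [hD]
    refine reGe_of_blocks (fun i j hij => ?_) fun k => ?_
    · rw [of_apply, hDoff _ _ _ hij, mul_zero]
    · exact (h1 k).mono (mul_le_mul_of_nonneg_right (hc₁k k) h4.1.le)
  · refine (h2 v).trans (mul_le_mul (le_max_left _ _) (enorm₂_le ?_) (enorm₂_nonneg _)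
      (hK₁.le.trans (le_max_left _ _)))
    rw [sum_sum_type]
    simp only [hS1, hS2]
    have (i : Fin s × Fin m) : ‖(if sg i.1 = true then v i else 0)‖ ^ 2 = 0 := by
      split_ifs with hi <;> simp [hv, *]
    simp only [this, Finset.sum_const_zero, add_zero, le_refl]

end Splitting


theorem taylor_of_flat {f : ℝ → ℝ} {x₀ x : ℝ} {s : ℕ} (hs : 1 ≤ s) (hx : x₀ ≠ x)
    (hf : ∀ y ∈ Set.uIcc x₀ x, ContDiffAt ℝ ω f y) (hflat : ∀ j, 1 ≤ j → j < s → iteratedDeriv j f x₀ = 0) :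
    ∃ x' ∈ Set.uIcc x₀ x, f x - f x₀ = iteratedDeriv s f x' * (x - x₀) ^ s / s.factorial := by
  obtain ⟨r, rfl⟩ : ∃ r, s = r + 1 := ⟨s - 1, by omega⟩
  obtain ⟨x', hx', h⟩ := taylor_mean_remainder_lagrange_iteratedDeriv (n := r) hx
    fun y hy => ((hf y hy).of_le le_top).contDiffWithinAt
  refine ⟨x', Set.Ioo_subset_Icc_self hx', ?_⟩
  rw [← h, taylor_within_apply, Finset.sum_range_succ', sum_eq_zero]
  · simp
  · intro j hj
    rw [iteratedDerivWithin_eq_iteratedDeriv (uniqueDiffOn_uIcc hx)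
      ((hf x₀ Set.left_mem_uIcc).of_le le_top) Set.left_mem_uIcc,
      hflat (j + 1) (by omega) (by have := mem_range.1 hj; omega), smul_zero]

section

variable {n k : ℕ} {E : Endstate n k} {τ₀ x₀ : ℝ} {η₀ : Fin k → ℝ} {l s m : ℕ}
  {g : (Fin k → ℝ) → ℝ} {e : ℕ → (Fin k → ℝ) → Matrix (Fin n) (Fin m) ℂ}
  {Lf : (Fin k → ℝ) → Matrix (Fin m) (Fin n) ℂ} {M : Matrix (Fin m) (Fin m) ℂ} {α : ℝ}
  {Y : Type*} {G : Filter Y} {η : Y → Fin k → ℝ} {τ ν : Y → ℝ} {b₀ t₀ δ : ℝ}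

theorem Chain.eventually_smooth (hC : Chain E τ₀ x₀ η₀ l s m g e Lf M α) :
    ∀ᶠ q : ℝ × (Fin k → ℝ) in 𝓝 (x₀, η₀), ContDiffAt ℝ ω (fun y => E.a l (vecCons y q.2)) q.1 := by
  have h1 : Tendsto (fun q : ℝ × (Fin k → ℝ) => (vecCons q.1 q.2 : Fin (k + 1) → ℝ)) (𝓝 (x₀, η₀))
      (𝓝 (vecCons x₀ η₀)) := Endstate.contDiff_vecCons.continuous.tendsto (x₀, η₀)
  filter_upwards [h1.eventually (hC.smooth_a.eventually (by simp))] with q hq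
  exact ContDiffAt.comp q.1 (g := E.a l) (f := fun y => (vecCons y q.2 : Fin (k + 1) → ℝ)) hq
    (Endstate.contDiff_vecCons.comp (contDiff_id.prodMk contDiff_const)).contDiffAt

theorem Chain.tendsto_quotient (hC : Chain E τ₀ x₀ η₀ l s m g e Lf M α) (hη : Tendsto η G (𝓝 η₀))
    (hν : ∀ᶠ p in G, 0 < ν p) (hν0 : Tendsto ν G (𝓝 0)) {b : ℝ} (hb : b ≠ 0) :
    Tendsto (fun p => (E.a l (vecCons (g (η p) + ν p * b) (η p)) - E.a l (vecCons (g (η p)) (η p))) / ν p ^ s) G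
      (𝓝 (α * b ^ s)) := by
  have h1 : Tendsto (fun q : ℝ × (Fin k → ℝ) => E.dA l s q.1 q.2 / s.factorial * b ^ s) (𝓝 (x₀, η₀))
      (𝓝 (α * b ^ s)) := by
    rw [hC.coeff]
    exact ((Endstate.contDiffAt_dA hC.smooth_a s).continuousAt.tendsto.div_const _).mul_const _
  rw [Metric.tendsto_nhds]
  intro ε hε
  obtain ⟨r, hr, hball⟩ := Metric.eventually_nhds_iff_ball.1
    ((Metric.tendsto_nhds.1 h1 ε hε).and hC.eventually_smooth)
  have hgc : Tendsto (fun p => g (η p)) G (𝓝 x₀) := hC.base ▸ hC.smooth_g.continuousAt.tendsto.comp hη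
  have h2 : Tendsto (fun p => |g (η p) - x₀| + ν p * |b|) G (𝓝 0) := by
    have := ((hgc.sub_const x₀).abs).add (hν0.mul_const |b|)
    simpa using this
  filter_upwards [h2.eventually_lt_const hr, Metric.tendsto_nhds.1 hη r hr, hν, hη.eventually hC.order]
    with p hp1 hp2 hp3 hp4
  have hmem : ∀ y ∈ Set.uIcc (g (η p)) (g (η p) + ν p * b), (y, η p) ∈ Metric.ball (x₀, η₀) r := by
    intro y hy
    rw [Metric.mem_ball, Prod.dist_eq, max_lt_iff]
    refine ⟨?_, hp2⟩
    have h3 := Set.abs_sub_left_of_mem_uIcc hy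
    rw [add_sub_cancel_left, abs_mul, abs_of_pos hp3] at h3
    rw [Real.dist_eq]
    calc |y - x₀| = |(y - g (η p)) + (g (η p) - x₀)| := by ring_nf
      _ ≤ |y - g (η p)| + |g (η p) - x₀| := abs_add_le _ _
      _ < r := by linarith
  obtain ⟨x', hx', h3⟩ := taylor_of_flat (f := fun y => E.a l (vecCons y (η p))) hC.s_pos
    (x₀ := g (η p)) (x := g (η p) + ν p * b) (by simp [hp3.ne', hb])
    (fun y hy => (hball _ (hmem y hy)).2) hp4.1
  have h4 := (hball _ (hmem x' hx')).1
  convert h4 using 2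
  rw [h3, add_sub_cancel_left, mul_pow]
  have := hp3.ne'
  simp only [Endstate.dA]
  field_simp

/-- Near the glancing surface, the real roots behave like the roots of `α b^s = t`. -/
theorem Chain.exists_real_root (hC : Chain E τ₀ x₀ η₀ l s m g e Lf M α) (hη : Tendsto η G (𝓝 η₀))
    (hν : ∀ᶠ p in G, 0 < ν p) (hν0 : Tendsto ν G (𝓝 0)) (ht₀ : t₀ ≠ 0) (hb : α * b₀ ^ s = t₀)
    (ht : Tendsto (fun p => (τ p - E.a l (vecCons (g (η p)) (η p))) / ν p ^ s) G (𝓝 t₀)) (hδ : 0 < δ) :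
    ∀ᶠ p in G, ∃ b, |b - b₀| ≤ δ ∧ E.a l (vecCons (g (η p) + ν p * b) (η p)) = τ p := by
  have hs : s ≠ 0 := by have := hC.s_pos; omega
  have hb₀ : b₀ ≠ 0 := by
    rintro rfl
    rw [zero_pow hs, mul_zero] at hb
    exact ht₀ hb.symm
  obtain ⟨θ, hθ0, hθ1, hθδ⟩ : ∃ θ : ℝ, 0 < θ ∧ θ < 1 ∧ θ * |b₀| ≤ δ := by
    refine ⟨min (1 / 2) (δ / |b₀|), by positivity, lt_of_le_of_lt (min_le_left _ _) (by norm_num), ?_⟩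
    rw [← le_div_iff₀ (abs_pos.2 hb₀)]
    exact min_le_right _ _
  let F : Y → ℝ → ℝ := fun p b =>
    (E.a l (vecCons (g (η p) + ν p * b) (η p)) - E.a l (vecCons (g (η p)) (η p))) / ν p ^ s
  have h1 := hC.tendsto_quotient hη hν hν0 (mul_ne_zero hb₀ (sub_pos.2 hθ1).ne')
  have h2 := hC.tendsto_quotient hη hν hν0 (mul_ne_zero hb₀ (by positivity : 1 + θ ≠ 0))
  have h3 := (h1.sub ht).mul (h2.sub ht)
  have h4 : (α * (b₀ * (1 - θ)) ^ s - t₀) * (α * (b₀ * (1 + θ)) ^ s - t₀) < 0 := by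
    rw [mul_pow, mul_pow, ← mul_assoc, ← mul_assoc, hb]
    have h5 : (1 - θ) ^ s < 1 := pow_lt_one₀ (by linarith) (by linarith) hs
    have h6 : 1 < (1 + θ) ^ s := one_lt_pow₀ (by linarith) hs
    have h7 : (t₀ * (1 - θ) ^ s - t₀) * (t₀ * (1 + θ) ^ s - t₀) =
      -(t₀ ^ 2 * ((1 - (1 - θ) ^ s) * ((1 + θ) ^ s - 1))) := by ring
    rw [h7, neg_lt_zero]
    exact mul_pos (by positivity) (mul_pos (by linarith) (by linarith))
  obtain ⟨r, hr, hball⟩ := Metric.eventually_nhds_iff_ball.1 hC.eventually_smooth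
  have hgc : Tendsto (fun p => g (η p)) G (𝓝 x₀) := hC.base ▸ hC.smooth_g.continuousAt.tendsto.comp hη
  have h5 : Tendsto (fun p => |g (η p) - x₀| + ν p * (|b₀| + δ)) G (𝓝 0) := by
    have := ((hgc.sub_const x₀).abs).add (hν0.mul_const (|b₀| + δ))
    simpa using this
  filter_upwards [h3.eventually_lt_const h4, h5.eventually_lt_const hr, Metric.tendsto_nhds.1 hη r hr, hν]
    with p hp1 hp2 hp3 hp4
  have hnear : ∀ b ∈ Set.uIcc (b₀ * (1 - θ)) (b₀ * (1 + θ)), |b - b₀| ≤ δ := by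
    intro b hb
    refine le_trans ?_ hθδ
    rw [Set.mem_uIcc] at hb
    rw [abs_le]
    rcases abs_cases b₀ with h | h <;> rcases hb with hb | hb <;> constructor <;> nlinarith
  have hcont : ContinuousOn (F p) (Set.uIcc (b₀ * (1 - θ)) (b₀ * (1 + θ))) := by
    intro b hb
    refine ContinuousAt.continuousWithinAt ?_
    have h6 : (g (η p) + ν p * b, η p) ∈ Metric.ball (x₀, η₀) r := by
      rw [Metric.mem_ball, Prod.dist_eq, max_lt_iff]
      refine ⟨?_, hp3⟩
      have h7 : |b| ≤ |b₀| + δ := by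
        have := abs_sub_abs_le_abs_sub b b₀
        linarith [hnear b hb]
      rw [Real.dist_eq]
      calc |g (η p) + ν p * b - x₀| = |(g (η p) - x₀) + ν p * b| := by ring_nf
        _ ≤ |g (η p) - x₀| + |ν p * b| := abs_add_le _ _
        _ ≤ |g (η p) - x₀| + ν p * (|b₀| + δ) := by rw [abs_mul, abs_of_pos hp4]; gcongr
        _ < r := hp2
    have h7 : ContinuousAt (fun y => E.a l (vecCons y (η p))) (g (η p) + ν p * b) := (hball _ h6).continuousAt
    have h8 : ContinuousAt (fun b => E.a l (vecCons (g (η p) + ν p * b) (η p))) b :=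
      ContinuousAt.comp (g := fun y => E.a l (vecCons y (η p))) (f := fun b => g (η p) + ν p * b) h7 (by fun_prop)
    exact (h8.sub continuousAt_const).div_const _
  have hmem : (τ p - E.a l (vecCons (g (η p)) (η p))) / ν p ^ s ∈
      Set.uIcc (F p (b₀ * (1 - θ))) (F p (b₀ * (1 + θ))) := by
    rw [Set.mem_uIcc]
    rcases mul_neg_iff.1 hp1 with ⟨h6, h7⟩ | ⟨h6, h7⟩
    · exact Or.inr ⟨(sub_neg.1 h7).le, (sub_pos.1 h6).le⟩
    · exact Or.inl ⟨(sub_neg.1 h6).le, (sub_pos.1 h7).le⟩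
  obtain ⟨b, hb, hFb⟩ := intermediate_value_uIcc hcont hmem
  refine ⟨b, hnear b hb, ?_⟩
  rw [div_left_inj' (pow_ne_zero _ hp4.ne')] at hFb
  linarith

end


section Roots

open Real in
/-- The signs of the imaginary parts of the roots, for arguments in the open half plane and at its
boundary. -/
theorem sin_sign {N s : ℕ} (hN : N + 1 ≤ 2 * s) {φ : ℝ} :
    (|φ| < π / 2 → 0 < sgn (decide (s ≤ N)) * -sin ((π * (N + 1 / 2) + φ) / s)) ∧
    ∀ t : ℝ, |t| = 1 → φ = t * (π / 2) → 0 < sgn (decide (s ≤ N)) * -sin ((π * (N + 1 / 2) + φ) / s) ∨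
      sin ((π * (N + 1 / 2) + φ) / s) = 0 ∧ 0 < sgn (decide (s ≤ N)) * cos ((π * (N + 1 / 2) + φ) / s) * t := by
  have hs : 0 < s := by omega
  have hsR : (0 : ℝ) < s := by exact_mod_cast hs
  have hπ := pi_pos
  have key : ∀ x : ℝ, (s ≤ N → π * s < x ∧ x < 2 * π * s) → (N < s → 0 < x ∧ x < π * s) →
      0 < sgn (decide (s ≤ N)) * -sin (x / s) := by
    intro x h1 h2
    by_cases h : s ≤ N
    · obtain ⟨h3, h4⟩ := h1 h
      have h5 : 0 < sin (x / s - π) := by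
        apply sin_pos_of_pos_of_lt_pi
        · rw [sub_pos, lt_div_iff₀ hsR]; exact h3
        · rw [sub_lt_iff_lt_add, div_lt_iff₀ hsR]; linarith
      rw [sin_sub_pi] at h5
      simpa [h, sgn] using h5
    · obtain ⟨h3, h4⟩ := h2 (by omega)
      have h5 : 0 < sin (x / s) := by
        apply sin_pos_of_pos_of_lt_pi (by positivity)
        rw [div_lt_iff₀ hsR]; exact h4
      simpa [h, sgn] using h5
  have hN' : ((N : ℝ) + 1) ≤ 2 * s := by exact_mod_cast hN
  refine ⟨fun hφ => key _ (fun h => ?_) fun h => ?_, fun t ht hφ => ?_⟩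
  · have h' : (s : ℝ) ≤ N := by exact_mod_cast h
    rw [abs_lt] at hφ
    constructor <;> nlinarith
  · have h' : (N : ℝ) + 1 ≤ s := by exact_mod_cast h
    rw [abs_lt] at hφ
    constructor <;> nlinarith
  · rcases (abs_eq zero_le_one).1 ht with rfl | rfl
    · have hx : π * (N + 1 / 2) + φ = π * (N + 1) := by rw [hφ]; ring
      rw [hx]
      by_cases h1 : N + 1 = 2 * s
      · right
        have h2 : ((N : ℝ) + 1) = 2 * s := by exact_mod_cast h1
        have h3 : π * ((N : ℝ) + 1) / s = 2 * π := by rw [h2]; field_simp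
        have h4 : s ≤ N := by omega
        simp [h3, h4, sgn]
      · by_cases h2 : N + 1 = s
        · right
          have h2 : ((N : ℝ) + 1) = s := by exact_mod_cast h2
          have h3 : π * ((N : ℝ) + 1) / s = π := by rw [h2]; field_simp
          have h4 : ¬ s ≤ N := by omega
          simp [h3, h4, sgn]
        · left
          refine key _ (fun h => ?_) fun h => ?_
          · have h3 : (s : ℝ) + 1 ≤ N + 1 := by exact_mod_cast Nat.succ_le_succ h
            have h4 : ((N : ℝ) + 1) + 1 ≤ 2 * s := by exact_mod_cast (by omega : N + 1 + 1 ≤ 2 * s)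
            constructor <;> nlinarith
          · have h3 : ((N : ℝ) + 1) + 1 ≤ s := by exact_mod_cast (by omega : N + 1 + 1 ≤ s)
            exact ⟨by positivity, by nlinarith⟩
    · have hx : π * (N + 1 / 2) + φ = π * N := by rw [hφ]; ring
      rw [hx]
      by_cases h1 : N = s
      · right
        have h3 : π * (N : ℝ) / s = π := by rw [h1]; field_simp
        have h4 : s ≤ N := by omega
        simp [h3, h4, sgn]
      · by_cases h2 : N = 0
        · right
          have h4 : ¬ s ≤ 0 := by omega
          subst h2
          simp [h4, sgn]
        · left
          refine key _ (fun h => ?_) fun h => ?_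
          · have h3 : (s : ℝ) + 1 ≤ N := by exact_mod_cast (by omega : s + 1 ≤ N)
            constructor <;> nlinarith
          · have h3 : (N : ℝ) + 1 ≤ s := by exact_mod_cast h
            have h4 : (1 : ℝ) ≤ N := by exact_mod_cast Nat.one_le_iff_ne_zero.2 h2
            constructor <;> nlinarith

/-- The limiting companion matrices have separated roots with real parts of the signs `sg`, or imaginary ones that
are moved to the right side by a perturbation. -/
def CompanionRoots {s : ℕ} (ε : Bool) (α : ℝ) (sg : Fin s → Bool) : Prop :=
  ∀ {m : ℕ} (κ t : ℝ) (μ : Fin m → ℝ), 0 ≤ κ → |t| + κ = 1 → (∀ a, 0 < μ a) →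
    ∃ y : Fin s → Fin m → ℂ, (∀ k a, y k a ≠ 0) ∧
      (∀ k a, y k a ^ s = (sgn ε * I) ^ (s - 1) *
        (sgn ε * (α : ℂ)⁻¹ * ((κ * μ a : ℝ) + I * (t : ℝ)))) ∧
      (∀ k k' a a', k ≠ k' → y k a ≠ y k' a') ∧
      ∀ k, (∀ a, 0 < sgn (sg k) * (y k a).re) ∨ (κ = 0 ∧ t ≠ 0 ∧ ∃ b : ℝ,
        (∀ a, y k a = I * (sgn ε * b : ℝ)) ∧ α * b ^ s = t ∧
        0 < sgn (sg k) * (sgn ε * b) * t)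

open Real in
theorem exists_companion_roots {s : ℕ} (hs : 1 ≤ s) (ε : Bool) {α : ℝ} (hα : α ≠ 0) :
    ∃ sg : Fin s → Bool, (univ.filter fun k => sg k = false).card ≤ (s + 1) / 2 ∧
      CompanionRoots ε α sg := by
  have hsR : (0 : ℝ) < s := by exact_mod_cast hs
  have hπ := pi_pos
  have hα0 : 0 < |α| := abs_pos.2 hα
  have hσ : sgn ε * sgn ε = 1 := by cases ε <;> simp [sgn]
  have hσ0 : sgn ε ≠ 0 := left_ne_zero_of_mul_eq_one hσ
  obtain ⟨h₀, hh₀, hsign⟩ : ∃ h₀ : ℕ, h₀ ≤ 1 ∧ -(-1) ^ h₀ * |α|⁻¹ = sgn ε ^ s * α⁻¹ := by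
    have h1 : sgn ε ^ s = 1 ∨ sgn ε ^ s = -1 := by
      cases ε
      · exact neg_one_pow_eq_or ℝ s
      · left; simp [sgn]
    rcases h1 with h1 | h1 <;> rcases abs_cases α with ⟨h2, -⟩ | ⟨h2, -⟩ <;> rw [h1, h2]
    · exact ⟨1, le_rfl, by simp⟩
    · exact ⟨0, zero_le_one, by simp [inv_neg]⟩
    · exact ⟨0, zero_le_one, by simp⟩
    · exact ⟨1, le_rfl, by simp [inv_neg]⟩
  refine ⟨fun k => decide (s ≤ 2 * (k : ℕ) + h₀), ?_, ?_⟩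
  · rw [← Finset.card_range ((s + 1) / 2)]
    refine Finset.card_le_card_of_injOn (fun k => (k : ℕ)) (fun k hk => ?_) fun _ _ _ _ h => Fin.ext h
    simp only [Finset.coe_filter, mem_univ, true_and, Set.mem_setOf_eq, decide_eq_false_iff_not] at hk
    simp only [Finset.coe_range, Set.mem_Iio]
    omega
  intro m κ t μ hκ htκ hμ
  let Z : Fin m → ℂ := fun a => (κ * μ a : ℝ) + I * (t : ℝ)
  have hZre : ∀ a, (Z a).re = κ * μ a := fun a => by simp [Z]
  have hZim : ∀ a, (Z a).im = t := fun a => by simp [Z]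
  have hZ0 : ∀ a, Z a ≠ 0 := by
    intro a h
    have h1 : κ * μ a = 0 := by rw [← hZre, h]; rfl
    have h2 : t = 0 := by rw [← hZim a, h]; rfl
    rcases mul_eq_zero.1 h1 with h3 | h3
    · rw [h2, h3] at htκ; simp at htκ
    · exact (hμ a).ne' h3
  have harg : ∀ a, |(Z a).arg| ≤ π / 2 := fun a => by
    rw [Complex.abs_arg_le_pi_div_two_iff, hZre]; exact mul_nonneg hκ (hμ a).le
  let ϑ : Fin s → ℝ → ℝ := fun k φ => (π * ((2 * (k : ℕ) + h₀ : ℕ) + 1 / 2) + φ) / s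
  let r : Fin m → ℝ := fun a => (‖Z a‖ / |α|) ^ (1 / (s : ℝ))
  have hr0 : ∀ a, 0 < r a := fun a => rpow_pos_of_pos (div_pos (norm_pos_iff.2 (hZ0 a)) hα0) _
  have hrs : ∀ a, r a ^ s = ‖Z a‖ / |α| := fun a => by
    rw [← rpow_natCast, ← rpow_mul (by positivity), one_div, inv_mul_cancel₀ hsR.ne', rpow_one]
  have hys : ∀ k a, ((r a : ℂ) * (I * Complex.exp (ϑ k (Z a).arg * I))) ^ s =
      (sgn ε * I) ^ (s - 1) * (sgn ε * (α : ℂ)⁻¹ * Z a) := by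
    intro k a
    have h1 : Complex.exp (ϑ k (Z a).arg * I) ^ s =
        (-1) ^ h₀ * I * Complex.exp ((Z a).arg * I) := by
      rw [← Complex.exp_nat_mul]
      have h2 : (s : ℂ) * (ϑ k (Z a).arg * I) = (k : ℕ) * (2 * π * I) + h₀ * (π * I) +
          π / 2 * I + (Z a).arg * I := by
        simp only [ϑ]; push_cast; field_simp
      rw [h2, Complex.exp_add, Complex.exp_add, Complex.exp_add, Complex.exp_nat_mul_two_pi_mul_I,
        Complex.exp_nat_mul, Complex.exp_pi_mul_I, Complex.exp_pi_div_two_mul_I, one_mul]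
    have h3 : ((r a : ℂ)) ^ s = ‖Z a‖ * (|α|⁻¹ : ℝ) := by
      rw [← ofReal_pow, hrs]; push_cast; rw [div_eq_mul_inv]
    have h4 := Complex.norm_mul_exp_arg_mul_I (Z a)
    have h5 : -(-1 : ℂ) ^ h₀ * (|α|⁻¹ : ℝ) = sgn ε ^ s * (α : ℂ)⁻¹ := by exact_mod_cast congrArg Complex.ofReal hsign
    have h6 : I ^ s = I ^ (s - 1) * I := by rw [← pow_succ, Nat.sub_add_cancel hs]
    have h7 : (sgn ε : ℂ) ^ s = sgn ε ^ (s - 1) * sgn ε := by rw [← pow_succ, Nat.sub_add_cancel hs]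
    rw [mul_pow, mul_pow, h1, h3, h6, mul_pow]
    rw [h7] at h5
    calc _ = I ^ (s - 1) * (-(-1 : ℂ) ^ h₀ * (|α|⁻¹ : ℝ)) * (‖Z a‖ * Complex.exp ((Z a).arg * I)) := by
            linear_combination (I ^ (s - 1) * (-1 : ℂ) ^ h₀ * (|α|⁻¹ : ℝ) * ‖Z a‖ *
              Complex.exp ((Z a).arg * I)) * I_mul_I
      _ = _ := by rw [h4, h5]; ring
  have hy0 : ∀ k a, (r a : ℂ) * (I * Complex.exp (ϑ k (Z a).arg * I)) ≠ 0 := fun k a =>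
    mul_ne_zero (by exact_mod_cast (hr0 a).ne') (mul_ne_zero I_ne_zero (Complex.exp_ne_zero _))
  have hre : ∀ k a, ((r a : ℂ) * (I * Complex.exp (ϑ k (Z a).arg * I))).re =
      r a * -sin (ϑ k (Z a).arg) := fun k a => by
    rw [re_ofReal_mul, I_mul_re, Complex.exp_ofReal_mul_I_im]
  have him : ∀ k a, ((r a : ℂ) * (I * Complex.exp (ϑ k (Z a).arg * I))).im =
      r a * cos (ϑ k (Z a).arg) := fun k a => by
    rw [Complex.im_ofReal_mul, I_mul_im, Complex.exp_ofReal_mul_I_re]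
  refine ⟨fun k a => (r a : ℂ) * (I * Complex.exp (ϑ k (Z a).arg * I)), hy0, hys, ?_, ?_⟩
  · intro k k' a a' hkk h
    have h1 : r a = r a' := by
      have := congrArg norm h
      simpa [Complex.norm_exp_ofReal_mul_I, abs_of_pos (hr0 _)] using this
    beta_reduce at h
    rw [h1] at h
    have h2 := mul_left_cancel₀ I_ne_zero (mul_left_cancel₀ (by exact_mod_cast (hr0 a').ne' : (r a' : ℂ) ≠ 0) h)
    obtain ⟨N, hN⟩ := Complex.exp_eq_exp_iff_exists_int.1 h2
    have h3 : ϑ k (Z a).arg = ϑ k' (Z a').arg + N * (2 * π) := by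
      have := congrArg Complex.im hN
      simpa using this
    have h4 : π * (2 * ((N : ℝ) * s - ((k : ℕ) - (k' : ℕ)))) = (Z a).arg - (Z a').arg := by
      simp only [ϑ] at h3
      field_simp at h3
      push_cast at h3
      linarith
    have h5 : |π * (2 * ((N : ℝ) * s - ((k : ℕ) - (k' : ℕ))))| ≤ π := by
      rw [h4]
      have := harg a
      have := harg a'
      rw [abs_le] at *
      constructor <;> linarith
    have h6 : |(N : ℝ) * s - ((k : ℕ) - (k' : ℕ))| < 1 := by
      rw [abs_mul, abs_of_pos hπ, abs_mul, abs_two] at h5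
      nlinarith
    have h7 : N * s - ((k : ℕ) - (k' : ℕ)) = (0 : ℤ) := by
      rw [← Int.abs_lt_one_iff]
      exact_mod_cast h6
    have h8 : N = 0 := by
      have := k.2
      have := k'.2
      by_contra h9
      have h10 : (s : ℤ) ≤ |N| * s := by
        have : 1 ≤ |N| := Int.one_le_abs h9
        nlinarith
      have h11 : |N| * s = |N * (s : ℤ)| := by rw [abs_mul, Nat.abs_cast]
      rw [h11, sub_eq_zero.1 h7] at h10
      rcases abs_cases (((k : ℕ) : ℤ) - (k' : ℕ)) with h | h <;> omega
    rw [h8] at h7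
    exact hkk (Fin.ext (by omega))
  · intro k
    have hk : 2 * (k : ℕ) + h₀ + 1 ≤ 2 * s := by have := k.2; omega
    rcases hκ.lt_or_eq with hκ0 | rfl
    · left
      intro a
      rw [hre, mul_left_comm]
      refine mul_pos (hr0 a) ((sin_sign hk).1 ?_)
      rw [Complex.abs_arg_lt_pi_div_two_iff, hZre]
      exact Or.inl (mul_pos hκ0 (hμ a))
    · rw [add_zero] at htκ
      have ht0 : t ≠ 0 := by rintro rfl; simp at htκ
      have hZ : ∀ a, Z a = I * t := fun a => by simp [Z]
      have hφ : ∀ a, (Z a).arg = t * (π / 2) := by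
        intro a
        rw [hZ]
        rcases (abs_eq zero_le_one).1 htκ with rfl | rfl <;> simp [Complex.arg_I, Complex.arg_neg_I]
      rcases isEmpty_or_nonempty (Fin m) with hm | ⟨⟨a₀⟩⟩
      · exact Or.inl fun a => hm.elim a
      rcases (sin_sign hk).2 t htκ rfl with h1 | ⟨h1, h2⟩
      · left
        intro a
        rw [hre, mul_left_comm, hφ]
        exact mul_pos (hr0 a) h1
      · right
        have hya : ∀ a, (r a : ℂ) * (I * Complex.exp (ϑ k (Z a).arg * I)) =
            I * (sgn ε * (sgn ε * (r a₀ * cos (ϑ k (t * (π / 2))))) : ℝ) := by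
          intro a
          have h3 : r a = r a₀ := by simp only [r, hZ]
          refine Complex.ext ?_ ?_
          · rw [hre, hφ, I_mul_re, Complex.ofReal_im, neg_zero]
            simp only [ϑ]
            rw [h1]; simp
          · rw [him, hφ, ← mul_assoc, hσ, one_mul, h3, I_mul_im, ofReal_re]
        refine ⟨rfl, ht0, sgn ε * (r a₀ * cos (ϑ k (t * (π / 2)))), hya, ?_, ?_⟩
        · have h3 := hys k a₀
          rw [hya, hZ] at h3
          have h4 : (sgn ε * I) ^ (s - 1) * (sgn ε * (α : ℂ)⁻¹ * (I * t)) =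
              (sgn ε * I) ^ s * ((α : ℂ)⁻¹ * t) := by
            have : (sgn ε * I) ^ s = (sgn ε * I) ^ (s - 1) * (sgn ε * I) := by
              rw [← pow_succ, Nat.sub_add_cancel hs]
            rw [this]; ring
          rw [h4, ofReal_mul, ← mul_assoc, mul_pow, mul_comm I] at h3
          have h5 := mul_left_cancel₀ (pow_ne_zero _ (mul_ne_zero (by exact_mod_cast hσ0) I_ne_zero)) h3
          have h6 : (sgn ε * (r a₀ * cos (ϑ k (t * (π / 2))))) ^ s = α⁻¹ * t := by exact_mod_cast h5
          rw [h6, mul_inv_cancel_left₀ hα]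
        · rw [← mul_assoc (sgn ε), hσ, one_mul]
          have : 0 < r a₀ * (sgn (decide (s ≤ 2 * (k : ℕ) + h₀)) * cos (ϑ k (t * (π / 2))) * t) :=
            mul_pos (hr0 a₀) h2
          linarith

end Roots

/-- Eventual uniformity along ultrafilters. -/
theorem eventually_of_ultrafilter {Y : Type*} {F : Filter Y} {P : ℕ → Y → Prop}
    (hP : ∀ i j y, i ≤ j → P i y → P j y) (h : ∀ G : Ultrafilter Y, ↑G ≤ F → ∃ i, ∀ᶠ y in G, P i y) :
    ∃ i, ∀ᶠ y in F, P i y := by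
  by_contra hne
  push Not at hne
  haveI : (⨅ i, F ⊓ 𝓟 {y | ¬ P i y}).NeBot := by
    refine iInf_neBot_of_directed' (Antitone.directed_ge fun i j hij => ?_) fun i => ?_
    · exact inf_le_inf_left _ (principal_mono.2 fun y hy h => hy (hP i j y hij h))
    · exact frequently_iff_neBot.1 (hne i)
  obtain ⟨i, hi⟩ := h (Ultrafilter.of (⨅ i, F ⊓ 𝓟 {y | ¬ P i y}))
    ((Ultrafilter.of_le _).trans ((iInf_le _ 0).trans inf_le_left))
  have h1 : ∀ᶠ y in (Ultrafilter.of (⨅ i, F ⊓ 𝓟 {y | ¬ P i y}) : Filter Y), ¬ P i y :=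
    ((Ultrafilter.of_le _).trans ((iInf_le _ i).trans inf_le_right)) (mem_principal_self _)
  obtain ⟨y, h2, h3⟩ := (hi.and h1).exists
  exact h3 h2


/-- Conjugation of a block matrix with the powers of `ν`, divided by `ν`. -/
noncomputable def scaled {s m : ℕ} (ν : ℝ) (N : BMat s m) :
    BMat s m :=
  of fun i j => (ν : ℂ) ^ (j.1 : ℕ) * ((ν : ℂ) ^ ((i.1 : ℕ) + 1))⁻¹ * N i j

theorem scaled_sub {s m : ℕ} (ν : ℝ) (N N' : BMat s m) :
    scaled ν (N - N') = scaled ν N - scaled ν N' := by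
  ext i j; simp [scaled, mul_sub]

theorem scaled_shift {s m : ℕ} {ν : ℝ} (hν : ν ≠ 0) (z : ℂ) :
    scaled ν (z • shiftMat s m) = z • shiftMat s m := by
  ext i j
  simp only [scaled, of_apply, Matrix.smul_apply, smul_eq_mul, shiftMat]
  split_ifs with h
  · have : (ν : ℂ) ≠ 0 := by exact_mod_cast hν
    rw [h.1]; field_simp
  · simp

/-- The diagonal matrix of the powers of `ν`. -/
noncomputable def powers (s m : ℕ) (ν : ℝ) : BMat s m :=
  diagonal fun i => (ν : ℂ) ^ (i.1 : ℕ)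

/-- The inverse of the diagonal matrix of the powers of `ν`. -/
noncomputable def powersInv (s m : ℕ) (ν : ℝ) : BMat s m :=
  diagonal fun i => ((ν : ℂ) ^ (i.1 : ℕ))⁻¹

theorem powersInv_mul {s m : ℕ} {ν : ℝ} (hν : ν ≠ 0) : powersInv s m ν * powers s m ν = 1 := by
  have : (ν : ℂ) ≠ 0 := by exact_mod_cast hν
  rw [powersInv, powers, diagonal_mul_diagonal, ← diagonal_one]
  congr 1; ext i; field_simp

theorem powersInv_mul_powers {s m : ℕ} {ν : ℝ} (hν : ν ≠ 0)
    (N : BMat s m) :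
    powersInv s m ν * N * powers s m ν = (ν : ℂ) • scaled ν N := by
  have : (ν : ℂ) ≠ 0 := by exact_mod_cast hν
  ext i j
  rw [powers, mul_diagonal, powersInv, diagonal_mul]
  simp only [scaled, of_apply, Matrix.smul_apply, smul_eq_mul, pow_succ]
  field_simp

section

variable {n k : ℕ} {E : Endstate n k} {c b : ℝ} {ζ₀ : Freq k} {x₀ : ℝ} {l s m : ℕ}
  {g : (Fin k → ℝ) → ℝ} {e : ℕ → (Fin k → ℝ) → Matrix (Fin n) (Fin m) ℂ}
  {Lf : (Fin k → ℝ) → Matrix (Fin m) (Fin n) ℂ} {μ : Fin m → ℝ} {α : ℝ}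
  {ι : Type*} [Fintype ι] [DecidableEq ι] {q : Pt k → Matrix ι ι ℂ} {u : Pt k → Matrix (Fin n) ι ℂ}
  {U : Pt k → Matrix (Fin n) (Fin s × Fin m) ℂ} {N : Pt k → BMat s m}
  {V : (Fin k → ℝ) → Matrix ι (Fin s × Fin m) ℂ} {Vi : (Fin k → ℝ) → Matrix (Fin s × Fin m) ι ℂ}
  {Y : Type*} {G : Filter Y} {π : Y → Pt k × ℝ} {ν d : Y → ℝ} {w : Fin m → ℂ}

theorem NormalForm.tendsto_scaled (hE : E.Admissible) (hγ : ζ₀.2.1 = 0)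
    (hC : Chain E ζ₀.1 x₀ ζ₀.2.2 l s m g e Lf (diagonal fun a => (μ a : ℂ)) α)
    (hN : NormalForm E c ζ₀ x₀ l s m g e q U N V Vi) (hπ : Tendsto π G (pairFilter c ζ₀))
    (hν : ∀ᶠ p in G, 0 < ν p) (hν0 : Tendsto ν G (𝓝 0)) (hd : ∀ᶠ p in G, 0 < d p)
    (hdist : (fun p => dist₀ (π p)) =O[G] d)
    (hw : ∀ a, Tendsto (fun p => (d p : ℂ)⁻¹ * (((π p).1.2.2.1 : ℂ) +
      I * (((π p).1.2.1 - (π p).2 : ℝ) : ℂ) + (π p).1.1 * μ a)) G (𝓝 (w a))) :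
    Tendsto (fun p => ((ν p ^ s / d p : ℝ) : ℂ) • scaled (ν p) (N (π p).1 - N (shadow (π p)))) G
      (𝓝 (corner s fun a => (α : ℂ)⁻¹ * w a)) := by
  have hs0 : 0 < s := hC.s_pos
  have hs1 : s - 1 < s := by omega
  rw [tendsto_matrix]
  rintro ⟨i, a⟩ ⟨j, a'⟩
  have hO : (fun p => (N (π p).1 - N (shadow (π p))) (i, a) (j, a')) =O[G] d :=
    (((hN.smooth_N.isBigO_pair hγ) (i, a) (j, a')).comp_tendsto hπ).trans hdist
  by_cases h : (i : ℕ) + 1 = s ∧ (j : ℕ) = 0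
  · have hi : i = ⟨s - 1, hs1⟩ := Fin.ext (by simp only; omega)
    have hj : j = ⟨0, hs0⟩ := Fin.ext h.2
    have h1 := ((hN.variation hE hγ hC hs1 a a').comp_tendsto hπ).trans_isBigO hdist
    have h2 := (h1.norm_left.tendsto_div_nhds_zero)
    have h3 : Tendsto (fun p => (d p : ℂ)⁻¹ * ((N (π p).1 - N (shadow (π p))) (i, a) (j, a') -
        (α : ℂ)⁻¹ * (if a = a' then (((π p).1.2.2.1 : ℂ) +
      I * (((π p).1.2.1 - (π p).2 : ℝ) : ℂ) + (π p).1.1 * μ a) else 0))) G (𝓝 0) := by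
      rw [tendsto_zero_iff_norm_tendsto_zero]
      refine h2.congr' ?_
      filter_upwards [hd] with p hp
      rw [norm_mul, norm_inv, norm_real, norm_of_nonneg hp.le, div_eq_inv_mul]
      congr 2
      simp only [Function.comp, mul_firstCols hs0, Matrix.sub_apply, submatrix_apply, Matrix.smul_apply,
        Matrix.add_apply, id, Matrix.one_apply, diagonal_apply, smul_eq_mul, hi, hj]
      split_ifs <;> simp
    have h4 : Tendsto (fun p => (d p : ℂ)⁻¹ * ((α : ℂ)⁻¹ * (if a = a' then (((π p).1.2.2.1 : ℂ) +
      I * (((π p).1.2.1 - (π p).2 : ℝ) : ℂ) + (π p).1.1 * μ a) else 0))) G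
        (𝓝 (corner s (fun a => (α : ℂ)⁻¹ * w a) (i, a) (j, a'))) := by
      by_cases ha : a = a'
      · simp only [ha, if_true, corner, of_apply, h.1, h.2, and_self]
        refine ((hw a').const_mul (α : ℂ)⁻¹).congr fun p => ?_
        ring
      · simp [ha, corner, tendsto_const_nhds]
    have h5 := h3.add h4
    rw [zero_add] at h5
    refine h5.congr' ?_
    filter_upwards [hν] with p hp
    simp only [scaled, Matrix.smul_apply, of_apply, smul_eq_mul, h.1, h.2, pow_zero, one_mul]
    push_cast
    field_simp
    ring
  · have h1 : corner s (fun a => (α : ℂ)⁻¹ * w a) (i, a) (j, a') = 0 := by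
      rw [corner, of_apply, if_neg]
      exact fun h' => h ⟨h'.1, h'.2.1⟩
    rw [h1]
    obtain ⟨r, hr⟩ : ∃ r, s + j = i + 1 + (r + 1) := ⟨s + j - i - 2, by have := i.2; omega⟩
    have h2 : (fun p => ν p * (ν p ^ r * (d p)⁻¹ * ‖(N (π p).1 - N (shadow (π p))) (i, a) (j, a')‖)) =o[G]
        (fun _ => (1 : ℝ)) := by
      have h3 : (fun p => ν p ^ r * (d p)⁻¹ * ‖(N (π p).1 - N (shadow (π p))) (i, a) (j, a')‖) =O[G]
          fun _ => (1 : ℝ) := by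
        have h4 : (fun p => (d p)⁻¹ * ‖(N (π p).1 - N (shadow (π p))) (i, a) (j, a')‖) =O[G] fun _ => (1 : ℝ) := by
          refine ((Asymptotics.isBigO_refl (fun p => (d p)⁻¹) G).mul hO.norm_left).trans_eventuallyEq ?_
          filter_upwards [hd] with p hp
          exact inv_mul_cancel₀ hp.ne'
        have h5 := ((hν0.pow r).isBigO_one ℝ).mul h4
        simpa only [mul_assoc, one_mul] using h5
      simpa using ((Asymptotics.isLittleO_one_iff ℝ).2 hν0).mul_isBigO h3
    rw [tendsto_zero_iff_norm_tendsto_zero]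
    refine ((Asymptotics.isLittleO_one_iff ℝ).1 h2).congr' ?_
    filter_upwards [hν, hd] with p hp hdp
    simp only [scaled, Matrix.smul_apply, of_apply, smul_eq_mul, norm_mul, norm_inv, norm_pow, norm_real,
      norm_of_nonneg hp.le, norm_of_nonneg (div_nonneg (pow_nonneg hp.le s) hdp.le)]
    have h4 : ν p ^ s * ν p ^ (j : ℕ) = ν p ^ ((i : ℕ) + 1) * (ν p ^ r * ν p) := by
      rw [← pow_add, hr, pow_add, pow_succ (ν p) r]
    have h5 : ν p ^ s / d p * (ν p ^ (j : ℕ) * (ν p ^ ((i : ℕ) + 1))⁻¹ * ‖(N (π p).1 - N (shadow (π p))) (i, a) (j, a')‖) =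
        (ν p ^ s * ν p ^ (j : ℕ)) * (ν p ^ ((i : ℕ) + 1))⁻¹ * ((d p)⁻¹ * ‖(N (π p).1 - N (shadow (π p))) (i, a) (j, a')‖) := by
      ring
    have := hp.ne'
    rw [h5, h4]
    field_simp

end


section

variable {n k : ℕ} {E : Endstate n k} {c b : ℝ} {ζ₀ : Freq k} {x₀ : ℝ} {l s m : ℕ}
  {g : (Fin k → ℝ) → ℝ} {e : ℕ → (Fin k → ℝ) → Matrix (Fin n) (Fin m) ℂ}
  {Lf : (Fin k → ℝ) → Matrix (Fin m) (Fin n) ℂ} {μ : Fin m → ℝ} {α : ℝ}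
  {ι : Type*} [Fintype ι] [DecidableEq ι] {q : Pt k → Matrix ι ι ℂ} {u : Pt k → Matrix (Fin n) ι ℂ}
  {U : Pt k → Matrix (Fin n) (Fin s × Fin m) ℂ} {N : Pt k → BMat s m}
  {V : (Fin k → ℝ) → Matrix ι (Fin s × Fin m) ℂ} {Vi : (Fin k → ℝ) → Matrix (Fin s × Fin m) ι ℂ}

/-- The frequencies at which the glancing blocks are split, near the base point. -/
def offAxis (c : ℝ) (ζ₀ : Freq k) : Filter (Pt k) :=
  𝓝 (0, ζ₀) ⊓ 𝓟 {p | p ∈ SBar k c ∧ ¬ (p.1 = 0 ∧ p.2.2.1 = 0)}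

/-- The distance to the glancing surface. -/
noncomputable def gdist (E : Endstate n k) (l : ℕ) (g : (Fin k → ℝ) → ℝ) (p : Pt k) : ℝ :=
  |p.2.1 - E.a l (vecCons (g p.2.2.2) p.2.2.2)| + p.2.2.1 + p.1

theorem SBar.off_axis (hb : 0 < b) (hb1 : b ≤ 1) (hc : 0 ≤ c) (hcb : c ≤ b / 4) {p : Pt k}
    (hp : p ∈ SBar k c ∧ ¬ (p.1 = 0 ∧ p.2.2.1 = 0)) :
    0 < p.1 + p.2.2.1 ∧ |p.2.2.1| ≤ 2 * (p.1 + p.2.2.1) ∧ 0 ≤ p.1 ∧ p.1 ≤ 2 * (p.1 + p.2.2.1) ∧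
      ∀ μ, b ≤ μ → b / 4 * (p.1 + p.2.2.1) ≤ p.2.2.1 + p.1 * μ := by
  obtain ⟨h1, h2⟩ := SBar.bounds hc hp.1
  have h3 : c * p.1 ≤ b / 4 * p.1 := mul_le_mul_of_nonneg_right hcb h1
  have h4 : b / 4 * p.1 ≤ p.1 / 4 := by nlinarith
  refine ⟨?_, ?_, h1, by linarith, fun μ hμ => ?_⟩
  · rcases h1.lt_or_eq with h5 | h5
    · linarith
    · have h6 : p.2.2.1 ≠ 0 := fun h => hp.2 ⟨h5.symm, h⟩
      rw [← h5] at h2 ⊢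
      simp only [mul_zero, neg_zero] at h2
      have := lt_of_le_of_ne h2 (Ne.symm h6)
      linarith
  · rw [abs_le]; constructor <;> linarith
  · have h5 : p.1 * b ≤ p.1 * μ := mul_le_mul_of_nonneg_left hμ h1
    nlinarith [mul_nonneg hb.le h1, mul_nonneg (mul_nonneg hb.le hb.le) h1]

theorem gdist_pos (hp : 0 < p.1 + p.2.2.1) : 0 < gdist E l g p := by
  rw [gdist]
  have := abs_nonneg (p.2.1 - E.a l (vecCons (g p.2.2.2) p.2.2.2))
  linarith

theorem nu_pos (h : 0 < gdist E l g p) : 0 < nu E l s g p := Real.rpow_pos_of_pos h _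

theorem nu_pow (hs : 1 ≤ s) (h : 0 < gdist E l g p) : nu E l s g p ^ s = gdist E l g p := by
  have hsR : (s : ℝ) ≠ 0 := by exact_mod_cast (by omega : s ≠ 0)
  change (gdist E l g p ^ (1 / (s : ℝ))) ^ s = _
  rw [← rpow_natCast, ← Real.rpow_mul h.le, one_div, inv_mul_cancel₀ hsR, Real.rpow_one]

theorem Chain.tendsto_surface {M : Matrix (Fin m) (Fin m) ℂ} (hC : Chain E ζ₀.1 x₀ ζ₀.2.2 l s m g e Lf M α) :
    Tendsto (fun p : Pt k => E.a l (vecCons (g p.2.2.2) p.2.2.2)) (𝓝 (0, ζ₀)) (𝓝 ζ₀.1) := by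
  have h1 : ContinuousAt (fun η : Fin k → ℝ => E.a l (vecCons (g η) η)) ζ₀.2.2 := by
    refine ContinuousAt.comp (g := E.a l) (f := fun η => (vecCons (g η) η : Fin (k + 1) → ℝ)) ?_ ?_
    · rw [hC.base]; exact hC.smooth_a.continuousAt
    · exact ContinuousAt.comp (g := fun q : ℝ × (Fin k → ℝ) => (vecCons q.1 q.2 : Fin (k + 1) → ℝ))
        (f := fun η => (g η, η)) Endstate.contDiff_vecCons.continuous.continuousAt
        (hC.smooth_g.continuousAt.prodMk continuousAt_id)
  have h2 : Tendsto (fun p : Pt k => p.2.2.2) (𝓝 (0, ζ₀)) (𝓝 ζ₀.2.2) :=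
    (continuous_snd.comp (continuous_snd.comp continuous_snd)).tendsto (0, ζ₀)
  have h3 := h1.tendsto.comp h2
  rwa [hC.base, hC.value] at h3

theorem Chain.tendsto_gdist {M : Matrix (Fin m) (Fin m) ℂ} (hγ : ζ₀.2.1 = 0)
    (hC : Chain E ζ₀.1 x₀ ζ₀.2.2 l s m g e Lf M α) :
    Tendsto (gdist E l g) (𝓝 (0, ζ₀)) (𝓝 0) := by
  have h1 : Tendsto (fun p : Pt k => p.2.1) (𝓝 (0, ζ₀)) (𝓝 ζ₀.1) :=
    (continuous_fst.comp continuous_snd).tendsto (0, ζ₀)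
  have h2 : Tendsto (fun p : Pt k => p.2.2.1) (𝓝 (0, ζ₀)) (𝓝 ζ₀.2.1) :=
    (continuous_fst.comp (continuous_snd.comp continuous_snd)).tendsto (0, ζ₀)
  have h3 := (((h1.sub hC.tendsto_surface).abs).add h2).add (continuous_fst.tendsto (0, ζ₀))
  rw [sub_self, abs_zero, hγ, add_zero, add_zero] at h3
  exact h3

theorem Chain.tendsto_nu {M : Matrix (Fin m) (Fin m) ℂ} (hγ : ζ₀.2.1 = 0)
    (hC : Chain E ζ₀.1 x₀ ζ₀.2.2 l s m g e Lf M α) :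
    Tendsto (nu E l s g) (𝓝 (0, ζ₀)) (𝓝 0) := by
  have hsR : (0 : ℝ) < 1 / (s : ℝ) := by
    have : (0 : ℝ) < s := by exact_mod_cast hC.s_pos
    positivity
  have h := (hC.tendsto_gdist hγ).rpow_const (p := 1 / (s : ℝ)) (Or.inr hsR.le)
  rw [Real.zero_rpow hsR.ne'] at h
  exact h

/-- The eigenvalues of the scaled block at `ρ = γ = 0`. -/
theorem NormalForm.scaled_exact (hC : Chain E ζ₀.1 x₀ ζ₀.2.2 l s m g e Lf (diagonal fun a => (μ a : ℂ)) α)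
    (hN : NormalForm E c ζ₀ x₀ l s m g e q U N V Vi) {G : Filter (Pt k)} (hG : G ≤ 𝓝 (0, ζ₀))
    {ν : Pt k → ℝ} (hν : ∀ᶠ p in G, 0 < ν p) (hν0 : Tendsto ν G (𝓝 0)) {b₀ t₀ δ : ℝ} (ht₀ : t₀ ≠ 0)
    (hb : α * b₀ ^ s = t₀) (ht : Tendsto (fun p : Pt k =>
      (p.2.1 - E.a l (vecCons (g p.2.2.2) p.2.2.2)) / ν p ^ s) G (𝓝 t₀)) (hδ : 0 < δ) :
    ∀ᶠ p in G, ∃ β : ℝ, |β - b₀| ≤ δ ∧ ∃ W : Matrix (Fin s × Fin m) (Fin m) ℂ,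
      (∀ v, W *ᵥ v = 0 → v = 0) ∧ scaled (ν p) (N (neutral p.2.1 p.2.2.2)) * W = (I * β) • W := by
  have hη : Tendsto (fun p : Pt k => p.2.2.2) G (𝓝 ζ₀.2.2) :=
    ((continuous_snd.comp (continuous_snd.comp continuous_snd)).tendsto (0, ζ₀)).mono_left hG
  have hgc : Tendsto (fun p : Pt k => g p.2.2.2) G (𝓝 x₀) := hC.base ▸ hC.smooth_g.continuousAt.tendsto.comp hη
  obtain ⟨r, hr, hball⟩ := Metric.eventually_nhds_iff_ball.1 hN.exact
  have h5 : Tendsto (fun p : Pt k => |g p.2.2.2 - x₀| + ν p * (|b₀| + δ)) G (𝓝 0) := by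
    have := ((hgc.sub_const x₀).abs).add (hν0.mul_const (|b₀| + δ))
    simpa using this
  filter_upwards [hC.exists_real_root hη hν hν0 ht₀ hb ht hδ, h5.eventually_lt_const hr,
    Metric.tendsto_nhds.1 hη r hr, hν] with p ⟨β, hβ, hroot⟩ hp2 hp3 hp4
  have h6 : (g p.2.2.2 + ν p * β, p.2.2.2) ∈ Metric.ball (x₀, ζ₀.2.2) r := by
    rw [Metric.mem_ball, Prod.dist_eq, max_lt_iff]
    refine ⟨?_, hp3⟩
    have h7 : |β| ≤ |b₀| + δ := by
      have := abs_sub_abs_le_abs_sub β b₀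
      linarith
    rw [Real.dist_eq]
    calc |g p.2.2.2 + ν p * β - x₀| = |(g p.2.2.2 - x₀) + ν p * β| := by ring_nf
      _ ≤ |g p.2.2.2 - x₀| + |ν p * β| := abs_add_le _ _
      _ ≤ |g p.2.2.2 - x₀| + ν p * (|b₀| + δ) := by rw [abs_mul, abs_of_pos hp4]; gcongr
      _ < r := hp2
  obtain ⟨W, hW, hNW⟩ := hball _ h6
  simp only [hroot, add_sub_cancel_left] at hNW
  have hν1 : (ν p : ℂ) ≠ 0 := by exact_mod_cast hp4.ne'
  have hinv := powersInv_mul (s := s) (m := m) hp4.ne'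
  have hinv' := mul_eq_one_comm.1 hinv
  refine ⟨β, hβ, powersInv s m (ν p) * W, fun v hv => hW v ?_, ?_⟩
  · have := congrArg (fun y => powers s m (ν p) *ᵥ y) hv
    simpa only [mulVec_mulVec, ← Matrix.mul_assoc, hinv', Matrix.one_mul, mulVec_zero] using this
  · have h7 : (ν p : ℂ) • (scaled (ν p) (N (neutral p.2.1 p.2.2.2)) * (powersInv s m (ν p) * W)) =
        (ν p : ℂ) • ((I * β) • (powersInv s m (ν p) * W)) := by
      rw [← smul_mul, ← powersInv_mul_powers hp4.ne', Matrix.mul_assoc, ← Matrix.mul_assoc (powers s m (ν p)),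
        hinv', Matrix.one_mul, Matrix.mul_assoc, hNW, Matrix.mul_smul, smul_smul]
      congr 1
      push_cast; ring
    exact smul_right_injective _ hν1 h7

/-- The splitting of the scaled block along an ultrafilter. -/
theorem NormalForm.ultrafilter_splitting (hE : E.Admissible) (hγ : ζ₀.2.1 = 0)
    (hC : Chain E ζ₀.1 x₀ ζ₀.2.2 l s m g e Lf (diagonal fun a => (μ a : ℂ)) α)
    (hN : NormalForm E c ζ₀ x₀ l s m g e q U N V Vi) (hb : 0 < b) (hb1 : b ≤ 1) (hμ : ∀ a, b ≤ μ a)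
    (hc : 0 ≤ c) (hcb : c ≤ b / 4) (ε : Bool) {sg : Fin s → Bool}
    (hcount : (univ.filter fun k => sg k = false).card ≤ (s + 1) / 2)
    (hsg : CompanionRoots ε α sg)
    (G : Ultrafilter (Pt k)) (hG : ↑G ≤ offAxis c ζ₀) :
    ∃ K c₁ : ℝ, 0 < K ∧ 0 < c₁ ∧ ∀ᶠ p in (G : Filter (Pt k)), SplitBy sg ((s + 1) / 2)
      ((sgn ε : ℂ) • scaled (nu E l s g p) (N p)) K (c₁ * ((p.1 + p.2.2.1) / gdist E l g p)) := by
  have hG1 : (G : Filter (Pt k)) ≤ 𝓝 (0, ζ₀) := hG.trans inf_le_left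
  have hGs : ∀ᶠ p in (G : Filter (Pt k)), p ∈ SBar k c ∧ ¬ (p.1 = 0 ∧ p.2.2.1 = 0) :=
    (hG.trans inf_le_right) (mem_principal_self _)
  have hGr : ∀ᶠ p in (G : Filter (Pt k)), p ∈ Reg k c := hGs.mono fun p hp => Or.inl hp.1
  have hoff := hGs.mono fun p hp => SBar.off_axis hb hb1 hc hcb hp
  have hε : ∀ᶠ p in (G : Filter (Pt k)), 0 < gdist E l g p := hoff.mono fun p hp => gdist_pos hp.1
  have hν : ∀ᶠ p in (G : Filter (Pt k)), 0 < nu E l s g p := hε.mono fun p hp => nu_pos hp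
  have hν0 := (hC.tendsto_nu hγ).mono_left hG1
  have haR := hC.tendsto_surface.mono_left hG1
  have hτ : Tendsto (fun p : Pt k => p.2.1) G (𝓝 ζ₀.1) :=
    ((continuous_fst.comp continuous_snd).tendsto (0, ζ₀)).mono_left hG1
  have hη : Tendsto (fun p : Pt k => p.2.2.2) G (𝓝 ζ₀.2.2) :=
    ((continuous_snd.comp (continuous_snd.comp continuous_snd)).tendsto (0, ζ₀)).mono_left hG1
  have hpair : ∀ {f : Pt k → ℝ}, Tendsto f G (𝓝 ζ₀.1) → Tendsto (fun p => (p, f p)) G (pairFilter c ζ₀) :=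
    fun hf => tendsto_inf.2 ⟨(tendsto_id.mono_left hG1).prodMk_nhds hf, tendsto_principal.2 hGr⟩
  let κ : Pt k → ℝ := fun p => (p.1 + p.2.2.1) / gdist E l g p
  let t : Pt k → ℝ := fun p => (p.2.1 - E.a l (vecCons (g p.2.2.2) p.2.2.2)) / gdist E l g p
  let r : Pt k → ℝ := fun p => p.1 / (p.1 + p.2.2.1)
  have hlim : ∀ {f : Pt k → ℝ} {A B : ℝ}, (∀ᶠ p in (G : Filter (Pt k)), f p ∈ Set.Icc A B) →
      ∃ y ∈ Set.Icc A B, Tendsto f G (𝓝 y) := fun hf =>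
    isCompact_Icc.ultrafilter_le_nhds' (G.map _) hf
  have hκ01 : ∀ᶠ p in (G : Filter (Pt k)), 0 < κ p ∧ κ p ≤ 1 := by
    filter_upwards [hoff, hε] with p hp hp'
    refine ⟨div_pos hp.1 hp', (div_le_one hp').2 ?_⟩
    rw [gdist]
    linarith [abs_nonneg (p.2.1 - E.a l (vecCons (g p.2.2.2) p.2.2.2))]
  have htκ : ∀ᶠ p in (G : Filter (Pt k)), |t p| + κ p = 1 := by
    filter_upwards [hε] with p hp'
    simp only [t, κ]
    rw [abs_div, abs_of_pos hp', ← add_div, div_eq_one_iff_eq hp'.ne', gdist]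
    ring
  obtain ⟨κ₀, hκ₀, hκ⟩ := hlim (f := κ) (A := 0) (B := 1) (hκ01.mono fun p hp => ⟨hp.1.le, hp.2⟩)
  obtain ⟨t₀, -, ht⟩ := hlim (f := t) (A := -1) (B := 1) (by
    filter_upwards [htκ, hκ01] with p h1 h2
    exact abs_le.1 (by linarith))
  obtain ⟨r₀, -, hr⟩ := hlim (f := r) (A := 0) (B := 2) (by
    filter_upwards [hoff] with p hp
    exact ⟨div_nonneg hp.2.2.1 hp.1.le, (div_le_iff₀ hp.1).2 hp.2.2.2.1⟩)
  have htκ0 : |t₀| + κ₀ = 1 :=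
    tendsto_nhds_unique ((ht.abs.add hκ).congr' htκ) tendsto_const_nhds
  let m₀ : Fin m → ℝ := fun a => 1 + r₀ * (μ a - 1)
  have hm : ∀ a, Tendsto (fun p : Pt k => (p.2.2.1 + p.1 * μ a) / (p.1 + p.2.2.1)) G (𝓝 (m₀ a)) := by
    intro a
    refine ((hr.mul_const (μ a - 1)).const_add 1).congr' ?_
    filter_upwards [hoff] with p hp
    have := hp.1.ne'
    simp only [r]
    field_simp
    ring
  have hm0 : ∀ a, 0 < m₀ a := by
    intro a
    refine lt_of_lt_of_le (by positivity : 0 < b / 4) (ge_of_tendsto (hm a) ?_)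
    filter_upwards [hoff] with p hp
    rw [le_div_iff₀ hp.1]
    exact hp.2.2.2.2 _ (hμ a)
  obtain ⟨y, hy0, hys, hyd, hy⟩ := hsg κ₀ t₀ m₀ hκ₀.1 htκ0 hm0
  have hL1 : Tendsto (fun p => (sgn ε : ℂ) • scaled (nu E l s g p) (N p)) G
      (𝓝 ((sgn ε * I) • shiftMat s m + corner s fun a => sgn ε * (α : ℂ)⁻¹ * ((κ₀ * m₀ a : ℝ) + I * (t₀ : ℝ)))) := by
    have h1 := hN.tendsto_scaled hE hγ hC (hpair haR) hν hν0 (d := gdist E l g) hε (by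
      refine Asymptotics.IsBigO.of_bound 4 ?_
      filter_upwards [hoff, hε] with p hp hp'
      rw [norm_of_nonneg hp'.le, dist₀, norm_of_nonneg (by positivity), gdist, abs_of_nonneg hp.2.2.1]
      have := abs_nonneg (p.2.1 - E.a l (vecCons (g p.2.2.2) p.2.2.2))
      linarith [hp.2.1, hp.2.2.2.1]) (w := fun a => (κ₀ * m₀ a : ℝ) + I * (t₀ : ℝ)) (by
      intro a
      have h2 : Tendsto (fun p => ((κ p * ((p.2.2.1 + p.1 * μ a) / (p.1 + p.2.2.1)) : ℝ) : ℂ) +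
          I * (t p : ℝ)) G (𝓝 ((κ₀ * m₀ a : ℝ) + I * (t₀ : ℝ))) :=
        ((continuous_ofReal.tendsto _).comp (hκ.mul (hm a))).add
          (((continuous_ofReal.tendsto _).comp ht).const_mul _)
      refine h2.congr' ?_
      filter_upwards [hoff, hε] with p hp hp'
      have h3 : ((p.1 : ℂ) + p.2.2.1) ≠ 0 := by exact_mod_cast hp.1.ne'
      have h4 : (gdist E l g p : ℂ) ≠ 0 := by exact_mod_cast hp'.ne'
      simp only [κ, t]
      push_cast
      field_simp
      ring)
    have h2 := tendsto_matrix_smul (tendsto_const_nhds (x := (sgn ε : ℂ)) (f := (G : Filter (Pt k))))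
      (tendsto_matrix_add (tendsto_const_nhds (x := I • shiftMat s m)) h1)
    have h3 : (sgn ε : ℂ) • (I • shiftMat s m + corner s fun a => (α : ℂ)⁻¹ * ((κ₀ * m₀ a : ℝ) + I * (t₀ : ℝ))) =
        (sgn ε * I) • shiftMat s m +
        corner s fun a => sgn ε * (α : ℂ)⁻¹ * ((κ₀ * m₀ a : ℝ) + I * (t₀ : ℝ)) := by
      rw [smul_add, smul_smul]
      congr 1
      ext i j
      simp only [corner, Matrix.smul_apply, of_apply, smul_eq_mul]
      split_ifs <;> ring
    rw [h3] at h2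
    refine h2.congr' ?_
    filter_upwards [hη.eventually hN.N_surface, hε] with p hp hp'
    rw [nu_pow hC.s_pos hp', div_self hp'.ne', ofReal_one, one_smul, scaled_sub]
    simp only [shadow]
    rw [hp, scaled_shift (nu_pos hp').ne', add_sub_cancel]
  have hL3 : Tendsto (fun p => (κ p : ℂ)⁻¹ • ((sgn ε : ℂ) • scaled (nu E l s g p) (N p) -
      (sgn ε : ℂ) • scaled (nu E l s g p) (N (neutral p.2.1 p.2.2.2)))) G
      (𝓝 (corner s fun a => sgn ε * (α : ℂ)⁻¹ * (m₀ a : ℝ))) := by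
    have h1 := hN.tendsto_scaled hE hγ hC (hpair hτ) hν hν0 (d := fun p => p.1 + p.2.2.1)
      (hoff.mono fun p hp => hp.1) (by
      refine Asymptotics.IsBigO.of_bound 4 ?_
      filter_upwards [hoff] with p hp
      rw [norm_of_nonneg hp.1.le, dist₀, norm_of_nonneg (by positivity), abs_of_nonneg hp.2.2.1, sub_self, abs_zero]
      linarith [hp.2.1, hp.2.2.2.1]) (w := fun a => (m₀ a : ℝ)) (by
      intro a
      refine ((continuous_ofReal.tendsto _).comp (hm a)).congr' ?_
      filter_upwards [hoff] with p hp
      have h3 : ((p.1 : ℂ) + p.2.2.1) ≠ 0 := by exact_mod_cast hp.1.ne'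
      simp only [Function.comp, sub_self, ofReal_zero, mul_zero, add_zero]
      push_cast
      field_simp)
    have h2 := tendsto_matrix_smul (tendsto_const_nhds (x := (sgn ε : ℂ)) (f := (G : Filter (Pt k)))) h1
    have h3 : (sgn ε : ℂ) • (corner s fun a => (α : ℂ)⁻¹ * (m₀ a : ℂ)) =
        corner s fun a => sgn ε * (α : ℂ)⁻¹ * (m₀ a : ℝ) := by
      ext i j
      simp only [corner, Matrix.smul_apply, of_apply, smul_eq_mul]
      split_ifs <;> ring
    rw [h3] at h2
    refine h2.congr' ?_
    filter_upwards [hoff, hε] with p hp hp'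
    simp only [shadow, κ]
    rw [nu_pow hC.s_pos hp', scaled_sub, ← smul_sub, smul_comm]
    congr 1
    rw [← Complex.ofReal_inv, inv_div]
  refine companion_splitting hC.s_pos hκ01
    (X₀ := fun p => (sgn ε : ℂ) • scaled (nu E l s g p) (N (neutral p.2.1 p.2.2.2)))
    (c := sgn ε * I) (w := fun a => sgn ε * (α : ℂ)⁻¹ * ((κ₀ * m₀ a : ℝ) + I * (t₀ : ℝ)))
    (y := y) ?_ hy0 hys hyd hL1 hcount fun i => ?_
  · have := norm_sgn ε
    exact mul_ne_zero (fun h => by rw [h] at this; simp at this) I_ne_zero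
  rcases hy i with h | ⟨hκ0, ht0, b₀, hyb, hbt, hpos⟩
  · exact Or.inl h
  right
  have hσ : sgn ε * sgn ε = 1 := by cases ε <;> simp [sgn]
  have hsR : (0 : ℝ) < s := by exact_mod_cast hC.s_pos
  have hb0 : b₀ ≠ 0 := by
    rintro rfl
    simp at hpos
  refine ⟨fun a => sgn ε * (α : ℂ)⁻¹ * (m₀ a : ℝ), I * (sgn ε * b₀ : ℝ), hyb, ?_, hL3, fun δ hδ => ?_, fun a => ?_⟩
  · have h1 := tendsto_matrix_smul ((continuous_ofReal.tendsto _).comp hκ) hL3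
    have h2 := tendsto_matrix_sub hL1 h1
    rw [hκ0, ofReal_zero, zero_smul, sub_zero, ← hκ0] at h2
    refine h2.congr' ?_
    filter_upwards [hκ01] with p hp
    have h3 : (κ p : ℂ) ≠ 0 := by exact_mod_cast hp.1.ne'
    simp only [Function.comp]
    rw [smul_smul, mul_inv_cancel₀ h3, one_smul, sub_sub_cancel]
  · have ht' : Tendsto (fun p : Pt k => (p.2.1 - E.a l (vecCons (g p.2.2.2) p.2.2.2)) / nu E l s g p ^ s) G (𝓝 t₀) := by
      refine ht.congr' ?_
      filter_upwards [hε] with p hp'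
      rw [nu_pow hC.s_pos hp']
    filter_upwards [hN.scaled_exact hC hG1 hν hν0 ht0 hbt ht' hδ] with p ⟨β, hβ, W, hW, hNW⟩
    refine ⟨sgn ε * β, ?_, W, hW, ?_⟩
    · rw [← mul_sub, norm_mul, norm_I, one_mul, ← ofReal_sub, ← mul_sub, ofReal_mul,
        norm_mul, norm_sgn, one_mul, norm_real]
      exact hβ
    · rw [smul_mul, hNW, smul_smul]
      congr 1
      push_cast; ring
  · have h1 : (sgn ε * I) / (I * (sgn ε * b₀ : ℝ)) = (b₀⁻¹ : ℂ) := by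
      have h2 : (sgn ε : ℂ) ≠ 0 := by exact_mod_cast left_ne_zero_of_mul_eq_one hσ
      have := I_ne_zero
      push_cast
      field_simp
    have h4 : (s : ℂ)⁻¹ * (b₀⁻¹ : ℂ) ^ (s - 1) * (sgn ε * (α : ℂ)⁻¹ * (m₀ a : ℝ)) =
        (((s : ℝ)⁻¹ * b₀⁻¹ ^ (s - 1) * (sgn ε * α⁻¹ * m₀ a) : ℝ) : ℂ) := by push_cast; rfl
    rw [h1, h4, ofReal_re]
    have h5 : b₀⁻¹ ^ (s - 1) * α⁻¹ = b₀ * t₀⁻¹ := by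
      obtain ⟨j, rfl⟩ : ∃ j, s = j + 1 := ⟨s - 1, by have := hC.s_pos; omega⟩
      rw [← hbt, Nat.add_sub_cancel, pow_succ, inv_pow]
      field_simp
    have h6 : sgn (sg i) * ((s : ℝ)⁻¹ * b₀⁻¹ ^ (s - 1) * (sgn ε * α⁻¹ * m₀ a)) =
        (s : ℝ)⁻¹ * m₀ a * (sgn (sg i) * (sgn ε * b₀) * t₀) * (t₀⁻¹) ^ 2 := by
      have h7 : sgn (sg i) * ((s : ℝ)⁻¹ * b₀⁻¹ ^ (s - 1) * (sgn ε * α⁻¹ * m₀ a)) =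
        sgn (sg i) * (s : ℝ)⁻¹ * sgn ε * m₀ a * (b₀⁻¹ ^ (s - 1) * α⁻¹) := by ring
      rw [h7, h5]
      field_simp
    rw [h6]
    have := hm0 a
    positivity

end


section

variable {n k : ℕ} {E : Endstate n k} {c b : ℝ} {ζ₀ : Freq k} {x₀ : ℝ} {l s m : ℕ}
  {g : (Fin k → ℝ) → ℝ} {e : ℕ → (Fin k → ℝ) → Matrix (Fin n) (Fin m) ℂ}
  {Lf : (Fin k → ℝ) → Matrix (Fin m) (Fin n) ℂ} {μ : Fin m → ℝ} {α : ℝ}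
  {ι : Type*} [Fintype ι] [DecidableEq ι] {q : Pt k → Matrix ι ι ℂ} {u : Pt k → Matrix (Fin n) ι ℂ}

theorem Chain.isGlancingCurve {M : Matrix (Fin m) (Fin m) ℂ} {τ₀ : ℝ} {η₀ : Fin k → ℝ} (hs : 2 ≤ s)
    (hC : Chain E τ₀ x₀ η₀ l s m g e Lf M α) : E.IsGlancingCurve τ₀ x₀ η₀ l s g :=
  ⟨hs, hC.smooth_g.of_le le_top, hC.base, hC.value, hC.order⟩

theorem norm_powers_le {s m : ℕ} {ν : ℝ} (h0 : 0 < ν) (h1 : ν ≤ 1) : ‖powers s m ν‖ ≤ 1 := by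
  rw [powers, l2_opNorm_diagonal, pi_norm_le_iff_of_nonneg zero_le_one]
  intro i
  rw [norm_pow, norm_real, norm_of_nonneg h0.le]
  exact pow_le_one₀ h0.le h1

theorem norm_powersInv_le {s m : ℕ} {ν : ℝ} (h0 : 0 < ν) (h1 : ν ≤ 1) :
    ‖powersInv s m ν‖ ≤ ν ^ (1 - (s : ℝ)) := by
  rw [powersInv, l2_opNorm_diagonal, pi_norm_le_iff_of_nonneg (rpow_nonneg h0.le _)]
  intro i
  rw [norm_inv, norm_pow, norm_real, norm_of_nonneg h0.le, ← rpow_natCast, ← Real.rpow_neg h0.le]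
  refine Real.rpow_le_rpow_of_exponent_ge h0 h1 ?_
  have : (i.1 : ℝ) + 1 ≤ s := by exact_mod_cast i.1.2
  linarith

theorem enorm₂_truncate_le {s m h : ℕ} {ν : ℝ} (h0 : 0 < ν) (h1 : ν ≤ 1) (v : Fin s × Fin m → ℂ) :
    enorm₂ (fun i : Fin s × Fin m => if (i.1 : ℕ) < h then v i else 0) ≤
      ν ^ (1 - (h : ℝ)) * enorm₂ (powers s m ν *ᵥ v) := by
  have h2 : 0 < ν ^ (1 - (h : ℝ)) := Real.rpow_pos_of_pos h0 _
  have h3 : enorm₂ (fun i : Fin s × Fin m => if (i.1 : ℕ) < h then v i else 0) ≤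
      enorm₂ (((ν ^ (1 - (h : ℝ)) : ℝ) : ℂ) • (powers s m ν *ᵥ v)) := by
    refine enorm₂_le (sum_le_sum fun i _ => pow_le_pow_left₀ (norm_nonneg _) ?_ 2)
    rw [Pi.smul_apply, powers, mulVec_diagonal, smul_eq_mul, ← mul_assoc, norm_mul]
    split_ifs with hi
    · refine le_mul_of_one_le_left (norm_nonneg _) ?_
      rw [norm_mul, norm_pow, norm_real, norm_real, norm_of_nonneg h0.le,
        norm_of_nonneg h2.le, ← rpow_natCast, ← Real.rpow_add h0]
      refine Real.one_le_rpow_of_pos_of_le_one_of_nonpos h0 h1 ?_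
      have : (i.1 : ℝ) + 1 ≤ h := by exact_mod_cast hi
      linarith
    · rw [norm_zero]; positivity
  refine h3.trans_eq ?_
  rw [enorm₂, WithLp.toLp_smul, norm_smul, norm_real, norm_of_nonneg h2.le]
  rfl

/-- The splitting of the block of a glancing mode. -/
theorem glancing_mode (hE : E.Admissible) (hγ : ζ₀.2.1 = 0) (hS : SlowBlock E c ζ₀ x₀ u q)
    (hC : Chain E ζ₀.1 x₀ ζ₀.2.2 l s m g e Lf (diagonal fun a => (μ a : ℂ)) α) (hb : 0 < b) (hb1 : b ≤ 1)
    (hμ : ∀ a, b ≤ μ a) (hc : 0 ≤ c) (hcb : c ≤ b / 4) (ε : Bool) :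
    ∃ (gp gm : ℕ) (K c₁ : ℝ), 0 < K ∧ 0 < c₁ ∧ ∀ᶠ p in 𝓝 (0, ζ₀), p ∈ SBar k c →
      ¬ (p.1 = 0 ∧ p.2.2.1 = 0) →
      ∃ (Tg : Matrix ι (Fin gp ⊕ Fin gm) ℂ) (Tgi : Matrix (Fin gp ⊕ Fin gm) ι ℂ)
        (Qp : Matrix (Fin gp) (Fin gp) ℂ) (Qm : Matrix (Fin gm) (Fin gm) ℂ),
        Tg * Tgi = 1 ∧ Tgi * Tg = 1 ∧ ‖Tg‖ ≤ K ∧ ‖Tgi‖ ≤ K * beta E l s g p ∧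
        (∀ w : Fin gm → ℂ, ‖WithLp.toLp 2 w‖ ≤ K * alpha E l s g p * ‖WithLp.toLp 2 (Tg *ᵥ Sum.elim 0 w)‖) ∧
        Tgi * ((sgn ε : ℂ) • q p) * Tg = fromBlocks Qp 0 0 Qm ∧
        ReGe Qp (c₁ * (p.1 + p.2.2.1) * beta E l s g p) ∧
        ReLe Qm (-(c₁ * (p.1 + p.2.2.1) * beta E l s g p)) := by
  obtain ⟨U, N, V, Vi, hN⟩ := exists_normalForm hE hγ hS hC
  obtain ⟨sg, hcount, hsg⟩ := exists_companion_roots hC.s_pos ε hC.coeff_ne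
  let P : ℕ → Pt k → Prop := fun i p => 0 ≤ (p.1 + p.2.2.1) / gdist E l g p ∧
    SplitBy sg ((s + 1) / 2) ((sgn ε : ℂ) • scaled (nu E l s g p) (N p)) i
      (1 / ((i : ℝ) + 1) * ((p.1 + p.2.2.1) / gdist E l g p))
  obtain ⟨i, hi⟩ : ∃ i, ∀ᶠ p in offAxis c ζ₀, P i p := by
    refine eventually_of_ultrafilter (fun i j p hij h => ⟨h.1, h.2.mono (by exact_mod_cast hij) ?_⟩) fun G hG => ?_
    · have := h.1
      gcongr
    · obtain ⟨K, c₁, hK, hc₁, h⟩ := hN.ultrafilter_splitting hE hγ hC hb hb1 hμ hc hcb ε hcount hsg G hG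
      obtain ⟨i, hi⟩ := exists_nat_ge (max K (1 / c₁))
      refine ⟨i, ?_⟩
      filter_upwards [h, (hG.trans inf_le_right) (mem_principal_self _)] with p h hp
      have hp1 := (SBar.off_axis hb hb1 hc hcb hp).1
      have h0 := (div_pos hp1 (gdist_pos (E := E) (l := l) (g := g) hp1)).le
      refine ⟨h0, h.mono ((le_max_left _ _).trans hi) (mul_le_mul_of_nonneg_right ?_ h0)⟩
      have h8 := (le_max_right _ _).trans hi
      rw [div_le_iff₀ hc₁] at h8
      rw [div_le_iff₀ (by positivity)]
      linarith
  obtain ⟨gp, gm, σ, hσ1, hσ2⟩ := exists_sign_equiv fun j : Fin s × Fin m => sg j.1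
  let R : Matrix (Fin s × Fin m) (Fin gp ⊕ Fin gm) ℂ := (1 : BMat s m).submatrix id σ
  let Ri : Matrix (Fin gp ⊕ Fin gm) (Fin s × Fin m) ℂ := (1 : BMat s m).submatrix σ id
  have hRr : ∀ {κ : Type _} (A : Matrix κ (Fin s × Fin m) ℂ), A * R = A.submatrix id σ := fun A => by
    have := (submatrix_mul A 1 id id σ bijective_id).symm
    rwa [Matrix.mul_one, submatrix_id_id] at this
  have hRl : ∀ {κ : Type _} (A : Matrix (Fin s × Fin m) κ ℂ), Ri * A = A.submatrix σ id := fun A => by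
    have := (submatrix_mul 1 A σ id id bijective_id).symm
    rwa [Matrix.one_mul, submatrix_id_id] at this
  have hRRi : R * Ri = 1 := by
    simp [R, Ri, submatrix_mul_equiv]
  have hRiR : Ri * R = 1 := by
    rw [hRl]; simp [R]
  have hη : Tendsto (fun p : Pt k => p.2.2.2) (𝓝 (0, ζ₀)) (𝓝 ζ₀.2.2) :=
    (continuous_snd.comp (continuous_snd.comp continuous_snd)).tendsto (0, ζ₀)
  set KV := ‖V ζ₀.2.2‖ + 1 with hKV
  set KVi := ‖Vi ζ₀.2.2‖ + 1 with hKVi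
  have hi0 : (0 : ℝ) ≤ i := Nat.cast_nonneg i
  refine ⟨gp, gm, KV * i * ‖R‖ + i * KVi * ‖Ri‖ + i * KVi + 1, 1 / ((i : ℝ) + 1), by positivity, by positivity, ?_⟩
  have hi' := eventually_inf_principal.1 hi
  filter_upwards [hi', (hN.smooth_V.continuousAt.norm.tendsto.comp hη).eventually_lt_const (lt_add_one _),
    (hN.smooth_Vi.continuousAt.norm.tendsto.comp hη).eventually_lt_const (lt_add_one _),
    hη.eventually hN.inv, (hC.tendsto_nu hγ).eventually_lt_const one_pos] with p hP hV hVi hinv hν1 hps hpax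
  obtain ⟨h0, T, Ti, h1, h2, h3, h4, h5, h6, h7⟩ := hP ⟨hps, hpax⟩
  have hp1 := (SBar.off_axis hb hb1 hc hcb ⟨hps, hpax⟩).1
  have hε := gdist_pos (E := E) (l := l) (g := g) hp1
  have hν : 0 < nu E l s g p := nu_pos hε
  have hνs := nu_pow hC.s_pos hε
  have hDi := powersInv_mul (s := s) (m := m) hν.ne'
  have hD := mul_eq_one_comm.1 hDi
  have hDN := powersInv_mul_powers hν.ne' (N p)
  have hβ : beta E l s g p = nu E l s g p / gdist E l g p := by
    rw [beta, Real.rpow_sub hν, Real.rpow_one, rpow_natCast, hνs]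
  have hβ0 : 0 < beta E l s g p := by rw [hβ]; positivity
  have hα0 : 0 < alpha E l s g p := Real.rpow_pos_of_pos hν _
  set X := (sgn ε : ℂ) • scaled (nu E l s g p) (N p) with hX
  set D := powers s m (nu E l s g p)
  set Di := powersInv s m (nu E l s g p)
  set Vp := V p.2.2.2
  set Vip := Vi p.2.2.2
  have hV' : ‖Vp‖ ≤ KV := hV.le
  have hVi' : ‖Vip‖ ≤ KVi := hVi.le
  have hDn : ‖D‖ ≤ 1 := norm_powers_le hν hν1.le
  have hDin : ‖Di‖ ≤ beta E l s g p := norm_powersInv_le hν hν1.le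
  let M := (nu E l s g p : ℂ) • (Ti * X * T) + (sgn ε * (I * g p.2.2.2)) • (1 : BMat s m)
  have hM : Ti * Di * Vip * ((sgn ε : ℂ) • q p) * (Vp * D * T) = M := by
    have h8 : Vip * q p * Vp = N p + (I * g p.2.2.2) • 1 := by
      rw [hN.conj p, Matrix.mul_sub, Matrix.sub_mul, Matrix.mul_smul, Matrix.mul_one, smul_mul, hinv.2,
        sub_add_cancel]
    have h9 : Ti * Di * Vip * ((sgn ε : ℂ) • q p) * (Vp * D * T) =
        (sgn ε : ℂ) • (Ti * (Di * (Vip * q p * Vp) * D) * T) := by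
      simp only [Matrix.mul_smul, smul_mul, Matrix.mul_assoc]
    rw [h9, h8, Matrix.mul_add, Matrix.add_mul, hDN, Matrix.mul_smul, Matrix.mul_one, smul_mul, hDi,
      Matrix.mul_add, Matrix.add_mul, Matrix.mul_smul, Matrix.mul_smul, Matrix.mul_one, smul_mul, smul_mul, h2]
    simp only [M, hX, Matrix.mul_smul, smul_mul, smul_add, smul_smul]
    congr 2
    ring
  have hMoff : ∀ i j : Fin s × Fin m, sg i.1 ≠ sg j.1 → M i j = 0 := by
    intro i j hij
    have h8 : i.1 ≠ j.1 := fun h => hij (by rw [h])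
    have h9 : i ≠ j := fun h => h8 (by rw [h])
    simp only [M, Matrix.add_apply, Matrix.smul_apply, h5 i j h8, one_apply_ne h9, smul_zero, add_zero]
  have hMre : ReGe (of fun i j => (sgn (sg i.1) : ℂ) * M i j) (1 / ((i : ℝ) + 1) * (p.1 + p.2.2.1) * beta E l s g p) := by
    have h8 := (h6.smul hν.le).add (reGe_diagonal (d := fun j : Fin s × Fin m =>
      ((sgn (sg j.1) * (sgn ε * g p.2.2.2) : ℝ) : ℂ) * I) (r := 0) fun j => by
        rw [re_ofReal_mul, I_re, mul_zero])
    convert h8 using 1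
    · ext i' j
      simp only [M, of_apply, Matrix.add_apply, Matrix.smul_apply, smul_eq_mul, Matrix.one_apply, diagonal_apply]
      split_ifs
      · push_cast; ring
      · push_cast; ring
    · rw [hβ]; ring
  obtain ⟨hs1, hs2, hs3⟩ := split_of_sign hσ1 hσ2 hMoff hMre
  have hnn : 0 ≤ KV * i * ‖R‖ ∧ 0 ≤ i * KVi * ‖Ri‖ ∧ 0 ≤ i * KVi := ⟨by positivity, by positivity, by positivity⟩
  have hVDT : ‖Vp * D * T‖ ≤ KV * i :=
    calc ‖Vp * D * T‖ ≤ ‖Vp‖ * ‖D‖ * ‖T‖ :=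
          (l2_opNorm_mul _ _).trans (mul_le_mul_of_nonneg_right (l2_opNorm_mul _ _) (norm_nonneg _))
      _ ≤ KV * 1 * i := by gcongr
      _ = KV * i := by ring
  have hTDV : ‖Ti * Di * Vip‖ ≤ i * KVi * beta E l s g p :=
    calc ‖Ti * Di * Vip‖ ≤ ‖Ti‖ * ‖Di‖ * ‖Vip‖ :=
          (l2_opNorm_mul _ _).trans (mul_le_mul_of_nonneg_right (l2_opNorm_mul _ _) (norm_nonneg _))
      _ ≤ i * beta E l s g p * KVi := by gcongr
      _ = i * KVi * beta E l s g p := by ring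
  have hinv1 : Vp * D * T * (Ti * Di * Vip) = 1 := by
    have : Vp * D * T * (Ti * Di * Vip) = Vp * (D * (T * Ti) * Di) * Vip := by simp only [Matrix.mul_assoc]
    rw [this, h1, Matrix.mul_one, hD, Matrix.mul_one, hinv.1]
  have hinv2 : Ti * Di * Vip * (Vp * D * T) = 1 := by
    have : Ti * Di * Vip * (Vp * D * T) = Ti * (Di * (Vip * Vp) * D) * T := by simp only [Matrix.mul_assoc]
    rw [this, hinv.2, Matrix.mul_one, hDi, Matrix.mul_one, h2]
  refine ⟨Vp * D * T * R, Ri * (Ti * Di * Vip), M.submatrix (σ ∘ Sum.inl) (σ ∘ Sum.inl),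
    M.submatrix (σ ∘ Sum.inr) (σ ∘ Sum.inr), ?_, ?_, ?_, ?_, fun w => ?_, ?_, hs2, hs3⟩
  · rw [Matrix.mul_assoc, ← Matrix.mul_assoc R, hRRi, Matrix.one_mul, hinv1]
  · rw [Matrix.mul_assoc, ← Matrix.mul_assoc _ _ R, hinv2, Matrix.one_mul, hRiR]
  · refine (l2_opNorm_mul _ _).trans ?_
    have := mul_le_mul_of_nonneg_right hVDT (norm_nonneg R)
    linarith [hnn.2.1, hnn.2.2]
  · refine (l2_opNorm_mul _ _).trans ?_
    have h8 := mul_le_mul_of_nonneg_left hTDV (norm_nonneg Ri)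
    have h9 : 0 ≤ (KV * i * ‖R‖ + i * KVi + 1) * beta E l s g p := by positivity
    linarith
  · let v : Fin s × Fin m → ℂ := Sum.elim 0 w ∘ σ.symm
    have hv : ∀ j, sg j.1 = true → v j = 0 := by
      intro j hj
      rcases h8 : σ.symm j with a | a
      · simp [v, h8]
      · have h9 := hσ2 a
        rw [← h8, Equiv.apply_symm_apply, hj] at h9
        exact absurd h9 (by simp)
    have hRv : R *ᵥ Sum.elim 0 w = v := by
      ext j
      have hRe : ∀ a, R j a = if j = σ a then 1 else 0 := fun a => Matrix.one_apply
      rw [mulVec, dotProduct, sum_eq_single (σ.symm j)]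
      · rw [hRe, Equiv.apply_symm_apply, if_pos rfl, one_mul]
        rfl
      · intro a _ ha
        rw [hRe, if_neg (fun h => ha (by rw [h, Equiv.symm_apply_apply])), zero_mul]
      · simp
    have hwv : enorm₂ w ≤ enorm₂ v := by
      refine enorm₂_le (le_of_eq ?_)
      rw [← σ.sum_comp, sum_sum_type]
      simp [v]
    have h8 : (Vp * D * T * R) *ᵥ Sum.elim 0 w = Vp *ᵥ (D *ᵥ (T *ᵥ v)) := by
      rw [← mulVec_mulVec, hRv, ← mulVec_mulVec, ← mulVec_mulVec]
    have h9 : D *ᵥ (T *ᵥ v) = Vip *ᵥ (Vp *ᵥ (D *ᵥ (T *ᵥ v))) := by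
      rw [mulVec_mulVec _ Vip, hinv.2, one_mulVec]
    have h10 : enorm₂ (D *ᵥ (T *ᵥ v)) ≤ KVi * enorm₂ (Vp *ᵥ (D *ᵥ (T *ᵥ v))) := by
      conv_lhs => rw [h9]
      exact (enorm₂_mulVec _ _).trans (mul_le_mul_of_nonneg_right hVi' (enorm₂_nonneg _))
    have h11 := enorm₂_truncate_le (h := (s + 1) / 2) hν hν1.le (T *ᵥ v)
    change enorm₂ w ≤ _ * enorm₂ ((Vp * D * T * R) *ᵥ Sum.elim 0 w)
    rw [h8]
    have h12 := enorm₂_nonneg (Vp *ᵥ (D *ᵥ (T *ᵥ v)))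
    calc enorm₂ w ≤ enorm₂ v := hwv
      _ ≤ i * enorm₂ fun i => if (i.1 : ℕ) < (s + 1) / 2 then (T *ᵥ v) i else 0 := h7 v hv
      _ ≤ i * (alpha E l s g p * (KVi * enorm₂ (Vp *ᵥ (D *ᵥ (T *ᵥ v))))) :=
        mul_le_mul_of_nonneg_left (h11.trans (mul_le_mul_of_nonneg_left h10 hα0.le)) hi0
      _ = i * KVi * (alpha E l s g p * enorm₂ (Vp *ᵥ (D *ᵥ (T *ᵥ v)))) := by ring
      _ ≤ (KV * i * ‖R‖ + i * KVi * ‖Ri‖ + i * KVi + 1) * (alpha E l s g p * enorm₂ (Vp *ᵥ (D *ᵥ (T *ᵥ v)))) := by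
        refine mul_le_mul_of_nonneg_right ?_ (by positivity)
        linarith [hnn.1, hnn.2.1]
      _ = _ := by ring
  · have h8 : Ri * (Ti * Di * Vip) * ((sgn ε : ℂ) • q p) * (Vp * D * T * R) =
        Ri * (Ti * Di * Vip * ((sgn ε : ℂ) • q p) * (Vp * D * T)) * R := by simp only [Matrix.mul_assoc]
    rw [h8, hM, hRl, hRr, submatrix_submatrix]
    exact hs1

end


/-! ### Existence of block decompositions -/

section

variable {n k : ℕ} {ζ₀ : Freq k}

theorem exists_riccati {C L R P Q : Pt k → Matrix (Fin n) (Fin n) ℂ} (hC : MSmooth ω C (0, ζ₀))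
    (hL : MSmooth ω L (0, ζ₀)) (hR : MSmooth ω R (0, ζ₀)) (hP : MSmooth ω P (0, ζ₀)) (hQ : MSmooth ω Q (0, ζ₀))
    (hL0 : (L (0, ζ₀)).det ≠ 0) (hR0 : (R (0, ζ₀)).det ≠ 0) :
    ∃ Z : Pt k → Matrix (Fin n) (Fin n) ℂ, MSmooth ω Z (0, ζ₀) ∧
      L (0, ζ₀) * Z (0, ζ₀) * R (0, ζ₀) = -C (0, ζ₀) ∧
      ∀ᶠ p in 𝓝 (0, ζ₀), C p + L p * Z p * R p + (p.1 : ℂ) • (P p * Z p * (Q p * Z p)) = 0 := by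
  have hLu := isUnit_iff_ne_zero.2 hL0
  have hRu := isUnit_iff_ne_zero.2 hR0
  let Φ : Pt k × (Fin n → Fin n → ℂ) → (Fin n → Fin n → ℂ) := fun t =>
    (C t.1 + L t.1 * of t.2 * R t.1 + (t.1.1 : ℂ) • (P t.1 * of t.2 * (Q t.1 * of t.2)) : Matrix (Fin n) (Fin n) ℂ)
  set z₀ : Fin n → Fin n → ℂ := -((L (0, ζ₀))⁻¹ * C (0, ζ₀) * (R (0, ζ₀))⁻¹) with hz₀
  have hz : L (0, ζ₀) * of z₀ * R (0, ζ₀) = -C (0, ζ₀) := by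
    have : of z₀ = -((L (0, ζ₀))⁻¹ * C (0, ζ₀) * (R (0, ζ₀))⁻¹) := rfl
    rw [this, Matrix.mul_neg, Matrix.neg_mul, Matrix.mul_assoc, Matrix.mul_assoc, Matrix.mul_assoc,
      nonsing_inv_mul _ hRu, Matrix.mul_one, mul_nonsing_inv_cancel_left _ _ hLu]
  have hsnd : MSmooth ω (fun t : Pt k × (Fin n → Fin n → ℂ) => of t.2) ((0, ζ₀), z₀) := fun i j =>
    contDiffAt_pi.1 (contDiffAt_pi.1 contDiffAt_snd i) j
  have hfst : ∀ {f : Pt k → Matrix (Fin n) (Fin n) ℂ}, MSmooth ω f (0, ζ₀) →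
      MSmooth ω (fun t : Pt k × (Fin n → Fin n → ℂ) => f t.1) ((0, ζ₀), z₀) := fun hf =>
    MSmooth.comp (g := fun t : Pt k × (Fin n → Fin n → ℂ) => t.1) hf contDiffAt_fst
  have hΦ : ContDiffAt ℝ ω Φ ((0, ζ₀), z₀) := by
    rw [contDiffAt_pi]; intro i
    rw [contDiffAt_pi]; intro j
    exact (((hfst hC).add (((hfst hL).mul hsnd).mul (hfst hR))).add (MSmooth.smul
      ((contDiff_rho.comp contDiff_fst).contDiffAt) (((hfst hP).mul hsnd).mul ((hfst hQ).mul hsnd)))) i j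
  have hlin : ∀ z, Φ ((0, ζ₀), z) = (C (0, ζ₀) + L (0, ζ₀) * of z * R (0, ζ₀) : Matrix (Fin n) (Fin n) ℂ) := by
    intro z
    simp only [Φ, ofReal_zero, zero_smul, add_zero]
    rfl
  obtain ⟨ψ, hψ0, hψs, hψ⟩ := exists_implicit_function Φ (0, ζ₀) z₀ hΦ (by
    rw [hlin, hz]; exact add_neg_cancel (C (0, ζ₀))) (by
    intro w hw
    let A : Fin n → Fin n → ℂ := (L (0, ζ₀) * of w * R (0, ζ₀) : Matrix (Fin n) (Fin n) ℂ)
    have hform : (fun t : ℝ => Φ ((0, ζ₀), z₀ + t • w)) = fun t : ℝ => t • A := by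
      funext t
      have h1 : of (z₀ + t • w) = of z₀ + (t : ℂ) • of w := by ext i j; simp
      rw [hlin, h1, Matrix.mul_add, Matrix.add_mul, hz, Matrix.mul_smul, smul_mul]
      funext i j
      simp only [A, Matrix.add_apply, Matrix.neg_apply, Matrix.smul_apply, smul_eq_mul, Pi.smul_apply,
        add_neg_cancel_left]
      exact real_smul.symm
    rw [hform] at hw
    have hA : HasDerivAt (fun t : ℝ => t • A) A 0 := by simpa using (hasDerivAt_id (0 : ℝ)).smul_const A
    have hA0 : L (0, ζ₀) * of w * R (0, ζ₀) = 0 := hA.unique hw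
    have h2 : of w = (L (0, ζ₀))⁻¹ * (L (0, ζ₀) * of w * R (0, ζ₀)) * (R (0, ζ₀))⁻¹ := by
      rw [Matrix.mul_assoc, Matrix.mul_assoc (L (0, ζ₀) * _), mul_nonsing_inv _ hRu, Matrix.mul_one,
        nonsing_inv_mul_cancel_left _ _ hLu]
    rw [hA0, Matrix.mul_zero, Matrix.zero_mul] at h2
    exact h2)
  refine ⟨fun p => of (ψ p), fun i j => contDiffAt_pi.1 (contDiffAt_pi.1 hψs i) j, ?_, hψ⟩
  simp only [hψ0]
  exact hz

/-- Separation of the slow and the fast modes. -/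
theorem exists_slow_fast {E : Endstate n k} (hE : E.Admissible) : ∃ (T : Pt k → Matrix (Fin n ⊕ Fin n) (Fin n ⊕ Fin n) ℂ)
    (h P : Pt k → Matrix (Fin n) (Fin n) ℂ), MSmooth ω T (0, ζ₀) ∧ MSmooth ω h (0, ζ₀) ∧ MSmooth ω P (0, ζ₀) ∧
      h (0, ζ₀) = -((cx (E.A 0))⁻¹ * lead E ζ₀) ∧ P (0, ζ₀) = cx (E.A 0) * (cx (E.B 0 0))⁻¹ ∧
      ∀ᶠ p in 𝓝 (0, ζ₀), (T p).det ≠ 0 ∧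
        Gmat E (p.1 • p.2) * T p = T p * fromBlocks ((p.1 : ℂ) • h p) 0 0 (P p) := by
  have hA : (cx (E.A 0)).det ≠ 0 := by rw [cx_det]; exact_mod_cast hE.A1_det
  have hB : (cx (E.B 0 0)).det ≠ 0 := by rw [cx_det]; exact_mod_cast hE.B11_det
  have hAu := isUnit_iff_ne_zero.2 hA
  have hBu := isUnit_iff_ne_zero.2 hB
  have hBi : ((cx (E.B 0 0))⁻¹).det ≠ 0 := (isUnit_nonsing_inv_det _ hBu).ne_zero
  have hρ : ContDiffAt ℝ ω (fun p : Pt k => (p.1 : ℂ)) (0, ζ₀) := contDiff_rho.contDiffAt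
  let s : Pt k → Matrix (Fin n) (Fin n) ℂ := fun p => lead E p.2 + (p.1 : ℂ) • quad E p.2
  let L : Pt k → Matrix (Fin n) (Fin n) ℂ := fun p => cx (E.A 0) - (p.1 : ℂ) • cross E p.2
  have hs : MSmooth ω s (0, ζ₀) := (mSmooth_lead E _).add (MSmooth.smul hρ (mSmooth_quad E _))
  have hL : MSmooth ω L (0, ζ₀) := (MSmooth.const _).sub (MSmooth.smul hρ (mSmooth_cross E _))
  have hL0 : L (0, ζ₀) = cx (E.A 0) := by simp [L]
  have hs0 : s (0, ζ₀) = lead E ζ₀ := by simp [s]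
  obtain ⟨h, hhs, hh0, hh⟩ := exists_riccati hs hL (MSmooth.const 1) (MSmooth.const (-cx (E.B 0 0)))
    (MSmooth.const 1) (by rw [hL0]; exact hA) (by simp)
  obtain ⟨X, hXs, hX0, hX⟩ := exists_riccati (MSmooth.const (-(cx (E.B 0 0))⁻¹)) (MSmooth.const 1)
    (hL.mul (MSmooth.const (cx (E.B 0 0))⁻¹)) (MSmooth.const 1) hs (by simp)
    (by rw [hL0, det_mul]; exact mul_ne_zero hA hBi)
  let T : Pt k → Matrix (Fin n ⊕ Fin n) (Fin n ⊕ Fin n) ℂ := fun p =>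
    fromBlocks 1 (X p) ((p.1 : ℂ) • (cx (E.B 0 0) * h p)) 1
  let P : Pt k → Matrix (Fin n) (Fin n) ℂ := fun p => (p.1 : ℂ) • (s p * X p) + L p * (cx (E.B 0 0))⁻¹
  have hT : MSmooth ω T (0, ζ₀) := MSmooth.fromBlocks (MSmooth.const 1) hXs
    (MSmooth.smul hρ ((MSmooth.const _).mul hhs)) (MSmooth.const 1)
  refine ⟨T, h, P, hT, hhs, (MSmooth.smul hρ (hs.mul hXs)).add (hL.mul (MSmooth.const _)), ?_, ?_, ?_⟩
  · rw [hL0, hs0, Matrix.mul_one] at hh0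
    rw [← Matrix.mul_neg, ← hh0, nonsing_inv_mul_cancel_left _ _ hAu]
  · simp [P, hL0]
  have hT0 : (T (0, ζ₀)).det ≠ 0 := by
    simp only [T, ofReal_zero, zero_smul, det_fromBlocks_zero₂₁]
    simp
  filter_upwards [hh, hX, hT.det.continuousAt.eventually_ne hT0] with p hp1 hp2 hp3
  refine ⟨hp3, ?_⟩
  have h1 : Gmat E (p.1 • p.2) = fromBlocks 0 (cx (E.B 0 0))⁻¹ ((p.1 : ℂ) • s p) (L p * (cx (E.B 0 0))⁻¹) := by
    rw [Gmat_smul, ← Matrix.neg_mul, neg_sub, smul_add, smul_smul, ← pow_two]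
  rw [h1]
  simp only [T, P, fromBlocks_multiply, Matrix.zero_mul, Matrix.mul_zero, zero_add, add_zero, Matrix.mul_one,
    Matrix.one_mul, smul_mul, Matrix.mul_smul]
  rw [Matrix.mul_one, Matrix.one_mul, Matrix.neg_mul, Matrix.neg_mul, smul_neg, ← sub_eq_add_neg, sub_eq_zero] at hp1
  rw [Matrix.one_mul, add_assoc, neg_add_eq_zero] at hp2
  have h2 : L p * (cx (E.B 0 0))⁻¹ * (cx (E.B 0 0) * h p) = L p * h p := by
    rw [Matrix.mul_assoc, ← Matrix.mul_assoc _ _ (h p), nonsing_inv_mul _ hBu, Matrix.one_mul]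
  rw [h2, ← smul_add, hp1, nonsing_inv_mul_cancel_left _ _ hBu, Matrix.mul_add,
    Matrix.mul_smul, add_comm ((p.1 : ℂ) • (X p * _)), ← hp2]

theorem exists_block_splitting {M : Pt k → Matrix (Fin n) (Fin n) ℂ} {x₀ : Pt k} (hM : MSmooth ω M x₀)
    {Λ : Type} [DecidableEq Λ] (lab : ℂ → Λ) : ∃ d : Fin n → ℂ,
      (M x₀).charpoly = ∏ i, (Polynomial.X - Polynomial.C (d i)) ∧ ∀ δ > 0,
      ∃ T D : Pt k → Matrix (Fin n) (Fin n) ℂ, MSmooth ω T x₀ ∧ MSmooth ω D x₀ ∧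
        (∀ x i j, lab (d i) ≠ lab (d j) → D x i j = 0) ∧
        ∀ᶠ x in 𝓝 x₀, M x * T x = T x * D x ∧ (T x).det ≠ 0 ∧ ∀ i j, ‖D x i j - diagonal d i j‖ ≤ δ := by
  obtain ⟨d, hd, hnear⟩ := nearDiag (M x₀)
  refine ⟨d, hd, fun δ hδ => ?_⟩
  obtain ⟨T, D, hT0, hD0, hTc, hDc, hsm, hoff, hTD, -⟩ := exists_blockDiag (fun i => lab (d i)) d
    fun i j hij h => hij (by rw [h])
  have hDδ : ∀ᶠ N in 𝓝 (diagonal d), ∀ i j, ‖D N i j - diagonal d i j‖ ≤ δ := by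
    simp only [eventually_all]
    intro i j
    have h1 := hDc.tendsto
    rw [hD0] at h1
    filter_upwards [Metric.tendsto_nhds.1 (tendsto_matrix.1 h1 i j) δ hδ] with N hN
    rw [dist_eq_norm] at hN
    exact hN.le
  choose C hC hCd using fun m : ℕ => hnear (1 / ((m : ℝ) + 1)) (by positivity)
  have hlim : Tendsto (fun m => (C m)⁻¹ * M x₀ * C m) atTop (𝓝 (diagonal d)) := by
    rw [tendsto_matrix]
    intro i j
    rw [tendsto_iff_norm_sub_tendsto_zero]
    exact squeeze_zero (fun _ => norm_nonneg _) (fun m => hCd m i j) tendsto_one_div_add_atTop_nhds_zero_nat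
  obtain ⟨m, hm⟩ := (hlim.eventually (hsm.and (hTD.and hDδ).eventually_nhds)).exists
  have hCu := isUnit_iff_ne_zero.2 (hC m)
  have hf : MSmooth ω (fun x => (C m)⁻¹ * M x * C m) x₀ := ((MSmooth.const _).mul hM).mul (MSmooth.const _)
  obtain ⟨h1, h2⟩ := hm.1 (Pt k) (fun x => (C m)⁻¹ * M x * C m) x₀ rfl hf
  refine ⟨fun x => C m * T ((C m)⁻¹ * M x * C m), fun x => D ((C m)⁻¹ * M x * C m), (MSmooth.const _).mul h1, h2,
    fun x i j hij => hoff _ i j hij, ?_⟩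
  filter_upwards [hf.continuousAt.tendsto.eventually hm.2] with x hx
  refine ⟨?_, ?_, hx.2⟩
  · rw [Matrix.mul_assoc (C m), ← hx.1.1]
    simp only [← Matrix.mul_assoc]
    rw [mul_nonsing_inv _ hCu, Matrix.one_mul]
  · rw [det_mul]
    exact mul_ne_zero (hC m) hx.1.2

end


/-- Labels of the modes: fast modes and elliptic modes with the sign of the real part, and the
purely imaginary modes. -/
abbrev Lab := Bool ⊕ (Bool ⊕ (Bool × ℝ))

section labels

variable {C : Type} [Fintype C] [DecidableEq C] (L : C → Lab)

/-- The number of columns with label `x`. -/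
noncomputable abbrev cnt (x : Lab) : ℕ := Nat.card {c // L c = x}

/-- An enumeration of the columns with label `x`. -/
noncomputable def fib (x : Lab) (i : Fin (cnt L x)) : C := ((Finite.equivFin {c // L c = x}).symm i).1

theorem label_fib (x : Lab) (i : Fin (cnt L x)) : L (fib L x i) = x := ((Finite.equivFin {c // L c = x}).symm i).2

theorem fib_injective (x : Lab) : Injective (fib L x) :=
  Subtype.val_injective.comp (Equiv.injective _)

theorem exists_fib {c : C} {x : Lab} (h : L c = x) : ∃ i, fib L x i = c :=
  ⟨Finite.equivFin _ ⟨c, h⟩, by simp [fib]⟩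

theorem cnt_le (x : Lab) : cnt L x ≤ card C := by
  simpa using Fintype.card_le_of_injective _ (fib_injective L x)

variable {L} {D : Matrix C C ℂ} {d : C → ℂ} {g δ : ℝ}

theorem eval_charpoly_block (hD : ∀ a b, L a ≠ L b → D a b = 0) {β : ℂ} (x : Lab)
    (h : (D.submatrix (fib L x) (fib L x)).charpoly.eval β = 0) : D.charpoly.eval β = 0 := by
  classical
  rw [eval_charpoly] at h ⊢
  rw [twoBlockTriangular_det _ (fun c => L c = x)]
  · refine mul_eq_zero_of_left ?_ _
    rw [← h, ← det_submatrix_equiv_self (Finite.equivFin {c // L c = x}).symm]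
    congr 1
    ext i j
    simp [toSquareBlockProp, fib, diagonal_apply, Subtype.val_inj]
  · intro i hi j hj
    have hij : i ≠ j := fun h => hi (h ▸ hj)
    simp [hij, hD i j fun h => hi (h.trans hj)]

theorem near_diagonal_block (hδ : ∀ a b, ‖D a b - diagonal d a b‖ ≤ δ) (x : Lab) (i j : Fin (cnt L x)) :
    ‖(D.submatrix (fib L x) (fib L x)) i j - (diagonal (fun i => d (fib L x i)) : Matrix _ _ ℂ) i j‖ ≤ δ := by
  have h := hδ (fib L x i) (fib L x j)
  simpa [diagonal_apply, (fib_injective L x).eq_iff] using h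

theorem charpoly_block (hD : ∀ a b, L a ≠ L b → D a b = 0) (hd : D.charpoly = ∏ c, (Polynomial.X - Polynomial.C (d c)))
    (hδ0 : 0 ≤ δ) (hδ : ∀ a b, ‖D a b - diagonal d a b‖ ≤ δ) (hg : ∀ a b, d a ≠ d b → g ≤ ‖d a - d b‖)
    (hδg : card C * δ < g) {x : Lab} {z : ℂ} (hx : ∀ c, L c = x → d c = z) :
    (D.submatrix (fib L x) (fib L x)).charpoly = (Polynomial.X - Polynomial.C z) ^ cnt L x := by
  set Q := D.submatrix (fib L x) (fib L x) with hQ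
  have hroot : ∀ β ∈ Q.charpoly.roots, β = z := by
    intro β hβ
    rw [mem_roots (charpoly_monic _).ne_zero, Polynomial.IsRoot.def] at hβ
    have h1 := eval_charpoly_block hD x hβ
    rw [hd, eval_prod, Finset.prod_eq_zero_iff] at h1
    obtain ⟨c, -, hc⟩ := h1
    have hc : β = d c := by simpa [sub_eq_zero] using hc
    rw [eval_charpoly] at hβ
    obtain ⟨v, hv, hQv⟩ := exists_mulVec_eq_zero_iff.2 hβ
    have hQv : Q *ᵥ v = β • v := by
      rw [sub_mulVec, sub_eq_zero] at hQv
      rw [← hQv]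
      ext i
      simp [mulVec_diagonal]
    obtain ⟨i, h2⟩ := eigenvalue_close (near_diagonal_block hδ x) hv hQv
    have hi := hx _ (label_fib L x i)
    by_contra hne
    have h3 := hg c (fib L x i) (by rwa [hi, ← hc])
    rw [← hc] at h3
    have h4 : (card (Fin (cnt L x)) : ℝ) ≤ card C := by
      rw [card_fin]; exact_mod_cast cnt_le L x
    nlinarith
  have hcard : Q.charpoly.roots.card = cnt L x := by
    rw [← (IsAlgClosed.splits Q.charpoly).natDegree_eq_card_roots, charpoly_natDegree_eq_dim, card_fin]
  rw [(IsAlgClosed.splits Q.charpoly).eq_prod_roots_of_monic (charpoly_monic _),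
    Multiset.eq_replicate.2 ⟨hcard, hroot⟩, Multiset.map_replicate, Multiset.prod_replicate]

theorem reGe_block (hδ0 : 0 ≤ δ) (hδ : ∀ a b, ‖D a b - diagonal d a b‖ ≤ δ) {x : Lab} {r : ℝ}
    (hx : ∀ c, L c = x → r ≤ (d c).re) :
    ReGe (D.submatrix (fib L x) (fib L x)) (r - card C * δ) := by
  have h1 := (reGe_diagonal (d := fun i => d (fib L x i)) (r := r) fun i => hx _ (label_fib L x i)).add
    (reGe_of_entries (M := D.submatrix (fib L x) (fib L x) - diagonal fun i => d (fib L x i))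
      (near_diagonal_block hδ x))
  rw [add_sub_cancel] at h1
  refine h1.mono ?_
  have h4 : (card (Fin (cnt L x)) : ℝ) ≤ card C := by
    rw [card_fin]; exact_mod_cast cnt_le L x
  nlinarith

theorem reLe_block (hδ0 : 0 ≤ δ) (hδ : ∀ a b, ‖D a b - diagonal d a b‖ ≤ δ) {x : Lab} {r : ℝ}
    (hx : ∀ c, L c = x → (d c).re ≤ -r) :
    ReLe (D.submatrix (fib L x) (fib L x)) (-(r - card C * δ)) := by
  rw [reLe_iff_reGe_neg, neg_neg]
  refine reGe_block (D := -D) (d := -d) hδ0 (fun a b => ?_) fun c hc => ?_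
  · rw [show (diagonal (-d) : Matrix C C ℂ) = -diagonal d from (diagonal_neg d).symm, Matrix.neg_apply,
      Matrix.neg_apply, neg_sub_neg, norm_sub_rev]
    exact hδ a b
  · have := hx c hc
    simp only [Pi.neg_apply, Complex.neg_re]
    linarith

variable (L) {n k : ℕ} (E : Bool → Endstate n k) (ζ₀ : Freq k)

/-- The columns, ordered by their labels. -/
noncomputable def cols : Col E ζ₀ (cnt L (.inl true)) (cnt L (.inl false)) (cnt L (.inr (.inl true)))
    (cnt L (.inr (.inl false))) (fun m => cnt L (.inr (.inr m))) → C :=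
  Sum.elim (Sum.elim (Sum.elim (fib L _) (fib L _)) (Sum.elim (fib L _) (fib L _)))
    (Sum.elim (fun x => fib L (.inr (.inr x.1.1)) x.2) (fun x => fib L (.inr (.inr x.1.1)) x.2))

theorem cols_bijective (hL : ∀ c m, L c = .inr (.inr m) → m ∈ modes E ζ₀) : Bijective (cols L E ζ₀) := by
  constructor
  · have key : ∀ {x y : Lab} {a : Fin (cnt L x)} {b : Fin (cnt L y)}, fib L x a = fib L y b → x = y := fun {x y a b} h => by
      have h1 := label_fib L x a
      rwa [h, label_fib L, eq_comm] at h1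
    rintro (((a | a) | (a | a)) | (⟨⟨r, hr⟩, a⟩ | ⟨⟨r, hr⟩, a⟩)) (((b | b) | (b | b)) | (⟨⟨t, ht⟩, b⟩ | ⟨⟨t, ht⟩, b⟩)) h <;>
    first
      | (exfalso; have h2 := key h; simp at h2; done)
      | (obtain rfl : r = t := by simpa using key h
         first
          | exact (BlockDecomposition.disjoint_modes hr ht).elim
          | exact (BlockDecomposition.disjoint_modes ht hr).elim
          | (have h2 := fib_injective L _ h; subst h2; rfl))
      | (have h2 := fib_injective L _ h; subst h2; rfl)
  · intro c
    rcases h : L c with (_ | _) | (_ | _) | m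
    · obtain ⟨i, hi⟩ := exists_fib L h
      exact ⟨.inl (.inl (.inr i)), hi⟩
    · obtain ⟨i, hi⟩ := exists_fib L h
      exact ⟨.inl (.inl (.inl i)), hi⟩
    · obtain ⟨i, hi⟩ := exists_fib L h
      exact ⟨.inl (.inr (.inr i)), hi⟩
    · obtain ⟨i, hi⟩ := exists_fib L h
      exact ⟨.inl (.inr (.inl i)), hi⟩
    · obtain ⟨i, hi⟩ := exists_fib L h
      by_cases hg : GlancingMode E ζ₀ m
      · exact ⟨.inr (.inr ⟨⟨m, by simpa [hyperbolicModes, glancingModes, hg] using hL c m h⟩, i⟩), hi⟩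
      · exact ⟨.inr (.inl ⟨⟨m, by simpa [hyperbolicModes, glancingModes, hg] using hL c m h⟩, i⟩), hi⟩

set_option maxHeartbeats 1000000 in
theorem submatrix_cols (hD : ∀ a b, L a ≠ L b → D a b = 0) (w : ℂ) :
    (of fun a b => (if (L a).isLeft then 1 else w) * D a b).submatrix (cols L E ζ₀) (cols L E ζ₀) =
      fromBlocks
        (fromBlocks (fromBlocks (D.submatrix (fib L _) (fib L _)) 0 0 (D.submatrix (fib L _) (fib L _))) 0 0
          (w • fromBlocks (D.submatrix (fib L _) (fib L _)) 0 0 (D.submatrix (fib L _) (fib L _)))) 0 0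
        (w • fromBlocks
          (blockDiagonal' (fun j : hyperbolicModes E ζ₀ => D.submatrix (fib L (.inr (.inr j.1))) (fib L (.inr (.inr j.1))))) 0 0
          (blockDiagonal' (fun j : glancingModes E ζ₀ => D.submatrix (fib L (.inr (.inr j.1))) (fib L (.inr (.inr j.1)))))) := by
  have key : ∀ {x y : Lab} {a : Fin (cnt L x)} {b : Fin (cnt L y)}, x ≠ y → D (fib L x a) (fib L y b) = 0 :=
    fun {x y a b} h => hD _ _ (by simpa only [label_fib] using h)
  ext i j
  rcases i with ((a | a) | (a | a)) | (⟨⟨r, hr⟩, a⟩ | ⟨⟨r, hr⟩, a⟩) <;>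
  rcases j with ((b | b) | (b | b)) | (⟨⟨t, ht⟩, b⟩ | ⟨⟨t, ht⟩, b⟩) <;>
  simp only [submatrix_apply, of_apply, cols, Sum.elim_inl, Sum.elim_inr, label_fib, Sum.isLeft_inl,
    Sum.isLeft_inr, if_true, one_mul, fromBlocks_apply₁₁, fromBlocks_apply₁₂, fromBlocks_apply₂₁,
    fromBlocks_apply₂₂, Matrix.smul_apply, smul_eq_mul, Matrix.zero_apply, mul_zero, reduceCtorEq, if_false,
    Bool.false_eq_true] <;>
  first
    | (refine key ?_; simp; done)
    | (refine mul_eq_zero_of_right _ (key ?_); simp; done)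
    | exact mul_eq_zero_of_right _ (key fun h => BlockDecomposition.disjoint_modes hr ((by simpa using h : r = t) ▸ ht))
    | exact mul_eq_zero_of_right _ (key fun h => BlockDecomposition.disjoint_modes ht ((by simpa using h : r = t) ▸ hr))
    | (rw [blockDiagonal'_apply]
       split_ifs with h
       · simp only [Subtype.mk.injEq] at h
         subst h
         rfl
       · rw [key fun e => h (Subtype.ext (by simpa using e)), mul_zero])

end labels

theorem MSmooth.blockDiagonal {X : Type*} [NormedAddCommGroup X] [NormedSpace ℝ X] {N : ℕ∞ω} {x : X} {o ι κ : Type*} [DecidableEq o]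
    {f : o → X → Matrix ι κ ℂ} (hf : ∀ s, MSmooth N (f s) x) :
    MSmooth N (fun p => blockDiagonal fun s => f s p) x := by
  rintro ⟨i, s⟩ ⟨j, t⟩
  simp only [blockDiagonal_apply]
  split_ifs
  exacts [hf s i j, contDiffAt_const]

theorem charpoly_blockDiagonal {ι o : Type*} [Fintype ι] [Fintype o] [DecidableEq ι] [DecidableEq o] (M : o → Matrix ι ι ℂ) :
    (blockDiagonal M).charpoly = ∏ s, (M s).charpoly := by
  simp only [charpoly]
  rw [← det_blockDiagonal]
  congr 1
  ext ⟨i, s⟩ ⟨j, t⟩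
  by_cases h : s = t <;> by_cases h' : i = j <;> simp [charmatrix_apply, blockDiagonal_apply, diagonal_apply, h, h']


theorem charpoly_of_conj {ι : Type*} [Fintype ι] [DecidableEq ι] {M T D : Matrix ι ι ℂ} (h : M * T = T * D) (hT : T.det ≠ 0) :
    D.charpoly = M.charpoly := by
  have hu := isUnit_iff_ne_zero.2 hT
  have h2 : T⁻¹ * M * T = D := by
    rw [Matrix.mul_assoc, h, nonsing_inv_mul_cancel_left _ _ hu]
  rw [← h2]
  exact charpoly_units_conj' (T.nonsingInvUnit hu) M

theorem MSmooth.eventually {X : Type*} [NormedAddCommGroup X] [NormedSpace ℝ X] {ι κ : Type*} [Finite ι] [Finite κ]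
    {f : X → Matrix ι κ ℂ} {x : X} (hf : MSmooth ω f x) : ∀ᶠ y in 𝓝 x, MSmooth ω f y :=
  eventually_all.2 fun i => eventually_all.2 fun j => (hf i j).eventually (by simp)

theorem MSmooth.contDiffOn {X : Type*} [NormedAddCommGroup X] [NormedSpace ℝ X] {ι κ : Type*} {f : X → Matrix ι κ ℂ} {U : Set X}
    (hf : ∀ x ∈ U, MSmooth ω f x) (i : ι) (j : κ) : ContDiffOn ℝ ∞ (fun p => f p i j) U :=
  fun x hx => ((hf x hx i j).of_le le_top).contDiffWithinAt

variable {n k : ℕ} {E : Bool → Endstate n k} {ζ₀ : Freq k}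

theorem re_ne_zero_of_fast (hE : ∀ s, (E s).Admissible) {s : Bool} {z : ℂ}
    (hz : ((sgn s : ℂ) • (cx ((E s).A 0) * (cx ((E s).B 0 0))⁻¹)).charpoly.eval z = 0) : z.re ≠ 0 := by
  intro h0
  rw [eval_charpoly] at hz
  obtain ⟨v, hv, hMv⟩ := exists_mulVec_eq_zero_iff.2 hz
  rw [sub_mulVec, sub_eq_zero, smul_mulVec] at hMv
  have hzv : (scalar (Fin n) z) *ᵥ v = z • v := by
    ext i
    simp [mulVec_diagonal]
  refine (hE s).fast (sgn s * z.im) (Module.End.hasEigenvalue_of_hasEigenvector (x := v) ⟨?_, hv⟩)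
  rw [Module.End.mem_eigenspace_iff, toLin'_apply]
  have h1 := congrArg (fun w => (sgn s : ℂ) • w) hMv
  simp only [hzv, smul_smul, sgn_mul_self_cx, one_smul] at h1
  rw [← h1]
  congr 1
  apply Complex.ext <;> simp [h0]

set_option maxHeartbeats 1000000 in
/-- Block decompositions exist. -/
theorem exists_blockDecomposition (hE : ∀ s, (E s).Admissible) (c : ℝ) : Nonempty (BlockDecomposition E c ζ₀) := by
  choose T₀ h P hT₀ hh hP hh0 hP0 hev using fun s => exists_slow_fast (ζ₀ := ζ₀) (hE s)
  let labS : Bool → ℂ → Lab := fun s z => if z.re = 0 then .inr (.inr (s, z.im)) else .inr (.inl (decide (0 < z.re)))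
  let labF : ℂ → Lab := fun z => .inl (decide (0 < z.re))
  choose dS hdS hS using fun s => exists_block_splitting (MSmooth.smul (a := fun _ => (sgn s : ℂ)) contDiffAt_const (hh s)) (labS s)
  choose dF hdF hF using fun s => exists_block_splitting (MSmooth.smul (a := fun _ => (sgn s : ℂ)) contDiffAt_const (hP s)) labF
  have hfast : ∀ s i, (dF s i).re ≠ 0 := fun s i => re_ne_zero_of_fast hE (s := s) (by
    rw [← hP0 s, hdF s, eval_prod]
    exact Finset.prod_eq_zero (mem_univ i) (by simp))
  let d : (Fin n ⊕ Fin n) × Bool → ℂ := fun c => Sum.elim (dS c.2) (dF c.2) c.1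
  let L : (Fin n ⊕ Fin n) × Bool → Lab := fun c => Sum.elim (fun i => labS c.2 (dS c.2 i)) (fun i => labF (dF c.2 i)) c.1
  have hmode : ∀ c m, L c = .inr (.inr m) → d c = I * (m.2 : ℂ) ∧ c.2 = m.1 ∧ m ∈ modes E ζ₀ := by
    rintro ⟨i | i, s⟩ m hm
    · change labS s (dS s i) = _ at hm
      simp only [labS] at hm
      split_ifs at hm with h0
      · simp only [Sum.inr.injEq] at hm
        subst hm
        refine ⟨Complex.ext (by simp [d, h0]) (by simp [d]), rfl, ?_⟩
        simp only [modes, Finset.mem_biUnion, mem_univ, true_and, Finset.mem_image, mem_filter,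
          Multiset.mem_toFinset]
        refine ⟨s, dS s i, ⟨?_, h0⟩, rfl⟩
        have h1 : H0 E s ζ₀ = (sgn s : ℂ) • h s (0, ζ₀) := by rw [hh0, smul_neg, H0, neg_smul]; rfl
        rw [mem_roots (charpoly_monic _).ne_zero, Polynomial.IsRoot.def, h1, hdS s, eval_prod]
        exact Finset.prod_eq_zero (mem_univ i) (by simp)
      · simp at hm
    · simp [L, labF] at hm
  obtain ⟨g₁, hg₁, hg1⟩ := exists_pos_le (fun c => if (d c).re = 0 then (1 : ℝ) else |(d c).re|) (fun c => by
    split_ifs with h; exacts [one_pos, abs_pos.2 h])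
  obtain ⟨g₂, hg₂, hg2⟩ := exists_pos_le (fun c : ((Fin n ⊕ Fin n) × Bool) × ((Fin n ⊕ Fin n) × Bool) =>
    if d c.1 = d c.2 then (1 : ℝ) else ‖d c.1 - d c.2‖) (fun c => by
    split_ifs with h; exacts [one_pos, norm_pos_iff.2 (sub_ne_zero.2 h)])
  have hsign : ∀ c b, (L c = .inl b ∨ L c = .inr (.inl b)) → g₁ ≤ sgn b * (d c).re := by
    rintro ⟨i, s⟩ b hb
    have h1 := hg1 (i, s)
    have h2 : (d (i, s)).re ≠ 0 ∧ decide (0 < (d (i, s)).re) = b := by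
      rcases i with i | i
      · simp only [L, labS, Sum.elim_inl] at hb
        split_ifs at hb with h0
        · simp at hb
        · exact ⟨h0, by simp only [Sum.inr.injEq, Sum.inl.injEq, reduceCtorEq, false_or] at hb; exact hb⟩
      · exact ⟨hfast s i, by simp only [L, labF, Sum.elim_inr, Sum.inl.injEq, reduceCtorEq, or_false] at hb; exact hb⟩
    simp only [h2.1, if_false] at h1
    rw [← h2.2]
    by_cases h3 : 0 < (d (i, s)).re
    · simpa [sgn, h3, abs_of_pos h3] using h1
    · simpa [sgn, h3, abs_of_nonpos (not_lt.1 h3)] using h1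
  set N : ℝ := (card ((Fin n ⊕ Fin n) × Bool) : ℝ) with hN
  obtain ⟨δ, hδ, hδ1, hδ2⟩ : ∃ δ > 0, N * δ ≤ g₁ / 2 ∧ N * δ < g₂ := by
    refine ⟨min (g₁ / 2) (g₂ / 2) / (N + 1), by positivity, ?_, ?_⟩ <;>
    have h1 : N * (min (g₁ / 2) (g₂ / 2) / (N + 1)) ≤ min (g₁ / 2) (g₂ / 2) := by
      rw [← mul_div_assoc, div_le_iff₀ (by positivity)]
      nlinarith [show 0 < min (g₁ / 2) (g₂ / 2) by positivity]
    · exact h1.trans (min_le_left _ _)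
    · exact (h1.trans (min_le_right _ _)).trans_lt (by linarith)
  choose TS DS hTS hDS hoffS hevS using fun s => hS s δ hδ
  choose TF DF hTF hDF hoffF hevF using fun s => hF s δ hδ
  let T : Pt k → Matrix ((Fin n ⊕ Fin n) × Bool) ((Fin n ⊕ Fin n) × Bool) ℂ := fun p =>
    blockDiagonal fun s => T₀ s p * fromBlocks (TS s p) 0 0 (TF s p)
  let D : Pt k → Matrix ((Fin n ⊕ Fin n) × Bool) ((Fin n ⊕ Fin n) × Bool) ℂ := fun p =>
    blockDiagonal fun s => fromBlocks (DS s p) 0 0 (DF s p)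
  have hT : MSmooth ω T (0, ζ₀) := MSmooth.blockDiagonal fun s =>
    (hT₀ s).mul (MSmooth.fromBlocks (hTS s) (MSmooth.const 0) (MSmooth.const 0) (hTF s))
  have hDs : MSmooth ω D (0, ζ₀) := MSmooth.blockDiagonal fun s =>
    MSmooth.fromBlocks (hDS s) (MSmooth.const 0) (MSmooth.const 0) (hDF s)
  have hD : ∀ p a b, L a ≠ L b → D p a b = 0 := by
    rintro p ⟨i, s⟩ ⟨j, t⟩ hab
    simp only [D, blockDiagonal_apply]
    split_ifs with hst
    · subst hst
      rcases i with i | i <;> rcases j with j | j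
      exacts [hoffS s p i j hab, rfl, rfl, hoffF s p i j hab]
    · rfl
  have hleft : ∀ i s, (L (Sum.inl i, s)).isLeft = false := by
    intro i s
    simp only [L, labS, Sum.elim_inl]
    split_ifs <;> rfl
  have hrel : ∀ᶠ p in 𝓝 (0, ζ₀), (T p).det ≠ 0 ∧
      Ginf E p * T p = T p * (of fun a b => (if (L a).isLeft then 1 else (p.1 : ℂ)) * D p a b) ∧
      ∀ a b, ‖D p a b - diagonal d a b‖ ≤ δ := by
    filter_upwards [eventually_all.2 hev, eventually_all.2 hevS, eventually_all.2 hevF] with p h1 h2 h3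
    refine ⟨?_, ?_, ?_⟩
    · simp only [T, det_blockDiagonal, det_mul, det_fromBlocks_zero₂₁]
      exact Finset.prod_ne_zero_iff.2 fun s _ => mul_ne_zero (h1 s).1 (mul_ne_zero (h2 s).2.1 (h3 s).2.1)
    · have h4 : (of fun a b => (if (L a).isLeft then 1 else (p.1 : ℂ)) * D p a b) =
          blockDiagonal fun s => fromBlocks ((p.1 : ℂ) • DS s p) 0 0 (DF s p) := by
        ext ⟨i, s⟩ ⟨j, t⟩
        simp only [D, of_apply, blockDiagonal_apply]
        by_cases hst : s = t
        · subst hst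
          rcases i with i | i
          · rw [hleft]
            rcases j with j | j <;> simp
          · rw [show (L (Sum.inr i, s)).isLeft = true from rfl]
            rcases j with j | j <;> simp
        · simp [hst]
      rw [h4]
      simp only [Ginf, T, ← blockDiagonal_mul]
      congr 1
      funext s
      rw [smul_mul, ← Matrix.mul_assoc, (h1 s).2, Matrix.mul_assoc, Matrix.mul_assoc, ← Matrix.mul_smul]
      congr 1
      rw [fromBlocks_multiply, fromBlocks_multiply, fromBlocks_smul]
      simp only [Matrix.mul_zero, Matrix.zero_mul, add_zero, zero_add, smul_zero, smul_mul, Matrix.mul_smul]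
      rw [← (h2 s).1, ← (h3 s).1, smul_mul, smul_mul, smul_comm]
    · rintro ⟨i, s⟩ ⟨j, t⟩
      simp only [D, blockDiagonal_apply]
      split_ifs with hst
      · subst hst
        rcases i with i | i <;> rcases j with j | j
        · simpa [diagonal_apply, d] using (h2 s).2.2 i j
        · simpa using hδ.le
        · simpa using hδ.le
        · simpa [diagonal_apply, d] using (h3 s).2.2 i j
      · simpa [hst] using hδ.le
  have hchar : (D (0, ζ₀)).charpoly = ∏ c, (Polynomial.X - Polynomial.C (d c)) := by
    simp only [D]
    rw [charpoly_blockDiagonal, Fintype.prod_prod_type_right]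
    refine Finset.prod_congr rfl fun s _ => ?_
    rw [charpoly_fromBlocks_zero₂₁, charpoly_of_conj (hevS s).self_of_nhds.1 (hevS s).self_of_nhds.2.1,
      charpoly_of_conj (hevF s).self_of_nhds.1 (hevF s).self_of_nhds.2.1, hdS, hdF, Fintype.prod_sum_type]
    rfl
  obtain ⟨U, hU, hUo, hU0⟩ := eventually_nhds_iff.1 (hrel.and (hT.eventually.and hDs.eventually))
  let σ := Equiv.ofBijective _ (cols_bijective L E ζ₀ fun c m hm => (hmode c m hm).2.2)
  have hg : ∀ a b, d a ≠ d b → g₂ ≤ ‖d a - d b‖ := fun a b hab => by simpa [hab] using hg2 (a, b)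
  have hsm : ∀ (x y : Lab) i j, ContDiffOn ℝ ∞ (fun p => (D p).submatrix (fib L x) (fib L y) i j) U := fun x y i j =>
    MSmooth.contDiffOn (fun p hp => (hU p hp).2.2) (fib L x i) (fib L y j)
  have hsup : ∀ (p : Pt k) (i : Fin n ⊕ Fin n) (s : Bool) (m : Bool × ℝ) (b : Fin (cnt L (.inr (.inr m)))), s ≠ m.1 →
      T p (i, s) (fib L (.inr (.inr m)) b) = 0 := by
    intro p i s m b hs
    have h1 := (hmode _ m (label_fib L _ b)).2.1
    simp only [T, blockDiagonal_apply, h1, hs, if_false]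
  have hinv : ∀ p ∈ U, T p * (T p)⁻¹ = 1 ∧ (T p)⁻¹ * T p = 1 := fun p hp =>
    have hu := isUnit_iff_ne_zero.2 (hU p hp).1.1
    ⟨mul_nonsing_inv _ hu, nonsing_inv_mul _ hu⟩
  exact ⟨{
    U := U
    isOpen_U := hUo
    base_mem := hU0
    kp := cnt L (.inl true)
    km := cnt L (.inl false)
    ep := cnt L (.inr (.inl true))
    em := cnt L (.inr (.inl false))
    ν := fun m => cnt L (.inr (.inr m))
    T := fun p => (T p).submatrix id σ
    Tinv := fun p => ((T p)⁻¹).submatrix σ id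
    Pp := fun p => (D p).submatrix (fib L _) (fib L _)
    Pm := fun p => (D p).submatrix (fib L _) (fib L _)
    Qep := fun p => (D p).submatrix (fib L _) (fib L _)
    Qem := fun p => (D p).submatrix (fib L _) (fib L _)
    Q := fun m p => (D p).submatrix (fib L _) (fib L _)
    smooth_T := fun i j => MSmooth.contDiffOn (fun p hp => (hU p hp).2.1) i (σ j)
    smooth_Pp := hsm _ _
    smooth_Pm := hsm _ _
    smooth_Qep := hsm _ _
    smooth_Qem := hsm _ _
    smooth_Q := fun m _ => hsm _ _
    mul_inv := fun p hp => by
      rw [submatrix_mul_equiv, (hinv p hp.1).1, submatrix_id_id]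
    inv_mul := fun p hp => by
      rw [← submatrix_mul _ _ _ _ _ bijective_id, (hinv p hp.1).2, submatrix_one_equiv]
    diag := fun p hp => by
      have h1 : Ginf E p = (Ginf E p).submatrix id id := rfl
      rw [h1, ← submatrix_mul _ _ _ _ _ bijective_id, ← submatrix_mul _ _ _ _ _ bijective_id,
        Matrix.mul_assoc, (hU p hp.1).1.2.1, ← Matrix.mul_assoc, (hinv p hp.1).2, Matrix.one_mul]
      exact submatrix_cols L E ζ₀ (hD p) _
    definite := ⟨g₁ / 2, half_pos hg₁, fun p hp => by
      have h1 := (hU p hp.1).1.2.2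
      have h2 : g₁ / 2 ≤ g₁ - N * δ := by linarith
      have hp' : ∀ x, (x = Sum.inl true ∨ x = .inr (.inl true)) → ReGe ((D p).submatrix (fib L x) (fib L x)) (g₁ / 2) :=
        fun x hx => (reGe_block hδ.le h1 (r := g₁) fun c hc => by
          have := hsign c true (hc ▸ hx)
          simpa [sgn] using this).mono h2
      have hm' : ∀ x, (x = Sum.inl false ∨ x = .inr (.inl false)) → ReLe ((D p).submatrix (fib L x) (fib L x)) (-(g₁ / 2)) :=
        fun x hx => by
          have h3 := reLe_block (L := L) hδ.le h1 (x := x) (r := g₁) fun c hc => by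
            have := hsign c false (hc ▸ hx)
            simp only [sgn, Bool.false_eq_true, if_false] at this
            linarith
          rw [reLe_iff_reGe_neg, neg_neg] at h3 ⊢
          exact h3.mono h2
      exact ⟨hp' _ (.inl rfl), hm' _ (.inl rfl), hp' _ (.inr rfl), hm' _ (.inr rfl)⟩⟩
    base_spectrum := fun j _ => charpoly_block (hD _) hchar hδ.le (hU _ hU0).1.2.2 hg hδ2 fun c hc => (hmode c j hc).1
    support_h := fun p _ i s j b hs => hsup p i s j.1 b hs
    support_g := fun p _ i s j b hs => hsup p i s j.1 b hs }⟩


variable {n k : ℕ} {E : Bool → Endstate n k} {c : ℝ} {ζ₀ : Freq k}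

theorem exists_hyperbolicSplitting (D : BlockDecomposition E c ζ₀)
    (h0 : ∀ p ∈ SBar k c, 0 ≤ p.1 + p.2.2.1)
    (h : ∀ j : hyperbolicModes E ζ₀, ∃ (T Ti : Matrix (Fin (D.ν j.1)) (Fin (D.ν j.1)) ℂ) (ε : Bool) (c₁ : ℝ),
      T * Ti = 1 ∧ Ti * T = 1 ∧ 0 < c₁ ∧ ∀ᶠ p in 𝓝 (0, ζ₀), p ∈ SBar k c →
        ReGe ((sgn ε : ℂ) • (Ti * D.Q j.1 p * T)) (c₁ * (p.1 + p.2.2.1))) :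
    ∃ V₀ ∈ 𝓝 (0, ζ₀), ∃ K₀ c₀ : ℝ, 0 < c₀ ∧ ∀ V ⊆ V₀, ∀ K c₁, K₀ ≤ K → c₁ ≤ c₀ → HyperbolicSplitting D V K c₁ := by
  choose T Ti ε c₁ hT hTi hc hev using h
  obtain ⟨c₀, hc₀, hc₀'⟩ := exists_pos_le c₁ hc
  obtain ⟨a, b, e, he1, he2⟩ := exists_sign_equiv fun i : (Σ j : hyperbolicModes E ζ₀, Fin (D.ν j.1)) => ε i.1
  let M : Pt k → Matrix (Σ j : hyperbolicModes E ζ₀, Fin (D.ν j.1)) (Σ j : hyperbolicModes E ζ₀, Fin (D.ν j.1)) ℂ := fun p =>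
    blockDiagonal' fun j => Ti j * D.Q j.1 p * T j
  refine ⟨_, eventually_all.2 hev, max ‖(blockDiagonal' T).submatrix id e‖ ‖(blockDiagonal' Ti).submatrix e id‖, c₀, hc₀,
    fun V hV K c' hK hc' => ⟨a, b, fun _ => (blockDiagonal' T).submatrix id e, fun _ => (blockDiagonal' Ti).submatrix e id,
      fun p => (M p).submatrix (e ∘ Sum.inl) (e ∘ Sum.inl), fun p => (M p).submatrix (e ∘ Sum.inr) (e ∘ Sum.inr),
      fun i j => contDiffOn_const, fun p hp => ?_⟩⟩
  have hsplit := split_of_sign (sg := fun i : (Σ j : hyperbolicModes E ζ₀, Fin (D.ν j.1)) => ε i.1) (M := M p) he1 he2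
    (fun i j hij => by
      obtain ⟨i, i'⟩ := i
      obtain ⟨j, j'⟩ := j
      exact blockDiagonal'_apply_ne _ _ _ fun h => hij (congrArg ε h))
    (r := c' * (p.1 + p.2.2.1)) (by
      have h1 : (of fun i j => (sgn (ε i.1) : ℂ) * M p i j) =
          blockDiagonal' fun j => (sgn (ε j) : ℂ) • (Ti j * D.Q j.1 p * T j) := by
        ext ⟨i, i'⟩ ⟨j, j'⟩
        simp only [M, of_apply, blockDiagonal'_apply]
        split_ifs with hij
        · subst hij
          rfl
        · rw [mul_zero]
      rw [h1]
      exact reGe_blockDiagonal' fun j => (hV hp.1 j hp.2).mono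
        (mul_le_mul_of_nonneg_right (hc'.trans (hc₀' j)) (h0 p hp.2)))
  refine ⟨?_, ?_, (le_max_left _ _).trans hK, (le_max_right _ _).trans hK, ?_, hsplit.2⟩
  · rw [submatrix_mul_equiv, ← blockDiagonal'_mul]
    simp only [hT]
    rw [submatrix_id_id]
    exact blockDiagonal'_one
  · rw [← submatrix_mul _ _ _ _ _ bijective_id, ← blockDiagonal'_mul]
    simp only [hTi]
    exact (congrArg (fun X => submatrix X e e) blockDiagonal'_one).trans (submatrix_one_equiv e)
  · rw [← hsplit.1]
    change _ = (blockDiagonal' fun j => Ti j * D.Q j.1 p * T j).submatrix e e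
    rw [blockDiagonal'_mul, blockDiagonal'_mul]
    rfl

theorem exists_glancingSplitting (D : BlockDecomposition E c ζ₀)
    (h0 : ∀ p ∈ SBar k c, 0 ≤ p.1 + p.2.2.1)
    (h : ∀ r : glancingModes E ζ₀, ∃ (l s : ℕ) (g : (Fin k → ℝ) → ℝ),
      (E r.1.1).IsGlancingCurve ζ₀.1 (sgn r.1.1 * r.1.2) ζ₀.2.2 l s g ∧
      ∃ (gp gm : ℕ) (K c₁ : ℝ), 0 < K ∧ 0 < c₁ ∧ ∀ᶠ p in 𝓝 (0, ζ₀), p ∈ SBar k c → ¬ (p.1 = 0 ∧ p.2.2.1 = 0) →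
      ∃ (Tg : Matrix (Fin (D.ν r.1)) (Fin gp ⊕ Fin gm) ℂ) (Tgi : Matrix (Fin gp ⊕ Fin gm) (Fin (D.ν r.1)) ℂ)
        (Qp : Matrix (Fin gp) (Fin gp) ℂ) (Qm : Matrix (Fin gm) (Fin gm) ℂ),
        Tg * Tgi = 1 ∧ Tgi * Tg = 1 ∧ ‖Tg‖ ≤ K ∧ ‖Tgi‖ ≤ K * beta (E r.1.1) l s g p ∧
        (∀ w : Fin gm → ℂ, ‖WithLp.toLp 2 w‖ ≤
          K * alpha (E r.1.1) l s g p * ‖WithLp.toLp 2 (Tg *ᵥ Sum.elim 0 w)‖) ∧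
        Tgi * D.Q r.1 p * Tg = fromBlocks Qp 0 0 Qm ∧
        ReGe Qp (c₁ * (p.1 + p.2.2.1) * beta (E r.1.1) l s g p) ∧
        ReLe Qm (-(c₁ * (p.1 + p.2.2.1) * beta (E r.1.1) l s g p))) :
    ∃ V₀ ∈ 𝓝 (0, ζ₀), ∃ K₀ c₀ : ℝ, 0 < c₀ ∧ ∀ V ⊆ V₀, ∀ K c₁, K₀ ≤ K → c₁ ≤ c₀ → GlancingSplitting D V K c₁ := by
  choose l s g hcurve gp gm K c₁ hK hc hev using h
  obtain ⟨c₀, hc₀, hc₀'⟩ := exists_pos_le c₁ hc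
  refine ⟨_, eventually_all.2 hev, ∑ r, K r, c₀, hc₀, fun V hV K' c' hK' hc' r hr => ?_⟩
  refine ⟨_, _, _, hcurve ⟨r, hr⟩, gp ⟨r, hr⟩, gm ⟨r, hr⟩, ?_⟩
  have h1 : ∀ p, ∃ Tg Tgi Qp Qm, p ∈ V ∩ SBar k c → ¬ (p.1 = 0 ∧ p.2.2.1 = 0) → _ := fun p => by
    by_cases hp : p ∈ V ∩ SBar k c ∧ ¬ (p.1 = 0 ∧ p.2.2.1 = 0)
    · obtain ⟨Tg, Tgi, Qp, Qm, h⟩ := hV hp.1.1 ⟨r, hr⟩ hp.1.2 hp.2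
      exact ⟨Tg, Tgi, Qp, Qm, fun _ _ => h⟩
    · exact ⟨0, 0, 0, 0, fun h h' => absurd ⟨h, h'⟩ hp⟩
  choose Tg Tgi Qp Qm h1 using h1
  refine ⟨Tg, Tgi, Qp, Qm, fun p hp hp' => ?_⟩
  obtain ⟨h2, h3, h4, h5, h6, h7, h8, h9⟩ := h1 p hp hp'
  have hKK : K ⟨r, hr⟩ ≤ K' :=
    (single_le_sum (f := K) (fun i _ => (hK i).le) (mem_univ _)).trans hK'
  have hnu : 0 ≤ nu (E r.1) (l ⟨r, hr⟩) (s ⟨r, hr⟩) (g ⟨r, hr⟩) p := by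
    refine rpow_nonneg ?_ _
    have := h0 p hp.2
    linarith [abs_nonneg (p.2.1 - (E r.1).a (l ⟨r, hr⟩) (vecCons (g ⟨r, hr⟩ p.2.2.2) p.2.2.2))]
  have hβ : 0 ≤ beta (E r.1) (l ⟨r, hr⟩) (s ⟨r, hr⟩) (g ⟨r, hr⟩) p := rpow_nonneg hnu _
  have hα : 0 ≤ alpha (E r.1) (l ⟨r, hr⟩) (s ⟨r, hr⟩) (g ⟨r, hr⟩) p := rpow_nonneg hnu _
  have hcc := mul_le_mul_of_nonneg_right (mul_le_mul_of_nonneg_right (hc'.trans (hc₀' ⟨r, hr⟩)) (h0 p hp.2)) hβ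
  refine ⟨h2, h3, h4.trans hKK, h5.trans (mul_le_mul_of_nonneg_right hKK hβ), fun w => (h6 w).trans ?_, h7, h8.mono hcc, ?_⟩
  · exact mul_le_mul_of_nonneg_right (mul_le_mul_of_nonneg_right hKK hα) (norm_nonneg _)
  · rw [reLe_iff_reGe_neg, neg_neg] at h9 ⊢
    exact h9.mono hcc

end HHShock

theorem proposition4p6 (n k : ℕ) (hk : 1 ≤ k) (E : Bool → HHShock.Endstate n k)
    (hE : ∀ s, (E s).Admissible) :
    ∃ c₀ : ℝ, 0 < c₀ ∧ ∀ c : ℝ, 0 < c → c < c₀ →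
      ∀ ζ₀ : HHShock.Freq k, HHShock.OnSphere ζ₀ → 0 ≤ ζ₀.2.1 →
        Nonempty (HHShock.BlockDecomposition E c ζ₀) ∧
        ∀ D : HHShock.BlockDecomposition E c ζ₀,
          ∃ (V : Set (HHShock.Pt k)) (K c₁ : ℝ), IsOpen V ∧ ((0 : ℝ), ζ₀) ∈ V ∧ V ⊆ D.U ∧
            0 < K ∧ 0 < c₁ ∧
            HHShock.HyperbolicSplitting D V K c₁ ∧
            ((∀ s, (E s).GlancingPersists) → (∀ s, (E s).SymmetricCompressions) →
              HHShock.GlancingSplitting D V K c₁) := by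
  classical
  choose b hb hb1 hchain using fun s => HHShock.Endstate.exists_mode_chain (hE s)
  obtain ⟨c₀, hc₀, hcb⟩ := HHShock.exists_pos_le (fun s => b s / 4) fun s => div_pos (hb s) four_pos
  refine ⟨c₀, hc₀, fun c hc hcc ζ₀ hS _ => ⟨HHShock.exists_blockDecomposition hE c, fun D => ?_⟩⟩
  have hcs : ∀ s, c ≤ b s / 4 := fun s => hcc.le.trans (hcb s)
  have h0 : ∀ p ∈ HHShock.SBar k c, 0 ≤ p.1 + p.2.2.1 := fun p hp => by
    have h1 := HHShock.SBar.bounds hc.le hp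
    have h2 : c ≤ 1 := by linarith [hcs true, hb1 true]
    nlinarith
  obtain ⟨V₁, hV₁, K₁, c₁, hc₁, h₁⟩ := HHShock.exists_hyperbolicSplitting D h0 fun j => by
    obtain ⟨r, hr⟩ := j
    have hr' := HHShock.BlockDecomposition.hyperbolicModes_subset E ζ₀ hr
    obtain ⟨hγ, hx, hv⟩ := HHShock.exists_root_of_mode hE hS hr'
    obtain ⟨l, m, M, hM, -, hch, -⟩ := hchain r.1 ζ₀ _ hS hγ hx hv
    obtain ⟨e, Lf, α, hC⟩ := hch (Finset.mem_filter.1 hr).2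
    obtain ⟨u, q, hB, hq⟩ := HHShock.BlockDecomposition.exists_slowBlock D hE hc hS hγ hr'
    obtain ⟨T, Ti, ε, c', h2, h3, h4, h5⟩ := HHShock.hyperbolic_mode (hE r.1) hγ hB hC (hb r.1) (hb1 r.1) hM hc.le (hcs r.1)
    refine ⟨T, Ti, ε == r.1, c', h2, h3, h4, h5.mono fun p hp hps => ?_⟩
    have h6 := hp hps
    rw [hq p hps, Matrix.mul_smul, Matrix.smul_mul, smul_smul] at h6
    rwa [show (HHShock.sgn (ε == r.1) : ℂ) = HHShock.sgn ε * HHShock.sgn r.1 by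
      cases ε <;> cases r.1 <;> simp [HHShock.sgn]]
  obtain ⟨V₂, hV₂, K₂, c₂, hc₂, h₂⟩ : ∃ V₂ ∈ 𝓝 ((0 : ℝ), ζ₀), ∃ K₂ c₂ : ℝ, 0 < c₂ ∧ ∀ V ⊆ V₂, ∀ K c', K₂ ≤ K → c' ≤ c₂ →
      (∀ s, (E s).GlancingPersists) → (∀ s, (E s).SymmetricCompressions) → HHShock.GlancingSplitting D V K c' := by
    by_cases hP : (∀ s, (E s).GlancingPersists) ∧ ∀ s, (E s).SymmetricCompressions
    · obtain ⟨V₂, hV₂, K₂, c₂, hc₂, h₂⟩ := HHShock.exists_glancingSplitting D h0 fun j => by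
        obtain ⟨r, hr⟩ := j
        have hr' := HHShock.BlockDecomposition.glancingModes_subset E ζ₀ hr
        obtain ⟨hγ, hx, hv⟩ := HHShock.exists_root_of_mode hE hS hr'
        obtain ⟨l, m, M, -, hM, -, hch⟩ := hchain r.1 ζ₀ _ hS hγ hx hv
        obtain ⟨μ, rfl, hμ⟩ := hM (hP.2 r.1)
        obtain ⟨s, g, e, Lf, α, hs, hC⟩ := hch (Finset.mem_filter.1 hr).2 (hP.1 r.1)
        obtain ⟨u, q, hB, hq⟩ := HHShock.BlockDecomposition.exists_slowBlock D hE hc hS hγ hr'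
        obtain ⟨gp, gm, K, c', hK, hc', hev⟩ :=
          HHShock.glancing_mode (hE r.1) hγ hB hC (hb r.1) (hb1 r.1) hμ hc.le (hcs r.1) r.1
        refine ⟨l, s, g, hC.isGlancingCurve hs, gp, gm, K, c', hK, hc', hev.mono fun p hp hps hp0 => ?_⟩
        have h6 := hp hps hp0
        rwa [hq p hps, smul_smul, HHShock.sgn_mul_self_cx, one_smul] at h6
      exact ⟨V₂, hV₂, K₂, c₂, hc₂, fun V hV K c' hK hc' _ _ => h₂ V hV K c' hK hc'⟩
    · exact ⟨_, Filter.univ_mem, 0, 1, one_pos, fun V _ K c' _ _ h h' => absurd ⟨h, h'⟩ hP⟩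
  obtain ⟨V, hV, hVo, hV0⟩ := mem_nhds_iff.1 (Filter.inter_mem (Filter.inter_mem hV₁ hV₂) (D.isOpen_U.mem_nhds D.base_mem))
  exact ⟨V, max 1 (max K₁ K₂), min c₁ c₂, hVo, hV0, fun p hp => (hV hp).2, lt_max_of_lt_left one_pos, lt_min hc₁ hc₂,
    h₁ V (fun p hp => (hV hp).1.1) _ _ ((le_max_left _ _).trans (le_max_right _ _)) (min_le_left _ _),
    h₂ V (fun p hp => (hV hp).1.2) _ _ ((le_max_right _ _).trans (le_max_right _ _)) (min_le_right _ _)⟩
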